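/- \textbf{Setting.} Let $\varphi:\mathbb R\to\mathbb R$ be a probability density with distribution function $\Phi(x)=\int_{-\infty}^x\varphi(y)\,dy$ such that $\varphi(x)>0$ and $\varphi(x)=\varphi(-x)$ for all $x$, $\sup_x\varphi(x)<\infty$, and for every $\delta>0$ there is $c_\delta>0$ with $\varphi(x)\ge c_\delta\,\Phi(x)^{1+\delta}$ for all $x\le 0$. \emph{Sobolev norm and ANOVA terms.} For $q>1$ and $v\subseteq\{1,\dots,s\}$ let $\partial^v f=\big(\prod_{j\in v}\partial/\partial x_j\big)f$ be the weak mixed derivative ($\partial^\emptyset f=f$), let $\|g\|_{L^q(\mathbb R^s,\varphi)}^q=\int_{\mathbb R^s}|g(x)|^q\prod_{j=1}^s\varphi(x_j)\,dx$ and $$\|f\|_{W^{1,q}_{\mathrm{mix}}(\mathbb R^s,\varphi)}=\Big(\sum_{v\subseteq\{1,\dots,s\}}\|\partial^vf\|_{L^q(\mathbb R^s,\varphi)}^q\Big)^{1/q};$$ the space $W^{1,q}_{\mathrm{mix}}(\mathbb R^s,\varphi)$ consists of the $f$ for which all $\partial^vf$ exist and lie in $L^q(\mathbb R^s,\varphi)$.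 With $P_jf=\int_{\mathbb R}f\,\varphi(x_j)\,dx_j$ and $P_w=\prod_{j\in w}P_j$, the ANOVA terms of $f$ are $f_v=\big(\prod_{j\in v}(I-P_j)\big)P_{\{1,\dots,s\}\setminus v}f$. Put $\|f\|_q=\sup_{v\subseteq\{1,\dots,s\}}\|f_v\|_{W^{1,q}_{\mathrm{mix}}(\mathbb R^s,\varphi)}$, and $\gamma_v=\|f_v\|_{W^{1,q}_{\mathrm{mix}}(\mathbb R^s,\varphi)}/\|f\|_q$ if $\|f\|_q>0$, $\gamma_v=0$ otherwise. \emph{Boundary-damping importance sampling (BDIS).} Fix $p\ge1$. Let $\eta(0)=0$ and $\eta(u)=2^{-p-2}u^{-p-1}\exp(2^p-u^{-p})$ for $u\in(0,1/2]$. For $\theta\in(0,1/2]$ let $(1-\theta)\,w_\theta(u)$ be $\eta(u/\theta)$ on $(0,\theta/2]$, $1-\eta(1-u/\theta)$ on $(\theta/2,\theta)$ and $1$ on $[\theta,1/2]$, and let $w_\theta(u)=w_\theta(1-u)$ on $(1/2,1)$. Put $T_\theta(u)=\Phi^{-1}\big(\int_0^uw_\theta(t)\,dt\big)$ and, given $\theta_1,\dots,\theta_s\in(0,1/2]$,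 $$f^w(u)=\Big(\prod_{j=1}^sw_{\theta_j}(u_j)\Big)\,f\big(T_{\theta_1}(u_1),\dots,T_{\theta_s}(u_s)\big),\qquad u\in(0,1)^s.$$ \emph{Scrambled nets.} Let $b\ge2$ and $m\ge1$ be integers and $n=b^m$. For $0\le t\le m$, points $x_0,\dots,x_{n-1}\in[0,1)^d$ form a $(t,m,d)$-net in base $b$ if every interval $\prod_{j=1}^d\big[a_jb^{-k_j},(a_j+1)b^{-k_j}\big)$ with integers $k_j\ge0$, $\sum_jk_j=m-t$, $0\le a_j<b^{k_j}$, contains exactly $b^t$ of them, counted with multiplicity. Let $x_0,\dots,x_{n-1}\in[0,1)^s$, and for each nonempty $\omega\subseteq\{1,\dots,s\}$ let $t_\omega$ be a $t$-quality parameter: the projections of the points on the coordinates in $\omega$ form a $(t_\omega,m,|\omega|)$-net in base $b$. (This holds in particular for digital nets.) Let $u_0,\dots,u_{n-1}$ be obtained by Owen's scrambling: in each coordinate, the $k$-th base-$b$ digit of a point is replaced by its image under a permutation of $\{0,\dots,b-1\}$ attached to that coordinate and to the preceding $k-1$ digits of the unscrambled point, where all these permutations are uniformly distributed and independent. \textbf{Theorem.}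 Let $\varphi$ be as above, $b\ge2$, $p\ge1$, $q>1$, $\alpha\in(0,1)$ and $\varepsilon>0$. There is a constant $C_*>0$ depending only on $\varphi,b,p,q,\alpha,\varepsilon$ such that for all $s$, all $m\ge1$, all $x_0,\dots,x_{n-1}$ with quality parameters $t_\omega$ as above, all $f\in W^{1,q}_{\mathrm{mix}}(\mathbb R^s,\varphi)$ and all $\theta_1,\dots,\theta_s\in(0,1/2]$, the estimator $\frac1n\sum_{i=0}^{n-1}f^w(u_i)$ is square-integrable and $$\mathbb E\Big|\frac1n\sum_{i=0}^{n-1}f^w(u_i)-\int_{\mathbb R^s}f(x)\prod_{j=1}^s\varphi(x_j)\,dx\Big|^2\le\frac{\|f\|_q^2}{n^{1+\alpha}}\sum_{\emptyset\ne\omega\subseteq\{1,\dots,s\}}C_*^{|\omega|}\,m^{|\omega|-1}\,\tilde\gamma_\omega,$$ where $$\tilde\gamma_\omega=b^{(1+\alpha)t_\omega}\sum_{v\subseteq\omega}\gamma_v^2\prod_{j\in v}\theta_j^{-\nu_{\alpha,q}-\varepsilon}\prod_{j\in\omega\setminus v}\theta_j^{1-\alpha},\qquad \nu_{\alpha,q}=\max\Big(\frac{2\alpha}{q},\frac2q+\alpha-1\Big).$$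 -/

import Mathlib

open MeasureTheory

namespace BDIS

noncomputable section

/-! ### The density and its distribution -/

/-- The cumulative distribution function `Φ` of the density `φ`. -/
def cdf (φ : ℝ → ℝ) (x : ℝ) : ℝ := ∫ y in Set.Iic x, φ y

/-- The quantile function `Φ⁻¹`. For a positive density it is the inverse of `Φ` on `(0,1)`. -/
def quantile (φ : ℝ → ℝ) (u : ℝ) : ℝ := sInf {x : ℝ | u ≤ cdf φ x}

/-- `φ` is a strictly positive, symmetric, bounded and light-tailed probability density on `ℝ`. -/
structure IsAdmissibleDensity (φ : ℝ → ℝ) : Prop where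
  measurable : Measurable φ
  integral_eq_one : ∫ x, φ x = 1
  pos : ∀ x, 0 < φ x
  symm : ∀ x, φ x = φ (-x)
  bounded : BddAbove (Set.range φ)
  light_tail : ∀ ε : ℝ, 0 < ε → ∃ c : ℝ, 0 < c ∧ ∀ x : ℝ, x ≤ 0 → c * cdf φ x ^ (1 + ε) ≤ φ x

/-- The probability measure on `ℝ` with density `φ`. -/
def lineMeasure (φ : ℝ → ℝ) : Measure ℝ :=
  volume.withDensity fun x => ENNReal.ofReal (φ x)

/-- The probability measure on `ℝ^s` with density `∏ j, φ (x j)`. -/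
def prodMeasure (φ : ℝ → ℝ) (s : ℕ) : Measure (Fin s → ℝ) :=
  Measure.pi fun _ => lineMeasure φ

/-! ### Mixed weak derivatives and Sobolev norms -/

/-- The classical mixed derivative `∂^v ψ`: one partial derivative in each coordinate `j ∈ v`. -/
def mixedPartial {s : ℕ} (v : Finset (Fin s)) (ψ : (Fin s → ℝ) → ℝ) : (Fin s → ℝ) → ℝ :=
  v.sort.foldr (fun j g x => fderiv ℝ g x (Pi.single j 1)) ψ

/-- `g` is a weak mixed derivative `∂^v f` on `ℝ^s`. -/
structure HasWeakMixedDeriv {s : ℕ} (v : Finset (Fin s)) (f g : (Fin s → ℝ) → ℝ) : Prop where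
  locallyIntegrable : LocallyIntegrable f
  locallyIntegrable_deriv : LocallyIntegrable g
  integral_eq : ∀ ψ : (Fin s → ℝ) → ℝ, ContDiff ℝ (⊤ : ℕ∞) ψ → HasCompactSupport ψ →
    ∫ x, f x * mixedPartial v ψ x = (-1 : ℝ) ^ v.card * ∫ x, g x * ψ x

open Classical in
/-- A representative of the weak mixed derivative `∂^v f`, which is unique up to null sets
(and `0` by convention if there is none). -/
def weakMixedDeriv {s : ℕ} (v : Finset (Fin s)) (f : (Fin s → ℝ) → ℝ) : (Fin s → ℝ) → ℝ :=
  if h : ∃ g, HasWeakMixedDeriv v f g then h.choose else 0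

/-- Membership in `W^{1,q}_mix(ℝ^s, φ)`: every weak mixed derivative `∂^v f`, including
`∂^∅ f = f`, exists and lies in `L^q(ℝ^s, φ)`. -/
def MemWmix {s : ℕ} (φ : ℝ → ℝ) (q : ℝ) (f : (Fin s → ℝ) → ℝ) : Prop :=
  ∀ v : Finset (Fin s), ∃ g, HasWeakMixedDeriv v f g ∧
    MemLp g (ENNReal.ofReal q) (prodMeasure φ s)

/-- The norm `‖f‖_{W^{1,q}_mix(ℝ^s, φ)} = (∑_v ‖∂^v f‖_{L^q(ℝ^s, φ)}^q)^{1/q}`. -/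
def wmixNorm {s : ℕ} (φ : ℝ → ℝ) (q : ℝ) (f : (Fin s → ℝ) → ℝ) : ℝ :=
  (∑ v : Finset (Fin s),
    (eLpNorm (weakMixedDeriv v f) (ENNReal.ofReal q) (prodMeasure φ s)).toReal ^ q) ^ (1 / q)

/-! ### ANOVA decomposition -/

/-- The operator `P_w = ∏_{j ∈ w} P_j` integrating out the variables in `w` against `φ`. The point
`w.piecewise y x` has the coordinates of `y` in `w` and those of `x` elsewhere, so the integrand
depends on `y` only through the coordinates in `w`, and the others integrate to one. -/
def integrateOut {s : ℕ} (φ : ℝ → ℝ) (w : Finset (Fin s)) (f : (Fin s → ℝ) → ℝ) :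
    (Fin s → ℝ) → ℝ :=
  fun x => ∫ y, f (w.piecewise y x) ∂(prodMeasure φ s)

/-- The ANOVA term `f_v = (∏_{j ∈ v} (I - P_j)) P_{vᶜ} f`, with the product multiplied out:
`f_v = ∑_{z ⊆ v} (-1)^|z| P_{vᶜ ∪ z} f`. -/
def anovaTerm {s : ℕ} (φ : ℝ → ℝ) (f : (Fin s → ℝ) → ℝ) (v : Finset (Fin s)) :
    (Fin s → ℝ) → ℝ :=
  fun x => ∑ z ∈ v.powerset, (-1 : ℝ) ^ z.card * integrateOut φ (vᶜ ∪ z) f x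

/-- `‖f‖_q = sup_{v ⊆ 1:s} ‖f_v‖_{W^{1,q}_mix(ℝ^s, φ)}`. -/
def anovaNorm {s : ℕ} (φ : ℝ → ℝ) (q : ℝ) (f : (Fin s → ℝ) → ℝ) : ℝ :=
  ⨆ v : Finset (Fin s), wmixNorm φ q (anovaTerm φ f v)

/-- The adjusted norm `γ_v` of the ANOVA term `f_v`. -/
def gam {s : ℕ} (φ : ℝ → ℝ) (q : ℝ) (f : (Fin s → ℝ) → ℝ) (v : Finset (Fin s)) : ℝ :=
  if 0 < anovaNorm φ q f then
    (anovaNorm φ q f)⁻¹ * wmixNorm φ q (anovaTerm φ f v)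
  else 0

/-! ### Boundary-damping importance sampling -/

/-- `η_p`, used on `[0, 1/2]`. -/
def eta (p u : ℝ) : ℝ :=
  if 0 < u then 2 ^ (-p - 2) * u ^ (-p - 1) * Real.exp (2 ^ p - u ^ (-p)) else 0

/-- `w_θ` on `(0, 1/2]`. -/
def leftWeight (p θ u : ℝ) : ℝ :=
  if u ≤ θ / 2 then (1 - θ)⁻¹ * eta p (u / θ)
  else if u < θ then (1 - θ)⁻¹ * (1 - eta p (1 - u / θ))
  else (1 - θ)⁻¹

/-- The weight `w_θ` on `(0, 1)`, symmetric about `1/2`. -/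
def weight (p θ u : ℝ) : ℝ :=
  if u ≤ 1 / 2 then leftWeight p θ u else leftWeight p θ (1 - u)

/-- The transport map `T_θ(u) = Φ⁻¹(∫_0^u w_θ)`. -/
def transport (φ : ℝ → ℝ) (p θ u : ℝ) : ℝ := quantile φ (∫ t in (0 : ℝ)..u, weight p θ t)

/-- The transformed integrand `f^w(u) = (∏ j, w_{θ_j}(u_j)) f(T(u))`. -/
def transformed {s : ℕ} (φ : ℝ → ℝ) (p : ℝ) (θ : Fin s → ℝ) (f : (Fin s → ℝ) → ℝ)
    (u : Fin s → ℝ) : ℝ :=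
  (∏ j, weight p (θ j) (u j)) * f fun j => transport φ p (θ j) (u j)

/-! ### Nets and scrambling -/

/-- The points `x 0, …, x (b^m - 1)` of `[0,1)^ι` form a `(t, m, |ι|)`-net in base `b`: each
elementary interval of volume `b^(t - m)` contains exactly `b^t` of them, counted with
multiplicity. -/
structure IsNet (b t m : ℕ) {ι : Type*} [Fintype ι] (x : Fin (b ^ m) → ι → ℝ) : Prop where
  t_le : t ≤ m
  mem_Ico : ∀ i j, x i j ∈ Set.Ico (0 : ℝ) 1
  card_eq : ∀ k : ι → ℕ, (∑ j, k j) + t = m → ∀ a : ι → ℕ, (∀ j, a j < b ^ k j) →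
    Nat.card {i // ∀ j, x i j ∈ Set.Ico ((a j : ℝ) / b ^ k j) (((a j : ℝ) + 1) / b ^ k j)} = b ^ t

/-- The numbers `t ω`, for nonempty `ω`, are `t`-quality parameters of the points `x`: the
projection of the points on the coordinates in `ω` is a `(t ω, m, |ω|)`-net. -/
def HasQualityParams (b m : ℕ) {s : ℕ} (t : Finset (Fin s) → ℕ)
    (x : Fin (b ^ m) → Fin s → ℝ) : Prop :=
  ∀ ω : Finset (Fin s), ω.Nonempty → IsNet b (t ω) m fun i (j : ω) => x i j

instance (b : ℕ) : MeasurableSpace (Equiv.Perm (Fin b)) := ⊤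

/-- The random permutations used in Owen's scrambling: for each coordinate `j` and each finite
string `l` of digits, `σ j l` is uniformly distributed over the permutations of the digits
`{0, …, b-1}`, and all these permutations are independent. -/
structure IsOwenPermutations {Ω : Type*} [MeasurableSpace Ω] (P : Measure Ω) {b s : ℕ}
    (σ : Fin s → List (Fin b) → Ω → Equiv.Perm (Fin b)) : Prop where
  measurable : ∀ j l, Measurable (σ j l)
  uniform : ∀ j l, P.map (σ j l) = (PMF.uniformOfFintype (Equiv.Perm (Fin b))).toMeasure
  indep : ProbabilityTheory.iIndepFun (fun jl : Fin s × List (Fin b) => σ jl.1 jl.2) P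

/-- Nested uniform scrambling of the point `x ∈ [0,1)^s`: if `x j` has the base-`b` digits
`d₀, d₁, …`, the `k`-th digit of the scrambled coordinate is the image of `d_k` under the
permutation attached to the preceding digits `d₀, …, d_{k-1}` of `x j`. -/
def scramble {b s : ℕ} [NeZero b] (σ : Fin s → List (Fin b) → Equiv.Perm (Fin b))
    (x : Fin s → ℝ) : Fin s → ℝ :=
  fun j => Real.ofDigits fun k =>
    σ j (List.ofFn fun i : Fin k => Real.digits (x j) b i) (Real.digits (x j) b k)

/-- The estimator `(1/n) ∑ i, f^w(u_i)` on the `n = b^m` scrambled points. -/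
def estimator {b m s : ℕ} [NeZero b] (φ : ℝ → ℝ) (p : ℝ) (θ : Fin s → ℝ)
    (f : (Fin s → ℝ) → ℝ) (x : Fin (b ^ m) → Fin s → ℝ)
    (σ : Fin s → List (Fin b) → Equiv.Perm (Fin b)) : ℝ :=
  ((b : ℝ) ^ m)⁻¹ * ∑ i, transformed φ p θ f (scramble σ (x i))

/-! ### The bound -/

/-- The exponent `ν_{α,q}`. -/
def nu (α q : ℝ) : ℝ := max (2 * α / q) (2 / q + α - 1)

/-- The weighted quantity `γ̃_ω`. -/
def gamTilde {s : ℕ} (φ : ℝ → ℝ) (q α ε : ℝ) (b : ℕ) (t : Finset (Fin s) → ℕ) (θ : Fin s → ℝ)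
    (f : (Fin s → ℝ) → ℝ) (ω : Finset (Fin s)) : ℝ :=
  (b : ℝ) ^ ((1 + α) * (t ω : ℝ)) * ∑ v ∈ ω.powerset,
    gam φ q f v ^ 2 * (∏ j ∈ v, θ j ^ (-nu α q - ε)) * ∏ j ∈ ω \ v, θ j ^ (1 - α)

end

end BDIS

/-! The error of a scrambled net is governed by Haar levels. For two scrambled points, the joint law
of their first `K` digits in one coordinate is a sum over levels `k` of a number depending only on
the unscrambled pair (`scrambleCorr`) times the reproducing kernel of the Haar functions of level
`k` (`prod_pairProb`). So the mean square error of the average of an integrable `g` on the cube is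
at most `1/n` times the sum, over multi-levels `k ≠ 0`, of a gain factor times the Haar energy of
`g` at `k`. Let `ω` be the support of `k`. The gain vanishes when `∑ k_j + t_ω ≤ m`, because
inclusion-exclusion then only counts points in boxes that the net fills evenly; otherwise it is at
most `4^|ω| b^(t_ω)` (`sum_sum_prod_scrambleCorr_le`). For step functions this is a finite
computation; cell averages, Lebesgue differentiation and Fatou's lemma carry it to general `g`
(`scrambled_net_error_le`).

What remains is to show that the energy of `g = f^w` at level `k` is at most `C^|ω| b^(-α ∑ k_j)`
times a sum over `v ⊆ ω` of `‖f_v‖² ∏_{j ∈ v} θ_j^(-ν-ε) ∏_{j ∈ ω \ v} θ_j^(1-α)`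
(`exists_haarEnergy_transformed_le`). Let `S_j` be the inverse of the transport `T_j`. Under `u =
S(x)` the weight becomes the density, and a Haar coefficient of `f^w` becomes the integral of `f(x)
∏_{j ∈ ω} h_j(S_j(x_j))` against `∏ φ(x_j)`, with `h_j` one-variable Haar functions. The ANOVA
decomposition splits it over `v ⊆ ω`: the term `f_v` is paired with the factors in `v`, and each
factor in `ω \ v` is replaced by its mean. Such a mean is `∫ h_j w`. As `w` is constant away from a
boundary layer of width `θ_j`, it vanishes for most cells, and the squares of the others sum to
`θ_j^(1-α)` (`exists_sum_mean_sq_le`).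

Factors in `v` are integrated by parts. With `Ψ = ∫_0 h`, the function `φ · (h + Ψ w'/w)(S)` is the
derivative of `(Ψ w)(S)`. So `h(S) = A + A₀` with `A₀ = -(Ψ w'/w)(S)`, and `A` becomes `B = (Ψ w /
φ(T))(S)` once a derivative is moved onto `f_v`. Here `|Ψ| ≤ 1` and `Ψ` lives on one cell of length
`H`; with `r` conjugate to `q`, the `L^r` norms of `B` and `A₀` are at most a constant times
`H^(1/r) d^(-(1+δ))`, where `d` is the distance to the boundary cut off below at `θ`
(`exists_isSplit_cellStep`). This rests on two properties of the profile `η`, both due to its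
exponential factor swallowing powers: `|w'| ≤ C θ⁻¹ w^κ` for every `κ < 1`, and `w^τ d ≤ C min(W, 1
- W)` for every `τ > 1`, with `W = ∫_0 w`. Through the light tail of `φ` the second one controls `w
/ φ(T)`. In boundary cells longer than `θ` nothing is integrated by parts. Hölder's inequality
localized to the cells, and summation over the cells, give `θ^(-ν-ε)`; the norms of derivatives are
combined differently for `q ≥ 2` and `q ≤ 2`.

The functions `B` are not quotients of test functions by `φ`, so the integration by parts is done by
density: `(B, A)` is an `L^r` limit of pairs `(ψ/φ, ψ'/φ)` (`IsTestLimit`). Only products of test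
functions of one variable are ever used, and `HasProductWeakDeriv.hasWeakMixedDeriv` shows that they
determine weak derivatives; with this the ANOVA terms are seen to lie in the Sobolev space.

Finally the energies are summed over the levels with `∑ k_j > m - t_ω`: a geometric tail with the
polynomial factor `m^(|ω|-1)` (`sum_prod_pow_le`). -/

open MeasureTheory

namespace BDIS

noncomputable section

/-! ### Digit prefixes -/

/-- The integer whose base-`b` digits are the first `k` terms of `d`. -/
def prefixVal {b : ℕ} (d : ℕ → Fin b) : ℕ → ℕ
  | 0 => 0
  | k + 1 => b * prefixVal d k + d k

lemma prefixVal_lt {b : ℕ} (d : ℕ → Fin b) (k : ℕ) : prefixVal d k < b ^ k := by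
  induction k with
  | zero => simp [prefixVal]
  | succ k ih =>
    have h := (d k).isLt
    calc b * prefixVal d k + d k < b * prefixVal d k + b := by omega
      _ = b * (prefixVal d k + 1) := by ring
      _ ≤ b * b ^ k := Nat.mul_le_mul_left _ ih
      _ = b ^ (k + 1) := by ring

lemma prefixVal_succ_div {b : ℕ} (d : ℕ → Fin b) (k : ℕ) :
    prefixVal d (k + 1) / b = prefixVal d k := by
  have h := (d k).isLt
  rw [prefixVal, Nat.mul_add_div (by omega), Nat.div_eq_of_lt h, add_zero]

lemma prefixVal_succ_eq_iff {b : ℕ} (d d' : ℕ → Fin b) (k : ℕ) :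
    prefixVal d (k + 1) = prefixVal d' (k + 1) ↔ prefixVal d k = prefixVal d' k ∧ d k = d' k := by
  constructor
  · intro h
    have h1 : prefixVal d k = prefixVal d' k := by
      rw [← prefixVal_succ_div d, ← prefixVal_succ_div d', h]
    refine ⟨h1, ?_⟩
    simp only [prefixVal, h1] at h
    exact Fin.ext (by omega)
  · rintro ⟨h1, h2⟩
    simp only [prefixVal, h1, h2]

lemma prefixVal_eq_iff {b : ℕ} (d d' : ℕ → Fin b) (k : ℕ) :
    prefixVal d k = prefixVal d' k ↔ ∀ l < k, d l = d' l := by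
  induction k with
  | zero => simp [prefixVal]
  | succ k ih =>
    rw [prefixVal_succ_eq_iff, ih]
    constructor
    · rintro ⟨h1, h2⟩ l hl
      rcases Nat.lt_succ_iff_lt_or_eq.mp hl with h | rfl
      · exact h1 l h
      · exact h2
    · intro h
      exact ⟨fun l hl => h l (by omega), h k (by omega)⟩

lemma prefixVal_mono {b : ℕ} {d d' : ℕ → Fin b} {k K : ℕ} (hk : k ≤ K)
    (h : prefixVal d K = prefixVal d' K) : prefixVal d k = prefixVal d' k := by
  rw [prefixVal_eq_iff] at h ⊢
  exact fun l hl => h l (by omega)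

lemma sum_ofDigitsTerm_eq {b : ℕ} (hb : 0 < b) (d : ℕ → Fin b) (k : ℕ) :
    ∑ i ∈ Finset.range k, Real.ofDigitsTerm d i = (prefixVal d k : ℝ) / (b : ℝ) ^ k := by
  have hb' : (b : ℝ) ≠ 0 := by positivity
  induction k with
  | zero => simp [prefixVal]
  | succ k ih =>
    rw [Finset.sum_range_succ, ih, Real.ofDigitsTerm, prefixVal]
    push_cast
    field_simp
    ring

lemma prefixVal_digits {b : ℕ} [NeZero b] {x : ℝ} (hx : x ∈ Set.Ico (0 : ℝ) 1) (k : ℕ) :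
    prefixVal (Real.digits x b) k = ⌊(b : ℝ) ^ k * x⌋₊ := by
  have hb : (b : ℝ) ≠ 0 := by exact_mod_cast NeZero.ne b
  have h := Real.ofDigits_digits_sum_eq (b := b) hx k
  rw [sum_ofDigitsTerm_eq (NeZero.pos b), mul_div_cancel₀ _ (pow_ne_zero _ hb)] at h
  exact_mod_cast h

lemma prefixVal_digits_eq_iff {b : ℕ} [NeZero b] {x : ℝ} (hx : x ∈ Set.Ico (0 : ℝ) 1) (k a : ℕ) :
    prefixVal (Real.digits x b) k = a ↔
      x ∈ Set.Ico ((a : ℝ) / (b : ℝ) ^ k) (((a : ℝ) + 1) / (b : ℝ) ^ k) := by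
  have hb : (0 : ℝ) < (b : ℝ) ^ k := by
    have : (0 : ℝ) < b := by exact_mod_cast NeZero.pos b
    positivity
  rw [prefixVal_digits hx, Nat.floor_eq_iff (mul_nonneg hb.le hx.1), Set.mem_Ico, div_le_iff₀ hb,
    lt_div_iff₀ hb, mul_comm]

/-- The cell has to be closed: a sequence ending in digits `b - 1` sums to the right endpoint. -/
lemma ofDigits_mem_Icc {b : ℕ} (hb : 0 < b) (d : ℕ → Fin b) (k : ℕ) :
    Real.ofDigits d ∈
      Set.Icc ((prefixVal d k : ℝ) / (b : ℝ) ^ k) (((prefixVal d k : ℝ) + 1) / (b : ℝ) ^ k) := by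
  rw [Real.ofDigits_eq_sum_add_ofDigits d k, sum_ofDigitsTerm_eq hb, add_div]
  have h0 := Real.ofDigits_nonneg fun i => d (i + k)
  have h1 := Real.ofDigits_le_one fun i => d (i + k)
  have hb' : (0 : ℝ) < ((b : ℝ) ^ k)⁻¹ := by positivity
  constructor
  · nlinarith
  · rw [one_div]
    nlinarith

/-- A digit sequence whose prefix of length `K` has the value `a`. -/
def digitsOf (b : ℕ) [NeZero b] (K a : ℕ) : ℕ → Fin b := Real.digits ((a : ℝ) / (b : ℝ) ^ K) b

lemma div_pow_mem_Ico {b : ℕ} [NeZero b] {K a : ℕ} (ha : a < b ^ K) :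
    (a : ℝ) / (b : ℝ) ^ K ∈ Set.Ico (0 : ℝ) 1 := by
  have hb : (0 : ℝ) < (b : ℝ) ^ K := by
    have : (0 : ℝ) < b := by exact_mod_cast NeZero.pos b
    positivity
  refine ⟨by positivity, ?_⟩
  rw [div_lt_one hb]
  exact_mod_cast ha

lemma prefixVal_digitsOf {b : ℕ} [NeZero b] {K a : ℕ} (ha : a < b ^ K) :
    prefixVal (digitsOf b K a) K = a := by
  have hb : (b : ℝ) ≠ 0 := by exact_mod_cast NeZero.ne b
  rw [digitsOf, prefixVal_digits (div_pow_mem_Ico ha), mul_div_cancel₀ _ (pow_ne_zero _ hb),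
    Nat.floor_natCast]

/-! ### Haar kernels -/

/-- Indicator that two digit sequences share their first `k` digits. -/
def agree {b : ℕ} (d d' : ℕ → Fin b) (k : ℕ) : ℝ :=
  if prefixVal d k = prefixVal d' k then 1 else 0

/-- The Haar function of level `k` attached to the cell with index `c`. -/
def haar {b : ℕ} (k c : ℕ) (d : ℕ → Fin b) : ℝ :=
  match k with
  | 0 => 1
  | k + 1 => (b : ℝ) ^ (k + 1) * (if prefixVal d (k + 1) = c then 1 else 0)
      - (b : ℝ) ^ k * (if prefixVal d k = c / b then 1 else 0)

/-- The reproducing kernel of the Haar functions of level `k`. -/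
def haarKer {b : ℕ} (k : ℕ) (d d' : ℕ → Fin b) : ℝ :=
  match k with
  | 0 => 1
  | k + 1 => (b : ℝ) ^ (k + 1) * agree d d' (k + 1) - (b : ℝ) ^ k * agree d d' k

/-- The correlation, at level `k`, of the scrambled images of two digit sequences. -/
def scrambleCorr {b : ℕ} (k : ℕ) (d d' : ℕ → Fin b) : ℝ :=
  match k with
  | 0 => 1
  | k + 1 => ((b : ℝ) * agree d d' (k + 1) - agree d d' k) / ((b : ℝ) - 1)

lemma haar_congr {b : ℕ} {k K : ℕ} (hk : k ≤ K) (c : ℕ) {d d' : ℕ → Fin b}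
    (h : prefixVal d K = prefixVal d' K) : haar k c d = haar k c d' := by
  cases k with
  | zero => rfl
  | succ k =>
    simp only [haar, prefixVal_mono hk h, prefixVal_mono (Nat.le_of_succ_le hk) h]

lemma sum_range_div_eq {b : ℕ} (hb : 0 < b) {k i : ℕ} (hi : i < b ^ k) :
    ∑ c ∈ Finset.range (b ^ (k + 1)), (if i = c / b then (1 : ℝ) else 0) = b := by
  rw [Finset.sum_ite, Finset.sum_const_zero, add_zero, Finset.sum_const, nsmul_eq_mul, mul_one]
  congr 1
  have : (Finset.range (b ^ (k + 1))).filter (fun c => i = c / b) =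
      Finset.Ico (i * b) ((i + 1) * b) := by
    ext c
    simp only [Finset.mem_filter, Finset.mem_range, Finset.mem_Ico]
    rw [eq_comm, Nat.div_eq_iff hb]
    have : (i + 1) * b ≤ b ^ (k + 1) := by
      rw [pow_succ]; exact Nat.mul_le_mul_right _ hi
    have h3 : (i + 1) * b = i * b + b := by ring
    omega
  rw [this, Nat.card_Ico]
  have h3 : (i + 1) * b = i * b + b := by ring
  omega

/-- A cell of level `k + 1` determines its parent `c / b`, so in the product of the two differences
each product of indicators collapses to one indicator times an agreement factor. Summed over `c`, a
child cell is met once and a parent `b` times. -/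
lemma sum_haar_mul_haar {b : ℕ} (hb : 0 < b) (k : ℕ) (d d' : ℕ → Fin b) :
    ∑ c ∈ Finset.range (b ^ k), haar k c d * haar k c d' = (b : ℝ) ^ k * haarKer k d d' := by
  cases k with
  | zero => simp [haar, haarKer]
  | succ k =>
    have hA : ∀ c, haar (k + 1) c d * haar (k + 1) c d' =
        (b : ℝ) ^ (k + 1) * (b : ℝ) ^ (k + 1) *
            ((if prefixVal d (k + 1) = c then 1 else 0) * agree d d' (k + 1))
          - (b : ℝ) ^ (k + 1) * (b : ℝ) ^ k *
            ((if prefixVal d (k + 1) = c then 1 else 0) * agree d d' k)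
          - (b : ℝ) ^ k * (b : ℝ) ^ (k + 1) *
            ((if prefixVal d' (k + 1) = c then 1 else 0) * agree d d' k)
          + (b : ℝ) ^ k * (b : ℝ) ^ k *
            ((if prefixVal d k = c / b then 1 else 0) * agree d d' k) := by
      intro c
      have e1 : ((if prefixVal d (k + 1) = c then 1 else 0) : ℝ) *
          (if prefixVal d' (k + 1) = c then 1 else 0) =
          (if prefixVal d (k + 1) = c then 1 else 0) * agree d d' (k + 1) := by
        unfold agree; split_ifs <;> simp_all
      have e2 : ((if prefixVal d (k + 1) = c then 1 else 0) : ℝ) *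
          (if prefixVal d' k = c / b then 1 else 0) =
          (if prefixVal d (k + 1) = c then 1 else 0) * agree d d' k := by
        unfold agree
        by_cases h : prefixVal d (k + 1) = c
        · have : c / b = prefixVal d k := by rw [← h, prefixVal_succ_div]
          simp only [h, this, eq_comm]
        · simp [h]
      have e3 : ((if prefixVal d k = c / b then 1 else 0) : ℝ) *
          (if prefixVal d' (k + 1) = c then 1 else 0) =
          (if prefixVal d' (k + 1) = c then 1 else 0) * agree d d' k := by
        unfold agree
        by_cases h : prefixVal d' (k + 1) = c
        · have : c / b = prefixVal d' k := by rw [← h, prefixVal_succ_div]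
          simp only [h, this, eq_comm]; simp
        · simp [h]
      have e4 : ((if prefixVal d k = c / b then 1 else 0) : ℝ) *
          (if prefixVal d' k = c / b then 1 else 0) =
          (if prefixVal d k = c / b then 1 else 0) * agree d d' k := by
        unfold agree; split_ifs <;> simp_all
      simp only [haar]
      linear_combination ((b : ℝ) ^ (k + 1) * (b : ℝ) ^ (k + 1)) * e1
        - ((b : ℝ) ^ (k + 1) * (b : ℝ) ^ k) * e2 - ((b : ℝ) ^ k * (b : ℝ) ^ (k + 1)) * e3
        + ((b : ℝ) ^ k * (b : ℝ) ^ k) * e4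
    have hB : ∀ e : ℕ → Fin b, ∑ c ∈ Finset.range (b ^ (k + 1)),
        (if prefixVal e (k + 1) = c then (1 : ℝ) else 0) = 1 := by
      intro e
      rw [Finset.sum_ite_eq, if_pos (Finset.mem_range.mpr (prefixVal_lt e _))]
    simp only [hA, Finset.sum_add_distrib, Finset.sum_sub_distrib, ← Finset.mul_sum,
      ← Finset.sum_mul, hB, sum_range_div_eq hb (prefixVal_lt d k), haarKer]
    ring

/-! ### The joint law of two scrambled digit sequences -/

/-- The conditional probability that the digits of index `l` of the scrambled images of `x`, `x'`
are those of `a`, `a'`. -/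
def pairProb {b : ℕ} (x x' a a' : ℕ → Fin b) (l : ℕ) : ℝ :=
  if prefixVal x l = prefixVal x' l then
    if x l = x' l then (if a l = a' l then (b : ℝ)⁻¹ else 0)
    else (if a l = a' l then 0 else ((b : ℝ) * ((b : ℝ) - 1))⁻¹)
  else ((b : ℝ) * b)⁻¹

lemma agree_succ {b : ℕ} (d d' : ℕ → Fin b) (k : ℕ) :
    agree d d' (k + 1) = agree d d' k * (if d k = d' k then 1 else 0) := by
  unfold agree
  simp only [prefixVal_succ_eq_iff]
  split_ifs <;> simp_all

/-- Three regimes. While the unscrambled digits agree, all correlations are 1; at the first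
disagreement the correlation is `-1/(b-1)`; afterwards the scrambled digits are independent and
uniform, each new factor is 1 after normalization, and all further correlations vanish. -/
lemma prod_pairProb {b : ℕ} (hb : 2 ≤ b) (x x' a a' : ℕ → Fin b) (K : ℕ) :
    ((b : ℝ) * b) ^ K * ∏ l ∈ Finset.range K, pairProb x x' a a' l =
      ∑ k ∈ Finset.range (K + 1), scrambleCorr k x x' * haarKer k a a' := by
  have hb1 : (b : ℝ) - 1 ≠ 0 := by
    have : (2 : ℝ) ≤ b := by exact_mod_cast hb
    linarith
  have hb0 : (b : ℝ) ≠ 0 := by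
    have : (2 : ℝ) ≤ b := by exact_mod_cast hb
    linarith
  -- With all correlations equal to 1 the Haar kernels telescope.
  have key : ∀ K, prefixVal x K = prefixVal x' K →
      ∑ k ∈ Finset.range (K + 1), scrambleCorr k x x' * haarKer k a a' =
        (b : ℝ) ^ K * agree a a' K := by
    intro K
    induction K with
    | zero => intro _; simp [scrambleCorr, haarKer, agree, prefixVal]
    | succ K ih =>
      intro h
      rw [Finset.sum_range_succ, ih (prefixVal_mono (Nat.le_succ K) h)]
      have h1 : agree x x' (K + 1) = 1 := by simp [agree, h]
      have h2 : agree x x' K = 1 := by simp [agree, prefixVal_mono (Nat.le_succ K) h]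
      simp only [scrambleCorr, haarKer, h1, h2]
      field_simp
      ring
  induction K with
  | zero => simp [scrambleCorr, haarKer]
  | succ K ih =>
    rw [Finset.prod_range_succ, pow_succ, Finset.sum_range_succ, ← ih]
    have hmul : ((b : ℝ) * b) ^ K * ((b : ℝ) * b) *
        ((∏ l ∈ Finset.range K, pairProb x x' a a' l) * pairProb x x' a a' K) =
        (((b : ℝ) * b) ^ K * ∏ l ∈ Finset.range K, pairProb x x' a a' l) *
          ((b : ℝ) * b * pairProb x x' a a' K) := by ring
    rw [hmul]
    by_cases h : prefixVal x K = prefixVal x' K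
    · rw [ih, key K h]
      have h2 : agree x x' K = 1 := by simp [agree, h]
      simp only [scrambleCorr, haarKer, agree_succ, h2, pairProb, h, if_true]
      by_cases hx : x K = x' K <;> by_cases ha : a K = a' K <;> simp [hx, ha] <;> field_simp <;> ring
    · have h2 : agree x x' K = 0 := by simp [agree, h]
      have h1 : agree x x' (K + 1) = 0 := by rw [agree_succ, h2, zero_mul]
      simp only [scrambleCorr, h1, h2, pairProb, h, if_false]
      field_simp
      ring

end

end BDIS

/-! ### The joint law of two scrambled points and second moments of step functions -/

open MeasureTheory

namespace BDIS

noncomputable section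

/-! ### Uniform random permutations -/

/-- The uniform distribution on the permutations of the digits. -/
abbrev uniformPerm (b : ℕ) : Measure (Equiv.Perm (Fin b)) :=
  (PMF.uniformOfFintype (Equiv.Perm (Fin b))).toMeasure

lemma measurableSet_perm {b : ℕ} (A : Set (Equiv.Perm (Fin b))) : MeasurableSet A :=
  MeasurableSpace.measurableSet_top

/-- Applied with transpositions, this makes all admissible values of a random permutation equally
likely, so their probabilities follow by counting. -/
lemma uniformPerm_mul_left {b : ℕ} (τ : Equiv.Perm (Fin b)) (A : Set (Equiv.Perm (Fin b))) :
    (uniformPerm b).real {π | τ * π ∈ A} = (uniformPerm b).real A := by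
  classical
  simp only [measureReal_def, uniformPerm]
  rw [PMF.toMeasure_uniformOfFintype_apply _ (measurableSet_perm _),
    PMF.toMeasure_uniformOfFintype_apply _ (measurableSet_perm _)]
  have : Fintype.card {π | τ * π ∈ A} = Fintype.card A :=
    Fintype.card_congr ((Equiv.mulLeft τ).subtypeEquiv fun π => Iff.rfl)
  rw [this]

lemma measurable_perm {b : ℕ} {β : Type*} [MeasurableSpace β] (g : Equiv.Perm (Fin b) → β) :
    Measurable g := fun _ _ => measurableSet_perm _

lemma uniformPerm_apply_eq {b : ℕ} (x a : Fin b) :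
    (uniformPerm b).real {π | π x = a} = (b : ℝ)⁻¹ := by
  have hconst : ∀ c, (uniformPerm b).real {π | π x = c} = (uniformPerm b).real {π | π x = a} := by
    intro c
    rw [← uniformPerm_mul_left (Equiv.swap c a) {π | π x = a}]
    congr 1
    ext π
    simp only [Set.mem_ofPred_eq, Equiv.Perm.mul_apply]
    rw [Equiv.swap_apply_eq_iff, Equiv.swap_apply_right]
  have hsum : ∑ c, (uniformPerm b).real {π | π x = c} = 1 := by
    have h := sum_measureReal_preimage_singleton (μ := uniformPerm b) (Finset.univ : Finset (Fin b))
      (f := fun π => π x) (fun _ _ => measurableSet_perm _)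
    simpa [Set.preimage] using h
  rw [Finset.sum_congr rfl fun c _ => hconst c] at hsum
  simp only [Finset.sum_const, Finset.card_univ, Fintype.card_fin, nsmul_eq_mul] at hsum
  exact eq_inv_of_mul_eq_one_right hsum

lemma uniformPerm_apply_eq_and {b : ℕ} (hb : 2 ≤ b) {x x' : Fin b} (hx : x ≠ x') (a a' : Fin b) :
    (uniformPerm b).real {π | π x = a ∧ π x' = a'} =
      if a = a' then 0 else ((b : ℝ) * ((b : ℝ) - 1))⁻¹ := by
  have hb1 : (b : ℝ) - 1 ≠ 0 := by
    have : (2 : ℝ) ≤ b := by exact_mod_cast hb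
    linarith
  have hb0 : (b : ℝ) ≠ 0 := by
    have : (2 : ℝ) ≤ b := by exact_mod_cast hb
    linarith
  have h0 : (uniformPerm b).real {π | π x = a ∧ π x' = a} = 0 := by
    have : {π : Equiv.Perm (Fin b) | π x = a ∧ π x' = a} = ∅ := by
      ext π
      simp only [Set.mem_ofPred_eq, Set.mem_empty_iff_false, iff_false, not_and]
      intro h1 h2
      exact hx (π.injective (h1.trans h2.symm))
    simp [this]
  split_ifs with h
  · rw [← h, h0]
  have hconst : ∀ c, c ≠ a → (uniformPerm b).real {π | π x = a ∧ π x' = c} =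
      (uniformPerm b).real {π | π x = a ∧ π x' = a'} := by
    intro c hc
    rw [← uniformPerm_mul_left (Equiv.swap c a') {π | π x = a ∧ π x' = a'}]
    congr 1
    ext π
    simp only [Set.mem_ofPred_eq, Equiv.Perm.mul_apply]
    rw [Equiv.swap_apply_eq_iff, Equiv.swap_apply_eq_iff, Equiv.swap_apply_right,
      Equiv.swap_apply_of_ne_of_ne hc.symm h]
  have hsum : ∑ c, (uniformPerm b).real {π | π x = a ∧ π x' = c} = (b : ℝ)⁻¹ := by
    rw [← uniformPerm_apply_eq x a]
    have h := sum_measureReal_preimage_singleton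
      (μ := (uniformPerm b).restrict {π | π x = a}) (Finset.univ : Finset (Fin b))
      (f := fun π => π x') (fun _ _ => measurableSet_perm _)
    simp only [measureReal_restrict_apply (measurableSet_perm _), Finset.coe_univ,
      Set.preimage_univ, Set.univ_inter] at h
    rw [← h]
    refine Finset.sum_congr rfl fun c _ => ?_
    congr 1
    ext π
    simp [and_comm]
  rw [← Finset.add_sum_erase _ _ (Finset.mem_univ a), h0, zero_add,
    Finset.sum_congr rfl fun c hc => hconst c (Finset.ne_of_mem_erase hc)] at hsum
  simp only [Finset.sum_const, Finset.card_erase_of_mem (Finset.mem_univ a), Finset.card_univ,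
    Fintype.card_fin, nsmul_eq_mul] at hsum
  rw [Nat.cast_sub (by omega), Nat.cast_one] at hsum
  rw [mul_inv, ← hsum]
  field_simp

/-! ### Law of the scrambled digits -/

/-- The digit sequence `d` scrambled by the permutations `π`. -/
def scrambledDigits {b : ℕ} (π : List (Fin b) → Equiv.Perm (Fin b)) (d : ℕ → Fin b) : ℕ → Fin b :=
  fun k => π (List.ofFn fun i : Fin k => d i) (d k)

lemma prefix_eq_iff {b : ℕ} (d d' : ℕ → Fin b) (k : ℕ) :
    (fun i : Fin k => d i) = (fun i : Fin k => d' i) ↔ prefixVal d k = prefixVal d' k := by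
  rw [prefixVal_eq_iff, funext_iff]
  exact ⟨fun h l hl => h ⟨l, hl⟩, fun h i => h i i.isLt⟩

/-- Only the permutations attached to the two prefixes that occur are constrained: a single
permutation if the prefixes coincide, two different ones otherwise. All other factors are 1. -/
lemma prod_uniformPerm_eq_pairProb {b : ℕ} (hb : 2 ≤ b) (x x' a a' : ℕ → Fin b) (l : ℕ) :
    ∏ v : Fin l → Fin b, (uniformPerm b).real
      {π | ((fun i : Fin l => x i) = v → π (x l) = a l) ∧
        ((fun i : Fin l => x' i) = v → π (x' l) = a' l)} = pairProb x x' a a' l := by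
  classical
  unfold pairProb
  by_cases h : prefixVal x l = prefixVal x' l
  · have h' := (prefix_eq_iff x x' l).mpr h
    rw [Finset.prod_eq_single (fun i : Fin l => x i)]
    · simp only [h'.symm, forall_const, h, if_true]
      by_cases hx : x l = x' l
      · simp only [hx, if_true]
        by_cases ha : a l = a' l
        · simp only [ha, and_self, if_true]
          exact uniformPerm_apply_eq _ _
        · have : {π : Equiv.Perm (Fin b) | π (x' l) = a l ∧ π (x' l) = a' l} = ∅ := by
            ext π
            simp only [Set.mem_ofPred_eq, Set.mem_empty_iff_false, iff_false, not_and]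
            intro h1 h2
            exact ha (h1.symm.trans h2)
          simp [ha, this]
      · simp only [hx, if_false]
        exact uniformPerm_apply_eq_and hb hx _ _
    · intro v _ hv
      have hv' : ¬ (fun i : Fin l => x' i) = v := by rw [← h']; exact fun e => hv e.symm
      have hv'' : ¬ (fun i : Fin l => x i) = v := fun e => hv e.symm
      simp [hv', hv'']
    · simp
  · have h' : ¬ (fun i : Fin l => x i) = (fun i : Fin l => x' i) := fun e =>
      h ((prefix_eq_iff x x' l).mp e)
    have h'' : ¬ (fun i : Fin l => x' i) = (fun i : Fin l => x i) := fun e => h' e.symm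
    rw [Finset.prod_eq_mul (fun i : Fin l => x i) (fun i : Fin l => x' i) h']
    · simp only [forall_const, h', h'', h, if_false, false_imp_iff, and_true, true_and]
      rw [uniformPerm_apply_eq, uniformPerm_apply_eq, mul_inv]
    · rintro v _ ⟨hv1, hv2⟩
      have hv' : ¬ (fun i : Fin l => x' i) = v := fun e => hv2 e.symm
      have hv'' : ¬ (fun i : Fin l => x i) = v := fun e => hv1 e.symm
      simp [hv', hv'']
    · simp
    · simp

lemma measurable_scrambledDigits {Ω : Type*} [MeasurableSpace Ω] {P : Measure Ω} {b s : ℕ}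
    {σ : Fin s → List (Fin b) → Ω → Equiv.Perm (Fin b)} (hσ : IsOwenPermutations P σ)
    (j : Fin s) (d : ℕ → Fin b) :
    Measurable fun r => scrambledDigits (fun l => σ j l r) d := by
  refine measurable_pi_lambda _ fun k => ?_
  exact (measurable_perm fun π : Equiv.Perm (Fin b) => π (d k)).comp (hσ.measurable j _)

lemma measurable_prefixVal {b : ℕ} (K : ℕ) : Measurable fun d : ℕ → Fin b => prefixVal d K := by
  induction K with
  | zero => exact measurable_const
  | succ K ih =>
    simp only [prefixVal]
    exact (ih.const_mul b).add
      ((measurable_from_top : Measurable fun i : Fin b => (i : ℕ)).comp (measurable_pi_apply K))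

/-- The joint law of the first `K` digits of two scrambled points. -/
lemma real_scrambledDigits_pair {Ω : Type*} [MeasurableSpace Ω] {P : Measure Ω}
    [IsProbabilityMeasure P] {b s : ℕ} (hb : 2 ≤ b)
    {σ : Fin s → List (Fin b) → Ω → Equiv.Perm (Fin b)} (hσ : IsOwenPermutations P σ) (K : ℕ)
    (x x' a a' : Fin s → ℕ → Fin b) :
    P.real {r | ∀ j, prefixVal (scrambledDigits (fun l => σ j l r) (x j)) K = prefixVal (a j) K ∧
      prefixVal (scrambledDigits (fun l => σ j l r) (x' j)) K = prefixVal (a' j) K} =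
      ∏ j, ∏ l ∈ Finset.range K, pairProb (x j) (x' j) (a j) (a' j) l := by
  classical
  -- The independent family is indexed by all prefixes of length below `K`, not only by those of `x`
  -- and `x'`; the event `A i` is trivial for the prefixes that do not occur.
  let g : Fin s × (Σ l : Fin K, Fin l → Fin b) → Fin s × List (Fin b) :=
    fun i => (i.1, List.ofFn i.2.2)
  have hg : Function.Injective g := by
    rintro ⟨j, l, v⟩ ⟨j', l', v'⟩ h
    simp only [g, Prod.mk.injEq] at h
    obtain ⟨rfl, h⟩ := h
    have hl : l = l' := by
      have := congrArg List.length h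
      simpa [Fin.ext_iff] using this
    subst hl
    rw [List.ofFn_injective h]
  have hind := hσ.indep.precomp hg
  let A : Fin s × (Σ l : Fin K, Fin l → Fin b) → Set (Equiv.Perm (Fin b)) := fun i =>
    {π | ((fun t : Fin i.2.1 => x i.1 t) = i.2.2 → π (x i.1 i.2.1) = a i.1 i.2.1) ∧
      ((fun t : Fin i.2.1 => x' i.1 t) = i.2.2 → π (x' i.1 i.2.1) = a' i.1 i.2.1)}
  have hmul := hind.measure_inter_preimage_eq_mul Finset.univ (sets := A)
    (fun i _ => measurableSet_perm _)
  have hset : {r | ∀ j, prefixVal (scrambledDigits (fun l => σ j l r) (x j)) K = prefixVal (a j) K ∧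
      prefixVal (scrambledDigits (fun l => σ j l r) (x' j)) K = prefixVal (a' j) K} =
      ⋂ i ∈ Finset.univ, (fun r => σ (g i).1 (g i).2 r) ⁻¹' A i := by
    ext r
    simp only [Set.mem_ofPred_eq, Finset.mem_univ, Set.iInter_true, Set.mem_iInter, Set.mem_preimage,
      prefixVal_eq_iff, A, g, scrambledDigits]
    constructor
    · rintro h ⟨j, l, v⟩
      exact ⟨fun e => by have := (h j).1 l l.isLt; rwa [e] at this,
        fun e => by have := (h j).2 l l.isLt; rwa [e] at this⟩
    · intro h j
      exact ⟨fun l hl => (h ⟨j, ⟨l, hl⟩, fun t => x j t⟩).1 rfl,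
        fun l hl => (h ⟨j, ⟨l, hl⟩, fun t => x' j t⟩).2 rfl⟩
  have hA : ∀ i, P ((fun r => σ (g i).1 (g i).2 r) ⁻¹' A i) = (uniformPerm b) (A i) := by
    intro i
    unfold uniformPerm
    rw [← hσ.uniform (g i).1 (g i).2, Measure.map_apply (hσ.measurable _ _) (measurableSet_perm _)]
  rw [hset, measureReal_def]
  rw [hmul, ENNReal.toReal_prod]
  simp only [hA]
  rw [Fintype.prod_prod_type]
  refine Finset.prod_congr rfl fun j _ => ?_
  rw [Fintype.prod_sigma, ← Fin.prod_univ_eq_prod_range]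
  refine Finset.prod_congr rfl fun l _ => ?_
  exact prod_uniformPerm_eq_pairProb hb (x j) (x' j) (a j) (a' j) l

end

end BDIS

open MeasureTheory

namespace BDIS

noncomputable section

/-! ### Second moments of step functions at scrambled points -/

lemma integral_comp_eq_sum {Ω ι : Type*} [MeasurableSpace Ω] {P : Measure Ω} [IsFiniteMeasure P]
    (Z : Ω → ι) (T : Finset ι) (hZ : ∀ r, Z r ∈ T) (hm : ∀ p, MeasurableSet (Z ⁻¹' {p}))
    (H : ι → ℝ) : ∫ r, H (Z r) ∂P = ∑ p ∈ T, H p * P.real (Z ⁻¹' {p}) := by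
  classical
  have h1 : ∀ r, H (Z r) = ∑ p ∈ T, H p * (Z ⁻¹' {p}).indicator 1 r := by
    intro r
    rw [Finset.sum_eq_single (Z r)]
    · simp
    · intro p _ hp
      simp [Set.indicator, hp.symm]
    · exact fun h => absurd (hZ r) h
  simp only [h1]
  rw [integral_finsetSum]
  · refine Finset.sum_congr rfl fun p _ => ?_
    rw [integral_const_mul, integral_indicator_one (hm p)]
  · exact fun p _ => ((integrable_const 1).indicator (hm p)).const_mul _

/-- The multi-indices of the cells of level `K` in each coordinate. -/
def cellBox (b s K : ℕ) : Finset (Fin s → ℕ) := Fintype.piFinset fun _ => Finset.range (b ^ K)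

/-- The coefficient of a level-`K` step function against a tensor product of Haar functions. -/
def haarCoeff {b s : ℕ} [NeZero b] (K : ℕ) (G : (Fin s → ℕ) → ℝ) (k c : Fin s → ℕ) : ℝ :=
  ∑ a ∈ cellBox b s K, G a * ∏ j, (((b : ℝ) ^ K)⁻¹ * haar (k j) (c j) (digitsOf b K (a j)))

/-- The cell at level `K` containing the scrambled image of the digit sequences `d`. -/
def scrambledCell {Ω : Type*} {b s : ℕ} (σ : Fin s → List (Fin b) → Ω → Equiv.Perm (Fin b)) (K : ℕ)
    (d : Fin s → ℕ → Fin b) (r : Ω) : Fin s → ℕ :=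
  fun j => prefixVal (scrambledDigits (fun l => σ j l r) (d j)) K

lemma scrambledCell_mem {Ω : Type*} {b s : ℕ} (σ : Fin s → List (Fin b) → Ω → Equiv.Perm (Fin b))
    (K : ℕ) (d : Fin s → ℕ → Fin b) (r : Ω) : scrambledCell σ K d r ∈ cellBox b s K := by
  simp only [cellBox, Fintype.mem_piFinset, Finset.mem_range]
  exact fun j => prefixVal_lt _ _

variable {Ω : Type*} [MeasurableSpace Ω] {P : Measure Ω} {b s : ℕ}
  {σ : Fin s → List (Fin b) → Ω → Equiv.Perm (Fin b)}

lemma measurable_scrambledCell (hσ : IsOwenPermutations P σ) (K : ℕ) (d : Fin s → ℕ → Fin b) :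
    Measurable (scrambledCell σ K d) :=
  measurable_pi_lambda _ fun j =>
    (measurable_prefixVal K).comp (measurable_scrambledDigits hσ j (d j))

lemma real_scrambledCell_pair [IsProbabilityMeasure P] [NeZero b] (hb : 2 ≤ b)
    (hσ : IsOwenPermutations P σ) (K : ℕ) (d d' : Fin s → ℕ → Fin b) {a a' : Fin s → ℕ}
    (ha : a ∈ cellBox b s K) (ha' : a' ∈ cellBox b s K) :
    P.real ((fun r => (scrambledCell σ K d r, scrambledCell σ K d' r)) ⁻¹' {(a, a')}) =
      ∏ j, ((((b : ℝ) ^ K)⁻¹ * ((b : ℝ) ^ K)⁻¹) * ∑ k ∈ Finset.range (K + 1),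
        scrambleCorr k (d j) (d' j) * haarKer k (digitsOf b K (a j)) (digitsOf b K (a' j))) := by
  have hb0 : (b : ℝ) ≠ 0 := by exact_mod_cast NeZero.ne b
  simp only [cellBox, Fintype.mem_piFinset, Finset.mem_range] at ha ha'
  have h := real_scrambledDigits_pair hb hσ K d d' (fun j => digitsOf b K (a j))
    (fun j => digitsOf b K (a' j))
  simp only [prefixVal_digitsOf (ha _), prefixVal_digitsOf (ha' _)] at h
  have hset : (fun r => (scrambledCell σ K d r, scrambledCell σ K d' r)) ⁻¹' {(a, a')} =
      {r | ∀ j, prefixVal (scrambledDigits (fun l => σ j l r) (d j)) K = a j ∧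
        prefixVal (scrambledDigits (fun l => σ j l r) (d' j)) K = a' j} := by
    ext r
    simp [scrambledCell, funext_iff, forall_and]
  rw [hset, h]
  refine Finset.prod_congr rfl fun j _ => ?_
  rw [← prod_pairProb hb, mul_pow]
  field_simp

/-- The kernel is a sum of products of Haar functions, so the quadratic form is a sum of squares of
Haar coefficients. -/
lemma sum_sum_prod_haarKer [NeZero b] (K : ℕ) (G : (Fin s → ℕ) → ℝ)
    (k : Fin s → ℕ) :
    ∑ a ∈ cellBox b s K, ∑ a' ∈ cellBox b s K, G a * G a' *
      ∏ j, ((((b : ℝ) ^ K)⁻¹ * ((b : ℝ) ^ K)⁻¹) *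
        haarKer (k j) (digitsOf b K (a j)) (digitsOf b K (a' j))) =
    (∏ j, ((b : ℝ) ^ k j)⁻¹) * ∑ c ∈ Fintype.piFinset fun j => Finset.range (b ^ k j),
      haarCoeff (b := b) K G k c ^ 2 := by
  have hb0 : (b : ℝ) ≠ 0 := by exact_mod_cast NeZero.ne b
  have h1 : ∀ a a' : Fin s → ℕ, ∏ j, ((((b : ℝ) ^ K)⁻¹ * ((b : ℝ) ^ K)⁻¹) *
        haarKer (k j) (digitsOf b K (a j)) (digitsOf b K (a' j))) =
      (∏ j, ((b : ℝ) ^ k j)⁻¹) * ∑ c ∈ Fintype.piFinset fun j => Finset.range (b ^ k j),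
        (∏ j, (((b : ℝ) ^ K)⁻¹ * haar (k j) (c j) (digitsOf b K (a j)))) *
        ∏ j, (((b : ℝ) ^ K)⁻¹ * haar (k j) (c j) (digitsOf b K (a' j))) := by
    intro a a'
    simp only [← Finset.prod_mul_distrib]
    rw [← Finset.prod_univ_sum (fun j => Finset.range (b ^ k j))
      (fun j c => ((b : ℝ) ^ K)⁻¹ * haar (k j) c (digitsOf b K (a j)) *
        (((b : ℝ) ^ K)⁻¹ * haar (k j) c (digitsOf b K (a' j)))), ← Finset.prod_mul_distrib]
    refine Finset.prod_congr rfl fun j _ => ?_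
    have hs := sum_haar_mul_haar (NeZero.pos b) (k j) (digitsOf b K (a j)) (digitsOf b K (a' j))
    have h2 : ∀ c, ((b : ℝ) ^ K)⁻¹ * haar (k j) c (digitsOf b K (a j)) *
        (((b : ℝ) ^ K)⁻¹ * haar (k j) c (digitsOf b K (a' j))) =
        (((b : ℝ) ^ K)⁻¹ * ((b : ℝ) ^ K)⁻¹) *
          (haar (k j) c (digitsOf b K (a j)) * haar (k j) c (digitsOf b K (a' j))) :=
      fun c => by ring
    simp only [h2]
    rw [← Finset.mul_sum, hs]
    field_simp
  simp only [h1]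
  simp only [haarCoeff, sq, Finset.sum_mul_sum]
  simp only [Finset.mul_sum]
  rw [Finset.sum_comm]
  rw [Finset.sum_congr rfl fun a _ => Finset.sum_comm, Finset.sum_comm]
  refine Finset.sum_congr rfl fun c _ => ?_
  refine Finset.sum_congr rfl fun a _ => Finset.sum_congr rfl fun a' _ => ?_
  ring

/-- The second moment of a sum of values of a level-`K` step function at scrambled points. -/
lemma integral_sum_scrambledCell_sq [IsProbabilityMeasure P] [NeZero b] (hb : 2 ≤ b)
    (hσ : IsOwenPermutations P σ) (K : ℕ) {n : ℕ} (d : Fin n → Fin s → ℕ → Fin b)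
    (G : (Fin s → ℕ) → ℝ) :
    ∫ r, (∑ i, G (scrambledCell σ K (d i) r)) ^ 2 ∂P =
      ∑ k ∈ Fintype.piFinset fun _ : Fin s => Finset.range (K + 1),
        (∑ i, ∑ i', ∏ j, scrambleCorr (k j) (d i j) (d i' j)) *
        ((∏ j, ((b : ℝ) ^ k j)⁻¹) * ∑ c ∈ Fintype.piFinset fun j => Finset.range (b ^ k j),
          haarCoeff (b := b) K G k c ^ 2) := by
  classical
  have hmeas : ∀ i i' : Fin n, Measurable fun r =>
      (scrambledCell σ K (d i) r, scrambledCell σ K (d i') r) := fun i i' =>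
    (measurable_scrambledCell hσ K (d i)).prodMk (measurable_scrambledCell hσ K (d i'))
  have hint : ∀ i i' : Fin n, Integrable (fun r =>
      G (scrambledCell σ K (d i) r) * G (scrambledCell σ K (d i') r)) P := by
    intro i i'
    have hm : Measurable fun r => G (scrambledCell σ K (d i) r) * G (scrambledCell σ K (d i') r) :=
      (measurable_from_prod_countable_left (f := fun p : (Fin s → ℕ) × (Fin s → ℕ) => G p.1 * G p.2)
        (fun _ => measurable_of_countable _)).comp (hmeas i i')
    refine Integrable.of_bound (C := (∑ a ∈ cellBox b s K, |G a|) * ∑ a ∈ cellBox b s K, |G a|)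
      hm.aestronglyMeasurable (Filter.Eventually.of_forall fun r => ?_)
    rw [norm_mul]
    have hG : ∀ i, ‖G (scrambledCell σ K (d i) r)‖ ≤ ∑ a ∈ cellBox b s K, |G a| := fun i =>
      Finset.single_le_sum (f := fun a => |G a|) (fun _ _ => abs_nonneg _)
        (scrambledCell_mem σ K (d i) r)
    exact mul_le_mul (hG i) (hG i') (norm_nonneg _) (Finset.sum_nonneg fun _ _ => abs_nonneg _)
  simp only [sq, Finset.sum_mul_sum]
  rw [integral_finsetSum _ fun i _ => integrable_finsetSum _ fun i' _ => hint i i']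
  rw [Finset.sum_congr rfl fun i _ => integral_finsetSum _ fun i' _ => hint i i']
  have hpair : ∀ i i' : Fin n,
      ∫ r, G (scrambledCell σ K (d i) r) * G (scrambledCell σ K (d i') r) ∂P =
      ∑ k ∈ Fintype.piFinset fun _ : Fin s => Finset.range (K + 1),
        (∏ j, scrambleCorr (k j) (d i j) (d i' j)) *
        ((∏ j, ((b : ℝ) ^ k j)⁻¹) * ∑ c ∈ Fintype.piFinset fun j => Finset.range (b ^ k j),
          haarCoeff (b := b) K G k c ^ 2) := by
    intro i i'
    rw [integral_comp_eq_sum (fun r => (scrambledCell σ K (d i) r, scrambledCell σ K (d i') r))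
      (cellBox b s K ×ˢ cellBox b s K)
      (fun r => Finset.mk_mem_product (scrambledCell_mem _ _ _ _) (scrambledCell_mem _ _ _ _))
      (fun p => (hmeas i i') (measurableSet_singleton p)) (fun p => G p.1 * G p.2),
      Finset.sum_product]
    rw [Finset.sum_congr rfl fun a ha => Finset.sum_congr rfl fun a' ha' => by
      rw [real_scrambledCell_pair hb hσ K (d i) (d i') ha ha']]
    simp only [← sum_sum_prod_haarKer (b := b) K G, Finset.mul_sum]
    symm
    rw [Finset.sum_comm]
    refine Finset.sum_congr rfl fun a _ => ?_
    rw [Finset.sum_comm]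
    refine Finset.sum_congr rfl fun a' _ => ?_
    symm
    rw [Finset.prod_univ_sum, Finset.mul_sum]
    refine Finset.sum_congr rfl fun k _ => ?_
    rw [mul_left_comm, ← Finset.prod_mul_distrib]
    congr 1
    exact Finset.prod_congr rfl fun j _ => by ring
  simp only [hpair, Finset.sum_mul]
  rw [Finset.sum_congr rfl fun i _ => Finset.sum_comm, Finset.sum_comm]
  simp only [sq]

lemma integral_scrambledCell [IsProbabilityMeasure P] [NeZero b] (hb : 2 ≤ b)
    (hσ : IsOwenPermutations P σ) (K : ℕ) (d : Fin s → ℕ → Fin b) (G : (Fin s → ℕ) → ℝ) :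
    ∫ r, G (scrambledCell σ K d r) ∂P = ∑ a ∈ cellBox b s K, G a * (((b : ℝ) ^ K)⁻¹) ^ s := by
  have hmeas := measurable_scrambledCell hσ K d
  rw [integral_comp_eq_sum (scrambledCell σ K d) (cellBox b s K) (scrambledCell_mem _ _ _)
    (fun p => hmeas (measurableSet_singleton p)) G]
  refine Finset.sum_congr rfl fun a ha => ?_
  congr 1
  have h := real_scrambledDigits_pair hb hσ K d d (fun j => digitsOf b K (a j))
    (fun j => digitsOf b K (a j))
  simp only [cellBox, Fintype.mem_piFinset, Finset.mem_range] at ha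
  simp only [prefixVal_digitsOf (ha _), and_self] at h
  have hset : scrambledCell σ K d ⁻¹' {a} =
      {r | ∀ j, prefixVal (scrambledDigits (fun l => σ j l r) (d j)) K = a j} := by
    ext r
    simp [scrambledCell, funext_iff]
  rw [hset, h]
  -- A point paired with itself: every factor is `b⁻¹`, so all cells of level `K` are equally
  -- likely.
  simp [pairProb]

end

end BDIS

/-! ### Counting the points of a net -/

open MeasureTheory

namespace BDIS

noncomputable section

/-! ### Gain coefficients of nets -/

/-- Serves to enlarge a cell below the resolution of the net to an elementary interval. -/
lemma exists_le_sum_eq {ι : Type*} [Fintype ι] [DecidableEq ι] (κ : ι → ℕ) {N : ℕ}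
    (hN : N ≤ ∑ j, κ j) : ∃ κ' : ι → ℕ, (∀ j, κ' j ≤ κ j) ∧ ∑ j, κ' j = N := by
  induction h : ∑ j, κ j generalizing κ with
  | zero => exact ⟨κ, fun _ => le_rfl, by omega⟩
  | succ M ih =>
    rcases Nat.eq_or_lt_of_le hN with h1 | h1
    · exact ⟨κ, fun _ => le_rfl, h1.symm⟩
    have : ∃ j, κ j ≠ 0 := by
      by_contra hc
      push Not at hc
      simp [hc] at h
    obtain ⟨j, hj⟩ := this
    have hs : ∑ i, Function.update κ j (κ j - 1) i = M := by
      have h2 := Finset.sum_update_of_mem (Finset.mem_univ j) κ (κ j - 1)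
      have h3 := Finset.add_sum_erase Finset.univ κ (Finset.mem_univ j)
      rw [← Finset.erase_eq] at h2
      omega
    obtain ⟨κ', h4, h5⟩ := ih (Function.update κ j (κ j - 1)) (by omega) hs
    refine ⟨κ', fun i => (h4 i).trans ?_, h5⟩
    by_cases hi : i = j
    · subst hi; simp
    · simp [hi]

/-- The net property concerns the finest elementary intervals only. A coarser box is cut into `b`
boxes along one fixed coordinate, by induction on the distance to the finest level. -/
lemma IsNet.card_filter_prefixVal {b t m : ℕ} [NeZero b] {ι : Type*} [Fintype ι] [Nonempty ι]
    {x : Fin (b ^ m) → ι → ℝ} (hx : IsNet b t m x) (κ : ι → ℕ) (hκ : ∑ j, κ j + t ≤ m)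
    (a : ι → ℕ) (ha : ∀ j, a j < b ^ κ j) :
    (Finset.univ.filter fun i => ∀ j, prefixVal (Real.digits (x i j) b) (κ j) = a j).card =
      b ^ (m - ∑ j, κ j) := by
  classical
  have hb : 0 < b := NeZero.pos b
  induction h : m - t - ∑ j, κ j generalizing κ a with
  | zero =>
    have h1 := hx.card_eq κ (by omega) a ha
    rw [Nat.card_eq_fintype_card, Fintype.card_subtype] at h1
    have h2 : m - ∑ j, κ j = t := by omega
    rw [h2, ← h1]
    congr 1
    ext i
    simp only [Finset.mem_filter, Finset.mem_univ, true_and]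
    exact forall_congr' fun j => prefixVal_digits_eq_iff (hx.mem_Ico i j) _ _
  | succ N ih =>
    obtain ⟨j₀⟩ := ‹Nonempty ι›
    have hsum : ∑ j, Function.update κ j₀ (κ j₀ + 1) j = ∑ j, κ j + 1 := by
      have h2 := Finset.sum_update_of_mem (Finset.mem_univ j₀) κ (κ j₀ + 1)
      have h3 := Finset.add_sum_erase Finset.univ κ (Finset.mem_univ j₀)
      rw [← Finset.erase_eq] at h2
      omega
    have hsplit : (Finset.univ.filter fun i => ∀ j,
        prefixVal (Real.digits (x i j) b) (κ j) = a j) =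
        (Finset.range b).biUnion fun e => Finset.univ.filter fun i => ∀ j,
          prefixVal (Real.digits (x i j) b) (Function.update κ j₀ (κ j₀ + 1) j) =
            Function.update a j₀ (b * a j₀ + e) j := by
      ext i
      simp only [Finset.mem_filter, Finset.mem_univ, true_and, Finset.mem_biUnion,
        Finset.mem_range]
      constructor
      · intro hi
        refine ⟨Real.digits (x i j₀) b (κ j₀), Fin.isLt _, fun j => ?_⟩
        by_cases hj : j = j₀
        · subst hj
          simp [prefixVal, hi]
        · simp [hj, hi]
      · rintro ⟨e, he, hi⟩ j
        by_cases hj : j = j₀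
        · subst hj
          have := hi j
          simp only [Function.update_self] at this
          rw [← prefixVal_succ_div, this, Nat.mul_add_div hb, Nat.div_eq_of_lt he, add_zero]
        · simpa [hj] using hi j
    rw [hsplit, Finset.card_biUnion]
    · rw [Finset.sum_congr rfl fun e he => ih (Function.update κ j₀ (κ j₀ + 1)) (by omega)
        (Function.update a j₀ (b * a j₀ + e)) (fun j => by
          by_cases hj : j = j₀
          · subst hj
            simp only [Function.update_self, pow_succ]
            have h1 := ha j
            have h2 := Finset.mem_range.mp he
            calc b * a j + e < b * (a j + 1) := by rw [mul_add, mul_one]; omega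
              _ ≤ b * b ^ κ j := Nat.mul_le_mul_left _ h1
              _ = _ := by ring
          · simpa [hj] using ha j) (by omega)]
      rw [Finset.sum_const, Finset.card_range, smul_eq_mul, hsum, ← pow_succ']
      congr 1
      omega
    · intro e _ e' _ hee
      rw [Function.onFun, Finset.disjoint_left]
      intro i hi hi'
      simp only [Finset.mem_filter, Finset.mem_univ, true_and] at hi hi'
      have := (hi j₀).symm.trans (hi' j₀)
      simp only [Function.update_self] at this
      omega

lemma IsNet.card_filter_prefixVal_le {b t m : ℕ} [NeZero b] {ι : Type*} [Fintype ι] [Nonempty ι]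
    {x : Fin (b ^ m) → ι → ℝ} (hx : IsNet b t m x) (κ : ι → ℕ) (l : ℕ)
    (hκ : m ≤ ∑ j, κ j + t + l) (i₀ : Fin (b ^ m)) :
    (Finset.univ.filter fun i => ∀ j, prefixVal (Real.digits (x i j) b) (κ j) =
      prefixVal (Real.digits (x i₀ j) b) (κ j)).card ≤ b ^ (t + l) := by
  classical
  have hb : 0 < b := NeZero.pos b
  have htm := hx.t_le
  by_cases h : ∑ j, κ j + t ≤ m
  · rw [hx.card_filter_prefixVal κ h _ fun j => prefixVal_lt _ _]
    exact Nat.pow_le_pow_right hb (by omega)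
  · obtain ⟨κ', h1, h2⟩ := exists_le_sum_eq κ (N := m - t) (by omega)
    calc _ ≤ (Finset.univ.filter fun i => ∀ j, prefixVal (Real.digits (x i j) b) (κ' j) =
          prefixVal (Real.digits (x i₀ j) b) (κ' j)).card := by
          refine Finset.card_le_card fun i hi => ?_
          simp only [Finset.mem_filter, Finset.mem_univ, true_and] at hi ⊢
          exact fun j => prefixVal_mono (h1 j) (hi j)
      _ = b ^ (m - (m - t)) := by
          rw [hx.card_filter_prefixVal κ' (by omega) _ fun j => prefixVal_lt _ _, h2]
      _ ≤ _ := Nat.pow_le_pow_right hb (by omega)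

/-- The number of pairs of points sharing `κ j` digits in each coordinate `j ∈ ω`. -/
lemma sum_prod_agree_eq {b n s : ℕ} (d : Fin n → Fin s → ℕ → Fin b) (ω : Finset (Fin s))
    (κ : Fin s → ℕ) (i : Fin n) :
    ∑ i', ∏ j ∈ ω, agree (d i j) (d i' j) (κ j) =
      ((Finset.univ.filter fun i' => ∀ j : ω, prefixVal (d i' j) (κ j) =
        prefixVal (d i j) (κ j)).card : ℝ) := by
  classical
  rw [Finset.card_filter]
  push_cast
  refine Finset.sum_congr rfl fun i' _ => ?_
  split_ifs with h
  · exact Finset.prod_eq_one fun j hj => by simp [agree, h ⟨j, hj⟩]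
  · push Not at h
    obtain ⟨j, hj⟩ := h
    exact Finset.prod_eq_zero j.2 (by simp [agree, Ne.symm hj])

/-- Each correlation is a difference of two agreement indicators; `z` collects the coordinates where
one digit less is compared. Summed over one point, every term of the expansion counts net points in
a box. -/
lemma prod_scrambleCorr_expand {b s : ℕ} (d d' : Fin s → ℕ → Fin b) (ω : Finset (Fin s))
    (k : Fin s → ℕ) (hk : ∀ j ∈ ω, k j ≠ 0) :
    ∏ j ∈ ω, scrambleCorr (k j) (d j) (d' j) = (((b : ℝ) - 1)⁻¹) ^ ω.card *
      ∑ z ∈ ω.powerset, (-1) ^ z.card * (b : ℝ) ^ (ω \ z).card *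
        ∏ j ∈ ω, agree (d j) (d' j) (if j ∈ z then k j - 1 else k j) := by
  classical
  have h1 : ∀ j ∈ ω, scrambleCorr (k j) (d j) (d' j) = ((b : ℝ) - 1)⁻¹ *
      (-agree (d j) (d' j) (k j - 1) + (b : ℝ) * agree (d j) (d' j) (k j)) := by
    intro j hj
    obtain ⟨l, hl⟩ := Nat.exists_eq_succ_of_ne_zero (hk j hj)
    rw [hl]
    simp only [scrambleCorr, Nat.succ_eq_add_one, Nat.add_sub_cancel]
    ring
  rw [Finset.prod_congr rfl h1, Finset.prod_mul_distrib, Finset.prod_const, Finset.prod_add]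
  congr 1
  refine Finset.sum_congr rfl fun z hz => ?_
  have hz' := Finset.mem_powerset.mp hz
  rw [Finset.prod_neg, Finset.prod_mul_distrib, Finset.prod_const,
    ← Finset.prod_sdiff hz']
  have e1 : ∏ j ∈ ω \ z, agree (d j) (d' j) (if j ∈ z then k j - 1 else k j) =
      ∏ j ∈ ω \ z, agree (d j) (d' j) (k j) :=
    Finset.prod_congr rfl fun j hj => by rw [if_neg (Finset.mem_sdiff.mp hj).2]
  have e2 : ∏ j ∈ z, agree (d j) (d' j) (if j ∈ z then k j - 1 else k j) =
      ∏ j ∈ z, agree (d j) (d' j) (k j - 1) :=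
    Finset.prod_congr rfl fun j hj => by rw [if_pos hj]
  rw [e1, e2]
  ring

variable {b s m : ℕ} [NeZero b]

lemma sum_lower_eq (ω z : Finset (Fin s)) (hz : z ⊆ ω) (k : Fin s → ℕ) (hk : ∀ j ∈ ω, k j ≠ 0) :
    ∑ j : ω, (if (j : Fin s) ∈ z then k j - 1 else k j) + z.card = ∑ j ∈ ω, k j := by
  classical
  rw [Finset.sum_coe_sort ω fun j => if j ∈ z then k j - 1 else k j]
  have h1 : z.card = ∑ j ∈ ω, if j ∈ z then 1 else 0 := by
    rw [← Finset.sum_filter, Finset.sum_const, smul_eq_mul, mul_one,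
      Finset.filter_mem_eq_inter, Finset.inter_eq_right.mpr hz]
  rw [h1, ← Finset.sum_add_distrib]
  refine Finset.sum_congr rfl fun j hj => ?_
  have := hk j hj
  split_ifs <;> omega

/-- Dropping a digit in the coordinates of `z` multiplies the number of points in the box by
`b^|z|`, which makes up for the smaller power `b^|ω \ z|`. The terms thus differ only in the sign
`(-1)^|z|`, and these signs cancel since `ω` is nonempty. -/
lemma sum_sum_prod_scrambleCorr_eq_zero {t : ℕ} {x : Fin (b ^ m) → Fin s → ℝ}
    {ω : Finset (Fin s)} (hω : ω.Nonempty) (hx : IsNet b t m fun i (j : ω) => x i j)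
    (k : Fin s → ℕ) (hk : ∀ j ∈ ω, k j ≠ 0) (hkm : ∑ j ∈ ω, k j + t ≤ m) :
    ∑ i, ∑ i', ∏ j ∈ ω, scrambleCorr (k j) (Real.digits (x i j) b) (Real.digits (x i' j) b) = 0 := by
  classical
  have : Nonempty ω := hω.to_subtype
  have hb0 : (b : ℝ) ≠ 0 := by exact_mod_cast NeZero.ne b
  refine Finset.sum_eq_zero fun i _ => ?_
  simp only [prod_scrambleCorr_expand _ _ ω k hk]
  rw [← Finset.mul_sum, Finset.sum_comm]
  have h1 : ∀ z ∈ ω.powerset, ∑ i' : Fin (b ^ m), (-1) ^ z.card * (b : ℝ) ^ (ω \ z).card *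
        ∏ j ∈ ω, agree (Real.digits (x i j) b) (Real.digits (x i' j) b)
          (if j ∈ z then k j - 1 else k j) =
      (-1) ^ z.card * ((b : ℝ) ^ ω.card * (b : ℝ) ^ (m - ∑ j ∈ ω, k j)) := by
    intro z hz
    have hz' := Finset.mem_powerset.mp hz
    have h2 := sum_lower_eq ω z hz' k hk
    rw [← Finset.mul_sum, sum_prod_agree_eq (fun i j => Real.digits (x i j) b) ω
      (fun j => if j ∈ z then k j - 1 else k j) i,
      hx.card_filter_prefixVal (fun j => if (j : Fin s) ∈ z then k j - 1 else k j) (by omega)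
      (fun j => prefixVal (Real.digits (x i j) b) (if (j : Fin s) ∈ z then k j - 1 else k j))
      (fun j => prefixVal_lt _ _)]
    rw [mul_assoc]
    congr 1
    push_cast
    rw [← pow_add, ← pow_add]
    congr 1
    have := Finset.card_sdiff_add_card_eq_card hz'
    omega
  rw [Finset.sum_congr rfl h1, ← Finset.sum_mul]
  have h3 : ∑ z ∈ ω.powerset, (-1 : ℝ) ^ z.card = 0 := by
    have := Finset.sum_powerset_neg_one_pow_card_of_nonempty hω
    exact_mod_cast this
  rw [h3, zero_mul, mul_zero]

/-- Beyond the resolution of the net there is no cancellation, but a box with `|z|` digits dropped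
still holds at most `b^(t+|z|)` points; the `2^|ω|` terms are estimated one by one. -/
lemma sum_sum_prod_scrambleCorr_le (hb : 2 ≤ b) {t : ℕ} {x : Fin (b ^ m) → Fin s → ℝ}
    {ω : Finset (Fin s)} (hω : ω.Nonempty) (hx : IsNet b t m fun i (j : ω) => x i j)
    (k : Fin s → ℕ) (hk : ∀ j ∈ ω, k j ≠ 0) :
    ∑ i, ∑ i', ∏ j ∈ ω, scrambleCorr (k j) (Real.digits (x i j) b) (Real.digits (x i' j) b) ≤
      if ∑ j ∈ ω, k j + t ≤ m then 0 else (b : ℝ) ^ m * (4 ^ ω.card * (b : ℝ) ^ t) := by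
  classical
  split_ifs with hkm
  · exact (sum_sum_prod_scrambleCorr_eq_zero hω hx k hk hkm).le
  have : Nonempty ω := hω.to_subtype
  have hb2 : (2 : ℝ) ≤ b := by exact_mod_cast hb
  have hb1 : 0 < (b : ℝ) - 1 := by linarith
  have hb0 : (0 : ℝ) < b := by linarith
  have hi : ∀ i : Fin (b ^ m), ∑ i', ∏ j ∈ ω, scrambleCorr (k j) (Real.digits (x i j) b)
      (Real.digits (x i' j) b) ≤ 4 ^ ω.card * (b : ℝ) ^ t := by
    intro i
    simp only [prod_scrambleCorr_expand _ _ ω k hk]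
    rw [← Finset.mul_sum, Finset.sum_comm]
    have h1 : ∀ z ∈ ω.powerset, ∑ i' : Fin (b ^ m), (-1) ^ z.card * (b : ℝ) ^ (ω \ z).card *
          ∏ j ∈ ω, agree (Real.digits (x i j) b) (Real.digits (x i' j) b)
            (if j ∈ z then k j - 1 else k j) ≤ (b : ℝ) ^ ω.card * (b : ℝ) ^ t := by
      intro z hz
      have hz' := Finset.mem_powerset.mp hz
      have h2 := sum_lower_eq ω z hz' k hk
      rw [← Finset.mul_sum, sum_prod_agree_eq (fun i j => Real.digits (x i j) b) ω
        (fun j => if j ∈ z then k j - 1 else k j) i]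
      have h3 := hx.card_filter_prefixVal_le
        (fun j => if (j : Fin s) ∈ z then k j - 1 else k j) z.card (by omega) i
      have h4 := Finset.card_sdiff_add_card_eq_card hz'
      calc _ ≤ 1 * (b : ℝ) ^ (ω \ z).card * (b : ℝ) ^ (t + z.card) := by
            refine mul_le_mul (mul_le_mul_of_nonneg_right ?_ (by positivity)) (by exact_mod_cast h3)
              (by positivity) (by positivity)
            rcases neg_one_pow_eq_or ℝ z.card with h | h <;> linarith
        _ = _ := by
            rw [one_mul, ← pow_add, ← pow_add]; congr 1; omega
    calc _ ≤ ((b : ℝ) - 1)⁻¹ ^ ω.card * ∑ _z ∈ ω.powerset, (b : ℝ) ^ ω.card * (b : ℝ) ^ t :=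
          mul_le_mul_of_nonneg_left (Finset.sum_le_sum h1) (by positivity)
      _ = (2 * (b : ℝ) * ((b : ℝ) - 1)⁻¹) ^ ω.card * (b : ℝ) ^ t := by
          rw [Finset.sum_const, Finset.card_powerset, nsmul_eq_mul, mul_pow, mul_pow]
          push_cast
          ring
      -- `2b/(b-1) ≤ 4` because `b ≥ 2`.
      _ ≤ _ := by
          refine mul_le_mul_of_nonneg_right (pow_le_pow_left₀ (by positivity) ?_ _) (by positivity)
          rw [← div_eq_mul_inv, div_le_iff₀ hb1]
          linarith
  calc _ ≤ ∑ _i : Fin (b ^ m), 4 ^ ω.card * (b : ℝ) ^ t := Finset.sum_le_sum fun i _ => hi i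
    _ = _ := by simp

end

end BDIS

/-! ### From step functions to integrable functions: the error of a scrambled net -/

open MeasureTheory

namespace BDIS

noncomputable section

open Filter Topology

/-! ### Cells -/

/-- The half-open cell of level `K` with multi-index `a`. -/
def cell (b : ℕ) {s : ℕ} (K : ℕ) (a : Fin s → ℕ) : Set (Fin s → ℝ) :=
  Set.univ.pi fun j => Set.Ico ((a j : ℝ) / (b : ℝ) ^ K) (((a j : ℝ) + 1) / (b : ℝ) ^ K)

/-- The half-open unit cube. -/
def unitCube (s : ℕ) : Set (Fin s → ℝ) := Set.univ.pi fun _ => Set.Ico (0 : ℝ) 1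

/-- The multi-index of the cell of level `K` containing the point `u`. -/
def cellIndex (b : ℕ) [NeZero b] {s : ℕ} (K : ℕ) (u : Fin s → ℝ) : Fin s → ℕ :=
  fun j => prefixVal (Real.digits (u j) b) K

/-- The average of `g` over the cell with multi-index `a`. -/
def cellAverage (b : ℕ) {s : ℕ} (K : ℕ) (g : (Fin s → ℝ) → ℝ) (a : Fin s → ℕ) : ℝ :=
  ((b : ℝ) ^ K) ^ s * ∫ u in cell b K a, g u

/-- The coefficient of `g` against a tensor product of Haar functions. -/
def haarInt (b : ℕ) [NeZero b] {s : ℕ} (g : (Fin s → ℝ) → ℝ) (k c : Fin s → ℕ) : ℝ :=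
  ∫ u, g u * ∏ j, haar (k j) (c j) (Real.digits (u j) b)

lemma measurableSet_cell (b : ℕ) {s : ℕ} (K : ℕ) (a : Fin s → ℕ) : MeasurableSet (cell b K a) :=
  MeasurableSet.univ_pi fun _ => measurableSet_Ico

lemma measurableSet_unitCube (s : ℕ) : MeasurableSet (unitCube s) :=
  MeasurableSet.univ_pi fun _ => measurableSet_Ico

lemma measurable_digits (b : ℕ) [NeZero b] : Measurable fun x : ℝ => Real.digits x b := by
  refine measurable_pi_lambda _ fun i => ?_
  unfold Real.digits
  exact (measurable_from_top (f := fun n : ℕ => Fin.ofNat b n)).comp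
    (Nat.measurable_floor.comp (measurable_id.mul_const _))

lemma measurable_haar {b : ℕ} (k c : ℕ) : Measurable fun d : ℕ → Fin b => haar k c d := by
  cases k with
  | zero => exact measurable_const
  | succ k =>
    simp only [haar]
    have h : ∀ K a, Measurable fun d : ℕ → Fin b => if prefixVal d K = a then (1 : ℝ) else 0 :=
      fun K a => Measurable.ite ((measurable_prefixVal K) (measurableSet_singleton a))
        measurable_const measurable_const
    exact ((h _ _).const_mul _).sub ((h _ _).const_mul _)

lemma abs_haar_le {b : ℕ} (hb : 0 < b) (k c : ℕ) (d : ℕ → Fin b) : |haar k c d| ≤ (b : ℝ) ^ k := by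
  have hb1 : (1 : ℝ) ≤ b := by exact_mod_cast hb
  cases k with
  | zero => simp [haar]
  | succ k =>
    simp only [haar]
    have h1 : (0 : ℝ) < (b : ℝ) ^ k := by positivity
    have h2 : (b : ℝ) ^ k ≤ (b : ℝ) ^ (k + 1) := pow_le_pow_right₀ hb1 (Nat.le_succ k)
    rw [abs_le]
    split_ifs <;> constructor <;> linarith

section

variable {b : ℕ} [NeZero b] {s : ℕ}

lemma base_pow_pos (K : ℕ) : (0 : ℝ) < (b : ℝ) ^ K := by
  have : (0 : ℝ) < b := by exact_mod_cast NeZero.pos b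
  positivity

lemma cell_subset_unitCube {K : ℕ} {a : Fin s → ℕ} (ha : a ∈ cellBox b s K) :
    cell b K a ⊆ unitCube s := by
  intro u hu j _
  simp only [cellBox, Fintype.mem_piFinset, Finset.mem_range] at ha
  have h := hu j trivial
  have hK := base_pow_pos (b := b) K
  refine ⟨le_trans (by positivity) h.1, h.2.trans_le ?_⟩
  rw [div_le_one hK]
  exact_mod_cast ha j

lemma mem_cell_iff {K : ℕ} {a : Fin s → ℕ} {u : Fin s → ℝ} (hu : u ∈ unitCube s) :
    u ∈ cell b K a ↔ cellIndex b K u = a := by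
  simp only [cell, Set.mem_univ_pi, cellIndex, funext_iff]
  exact forall_congr' fun j => (prefixVal_digits_eq_iff (hu j trivial) _ _).symm

lemma cellIndex_mem (K : ℕ) (u : Fin s → ℝ) : cellIndex b K u ∈ cellBox b s K := by
  simp only [cellBox, Fintype.mem_piFinset, Finset.mem_range]
  exact fun j => prefixVal_lt _ _

lemma unitCube_eq_biUnion (K : ℕ) :
    unitCube s = ⋃ a ∈ cellBox b s K, cell b K a := by
  ext u
  simp only [Set.mem_iUnion]
  exact ⟨fun hu => ⟨_, cellIndex_mem K u, (mem_cell_iff hu).mpr rfl⟩,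
    fun ⟨a, ha, hu⟩ => cell_subset_unitCube ha hu⟩

lemma sum_setIntegral_cell (K : ℕ) {F : (Fin s → ℝ) → ℝ} (hF : IntegrableOn F (unitCube s)) :
    ∑ a ∈ cellBox b s K, ∫ u in cell b K a, F u = ∫ u in unitCube s, F u := by
  rw [unitCube_eq_biUnion (b := b) K, integral_biUnion_finset]
  · exact fun a _ => measurableSet_cell b K a
  · intro a ha a' ha' hne
    rw [Function.onFun, Set.disjoint_left]
    intro u hu hu'
    have huc := cell_subset_unitCube ha hu
    exact hne (((mem_cell_iff huc).mp hu).symm.trans ((mem_cell_iff huc).mp hu'))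
  · exact fun a ha => hF.mono_set (cell_subset_unitCube ha)

lemma volume_real_cell (K : ℕ) (a : Fin s → ℕ) :
    volume.real (cell b K a) = (((b : ℝ) ^ K)⁻¹) ^ s := by
  have hK := base_pow_pos (b := b) K
  have h : ∀ j : Fin s, (volume (Set.Ico ((a j : ℝ) / (b : ℝ) ^ K)
      (((a j : ℝ) + 1) / (b : ℝ) ^ K))) = ENNReal.ofReal (((b : ℝ) ^ K)⁻¹) := by
    intro j
    rw [Real.volume_Ico]
    congr 1
    ring
  rw [measureReal_def, cell, volume_pi_pi, Finset.prod_congr rfl fun j _ => h j, Finset.prod_const,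
    Finset.card_univ, Fintype.card_fin, ENNReal.toReal_pow,
    ENNReal.toReal_ofReal (inv_nonneg.mpr hK.le)]

lemma volume_unitCube : volume (unitCube s) = 1 := by
  rw [unitCube, volume_pi_pi]
  simp

/-- Haar functions of level at most `K` are constant on the cells of level `K`, so averaging over
these cells loses nothing. -/
lemma haarCoeff_cellAverage {g : (Fin s → ℝ) → ℝ} (hg : Integrable g)
    (hg0 : ∀ u, u ∉ unitCube s → g u = 0) {K : ℕ} {k : Fin s → ℕ} (hk : ∀ j, k j ≤ K)
    (c : Fin s → ℕ) :
    haarCoeff (b := b) K (cellAverage b K g) k c = haarInt b g k c := by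
  have hK := base_pow_pos (b := b) K
  have hm : AEStronglyMeasurable
      (fun u : Fin s → ℝ => ∏ j, haar (k j) (c j) (Real.digits (u j) b)) :=
    (Finset.measurable_prod _ fun j _ => (measurable_haar (k j) (c j)).comp
      ((measurable_digits b).comp (measurable_pi_apply j))).aestronglyMeasurable
  have hint : Integrable fun u => g u * ∏ j, haar (k j) (c j) (Real.digits (u j) b) := by
    refine hg.mul_bdd (c := ∏ j, (b : ℝ) ^ k j) hm (Eventually.of_forall fun u => ?_)
    rw [Real.norm_eq_abs, Finset.abs_prod]
    exact Finset.prod_le_prod (fun _ _ => abs_nonneg _) fun j _ => abs_haar_le (NeZero.pos b) _ _ _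
  have h0 : haarInt b g k c =
      ∫ u in unitCube s, g u * ∏ j, haar (k j) (c j) (Real.digits (u j) b) := by
    rw [haarInt, setIntegral_eq_integral_of_forall_compl_eq_zero]
    intro u hu
    rw [hg0 u hu, zero_mul]
  rw [h0, ← sum_setIntegral_cell (b := b) K hint.integrableOn, haarCoeff]
  refine Finset.sum_congr rfl fun a ha => ?_
  have ha' := ha
  simp only [cellBox, Fintype.mem_piFinset, Finset.mem_range] at ha'
  rw [cellAverage, Finset.prod_mul_distrib, Finset.prod_const, Finset.card_univ, Fintype.card_fin]
  have hset : ∫ u in cell b K a, g u * ∏ j, haar (k j) (c j) (Real.digits (u j) b) =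
      ∫ u in cell b K a, g u * ∏ j, haar (k j) (c j) (digitsOf b K (a j)) := by
    refine setIntegral_congr_fun (measurableSet_cell b K a) fun u hu => ?_
    congr 1
    refine Finset.prod_congr rfl fun j _ => haar_congr (hk j) _ ?_
    rw [prefixVal_digitsOf (ha' j)]
    exact congrFun ((mem_cell_iff (cell_subset_unitCube ha hu)).mp hu) j
  rw [hset, integral_mul_const, inv_pow]
  field_simp

lemma cellAverage_eq_average (K : ℕ) (g : (Fin s → ℝ) → ℝ) (a : Fin s → ℕ) :
    cellAverage b K g a =
      ⨍ u in Metric.closedBall (fun j => ((a j : ℝ) + 1 / 2) / (b : ℝ) ^ K)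
        (((b : ℝ) ^ K)⁻¹ / 2), g u := by
  have hK := base_pow_pos (b := b) K
  have hball : Metric.closedBall (fun j : Fin s => ((a j : ℝ) + 1 / 2) / (b : ℝ) ^ K)
      (((b : ℝ) ^ K)⁻¹ / 2) = Set.univ.pi fun j =>
        Set.Icc ((a j : ℝ) / (b : ℝ) ^ K) (((a j : ℝ) + 1) / (b : ℝ) ^ K) := by
    rw [closedBall_pi _ (by positivity)]
    congr 1
    ext1 j
    rw [Real.closedBall_eq_Icc]
    congr 1 <;> ring
  have hae : (Metric.closedBall (fun j : Fin s => ((a j : ℝ) + 1 / 2) / (b : ℝ) ^ K)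
      (((b : ℝ) ^ K)⁻¹ / 2) : Set (Fin s → ℝ)) =ᵐ[volume] cell b K a := by
    rw [hball, cell]
    exact Measure.ae_eq_set_pi fun j _ => Ico_ae_eq_Icc.symm
  rw [setAverage_congr hae, setAverage_eq, volume_real_cell, cellAverage, smul_eq_mul, inv_pow,
    inv_inv]

/-- Lebesgue differentiation along cubes containing `u` but not centred at it. The cells are closed
because scrambled points may fall on the right boundary, and the sequence of cells is quantified
after the null set because it will be random. -/
lemma ae_tendsto_cellAverage (hb : 2 ≤ b) {g : (Fin s → ℝ) → ℝ} (hg : Integrable g) :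
    ∀ᵐ u : Fin s → ℝ, ∀ a : ℕ → Fin s → ℕ, (∀ K j, u j ∈ Set.Icc ((a K j : ℝ) / (b : ℝ) ^ K)
      (((a K j : ℝ) + 1) / (b : ℝ) ^ K)) →
      Tendsto (fun K => cellAverage b K g (a K)) atTop (𝓝 (g u)) := by
  filter_upwards [IsUnifLocDoublingMeasure.ae_tendsto_average volume hg.locallyIntegrable 1]
    with u hu a ha
  have hb1 : (1 : ℝ) < b := by exact_mod_cast (by omega : 1 < b)
  simp only [cellAverage_eq_average]
  refine hu (fun K j => ((a K j : ℝ) + 1 / 2) / (b : ℝ) ^ K) (fun K => ((b : ℝ) ^ K)⁻¹ / 2) ?_ ?_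
  · rw [tendsto_nhdsWithin_iff]
    constructor
    · have := (tendsto_inv_atTop_zero.comp (tendsto_pow_atTop_atTop_of_one_lt hb1)).div_const 2
      simpa [Function.comp_def] using this
    · exact Eventually.of_forall fun K => half_pos (inv_pos.mpr (base_pow_pos K))
  · refine Eventually.of_forall fun K => ?_
    have hK := base_pow_pos (b := b) K
    rw [Metric.mem_closedBall, one_mul, dist_pi_le_iff (by positivity)]
    intro j
    have h := ha K j
    rw [Real.dist_eq, abs_le]
    have e1 : ((a K j : ℝ) + 1 / 2) / (b : ℝ) ^ K =
      (a K j : ℝ) / (b : ℝ) ^ K + ((b : ℝ) ^ K)⁻¹ / 2 := by ring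
    have e2 : ((a K j : ℝ) + 1) / (b : ℝ) ^ K =
      (a K j : ℝ) / (b : ℝ) ^ K + ((b : ℝ) ^ K)⁻¹ := by ring
    rw [Set.mem_Icc, e2] at h
    rw [e1]
    constructor <;> linarith [h.1, h.2]

lemma tendsto_prefixVal_div (hb : 2 ≤ b) (d : ℕ → Fin b) :
    Tendsto (fun K => (prefixVal d K : ℝ) / (b : ℝ) ^ K) atTop (𝓝 (Real.ofDigits d)) := by
  have hb1 : (1 : ℝ) < b := by exact_mod_cast (by omega : 1 < b)
  have h0 : Tendsto (fun K : ℕ => Real.ofDigits d - ((b : ℝ) ^ K)⁻¹) atTop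
      (𝓝 (Real.ofDigits d)) := by
    simpa using tendsto_const_nhds.sub
      (tendsto_inv_atTop_zero.comp (tendsto_pow_atTop_atTop_of_one_lt hb1))
  refine tendsto_of_tendsto_of_tendsto_of_le_of_le h0 tendsto_const_nhds (fun K => ?_) (fun K => ?_)
  · have := (ofDigits_mem_Icc (NeZero.pos b) d K).2
    simp only
    rw [add_div, one_div] at this
    linarith
  · exact (ofDigits_mem_Icc (NeZero.pos b) d K).1

end

/-! ### Scrambled points are uniformly distributed -/

section

variable {Ω : Type*} [MeasurableSpace Ω] {P : Measure Ω} {b s : ℕ} [NeZero b]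
  {σ : Fin s → List (Fin b) → Ω → Equiv.Perm (Fin b)}

lemma measurable_scramble (hσ : IsOwenPermutations P σ) (x : Fin s → ℝ) :
    Measurable fun r => scramble (fun j l => σ j l r) x := by
  refine measurable_pi_lambda _ fun j => ?_
  have h : Measurable (@Real.ofDigits b) := Real.continuous_ofDigits.measurable
  exact h.comp (measurable_scrambledDigits hσ j _)

/-- A bounded continuous function is replaced by its value at the lower corner of the cell of level
`K`. For the scrambled point and for a uniform point the integral is then the same average over the
cells, and `K → ∞` identifies the two laws. -/
lemma map_scramble [IsProbabilityMeasure P] (hb : 2 ≤ b) (hσ : IsOwenPermutations P σ)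
    (x : Fin s → ℝ) :
    P.map (fun r => scramble (fun j l => σ j l r) x) = volume.restrict (unitCube s) := by
  have hmeas := measurable_scramble hσ x
  have : IsFiniteMeasure (volume.restrict (unitCube s)) := ⟨by
    rw [Measure.restrict_apply_univ, volume_unitCube]; exact ENNReal.one_lt_top⟩
  have : IsProbabilityMeasure (P.map (fun r => scramble (fun j l => σ j l r) x)) :=
    Measure.isProbabilityMeasure_map hmeas.aemeasurable
  refine ext_of_forall_integral_eq_of_IsFiniteMeasure fun f => ?_
  rw [integral_map hmeas.aemeasurable f.continuous.aestronglyMeasurable]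
  let G : ℕ → (Fin s → ℕ) → ℝ := fun K a => f fun j => (a j : ℝ) / (b : ℝ) ^ K
  have h1 : Tendsto (fun K => ∫ r, G K (scrambledCell σ K (fun j => Real.digits (x j) b) r) ∂P)
      atTop (𝓝 (∫ r, f (scramble (fun j l => σ j l r) x) ∂P)) := by
    refine tendsto_integral_of_dominated_convergence (fun _ => ‖f‖) (fun K => ?_)
      (integrable_const _) (fun K => Eventually.of_forall fun r => f.norm_coe_le_norm _)
      (Eventually.of_forall fun r => ?_)
    · exact ((measurable_of_countable (G K)).comp
        (measurable_scrambledCell hσ K _)).aestronglyMeasurable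
    · refine (f.continuous.tendsto _).comp (tendsto_pi_nhds.mpr fun j => ?_)
      exact tendsto_prefixVal_div hb _
  have h2 : Tendsto (fun K => ∫ u in unitCube s, G K (cellIndex b K u)) atTop
      (𝓝 (∫ u in unitCube s, f u)) := by
    refine tendsto_integral_of_dominated_convergence (fun _ => ‖f‖) (fun K => ?_)
      (integrable_const _) (fun K => Eventually.of_forall fun r => f.norm_coe_le_norm _)
      ((ae_restrict_iff' (measurableSet_unitCube s)).mpr (Eventually.of_forall fun u hu => ?_))
    · exact ((measurable_of_countable (G K)).comp (measurable_pi_lambda _ fun j =>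
        (measurable_prefixVal K).comp ((measurable_digits b).comp
          (measurable_pi_apply j)))).aestronglyMeasurable
    · refine (f.continuous.tendsto _).comp (tendsto_pi_nhds.mpr fun j => ?_)
      have := tendsto_prefixVal_div hb (Real.digits (u j) b)
      rwa [Real.ofDigits_digits (by omega) (hu j trivial)] at this
  refine tendsto_nhds_unique h1 (h2.congr fun K => ?_)
  rw [integral_scrambledCell hb hσ K _ (G K), ← sum_setIntegral_cell (b := b) K]
  · refine Finset.sum_congr rfl fun a ha => ?_
    rw [setIntegral_congr_fun (measurableSet_cell b K a) (g := fun _ => G K a), setIntegral_const,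
      volume_real_cell, smul_eq_mul, mul_comm]
    intro u hu
    simp only [(mem_cell_iff (cell_subset_unitCube ha hu)).mp hu]
  · refine Integrable.of_bound (C := ‖f‖) ?_ (Eventually.of_forall fun u => f.norm_coe_le_norm _)
    exact ((measurable_of_countable (G K)).comp (measurable_pi_lambda _ fun j =>
        (measurable_prefixVal K).comp ((measurable_digits b).comp
          (measurable_pi_apply j)))).aestronglyMeasurable

end

end

end BDIS

open MeasureTheory

namespace BDIS

noncomputable section

open Filter Topology

/-! ### The variance of a scrambled net -/

variable {Ω : Type*} [MeasurableSpace Ω] {P : Measure Ω} {b s m : ℕ} [NeZero b]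
  {σ : Fin s → List (Fin b) → Ω → Equiv.Perm (Fin b)}

/-- The set of coordinates in which a multi-index is positive. -/
def support {s : ℕ} (k : Fin s → ℕ) : Finset (Fin s) := Finset.univ.filter fun j => k j ≠ 0

/-- The part of the `L²` norm of `g` belonging to the Haar functions of level `k`. -/
def haarEnergy (b : ℕ) [NeZero b] {s : ℕ} (g : (Fin s → ℝ) → ℝ) (k : Fin s → ℕ) : ℝ :=
  (∏ j, ((b : ℝ) ^ k j)⁻¹) * ∑ c ∈ Fintype.piFinset fun j => Finset.range (b ^ k j),
    haarInt b g k c ^ 2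

/-- An upper bound for the gain coefficient of level `k`. -/
def gainBound (b m : ℕ) {s : ℕ} (t : Finset (Fin s) → ℕ) (k : Fin s → ℕ) : ℝ :=
  if ∑ j, k j + t (support k) ≤ m then 0 else 4 ^ (support k).card * (b : ℝ) ^ t (support k)

lemma haarEnergy_nonneg (g : (Fin s → ℝ) → ℝ) (k : Fin s → ℕ) : 0 ≤ haarEnergy b g k := by
  unfold haarEnergy; positivity

lemma sum_sum_scrambleCorr_le_gainBound (hb : 2 ≤ b) {t : Finset (Fin s) → ℕ}
    {x : Fin (b ^ m) → Fin s → ℝ} (hx : HasQualityParams b m t x) (k : Fin s → ℕ)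
    (hk : (support k).Nonempty) :
    ∑ i, ∑ i', ∏ j, scrambleCorr (k j) (Real.digits (x i j) b) (Real.digits (x i' j) b) ≤
      (b : ℝ) ^ m * gainBound b m t k := by
  have h1 : ∀ i i', ∏ j, scrambleCorr (k j) (Real.digits (x i j) b) (Real.digits (x i' j) b) =
      ∏ j ∈ support k, scrambleCorr (k j) (Real.digits (x i j) b) (Real.digits (x i' j) b) := by
    intro i i'
    symm
    refine Finset.prod_subset (Finset.subset_univ _) fun j _ hj => ?_
    have : k j = 0 := by simpa [support] using hj
    rw [this]; rfl
  have h2 : ∑ j ∈ support k, k j = ∑ j, k j :=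
    Finset.sum_filter_ne_zero _
  have h3 := sum_sum_prod_scrambleCorr_le hb hk (hx _ hk) k
    (fun j hj => by simpa [support] using hj)
  simp only [h1]
  refine h3.trans (le_of_eq ?_)
  rw [gainBound, h2]
  split_ifs <;> simp

lemma memLp_comp_scrambledCell [IsFiniteMeasure P] (hσ : IsOwenPermutations P σ) (K : ℕ)
    (d : Fin s → ℕ → Fin b) (G : (Fin s → ℕ) → ℝ) :
    MemLp (fun r => G (scrambledCell σ K d r)) 2 P := by
  refine MemLp.of_bound ((measurable_of_countable G).comp
    (measurable_scrambledCell hσ K d)).aestronglyMeasurable (∑ a ∈ cellBox b s K, |G a|)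
    (Eventually.of_forall fun r => ?_)
  exact Finset.single_le_sum (f := fun a => |G a|) (fun _ _ => abs_nonneg _)
        (scrambledCell_mem σ K d r)

/-- The level `k = 0` contributes exactly the square of the mean to the second moment and drops out
of the variance; the gain bounds apply to the other levels. -/
lemma integral_cellAverage_sub_sq_le [IsProbabilityMeasure P] (hb : 2 ≤ b)
    (hσ : IsOwenPermutations P σ) {t : Finset (Fin s) → ℕ} {x : Fin (b ^ m) → Fin s → ℝ}
    (hx : HasQualityParams b m t x) {g : (Fin s → ℝ) → ℝ} (hg : Integrable g)
    (hg0 : ∀ u, u ∉ unitCube s → g u = 0) (K : ℕ) :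
    ∫ r, (((b : ℝ) ^ m)⁻¹ * ∑ i, cellAverage b K g
        (scrambledCell σ K (fun j => Real.digits (x i j) b) r) - ∫ u, g u) ^ 2 ∂P ≤
      ((b : ℝ) ^ m)⁻¹ * ∑ k ∈ (Fintype.piFinset fun _ : Fin s => Finset.range (K + 1)).filter
        (fun k => (support k).Nonempty), gainBound b m t k * haarEnergy b g k := by
  classical
  set I := ∫ u, g u with hI
  set G := cellAverage b K g
  have hbm := base_pow_pos (b := b) m
  have hbK := base_pow_pos (b := b) K
  have hI' : ∑ a ∈ cellBox b s K, G a * (((b : ℝ) ^ K)⁻¹) ^ s = I := by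
    have h1 : ∀ a, G a * (((b : ℝ) ^ K)⁻¹) ^ s = ∫ u in cell b K a, g u := by
      intro a
      simp only [G, cellAverage, inv_pow]
      field_simp
    rw [Finset.sum_congr rfl fun a _ => h1 a, sum_setIntegral_cell K hg.integrableOn,
      setIntegral_eq_integral_of_forall_compl_eq_zero hg0]
  set S : Ω → ℝ := fun r => ∑ i, G (scrambledCell σ K (fun j => Real.digits (x i j) b) r) with hS
  have hSL : MemLp S 2 P := memLp_finsetSum _ fun i _ => memLp_comp_scrambledCell hσ K _ G
  have hSi : Integrable S P := hSL.integrable one_le_two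
  have hS2 : Integrable (fun r => S r ^ 2) P := hSL.integrable_sq
  have hES : ∫ r, S r ∂P = (b : ℝ) ^ m * I := by
    rw [hS, integral_finsetSum _ fun i _ =>
      (memLp_comp_scrambledCell hσ K _ G).integrable one_le_two]
    simp only [integral_scrambledCell hb hσ K _ G, hI']
    simp
  have hES2 := integral_sum_scrambledCell_sq hb hσ K
    (fun i j => Real.digits (x i j) b) G
  change ∫ r, S r ^ 2 ∂P = _ at hES2
  have h0 : ∀ k ∈ Fintype.piFinset fun _ : Fin s => Finset.range (K + 1),
      ∀ c, haarCoeff (b := b) K G k c = haarInt b g k c := by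
    intro k hk c
    simp only [Fintype.mem_piFinset, Finset.mem_range] at hk
    exact haarCoeff_cellAverage hg hg0 (fun j => by have := hk j; omega) c
  have hterm : ∀ k ∈ Fintype.piFinset fun _ : Fin s => Finset.range (K + 1),
      (∑ i, ∑ i', ∏ j, scrambleCorr (k j) (Real.digits (x i j) b) (Real.digits (x i' j) b)) *
        ((∏ j, ((b : ℝ) ^ k j)⁻¹) * ∑ c ∈ Fintype.piFinset fun j => Finset.range (b ^ k j),
          haarCoeff (b := b) K G k c ^ 2) =
      (∑ i, ∑ i', ∏ j, scrambleCorr (k j) (Real.digits (x i j) b) (Real.digits (x i' j) b)) *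
        haarEnergy b g k := by
    intro k hk
    rw [haarEnergy]
    simp only [h0 k hk]
  rw [Finset.sum_congr rfl hterm] at hES2
  have hzero : (fun _ => 0 : Fin s → ℕ) ∈ Fintype.piFinset fun _ : Fin s => Finset.range (K + 1) :=
    by simp
  have hE0 : haarEnergy b g (fun _ => 0 : Fin s → ℕ) = I ^ 2 := by
    have h1 : (Fintype.piFinset fun _ : Fin s => Finset.range (b ^ 0)) = {fun _ => 0} := by
      ext c; simp [funext_iff]
    rw [haarEnergy, h1]
    simp [haarInt, haar, hI]
  have hfilter : (Fintype.piFinset fun _ : Fin s => Finset.range (K + 1)).filter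
      (fun k => (support k).Nonempty) =
      (Fintype.piFinset fun _ : Fin s => Finset.range (K + 1)).erase (fun _ => 0) := by
    ext k
    simp only [Finset.mem_filter, Finset.mem_erase, support, ne_eq, funext_iff]
    simp [Finset.Nonempty, and_comm]
  rw [← Finset.add_sum_erase _ _ hzero, hE0, ← hfilter] at hES2
  simp only [scrambleCorr, Finset.prod_const_one, Finset.sum_const, Finset.card_univ,
    Fintype.card_fin, nsmul_eq_mul, mul_one] at hES2
  push_cast at hES2
  have hle : ∫ r, S r ^ 2 ∂P ≤ ((b : ℝ) ^ m * I) ^ 2 + (b : ℝ) ^ m * ∑ k ∈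
      (Fintype.piFinset fun _ : Fin s => Finset.range (K + 1)).filter
        (fun k => (support k).Nonempty), gainBound b m t k * haarEnergy b g k := by
    rw [hES2, Finset.mul_sum]
    refine add_le_add (le_of_eq (by ring)) (Finset.sum_le_sum fun k hk => ?_)
    rw [← mul_assoc]
    exact mul_le_mul_of_nonneg_right
      (sum_sum_scrambleCorr_le_gainBound hb hx k (Finset.mem_filter.mp hk).2)
      (haarEnergy_nonneg g k)
  have hexp : ∀ r, (((b : ℝ) ^ m)⁻¹ * S r - I) ^ 2 =
      (((b : ℝ) ^ m)⁻¹) ^ 2 * S r ^ 2 - 2 * ((b : ℝ) ^ m)⁻¹ * I * S r + I ^ 2 := fun r => by ring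
  change ∫ r, (((b : ℝ) ^ m)⁻¹ * S r - I) ^ 2 ∂P ≤ _
  simp only [hexp]
  have hi1 : Integrable (fun r => (((b : ℝ) ^ m)⁻¹) ^ 2 * S r ^ 2) P := hS2.const_mul _
  have hi2 : Integrable (fun r => 2 * ((b : ℝ) ^ m)⁻¹ * I * S r) P := hSi.const_mul _
  have hi3 : Integrable (fun r => (((b : ℝ) ^ m)⁻¹) ^ 2 * S r ^ 2 -
      2 * ((b : ℝ) ^ m)⁻¹ * I * S r) P := hi1.sub hi2
  rw [integral_add hi3 (integrable_const _), integral_sub hi1 hi2, integral_const_mul,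
    integral_const_mul, hES]
  simp only [integral_const, probReal_univ, one_smul]
  set A := ∑ k ∈ (Fintype.piFinset fun _ : Fin s => Finset.range (K + 1)).filter
        (fun k => (support k).Nonempty), gainBound b m t k * haarEnergy b g k
  have h5 : (((b : ℝ) ^ m)⁻¹) ^ 2 * ∫ r, S r ^ 2 ∂P ≤
      (((b : ℝ) ^ m)⁻¹) ^ 2 * (((b : ℝ) ^ m * I) ^ 2 + (b : ℝ) ^ m * A) :=
    mul_le_mul_of_nonneg_left hle (by positivity)
  have h6 : (((b : ℝ) ^ m)⁻¹) ^ 2 * (((b : ℝ) ^ m * I) ^ 2 + (b : ℝ) ^ m * A) -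
      2 * ((b : ℝ) ^ m)⁻¹ * I * ((b : ℝ) ^ m * I) + I ^ 2 = ((b : ℝ) ^ m)⁻¹ * A := by
    field_simp; ring
  linarith

/-- The mean square error of the scrambled net estimator of the integral of `g` is bounded by the
Haar energies of `g`, weighted with the gain coefficients. -/
theorem scrambled_net_error_le [IsProbabilityMeasure P] (hb : 2 ≤ b)
    (hσ : IsOwenPermutations P σ) {t : Finset (Fin s) → ℕ} {x : Fin (b ^ m) → Fin s → ℝ}
    (hx : HasQualityParams b m t x) {g : (Fin s → ℝ) → ℝ} (hg : Integrable g)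
    (hg0 : ∀ u, u ∉ unitCube s → g u = 0) {B : ℝ}
    (hB : ∀ K, ((b : ℝ) ^ m)⁻¹ * ∑ k ∈ (Fintype.piFinset fun _ : Fin s =>
      Finset.range (K + 1)).filter (fun k => (support k).Nonempty),
        gainBound b m t k * haarEnergy b g k ≤ B) :
    MemLp (fun r => ((b : ℝ) ^ m)⁻¹ * ∑ i, g (scramble (fun j l => σ j l r) (x i))) 2 P ∧
      ∫ r, |((b : ℝ) ^ m)⁻¹ * ∑ i, g (scramble (fun j l => σ j l r) (x i)) - ∫ u, g u| ^ 2 ∂P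
        ≤ B := by
  set I := ∫ u, g u
  set Q : ℕ → Ω → ℝ := fun K r => ((b : ℝ) ^ m)⁻¹ * ∑ i, cellAverage b K g
        (scrambledCell σ K (fun j => Real.digits (x i j) b) r) - I with hQ
  set Q' : Ω → ℝ := fun r => ((b : ℝ) ^ m)⁻¹ * ∑ i, g (scramble (fun j l => σ j l r) (x i)) - I
  have hQL : ∀ K, MemLp (Q K) 2 P := fun K => ((memLp_finsetSum _ fun i _ =>
    memLp_comp_scrambledCell hσ K _ (cellAverage b K g)).const_mul _).sub (memLp_const _)
  have hlim : ∀ᵐ r ∂P, Tendsto (fun K => Q K r) atTop (𝓝 (Q' r)) := by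
    have h1 : ∀ i, ∀ᵐ r ∂P, Tendsto (fun K => cellAverage b K g
        (scrambledCell σ K (fun j => Real.digits (x i j) b) r)) atTop
        (𝓝 (g (scramble (fun j l => σ j l r) (x i)))) := by
      intro i
      have h2 := ae_tendsto_cellAverage hb hg
      have h3 : ∀ᵐ u ∂(P.map fun r => scramble (fun j l => σ j l r) (x i)),
          ∀ a : ℕ → Fin s → ℕ, (∀ K j, u j ∈ Set.Icc ((a K j : ℝ) / (b : ℝ) ^ K)
            (((a K j : ℝ) + 1) / (b : ℝ) ^ K)) →
            Tendsto (fun K => cellAverage b K g (a K)) atTop (𝓝 (g u)) := by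
        -- Scrambled points are uniform, so almost surely they avoid the exceptional Lebesgue-null
        -- set.
        rw [map_scramble hb hσ]
        exact ae_restrict_of_ae h2
      filter_upwards [ae_of_ae_map (measurable_scramble hσ (x i)).aemeasurable h3] with r hr
      exact hr _ fun K j => ofDigits_mem_Icc (NeZero.pos b) _ K
    filter_upwards [ae_all_iff.mpr h1] with r hr
    exact ((tendsto_finsetSum _ fun i _ => hr i).const_mul _).sub_const _
  have hmeas : AEStronglyMeasurable Q' P :=
    aestronglyMeasurable_of_tendsto_ae atTop (fun K => (hQL K).aestronglyMeasurable) hlim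
  have hB0 : 0 ≤ B := le_trans (integral_nonneg fun r => sq_nonneg _)
    ((integral_cellAverage_sub_sq_le hb hσ hx hg hg0 0).trans (hB 0))
  -- Fatou's lemma along the cell averages; it yields square integrability and the bound at once.
  have hlint : ∫⁻ r, ENNReal.ofReal (Q' r ^ 2) ∂P ≤ ENNReal.ofReal B := by
    have h1 : ∫⁻ r, ENNReal.ofReal (Q' r ^ 2) ∂P ≤
        ∫⁻ r, liminf (fun K => ENNReal.ofReal (Q K r ^ 2)) atTop ∂P := by
      refine lintegral_mono_ae ?_
      filter_upwards [hlim] with r hr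
      have : Tendsto (fun K => ENNReal.ofReal (Q K r ^ 2)) atTop
          (𝓝 (ENNReal.ofReal (Q' r ^ 2))) :=
        (ENNReal.continuous_ofReal.tendsto _).comp (hr.pow 2)
      exact this.liminf_eq.ge
    refine h1.trans ((lintegral_liminf_le' fun K => ?_).trans ?_)
    · exact (((hQL K).aestronglyMeasurable.aemeasurable).pow_const 2).ennreal_ofReal
    · have h2 : ∀ K, ∫⁻ r, ENNReal.ofReal (Q K r ^ 2) ∂P ≤ ENNReal.ofReal B := by
        intro K
        rw [← ofReal_integral_eq_lintegral_ofReal (hQL K).integrable_sq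
          (Eventually.of_forall fun r => sq_nonneg _)]
        exact ENNReal.ofReal_le_ofReal
          ((integral_cellAverage_sub_sq_le hb hσ hx hg hg0 K).trans (hB K))
      exact liminf_le_of_frequently_le' (Frequently.of_forall h2)
  have hQ'L : MemLp Q' 2 P := by
    rw [memLp_two_iff_integrable_sq hmeas]
    refine ⟨hmeas.pow 2, ?_⟩
    rw [hasFiniteIntegral_iff_ofReal (Eventually.of_forall fun r => sq_nonneg _)]
    exact hlint.trans_lt ENNReal.ofReal_lt_top
  constructor
  · have := hQ'L.add (memLp_const I)
    refine this.ae_eq (Eventually.of_forall fun r => ?_)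
    simp [Q']
  · simp only [sq_abs]
    change ∫ r, Q' r ^ 2 ∂P ≤ B
    rw [integral_eq_lintegral_of_nonneg_ae (Eventually.of_forall fun r => sq_nonneg _)
      (hmeas.pow 2)]
    exact ENNReal.toReal_le_of_le_ofReal hB0 hlint

end

end BDIS

/-! ### The damping weight, its transport map and the one-variable estimates -/

open MeasureTheory

namespace BDIS

noncomputable section

open Filter Topology

/-! ### The profile `η` and its derivative -/

lemma exists_rpow_mul_exp_le {r c : ℝ} (hr : 0 ≤ r) (hc : 0 < c) :
    ∃ C, 0 < C ∧ ∀ x : ℝ, 0 < x → x ^ r * Real.exp (-(c * x)) ≤ C := by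
  obtain ⟨n, hn⟩ := exists_nat_ge r
  refine ⟨1 + (n.factorial : ℝ) / c ^ n, by positivity, fun x hx => ?_⟩
  have h1 : x ^ r ≤ 1 + x ^ n := by
    rcases le_total x 1 with h | h
    · have : x ^ r ≤ 1 := Real.rpow_le_one hx.le h hr
      have : (0 : ℝ) ≤ x ^ n := by positivity
      linarith
    · have : x ^ r ≤ x ^ (n : ℝ) := Real.rpow_le_rpow_of_exponent_le h hn
      rw [Real.rpow_natCast] at this
      linarith
  have h2 : (c * x) ^ n / n.factorial ≤ Real.exp (c * x) :=
    Real.pow_div_factorial_le_exp (c * x) (by positivity) n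
  have h3 : x ^ n ≤ (n.factorial : ℝ) / c ^ n * Real.exp (c * x) := by
    rw [mul_pow, div_le_iff₀ (by positivity)] at h2
    rw [div_mul_eq_mul_div, le_div_iff₀ (by positivity)]
    linarith
  have h4 : (1 : ℝ) ≤ Real.exp (c * x) := Real.one_le_exp (by positivity)
  calc x ^ r * Real.exp (-(c * x)) ≤
        ((1 + (n.factorial : ℝ) / c ^ n) * Real.exp (c * x)) * Real.exp (-(c * x)) := by
        refine mul_le_mul_of_nonneg_right ?_ (Real.exp_pos _).le
        rw [add_mul, one_mul]; linarith
    _ = _ := by rw [mul_assoc, ← Real.exp_add]; simp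

lemma exists_rpow_neg_mul_exp_le {p a c : ℝ} (hp : 0 < p) (ha : 0 ≤ a) (hc : 0 < c) :
    ∃ C, 0 < C ∧ ∀ t : ℝ, 0 < t → t ^ (-a) * Real.exp (-(c * t ^ (-p))) ≤ C := by
  obtain ⟨C, hC, h⟩ := exists_rpow_mul_exp_le (r := a / p) (div_nonneg ha hp.le) hc
  refine ⟨C, hC, fun t ht => ?_⟩
  have := h (t ^ (-p)) (Real.rpow_pos_of_pos ht _)
  rwa [← Real.rpow_mul ht.le, show -p * (a / p) = -a by field_simp] at this

/-- The normalizing constant of `η`. -/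
def etaConst (p : ℝ) : ℝ := 2 ^ (-p - 2) * Real.exp (2 ^ p)

lemma etaConst_pos (p : ℝ) : 0 < etaConst p :=
  mul_pos (Real.rpow_pos_of_pos two_pos _) (Real.exp_pos _)

lemma eta_of_pos {p t : ℝ} (ht : 0 < t) :
    eta p t = etaConst p * (t ^ (-p - 1) * Real.exp (-t ^ (-p))) := by
  rw [eta, if_pos ht, etaConst, sub_eq_add_neg (2 ^ p : ℝ), Real.exp_add]
  ring

lemma eta_of_nonpos {p t : ℝ} (ht : t ≤ 0) : eta p t = 0 := if_neg ht.not_gt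

lemma eta_pos {p t : ℝ} (ht : 0 < t) : 0 < eta p t := by
  rw [eta_of_pos ht]
  exact mul_pos (etaConst_pos p) (mul_pos (Real.rpow_pos_of_pos ht _) (Real.exp_pos _))

lemma eta_nonneg (p t : ℝ) : 0 ≤ eta p t := by
  rcases le_or_gt t 0 with h | h
  · rw [eta_of_nonpos h]
  · exact (eta_pos h).le

lemma eta_half (p : ℝ) : eta p (1 / 2) = 1 / 2 := by
  rw [eta, if_pos (by norm_num)]
  have h : ∀ r : ℝ, (1 / 2 : ℝ) ^ (-r) = 2 ^ r := fun r => by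
    rw [one_div, Real.inv_rpow two_pos.le, Real.rpow_neg two_pos.le, inv_inv]
  rw [h, sub_self, Real.exp_zero, mul_one, show -p - 1 = -(p + 1) by ring, h,
    ← Real.rpow_add two_pos, show -p - 2 + (p + 1) = -1 by ring, Real.rpow_neg_one]
  norm_num

/-- With `τ = 2t` and `y = τ^(-p) ≥ 1` one has `η = (1/2) τ^(-(p+1)) exp(2^p (1-y))`. As `p ≥ 1`,
the power is at most `y²` and `2^p ≥ 2`, and `y ≤ exp(y-1)` concludes. -/
lemma eta_le_half {p t : ℝ} (hp : 1 ≤ p) (ht : t ≤ 1 / 2) : eta p t ≤ 1 / 2 := by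
  rcases le_or_gt t 0 with h | h
  · rw [eta_of_nonpos h]; norm_num
  set τ := 2 * t with hτ
  have hτ0 : 0 < τ := by positivity
  have hτ1 : τ ≤ 1 := by linarith
  have ht' : t = τ / 2 := by rw [hτ]; ring
  set y := τ ^ (-p) with hy
  have hy1 : 1 ≤ y := Real.one_le_rpow_of_pos_of_le_one_of_nonpos hτ0 hτ1 (by linarith)
  have h2p : (2 : ℝ) ≤ 2 ^ p := by
    simpa using Real.rpow_le_rpow_of_exponent_le (one_le_two : (1 : ℝ) ≤ 2) hp
  have hdiv : ∀ r : ℝ, t ^ (-r) = 2 ^ r * τ ^ (-r) := by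
    intro r
    rw [ht', Real.div_rpow hτ0.le two_pos.le, Real.rpow_neg two_pos.le, div_inv_eq_mul, mul_comm]
  have e1 : eta p t = 1 / 2 * (τ ^ (-(p + 1)) * Real.exp (2 ^ p * (1 - y))) := by
    rw [eta, if_pos h, show -p - 1 = -(p + 1) by ring, hdiv, hdiv, ← hy,
      show (2 : ℝ) ^ p - 2 ^ p * y = 2 ^ p * (1 - y) by ring]
    have : (2 : ℝ) ^ (-p - 2) * 2 ^ (p + 1) = 1 / 2 := by
      rw [← Real.rpow_add two_pos, show -p - 2 + (p + 1) = -1 by ring, Real.rpow_neg_one]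
      norm_num
    linear_combination (τ ^ (-(p + 1)) * Real.exp (2 ^ p * (1 - y))) * this
  have e2 : τ ^ (-(p + 1)) ≤ y ^ 2 := by
    rw [hy, ← Real.rpow_natCast, ← Real.rpow_mul hτ0.le]
    exact Real.rpow_le_rpow_of_exponent_ge hτ0 hτ1 (by push_cast; linarith)
  have e3 : y ≤ Real.exp (y - 1) := by linarith [Real.add_one_le_exp (y - 1)]
  have e4 : y ^ 2 ≤ Real.exp (2 ^ p * (y - 1)) := by
    calc y ^ 2 ≤ Real.exp (y - 1) ^ 2 := pow_le_pow_left₀ (by linarith) e3 2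
      _ = Real.exp (2 * (y - 1)) := by rw [← Real.exp_nat_mul]; norm_num
      _ ≤ _ := Real.exp_le_exp.mpr (mul_le_mul_of_nonneg_right h2p (by linarith))
  have e5 : τ ^ (-(p + 1)) * Real.exp (2 ^ p * (1 - y)) ≤ 1 := by
    calc _ ≤ Real.exp (2 ^ p * (y - 1)) * Real.exp (2 ^ p * (1 - y)) :=
          mul_le_mul_of_nonneg_right (e2.trans e4) (Real.exp_pos _).le
      _ = 1 := by rw [← Real.exp_add]; simp [← mul_add]
  rw [e1]
  linarith

/-- The derivative of `η`. -/
def etaDeriv (p t : ℝ) : ℝ := eta p t * (p * t ^ (-p - 1) - (p + 1) / t)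

lemma etaDeriv_of_nonpos {p t : ℝ} (ht : t ≤ 0) : etaDeriv p t = 0 := by
  rw [etaDeriv, eta_of_nonpos ht, zero_mul]

lemma exists_eta_le {p : ℝ} (hp : 1 ≤ p) (a : ℝ) (ha : 0 ≤ a) :
    ∃ C, 0 < C ∧ ∀ t, 0 < t → eta p t ≤ C * t ^ a := by
  obtain ⟨C, hC, h⟩ := exists_rpow_neg_mul_exp_le (p := p) (a := p + 1 + a) (c := 1) (by linarith)
    (by linarith) one_pos
  refine ⟨etaConst p * C, mul_pos (etaConst_pos p) hC, fun t ht => ?_⟩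
  rw [eta_of_pos ht, mul_assoc]
  refine mul_le_mul_of_nonneg_left ?_ (etaConst_pos p).le
  have h1 := h t ht
  have h2 : t ^ (-p - 1) = t ^ (-(p + 1 + a)) * t ^ a := by
    rw [← Real.rpow_add ht]; congr 1; ring
  rw [h2, mul_right_comm]
  rw [one_mul] at h1
  exact mul_le_mul_of_nonneg_right h1 (Real.rpow_nonneg ht.le _)

lemma hasDerivAt_eta {p : ℝ} (hp : 1 ≤ p) (t : ℝ) : HasDerivAt (eta p) (etaDeriv p t) t := by
  rcases lt_trichotomy t 0 with h | h | h
  · rw [etaDeriv_of_nonpos h.le]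
    refine (hasDerivAt_const t (0 : ℝ)).congr_of_eventuallyEq ?_
    filter_upwards [Iio_mem_nhds h] with x hx
    exact eta_of_nonpos (le_of_lt hx)
  · subst h
    rw [etaDeriv_of_nonpos le_rfl]
    -- `η` vanishes to second order at the origin, so its extension by zero is differentiable there.
    obtain ⟨C, hC, hle⟩ := exists_eta_le hp 2 two_pos.le
    have hO : (fun x => eta p x - eta p 0 - (x - 0) * 0) =O[𝓝 0] fun x => x ^ 2 := by
      refine Asymptotics.IsBigO.of_bound C (Eventually.of_forall fun x => ?_)
      rw [eta_of_nonpos le_rfl, mul_zero, sub_zero, sub_zero, Real.norm_of_nonneg (eta_nonneg p x),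
        Real.norm_of_nonneg (sq_nonneg x)]
      rcases le_or_gt x 0 with h | h
      · rw [eta_of_nonpos h]; positivity
      · have := hle x h
        rwa [Real.rpow_two] at this
    rw [hasDerivAt_iff_isLittleO]
    have ho : (fun x : ℝ => x ^ 2) =o[𝓝 0] fun x => x - 0 := by
      simpa using (Asymptotics.isLittleO_pow_id (𝕜 := ℝ) one_lt_two)
    simpa using hO.trans_isLittleO ho
  · have h1 : HasDerivAt (fun x : ℝ => x ^ (-p - 1)) ((-p - 1) * t ^ (-p - 1 - 1)) t :=
      Real.hasDerivAt_rpow_const (Or.inl h.ne')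
    have h2 : HasDerivAt (fun x : ℝ => x ^ (-p)) (-p * t ^ (-p - 1)) t :=
      Real.hasDerivAt_rpow_const (Or.inl h.ne')
    have h3 := (h1.mul h2.neg.exp).const_mul (etaConst p)
    have h4 := h3.congr_of_eventuallyEq (f₁ := eta p) (by
      filter_upwards [Ioi_mem_nhds h] with x hx
      exact eta_of_pos hx)
    refine h4.congr_deriv ?_
    rw [etaDeriv, eta_of_pos h, Real.rpow_sub_one h.ne' (-p - 1)]
    simp only [Pi.neg_apply]
    field_simp
    ring

/-- Differentiation costs only powers of `t`. Splitting off `η^(1-κ)` leaves a factor `exp(-(1-κ)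
t^(-p))`, which absorbs them. -/
lemma exists_abs_etaDeriv_le {p κ : ℝ} (hp : 1 ≤ p) (hκ : 0 ≤ κ) (hκ1 : κ < 1) :
    ∃ C, 0 < C ∧ ∀ t, |etaDeriv p t| ≤ C * eta p t ^ κ := by
  have hκ' : 0 < 1 - κ := by linarith
  obtain ⟨C₁, hC₁, h₁⟩ := exists_rpow_neg_mul_exp_le (p := p) (a := (p + 1) * (1 - κ) + (p + 1))
    (c := 1 - κ) (by linarith) (by positivity) hκ'
  obtain ⟨C₂, hC₂, h₂⟩ := exists_rpow_neg_mul_exp_le (p := p) (a := (p + 1) * (1 - κ) + 1)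
    (c := 1 - κ) (by linarith) (by positivity) hκ'
  set A := etaConst p ^ (1 - κ)
  have hA : 0 < A := Real.rpow_pos_of_pos (etaConst_pos p) _
  refine ⟨A * (p * C₁ + (p + 1) * C₂), by positivity, fun t => ?_⟩
  rcases le_or_gt t 0 with h | h
  · rw [etaDeriv_of_nonpos h, abs_zero]
    exact mul_nonneg (by positivity) (Real.rpow_nonneg (eta_nonneg _ _) _)
  have he := eta_pos (p := p) h
  have e1 : eta p t = eta p t ^ κ * eta p t ^ (1 - κ) := by
    rw [← Real.rpow_add he]; simp
  have e2 : eta p t ^ (1 - κ) =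
      A * (t ^ (-((p + 1) * (1 - κ))) * Real.exp (-((1 - κ) * t ^ (-p)))) := by
    rw [eta_of_pos h, Real.mul_rpow (etaConst_pos p).le (by positivity),
      Real.mul_rpow (by positivity) (by positivity), ← Real.rpow_mul h.le, ← Real.exp_mul]
    congr 3
    · ring
    · ring_nf
  rw [etaDeriv, abs_mul, abs_of_pos he]
  have e3 : |p * t ^ (-p - 1) - (p + 1) / t| ≤ p * t ^ (-(p + 1)) + (p + 1) * t ^ (-1 : ℝ) := by
    rw [show -p - 1 = -(p + 1) by ring, Real.rpow_neg_one, ← div_eq_mul_inv]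
    refine (abs_sub _ _).trans (le_of_eq ?_)
    rw [abs_of_nonneg (by positivity), abs_of_nonneg (by positivity)]
  calc eta p t * |p * t ^ (-p - 1) - (p + 1) / t|
      ≤ eta p t * (p * t ^ (-(p + 1)) + (p + 1) * t ^ (-1 : ℝ)) :=
        mul_le_mul_of_nonneg_left e3 he.le
    _ = eta p t ^ κ * (A * (p * ((t ^ (-((p + 1) * (1 - κ))) * t ^ (-(p + 1))) *
          Real.exp (-((1 - κ) * t ^ (-p)))) + (p + 1) * ((t ^ (-((p + 1) * (1 - κ))) *
          t ^ (-1 : ℝ)) * Real.exp (-((1 - κ) * t ^ (-p)))))) := by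
        conv_lhs => rw [e1, e2]
        ring
    _ ≤ eta p t ^ κ * (A * (p * C₁ + (p + 1) * C₂)) := by
        rw [← Real.rpow_add h, ← Real.rpow_add h, ← neg_add, ← neg_add]
        have := h₁ t h
        have := h₂ t h
        gcongr
    _ = _ := mul_comm _ _

/-! ### The ramp from `0` to `1` -/

/-- The increasing profile of the weight, equal to `0` on `(-∞, 0]` and to `1` on `[1, ∞)`. -/
def ramp (p t : ℝ) : ℝ := if t ≤ 1 / 2 then eta p t else 1 - eta p (1 - t)

/-- The derivative of the ramp. -/
def rampDeriv (p t : ℝ) : ℝ := if t ≤ 1 / 2 then etaDeriv p t else etaDeriv p (1 - t)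

lemma hasDerivAt_ramp {p : ℝ} (hp : 1 ≤ p) (t : ℝ) : HasDerivAt (ramp p) (rampDeriv p t) t := by
  have hL := hasDerivAt_eta hp t
  have hR : HasDerivAt (fun x => 1 - eta p (1 - x)) (etaDeriv p (1 - t)) t := by
    have h := ((hasDerivAt_eta hp (1 - t)).comp t ((hasDerivAt_id t).const_sub 1)).const_sub 1
    simpa using h
  rcases lt_trichotomy t (1 / 2) with h | h | h
  · rw [rampDeriv, if_pos h.le]
    refine hL.congr_of_eventuallyEq ?_
    filter_upwards [Iio_mem_nhds h] with x hx
    exact if_pos (le_of_lt hx)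
  -- At `1/2` the two branches have the common value `1/2` and the same slope.
  · have e : etaDeriv p (1 - t) = etaDeriv p t := by rw [h]; norm_num
    rw [rampDeriv, if_pos h.le]
    rw [e] at hR
    have h1 : HasDerivWithinAt (ramp p) (etaDeriv p t) (Set.Iic t) t := by
      refine hL.hasDerivWithinAt.congr (fun x hx => if_pos (le_trans hx h.le)) (if_pos h.le)
    have h2 : HasDerivWithinAt (ramp p) (etaDeriv p t) (Set.Ici t) t := by
      have e2 : ramp p t = 1 - eta p (1 - t) := by
        rw [ramp, if_pos h.le, h]; norm_num [eta_half]
      refine hR.hasDerivWithinAt.congr (fun x hx => ?_) e2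
      rcases eq_or_lt_of_le (show t ≤ x from hx) with h3 | h3
      · rw [← h3, e2]
      · exact if_neg (by linarith)
    have h3 := h1.union h2
    rwa [Set.Iic_union_Ici, hasDerivWithinAt_univ] at h3
  · rw [rampDeriv, if_neg h.not_ge]
    refine hR.congr_of_eventuallyEq ?_
    filter_upwards [Ioi_mem_nhds h] with x hx
    exact if_neg (not_le.mpr hx)

lemma ramp_of_nonpos {p t : ℝ} (ht : t ≤ 0) : ramp p t = 0 := by
  rw [ramp, if_pos (by linarith), eta_of_nonpos ht]

lemma ramp_of_one_le {p t : ℝ} (ht : 1 ≤ t) : ramp p t = 1 := by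
  rw [ramp, if_neg (by linarith), eta_of_nonpos (by linarith), sub_zero]

lemma rampDeriv_of_nonpos {p t : ℝ} (ht : t ≤ 0) : rampDeriv p t = 0 := by
  rw [rampDeriv, if_pos (by linarith), etaDeriv_of_nonpos ht]

lemma rampDeriv_of_one_le {p t : ℝ} (ht : 1 ≤ t) : rampDeriv p t = 0 := by
  rw [rampDeriv, if_neg (by linarith), etaDeriv_of_nonpos (by linarith)]

lemma ramp_one_sub (p t : ℝ) : ramp p (1 - t) = 1 - ramp p t := by
  unfold ramp
  rcases lt_trichotomy t (1 / 2) with h | h | h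
  · rw [if_neg (by linarith), if_pos h.le]; ring_nf
  · subst h; norm_num [eta_half]
  · rw [if_pos (by linarith), if_neg (by linarith)]; ring_nf

lemma half_le_ramp {p t : ℝ} (hp : 1 ≤ p) (ht : 1 / 2 ≤ t) : 1 / 2 ≤ ramp p t := by
  rcases eq_or_lt_of_le ht with h | h
  · rw [ramp, if_pos h.ge, ← h, eta_half]
  · rw [ramp, if_neg h.not_ge]
    linarith [eta_le_half hp (t := 1 - t) (by linarith)]

lemma ramp_nonneg {p : ℝ} (hp : 1 ≤ p) (t : ℝ) : 0 ≤ ramp p t := by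
  rcases le_total t (1 / 2) with h | h
  · rw [ramp, if_pos h]; exact eta_nonneg _ _
  · linarith [half_le_ramp hp h]

lemma ramp_le_one {p : ℝ} (hp : 1 ≤ p) (t : ℝ) : ramp p t ≤ 1 := by
  have := ramp_nonneg hp (1 - t)
  rw [ramp_one_sub] at this
  linarith

lemma ramp_pos {p t : ℝ} (hp : 1 ≤ p) (ht : 0 < t) : 0 < ramp p t := by
  rcases le_total t (1 / 2) with h | h
  · rw [ramp, if_pos h]; exact eta_pos ht
  · linarith [half_le_ramp hp h]

lemma continuous_ramp {p : ℝ} (hp : 1 ≤ p) : Continuous (ramp p) :=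
  continuous_iff_continuousAt.mpr fun t => (hasDerivAt_ramp hp t).continuousAt

/-- Left of `1/2` this is the estimate for `η`. On the right the ramp is at least `1/2`, so
boundedness of the derivative is enough. -/
lemma exists_abs_rampDeriv_le {p κ : ℝ} (hp : 1 ≤ p) (hκ : 0 ≤ κ) (hκ1 : κ < 1) :
    ∃ C, 0 < C ∧ ∀ t, |rampDeriv p t| ≤ C * ramp p t ^ κ := by
  obtain ⟨C₁, hC₁, h₁⟩ := exists_abs_etaDeriv_le hp hκ hκ1
  obtain ⟨C₂, hC₂, h₂⟩ := exists_abs_etaDeriv_le (p := p) hp le_rfl one_pos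
  simp only [Real.rpow_zero, mul_one] at h₂
  refine ⟨C₁ + C₂ * 2, by positivity, fun t => ?_⟩
  have h0 : 0 ≤ ramp p t ^ κ := Real.rpow_nonneg (ramp_nonneg hp t) _
  rcases le_or_gt t (1 / 2) with h | h
  · have h3 := h₁ t
    rw [rampDeriv, if_pos h]
    have e : ramp p t = eta p t := if_pos h
    rw [e] at h0 ⊢
    nlinarith
  · rw [rampDeriv, if_neg h.not_ge]
    have h3 : 1 / 2 ≤ ramp p t ^ κ := by
      have h4 := half_le_ramp hp h.le
      calc (1 / 2 : ℝ) = (1 / 2) ^ (1 : ℝ) := by simp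
        _ ≤ (1 / 2) ^ κ := Real.rpow_le_rpow_of_exponent_ge (by norm_num) (by norm_num) hκ1.le
        _ ≤ _ := Real.rpow_le_rpow (by norm_num) h4 hκ
    have := h₂ (1 - t)
    nlinarith

lemma integral_ramp {p : ℝ} (hp : 1 ≤ p) : ∫ t in (0 : ℝ)..1, ramp p t = 1 / 2 := by
  have h := intervalIntegral.integral_comp_sub_left (a := 0) (b := 1) (fun t => ramp p t) 1
  simp only [ramp_one_sub, sub_zero, sub_self] at h
  rw [intervalIntegral.integral_sub (by simp) ((continuous_ramp hp).intervalIntegrable _ _)] at h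
  simp at h
  linarith

/-! ### The weight -/

/-- The derivative of the weight. -/
def weightDeriv (p θ u : ℝ) : ℝ :=
  (1 - θ)⁻¹ * (θ⁻¹ * rampDeriv p (u / θ) - θ⁻¹ * rampDeriv p ((1 - u) / θ))

section

variable {p θ : ℝ}

/-- As `θ ≤ 1/2`, on each half of the line one of the two ramps is identically 1. One formula on the
whole line gives differentiability and symmetry without cases, and also describes the weight outside
`(0,1)`. -/
lemma weight_eq (hθ : 0 < θ) (hθ2 : θ ≤ 1 / 2) (u : ℝ) :
    weight p θ u = (1 - θ)⁻¹ * (ramp p (u / θ) + ramp p ((1 - u) / θ) - 1) := by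
  have hleft : ∀ v, leftWeight p θ v = (1 - θ)⁻¹ * ramp p (v / θ) := by
    intro v
    have h1 : v ≤ θ / 2 ↔ v / θ ≤ 1 / 2 := by
      rw [div_le_iff₀ hθ]; constructor <;> intro h <;> linarith
    rw [leftWeight, ramp]
    by_cases h : v ≤ θ / 2
    · rw [if_pos h, if_pos (h1.mp h)]
    · rw [if_neg h, if_neg (fun h' => h (h1.mpr h'))]
      split_ifs with h2
      · rfl
      · rw [eta_of_nonpos, sub_zero, mul_one]
        rw [sub_nonpos, le_div_iff₀ hθ]; linarith
  have hone : ∀ v, 1 / 2 ≤ v → ramp p (v / θ) = 1 := by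
    intro v hv
    refine ramp_of_one_le ?_
    rw [le_div_iff₀ hθ]; linarith
  rw [weight]
  split_ifs with h
  · rw [hleft, hone (1 - u) (by linarith)]; ring
  · rw [hleft, hone u (by linarith)]; ring

lemma weight_one_sub (hθ : 0 < θ) (hθ2 : θ ≤ 1 / 2) (u : ℝ) :
    weight p θ (1 - u) = weight p θ u := by
  rw [weight_eq hθ hθ2, weight_eq hθ hθ2, sub_sub_cancel]; ring

lemma weightDeriv_one_sub (u : ℝ) : weightDeriv p θ (1 - u) = - weightDeriv p θ u := by
  rw [weightDeriv, weightDeriv, sub_sub_cancel]; ring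

lemma weight_of_le_half (hθ : 0 < θ) (hθ2 : θ ≤ 1 / 2) {u : ℝ} (hu : u ≤ 1 / 2) :
    weight p θ u = (1 - θ)⁻¹ * ramp p (u / θ) := by
  rw [weight_eq hθ hθ2, ramp_of_one_le (t := (1 - u) / θ), add_sub_cancel_right]
  rw [le_div_iff₀ hθ]; linarith

lemma weightDeriv_of_le_half (hθ : 0 < θ) (hθ2 : θ ≤ 1 / 2) {u : ℝ} (hu : u ≤ 1 / 2) :
    weightDeriv p θ u = (1 - θ)⁻¹ * (θ⁻¹ * rampDeriv p (u / θ)) := by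
  rw [weightDeriv, rampDeriv_of_one_le (t := (1 - u) / θ), mul_zero, sub_zero]
  rw [le_div_iff₀ hθ]; linarith

lemma hasDerivAt_weight (hp : 1 ≤ p) (hθ : 0 < θ) (hθ2 : θ ≤ 1 / 2) (u : ℝ) :
    HasDerivAt (weight p θ) (weightDeriv p θ u) u := by
  have h1 : HasDerivAt (fun x => ramp p (x / θ)) (θ⁻¹ * rampDeriv p (u / θ)) u := by
    have := (hasDerivAt_ramp hp (u / θ)).comp u ((hasDerivAt_id u).div_const θ)
    simpa [mul_comm, Function.comp_def] using this
  have h2 : HasDerivAt (fun x => ramp p ((1 - x) / θ)) (-(θ⁻¹ * rampDeriv p ((1 - u) / θ))) u := by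
    have := (hasDerivAt_ramp hp ((1 - u) / θ)).comp u
      (((hasDerivAt_id u).const_sub 1).div_const θ)
    refine this.congr_deriv ?_
    ring
  have h3 := ((h1.add h2).sub_const 1).const_mul (1 - θ)⁻¹
  have h4 : (weight p θ) = fun x => (1 - θ)⁻¹ * (ramp p (x / θ) + ramp p ((1 - x) / θ) - 1) :=
    funext (weight_eq hθ hθ2)
  rw [h4]
  exact h3.congr_deriv (by rw [weightDeriv]; ring)

lemma continuous_weight (hp : 1 ≤ p) (hθ : 0 < θ) (hθ2 : θ ≤ 1 / 2) : Continuous (weight p θ) :=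
  continuous_iff_continuousAt.mpr fun t => (hasDerivAt_weight hp hθ hθ2 t).continuousAt

lemma one_sub_inv_bounds (hθ : 0 < θ) (hθ2 : θ ≤ 1 / 2) : 1 ≤ (1 - θ)⁻¹ ∧ (1 - θ)⁻¹ ≤ 2 := by
  constructor
  · rw [one_le_inv₀ (by linarith)]; linarith
  · rw [inv_le_comm₀ (by linarith) two_pos]; linarith

lemma weight_nonneg (hp : 1 ≤ p) (hθ : 0 < θ) (hθ2 : θ ≤ 1 / 2) (u : ℝ) : 0 ≤ weight p θ u := by
  have h1 : (0 : ℝ) ≤ (1 - θ)⁻¹ := by linarith [(one_sub_inv_bounds hθ hθ2).1]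
  rcases le_total u (1 / 2) with h | h
  · rw [weight_of_le_half hθ hθ2 h]
    exact mul_nonneg h1 (ramp_nonneg hp _)
  · rw [← weight_one_sub hθ hθ2, weight_of_le_half hθ hθ2 (by linarith)]
    exact mul_nonneg h1 (ramp_nonneg hp _)

lemma weight_le_two (hp : 1 ≤ p) (hθ : 0 < θ) (hθ2 : θ ≤ 1 / 2) (u : ℝ) : weight p θ u ≤ 2 := by
  have h1 := one_sub_inv_bounds hθ hθ2
  have h2 : ∀ v, v ≤ 1 / 2 → weight p θ v ≤ 2 := by
    intro v hv
    rw [weight_of_le_half hθ hθ2 hv]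
    have := ramp_le_one hp (v / θ)
    have := ramp_nonneg hp (v / θ)
    nlinarith
  rcases le_total u (1 / 2) with h | h
  · exact h2 u h
  · rw [← weight_one_sub hθ hθ2]; exact h2 _ (by linarith)

lemma weight_pos (hp : 1 ≤ p) (hθ : 0 < θ) (hθ2 : θ ≤ 1 / 2) {u : ℝ} (hu : u ∈ Set.Ioo (0 : ℝ) 1) :
    0 < weight p θ u := by
  have h1 : (0 : ℝ) < (1 - θ)⁻¹ := by linarith [(one_sub_inv_bounds hθ hθ2).1]
  rcases le_total u (1 / 2) with h | h
  · rw [weight_of_le_half hθ hθ2 h]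
    exact mul_pos h1 (ramp_pos hp (div_pos hu.1 hθ))
  · rw [← weight_one_sub hθ hθ2, weight_of_le_half hθ hθ2 (by linarith)]
    exact mul_pos h1 (ramp_pos hp (div_pos (by linarith [hu.2]) hθ))

lemma weight_eq_zero (hθ : 0 < θ) (hθ2 : θ ≤ 1 / 2) {u : ℝ} (hu : u ∉ Set.Ioo (0 : ℝ) 1) :
    weight p θ u = 0 := by
  have h2 : ∀ v, v ≤ 0 → weight p θ v = 0 := by
    intro v hv
    rw [weight_of_le_half hθ hθ2 (by linarith), ramp_of_nonpos (div_nonpos_of_nonpos_of_nonneg hv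
      hθ.le), mul_zero]
  rw [Set.mem_Ioo, not_and_or, not_lt, not_lt] at hu
  rcases hu with h | h
  · exact h2 u h
  · rw [← weight_one_sub hθ hθ2]; exact h2 _ (by linarith)

lemma weight_eq_const (hθ : 0 < θ) (hθ2 : θ ≤ 1 / 2) {u : ℝ} (hu : u ∈ Set.Icc θ (1 - θ)) :
    weight p θ u = (1 - θ)⁻¹ := by
  rw [weight_eq hθ hθ2, ramp_of_one_le ((one_le_div hθ).mpr hu.1),
    ramp_of_one_le ((one_le_div hθ).mpr (by linarith [hu.2]))]
  ring

lemma weightDeriv_eq_zero (hθ : 0 < θ) {u : ℝ} (hu : u ∈ Set.Icc θ (1 - θ)) :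
    weightDeriv p θ u = 0 := by
  rw [weightDeriv, rampDeriv_of_one_le ((one_le_div hθ).mpr hu.1),
    rampDeriv_of_one_le ((one_le_div hθ).mpr (by linarith [hu.2]))]
  ring

end

lemma exists_abs_weightDeriv_le {p κ : ℝ} (hp : 1 ≤ p) (hκ : 0 ≤ κ) (hκ1 : κ < 1) :
    ∃ C, 0 < C ∧ ∀ θ : ℝ, 0 < θ → θ ≤ 1 / 2 → ∀ u,
      |weightDeriv p θ u| ≤ C * θ⁻¹ * weight p θ u ^ κ := by
  obtain ⟨C, hC, h⟩ := exists_abs_rampDeriv_le (p := p) hp hκ hκ1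
  refine ⟨2 * C, by positivity, fun θ hθ hθ2 u => ?_⟩
  obtain ⟨h1, h2⟩ := one_sub_inv_bounds hθ hθ2
  have h3 : ∀ v, v ≤ 1 / 2 → |weightDeriv p θ v| ≤ 2 * C * θ⁻¹ * weight p θ v ^ κ := by
    intro v hv
    rw [weightDeriv_of_le_half hθ hθ2 hv, weight_of_le_half hθ hθ2 hv, abs_mul, abs_mul,
      abs_of_nonneg (by linarith), abs_of_nonneg (by positivity)]
    have h4 := ramp_nonneg hp (v / θ)
    have h5 : ramp p (v / θ) ^ κ ≤ ((1 - θ)⁻¹ * ramp p (v / θ)) ^ κ :=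
      Real.rpow_le_rpow h4 (by nlinarith) hκ
    have h6 := h (v / θ)
    calc (1 - θ)⁻¹ * (θ⁻¹ * |rampDeriv p (v / θ)|)
        ≤ 2 * (θ⁻¹ * (C * ((1 - θ)⁻¹ * ramp p (v / θ)) ^ κ)) := by
          have h7 : |rampDeriv p (v / θ)| ≤ C * ((1 - θ)⁻¹ * ramp p (v / θ)) ^ κ :=
            h6.trans (mul_le_mul_of_nonneg_left h5 hC.le)
          have : 0 ≤ θ⁻¹ * |rampDeriv p (v / θ)| := by positivity
          have : 0 < θ⁻¹ := by positivity
          gcongr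
      _ = _ := by ring
  rcases le_total u (1 / 2) with hu | hu
  · exact h3 u hu
  · have := h3 (1 - u) (by linarith)
    rwa [weightDeriv_one_sub, abs_neg, weight_one_sub hθ hθ2] at this

end

end BDIS

open MeasureTheory

namespace BDIS

noncomputable section

open Filter Topology

/-! ### The distribution function -/

section

variable {φ : ℝ → ℝ} (hφ : IsAdmissibleDensity φ)

include hφ

lemma IsAdmissibleDensity.integrable : Integrable φ := by
  by_contra h
  have := hφ.integral_eq_one
  rw [integral_undef h] at this
  exact zero_ne_one this

lemma IsAdmissibleDensity.isProbabilityMeasure : IsProbabilityMeasure (lineMeasure φ) := by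
  refine ⟨?_⟩
  rw [lineMeasure, withDensity_apply _ MeasurableSet.univ, Measure.restrict_univ,
    ← ofReal_integral_eq_lintegral_ofReal hφ.integrable (Eventually.of_forall fun x => (hφ.pos x).le),
    hφ.integral_eq_one, ENNReal.ofReal_one]

lemma cdf_sub_cdf {x y : ℝ} : cdf φ y - cdf φ x = ∫ t in x..y, φ t :=
  intervalIntegral.integral_Iic_sub_Iic hφ.integrable.integrableOn hφ.integrable.integrableOn

lemma lineMeasure_Iic (x : ℝ) : lineMeasure φ (Set.Iic x) = ENNReal.ofReal (cdf φ x) := by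
  rw [lineMeasure, withDensity_apply _ measurableSet_Iic, cdf,
    ofReal_integral_eq_lintegral_ofReal hφ.integrable.integrableOn
      (Eventually.of_forall fun x => (hφ.pos x).le)]

lemma strictMono_cdf : StrictMono (cdf φ) := by
  intro x y hxy
  rw [← sub_pos, cdf_sub_cdf hφ]
  exact intervalIntegral.intervalIntegral_pos_of_pos_on hφ.integrable.intervalIntegrable
    (fun t _ => hφ.pos t) hxy

lemma continuous_cdf : Continuous (cdf φ) := by
  have h : cdf φ = fun x => cdf φ 0 + ∫ t in (0 : ℝ)..x, φ t := by
    funext x; rw [← cdf_sub_cdf hφ]; ring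
  rw [h]
  exact continuous_const.add
    (intervalIntegral.continuous_primitive (fun a b => hφ.integrable.intervalIntegrable) 0)

lemma cdf_neg (x : ℝ) : cdf φ (-x) = 1 - cdf φ x := by
  have h1 : cdf φ (-x) = ∫ y in Set.Ioi x, φ y := by
    rw [cdf, ← integral_comp_neg_Ioi]
    refine setIntegral_congr_fun measurableSet_Ioi fun y _ => (hφ.symm y).symm
  have h2 := intervalIntegral.integral_Iic_add_Ioi (b := x) hφ.integrable.integrableOn
    hφ.integrable.integrableOn
  rw [hφ.integral_eq_one] at h2
  rw [h1, cdf]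
  linarith

lemma tendsto_cdf_atBot : Tendsto (cdf φ) atBot (𝓝 0) := by
  have := hφ.isProbabilityMeasure
  have h := ProbabilityTheory.tendsto_cdf_atBot (lineMeasure φ)
  refine h.congr fun x => ?_
  rw [ProbabilityTheory.cdf_eq_real, measureReal_def, lineMeasure_Iic hφ, ENNReal.toReal_ofReal]
  exact setIntegral_nonneg measurableSet_Iic fun x _ => (hφ.pos x).le

lemma tendsto_cdf_atTop : Tendsto (cdf φ) atTop (𝓝 1) := by
  have h : cdf φ = fun x => 1 - cdf φ (-x) := by funext x; rw [cdf_neg hφ]; ring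
  rw [h]
  simpa using ((tendsto_cdf_atBot hφ).comp tendsto_neg_atTop_atBot).const_sub 1

lemma cdf_pos (x : ℝ) : 0 < cdf φ x := by
  have h1 : 0 ≤ cdf φ (x - 1) := setIntegral_nonneg measurableSet_Iic fun x _ => (hφ.pos x).le
  exact h1.trans_lt (strictMono_cdf hφ (by linarith))

lemma cdf_lt_one (x : ℝ) : cdf φ x < 1 := by
  have := cdf_pos hφ (-x)
  rw [cdf_neg hφ] at this
  linarith

lemma exists_cdf_eq {v : ℝ} (hv : v ∈ Set.Ioo (0 : ℝ) 1) : ∃ x, cdf φ x = v := by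
  obtain ⟨a, ha⟩ := ((tendsto_cdf_atBot hφ).eventually (gt_mem_nhds hv.1)).exists
  obtain ⟨b, hb⟩ := ((tendsto_cdf_atTop hφ).eventually (lt_mem_nhds hv.2)).exists
  exact mem_range_of_exists_le_of_exists_ge (continuous_cdf hφ) ⟨a, ha.le⟩ ⟨b, hb.le⟩

lemma quantile_cdf (x : ℝ) : quantile φ (cdf φ x) = x := by
  have : {y : ℝ | cdf φ x ≤ cdf φ y} = Set.Ici x := by
    ext y; simp [(strictMono_cdf hφ).le_iff_le]
  rw [quantile, this, csInf_Ici]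

/-- The density is bounded below by a power of the distance of `Φ` to `{0, 1}`. -/
lemma exists_min_rpow_le_density {δ : ℝ} (hδ : 0 < δ) :
    ∃ c, 0 < c ∧ ∀ x, c * min (cdf φ x) (1 - cdf φ x) ^ (1 + δ) ≤ φ x := by
  obtain ⟨c, hc, h⟩ := hφ.light_tail δ hδ
  refine ⟨c, hc, fun x => ?_⟩
  have key : ∀ y, y ≤ 0 → c * min (cdf φ y) (1 - cdf φ y) ^ (1 + δ) ≤ φ y := by
    intro y hy
    refine le_trans ?_ (h y hy)
    have h0 : 0 ≤ min (cdf φ y) (1 - cdf φ y) :=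
      le_min (cdf_pos hφ y).le (by linarith [cdf_lt_one hφ y])
    gcongr
    exact min_le_left _ _
  rcases le_total x 0 with hx | hx
  · exact key x hx
  · have := key (-x) (by linarith)
    rwa [cdf_neg hφ, sub_sub_cancel, min_comm, ← hφ.symm] at this

end

/-! ### The cumulative weight -/

/-- The cumulative weight `W(u) = ∫_0^u w_θ`. -/
def cumWeight (p θ u : ℝ) : ℝ := ∫ t in (0 : ℝ)..u, weight p θ t

lemma transport_eq (φ : ℝ → ℝ) (p θ u : ℝ) : transport φ p θ u = quantile φ (cumWeight p θ u) := rfl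

section

variable {p θ : ℝ} (hp : 1 ≤ p) (hθ : 0 < θ) (hθ2 : θ ≤ 1 / 2)

include hp hθ hθ2

lemma intervalIntegrable_weight (a b : ℝ) : IntervalIntegrable (weight p θ) volume a b :=
  (continuous_weight hp hθ hθ2).intervalIntegrable a b

lemma hasDerivAt_cumWeight (u : ℝ) : HasDerivAt (cumWeight p θ) (weight p θ u) u :=
  intervalIntegral.integral_hasDerivAt_right (intervalIntegrable_weight hp hθ hθ2 _ _)
    ((continuous_weight hp hθ hθ2).stronglyMeasurableAtFilter _ _)
    (continuous_weight hp hθ hθ2).continuousAt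

lemma continuous_cumWeight : Continuous (cumWeight p θ) :=
  continuous_iff_continuousAt.mpr fun u => (hasDerivAt_cumWeight hp hθ hθ2 u).continuousAt

lemma cumWeight_sub (a b : ℝ) : cumWeight p θ b - cumWeight p θ a = ∫ t in a..b, weight p θ t :=
  intervalIntegral.integral_interval_sub_left (intervalIntegrable_weight hp hθ hθ2 _ _)
    (intervalIntegrable_weight hp hθ hθ2 _ _)

lemma integral_ramp_div : ∫ t in (0 : ℝ)..1, ramp p (t / θ) = 1 - θ / 2 := by
  have hi : ∀ a b, IntervalIntegrable (ramp p) volume a b := fun a b =>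
    (continuous_ramp hp).intervalIntegrable a b
  rw [intervalIntegral.integral_comp_div _ hθ.ne', zero_div,
    ← intervalIntegral.integral_add_adjacent_intervals (hi 0 1) (hi 1 (1 / θ)), integral_ramp hp]
  have h1 : ∫ t in (1 : ℝ)..1 / θ, ramp p t = ∫ t in (1 : ℝ)..1 / θ, 1 := by
    refine intervalIntegral.integral_congr fun t ht => ?_
    rw [Set.uIcc_of_le (by rw [le_div_iff₀ hθ]; linarith)] at ht
    exact ramp_of_one_le ht.1
  rw [h1, intervalIntegral.integral_const, smul_eq_mul, smul_eq_mul]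
  field_simp
  ring

/-- Each of the two ramps falls short of 1 by the area `θ/2`, which the factor `(1-θ)⁻¹` makes up
for. -/
lemma cumWeight_one : cumWeight p θ 1 = 1 := by
  have hi : IntervalIntegrable (fun t => ramp p (t / θ)) volume 0 1 :=
    ((continuous_ramp hp).comp (continuous_id.div_const θ)).intervalIntegrable _ _
  have hi' : IntervalIntegrable (fun t => ramp p ((1 - t) / θ)) volume 0 1 :=
    ((continuous_ramp hp).comp ((continuous_const.sub continuous_id).div_const θ)).intervalIntegrable
      _ _
  have h2 : ∫ t in (0 : ℝ)..1, ramp p ((1 - t) / θ) = 1 - θ / 2 := by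
    rw [intervalIntegral.integral_comp_sub_left (fun t => ramp p (t / θ)) 1]
    simpa using integral_ramp_div hp hθ hθ2
  rw [cumWeight, intervalIntegral.integral_congr fun t _ => weight_eq hθ hθ2 t,
    intervalIntegral.integral_const_mul, intervalIntegral.integral_sub (hi.add hi') (by simp),
    intervalIntegral.integral_add hi hi', h2, integral_ramp_div hp hθ hθ2]
  simp only [intervalIntegral.integral_const, smul_eq_mul]
  have : 1 - θ ≠ 0 := by linarith
  field_simp
  ring

omit hp hθ hθ2 in
lemma cumWeight_zero : cumWeight p θ 0 = 0 := intervalIntegral.integral_same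

lemma cumWeight_one_sub (u : ℝ) : cumWeight p θ (1 - u) = 1 - cumWeight p θ u := by
  have h1 : ∫ t in (0 : ℝ)..u, weight p θ t = ∫ t in (1 - u)..1, weight p θ t := by
    rw [intervalIntegral.integral_congr fun t _ => (weight_one_sub (p := p) hθ hθ2 t).symm,
      intervalIntegral.integral_comp_sub_left (fun t => weight p θ t) 1, sub_zero]
  have h2 := cumWeight_sub hp hθ hθ2 (1 - u) 1
  rw [cumWeight_one hp hθ hθ2, ← h1] at h2
  change 1 - _ = cumWeight p θ u at h2
  linarith

lemma monotone_cumWeight : Monotone (cumWeight p θ) := by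
  intro a b hab
  rw [← sub_nonneg, cumWeight_sub hp hθ hθ2]
  exact intervalIntegral.integral_nonneg hab fun t _ => weight_nonneg hp hθ hθ2 t

lemma strictMonoOn_cumWeight : StrictMonoOn (cumWeight p θ) (Set.Icc 0 1) := by
  intro a ha b hb hab
  rw [← sub_pos, cumWeight_sub hp hθ hθ2]
  refine intervalIntegral.intervalIntegral_pos_of_pos_on
    (intervalIntegrable_weight hp hθ hθ2 _ _) (fun t ht => ?_) hab
  exact weight_pos hp hθ hθ2 ⟨ha.1.trans_lt ht.1, ht.2.trans_le hb.2⟩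

lemma cumWeight_mem_Ioo {u : ℝ} (hu : u ∈ Set.Ioo (0 : ℝ) 1) :
    cumWeight p θ u ∈ Set.Ioo (0 : ℝ) 1 := by
  have h := strictMonoOn_cumWeight hp hθ hθ2
  constructor
  · rw [← cumWeight_zero (p := p) (θ := θ)]
    exact h (by simp) (Set.Ioo_subset_Icc_self hu) hu.1
  · rw [← cumWeight_one hp hθ hθ2]
    exact h (Set.Ioo_subset_Icc_self hu) (by simp) hu.2

lemma cumWeight_of_nonpos {u : ℝ} (hu : u ≤ 0) : cumWeight p θ u = 0 := by
  rw [cumWeight]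
  rw [intervalIntegral.integral_congr (g := fun _ => 0), intervalIntegral.integral_zero]
  intro t ht
  rw [Set.uIcc_of_ge hu] at ht
  exact weight_eq_zero hθ hθ2 fun h => absurd ht.2 (not_le.mpr h.1)

lemma cumWeight_of_one_le {u : ℝ} (hu : 1 ≤ u) : cumWeight p θ u = 1 := by
  have := cumWeight_one_sub hp hθ hθ2 u
  rw [cumWeight_of_nonpos hp hθ hθ2 (by linarith)] at this
  linarith

lemma exists_cumWeight_eq {v : ℝ} (hv : v ∈ Set.Ioo (0 : ℝ) 1) :
    ∃ u ∈ Set.Ioo (0 : ℝ) 1, cumWeight p θ u = v := by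
  have h := intermediate_value_Ioo (zero_le_one (α := ℝ)) (f := cumWeight p θ)
    (continuous_cumWeight hp hθ hθ2).continuousOn
  rw [cumWeight_zero, cumWeight_one hp hθ hθ2] at h
  exact h hv

end

/-- The distance of `u` to the boundary of `(0,1)`, truncated below at `θ`. -/
def bdist (θ u : ℝ) : ℝ := max θ (min u (1 - u))

lemma bdist_pos {θ : ℝ} (hθ : 0 < θ) (u : ℝ) : 0 < bdist θ u := lt_max_of_lt_left hθ

/-- The power in `η` makes it an exact derivative, so the mass near the boundary is explicit. -/
lemma integral_eta {p t : ℝ} (hp : 1 ≤ p) (ht : 0 < t) :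
    ∫ x in (0 : ℝ)..t, eta p x = etaConst p / p * Real.exp (-t ^ (-p)) := by
  have hd : ∀ x : ℝ, 0 < x →
      HasDerivAt (fun x : ℝ => etaConst p / p * Real.exp (-x ^ (-p))) (eta p x) x := by
    intro x hx
    have h2 : HasDerivAt (fun x : ℝ => x ^ (-p)) (-p * x ^ (-p - 1)) x :=
      Real.hasDerivAt_rpow_const (Or.inl hx.ne')
    refine (h2.neg.exp.const_mul (etaConst p / p)).congr_deriv ?_
    rw [eta_of_pos hx]
    have : p ≠ 0 := by linarith
    simp only [Pi.neg_apply]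
    field_simp
  have hc : Continuous (eta p) := continuous_iff_continuousAt.mpr fun t =>
    (hasDerivAt_eta hp t).continuousAt
  have h0 : Tendsto (fun x : ℝ => etaConst p / p * Real.exp (-x ^ (-p))) (𝓝[>] 0) (𝓝 0) := by
    obtain ⟨C, hC, h⟩ := exists_rpow_neg_mul_exp_le (p := p) (a := 1) (c := 1) (by linarith)
      zero_le_one one_pos
    have h1 : Tendsto (fun x : ℝ => etaConst p / p * (C * x)) (𝓝[>] 0) (𝓝 0) := by
      have : Tendsto (fun x : ℝ => etaConst p / p * (C * x)) (𝓝 0) (𝓝 (etaConst p / p * (C * 0))) :=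
        (continuous_const.mul (continuous_const.mul continuous_id)).tendsto 0
      simp only [mul_zero] at this
      exact this.mono_left nhdsWithin_le_nhds
    have hk : 0 ≤ etaConst p / p := div_nonneg (etaConst_pos p).le (by linarith)
    refine tendsto_of_tendsto_of_tendsto_of_le_of_le' tendsto_const_nhds h1 ?_ ?_
    · exact Eventually.of_forall fun x => mul_nonneg hk (Real.exp_pos _).le
    · filter_upwards [self_mem_nhdsWithin] with x hx
      have hx' : (0 : ℝ) < x := hx
      refine mul_le_mul_of_nonneg_left ?_ hk
      have := h x hx'
      rw [one_mul, Real.rpow_neg_one, inv_mul_le_iff₀ hx'] at this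
      linarith
  have h1 : Tendsto (fun x : ℝ => etaConst p / p * Real.exp (-x ^ (-p))) (𝓝[<] t)
      (𝓝 (etaConst p / p * Real.exp (-t ^ (-p)))) :=
    (hd t ht).continuousAt.tendsto.mono_left nhdsWithin_le_nhds
  have := intervalIntegral.integral_eq_sub_of_hasDerivAt_of_tendsto ht
    (fun x hx => hd x hx.1) (hc.intervalIntegrable _ _) h0 h1
  rw [this, sub_zero]

/-- The weight is far smaller than its own integral near the boundary, relative to the scale `θ`.
For `u ≤ θ/2` and `t = u/θ`, `W` is at least a multiple of `θ exp(-t^(-p))`, while `w^τ` is bounded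
by a power of `t` times `exp(-τ t^(-p))`; as `τ > 1` the excess `exp(-(τ-1) t^(-p))` kills the
power. Further inside, `w` is bounded and `W` grows linearly. -/
lemma exists_weight_rpow_mul_bdist_le {p τ : ℝ} (hp : 1 ≤ p) (hτ : 1 < τ) :
    ∃ C, 0 < C ∧ ∀ θ : ℝ, 0 < θ → θ ≤ 1 / 2 → ∀ u ∈ Set.Ioo (0 : ℝ) 1,
      weight p θ u ^ τ * bdist θ u ≤ C * min (cumWeight p θ u) (1 - cumWeight p θ u) := by
  obtain ⟨C₁, hC₁, h₁⟩ := exists_rpow_neg_mul_exp_le (p := p) (a := (p + 1) * τ) (c := τ - 1)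
    (by linarith) (mul_nonneg (by linarith) (by linarith)) (by linarith)
  have hp0 : 0 < p := by linarith
  have he := etaConst_pos p
  set E := (2 * etaConst p) ^ τ
  have hE : 0 < E := Real.rpow_pos_of_pos (by positivity) _
  set e0 := etaConst p / p * Real.exp (-(1 / 2) ^ (-p))
  have he0 : 0 < e0 := by positivity
  set T := (2 : ℝ) ^ τ
  have hT : 0 < T := Real.rpow_pos_of_pos two_pos _
  -- The first summand serves `u ≤ θ/2`, the other two `θ/2 ≤ u ≤ 1/2`.
  set C := E * C₁ * (p / etaConst p) + T * (1 / e0) + T * 4 with hCdef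
  have hC : 0 < C := by positivity
  have hA : 0 < E * C₁ * (p / etaConst p) := by positivity
  have hB : 0 < T * (1 / e0) := by positivity
  refine ⟨C, hC, fun θ hθ hθ2 => ?_⟩
  have hr : ∀ u, 0 < u → u ≤ θ / 2 →
      θ * (etaConst p / p * Real.exp (-(u / θ) ^ (-p))) ≤ cumWeight p θ u := by
    intro u hu hu2
    have h2 : cumWeight p θ u = (1 - θ)⁻¹ * (θ * ∫ x in (0 : ℝ)..u / θ, eta p x) := by
      rw [cumWeight]
      have : ∀ x ∈ Set.uIcc 0 u, weight p θ x = (1 - θ)⁻¹ * eta p (x / θ) := by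
        intro x hx
        rw [Set.uIcc_of_le hu.le] at hx
        rw [weight_of_le_half hθ hθ2 (by linarith [hx.2]), ramp, if_pos]
        rw [div_le_iff₀ hθ]; linarith [hx.2]
      rw [intervalIntegral.integral_congr this, intervalIntegral.integral_const_mul,
        intervalIntegral.integral_comp_div _ hθ.ne', zero_div, smul_eq_mul]
    rw [h2, integral_eta hp (div_pos hu hθ)]
    exact le_mul_of_one_le_left (by positivity) (one_sub_inv_bounds hθ hθ2).1
  have key : ∀ u, 0 < u → u ≤ 1 / 2 → weight p θ u ^ τ * max θ u ≤ C * cumWeight p θ u := by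
    intro u hu hu2
    rcases le_total u (θ / 2) with h | h
    · rw [max_eq_left (by linarith)]
      have ht : 0 < u / θ := div_pos hu hθ
      set t := u / θ with htdef
      have hw : weight p θ u ≤ 2 * etaConst p * (t ^ (-(p + 1)) * Real.exp (-t ^ (-p))) := by
        rw [weight_of_le_half hθ hθ2 hu2, ramp, if_pos (by rw [div_le_iff₀ hθ]; linarith),
          eta_of_pos ht, show -p - 1 = -(p + 1) by ring, mul_assoc]
        exact mul_le_mul_of_nonneg_right (one_sub_inv_bounds hθ hθ2).2 (by positivity)
      have hw2 : weight p θ u ^ τ ≤ E * C₁ * Real.exp (-t ^ (-p)) := by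
        calc weight p θ u ^ τ
            ≤ (2 * etaConst p * (t ^ (-(p + 1)) * Real.exp (-t ^ (-p)))) ^ τ :=
              Real.rpow_le_rpow (weight_nonneg hp hθ hθ2 u) hw (by linarith)
          _ = E * ((t ^ (-((p + 1) * τ)) * Real.exp (-((τ - 1) * t ^ (-p)))) *
                Real.exp (-t ^ (-p))) := by
              rw [Real.mul_rpow (x := 2 * etaConst p) (by positivity) (by positivity),
                Real.mul_rpow (x := t ^ _) (by positivity) (by positivity), ← Real.rpow_mul ht.le,
                ← Real.exp_mul, mul_assoc (t ^ _), ← Real.exp_add]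
              congr 3
              · ring
              · ring_nf
          _ ≤ E * (C₁ * Real.exp (-t ^ (-p))) := by
              gcongr
              exact h₁ t ht
          _ = _ := by ring
      have h3 := hr u hu h
      calc weight p θ u ^ τ * θ ≤ E * C₁ * Real.exp (-t ^ (-p)) * θ := by gcongr
        _ = E * C₁ * (p / etaConst p) * (θ * (etaConst p / p * Real.exp (-t ^ (-p)))) := by
            field_simp
        _ ≤ E * C₁ * (p / etaConst p) * cumWeight p θ u := by gcongr
        _ ≤ C * cumWeight p θ u := by
            refine mul_le_mul_of_nonneg_right ?_ ?_
            · rw [hCdef]; linarith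
            · exact le_trans (by positivity) h3
    · have hw : weight p θ u ^ τ ≤ T :=
        Real.rpow_le_rpow (weight_nonneg hp hθ hθ2 u) (weight_le_two hp hθ hθ2 u) (by linarith)
      have h4 : θ * e0 ≤ cumWeight p θ (θ / 2) := by
        have := hr (θ / 2) (by linarith) le_rfl
        rwa [show θ / 2 / θ = 1 / 2 by field_simp] at this
      -- Beyond `θ/2` the weight is at least `1/2`.
      have h5 : (u - θ / 2) * (1 / 2) ≤ cumWeight p θ u - cumWeight p θ (θ / 2) := by
        rw [cumWeight_sub hp hθ hθ2, ← smul_eq_mul, ← intervalIntegral.integral_const]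
        refine intervalIntegral.integral_mono_on h (by simp)
          (intervalIntegrable_weight hp hθ hθ2 _ _) fun x hx => ?_
        rw [weight_of_le_half hθ hθ2 (by linarith [hx.2])]
        have := half_le_ramp hp (t := x / θ) (by rw [le_div_iff₀ hθ]; linarith [hx.1])
        have := (one_sub_inv_bounds hθ hθ2).1
        nlinarith
      have h6 : max θ u ≤ (1 / e0 + 4) * cumWeight p θ u := by
        have h7 : θ ≤ 1 / e0 * cumWeight p θ (θ / 2) := by
          rw [one_div, le_inv_mul_iff₀ he0]; linarith
        have h8 : 0 ≤ cumWeight p θ (θ / 2) := le_trans (by positivity) h4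
        have h9 : cumWeight p θ (θ / 2) ≤ cumWeight p θ u := by linarith
        have h10 : 1 / e0 * cumWeight p θ (θ / 2) ≤ 1 / e0 * cumWeight p θ u := by gcongr
        refine max_le (by linarith) (by linarith)
      calc weight p θ u ^ τ * max θ u ≤ T * ((1 / e0 + 4) * cumWeight p θ u) := by
            gcongr
        _ = (T * (1 / e0) + T * 4) * cumWeight p θ u := by ring
        _ ≤ C * cumWeight p θ u := by
            refine mul_le_mul_of_nonneg_right (by rw [hCdef]; linarith) ?_
            rw [← cumWeight_zero (p := p) (θ := θ)]
            exact monotone_cumWeight hp hθ hθ2 hu.le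
  have hsym : ∀ u, u ≤ 1 / 2 →
      min (cumWeight p θ u) (1 - cumWeight p θ u) = cumWeight p θ u := by
    intro u hu
    rw [← cumWeight_one_sub hp hθ hθ2]
    exact min_eq_left (monotone_cumWeight hp hθ hθ2 (by linarith))
  intro u hu
  rcases le_total u (1 / 2) with h | h
  · rw [hsym u h, bdist, min_eq_left (by linarith)]
    exact key u hu.1 h
  · have h2 := key (1 - u) (by linarith [hu.2]) (by linarith)
    rw [weight_one_sub hθ hθ2] at h2
    rw [min_comm, ← sub_sub_cancel 1 (cumWeight p θ u), ← cumWeight_one_sub hp hθ hθ2,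
      sub_sub_cancel, hsym _ (by linarith), bdist, min_eq_right (by linarith)]
    exact h2

end

end BDIS

open MeasureTheory

namespace BDIS

noncomputable section

open Filter Topology

/-! ### The inverse transport -/

/-- The inverse `S` of the transport map: `W(S(x)) = Φ(x)`. -/
def invTransport (φ : ℝ → ℝ) (p θ x : ℝ) : ℝ :=
  Function.invFunOn (cumWeight p θ) (Set.Ioo 0 1) (cdf φ x)

/-- The probability measure on `(0,1)` with density `w_θ`. -/
def weightMeasure (p θ : ℝ) : Measure ℝ := volume.withDensity fun u => ENNReal.ofReal (weight p θ u)

section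

variable {φ : ℝ → ℝ} (hφ : IsAdmissibleDensity φ) {p θ : ℝ} (hp : 1 ≤ p) (hθ : 0 < θ)
  (hθ2 : θ ≤ 1 / 2)

include hφ hp hθ hθ2

lemma invTransport_mem (x : ℝ) : invTransport φ p θ x ∈ Set.Ioo (0 : ℝ) 1 :=
  Function.invFunOn_mem (exists_cumWeight_eq hp hθ hθ2 ⟨cdf_pos hφ x, cdf_lt_one hφ x⟩)

lemma cumWeight_invTransport (x : ℝ) : cumWeight p θ (invTransport φ p θ x) = cdf φ x :=
  Function.invFunOn_eq (exists_cumWeight_eq hp hθ hθ2 ⟨cdf_pos hφ x, cdf_lt_one hφ x⟩)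

lemma transport_invTransport (x : ℝ) : transport φ p θ (invTransport φ p θ x) = x := by
  rw [transport_eq, cumWeight_invTransport hφ hp hθ hθ2, quantile_cdf hφ]

lemma cdf_transport {u : ℝ} (hu : u ∈ Set.Ioo (0 : ℝ) 1) :
    cdf φ (transport φ p θ u) = cumWeight p θ u := by
  obtain ⟨x, hx⟩ := exists_cdf_eq hφ (cumWeight_mem_Ioo hp hθ hθ2 hu)
  rw [transport_eq, ← hx, quantile_cdf hφ]

lemma invTransport_transport {u : ℝ} (hu : u ∈ Set.Ioo (0 : ℝ) 1) :
    invTransport φ p θ (transport φ p θ u) = u := by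
  refine (strictMonoOn_cumWeight hp hθ hθ2).injOn
    (Set.Ioo_subset_Icc_self (invTransport_mem hφ hp hθ hθ2 _)) (Set.Ioo_subset_Icc_self hu) ?_
  rw [cumWeight_invTransport hφ hp hθ hθ2, cdf_transport hφ hp hθ hθ2 hu]

lemma invTransport_le_iff {x u : ℝ} (hu : u ∈ Set.Ioo (0 : ℝ) 1) :
    invTransport φ p θ x ≤ u ↔ x ≤ transport φ p θ u := by
  rw [← (strictMonoOn_cumWeight hp hθ hθ2).le_iff_le
    (Set.Ioo_subset_Icc_self (invTransport_mem hφ hp hθ hθ2 _)) (Set.Ioo_subset_Icc_self hu),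
    cumWeight_invTransport hφ hp hθ hθ2, ← cdf_transport hφ hp hθ hθ2 hu,
    (strictMono_cdf hφ).le_iff_le]

lemma strictMono_invTransport : StrictMono (invTransport φ p θ) := by
  intro x y hxy
  rw [← (strictMonoOn_cumWeight hp hθ hθ2).lt_iff_lt
    (Set.Ioo_subset_Icc_self (invTransport_mem hφ hp hθ hθ2 _))
    (Set.Ioo_subset_Icc_self (invTransport_mem hφ hp hθ hθ2 _)),
    cumWeight_invTransport hφ hp hθ hθ2, cumWeight_invTransport hφ hp hθ hθ2]
  exact strictMono_cdf hφ hxy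

lemma measurable_invTransport : Measurable (invTransport φ p θ) :=
  (strictMono_invTransport hφ hp hθ hθ2).monotone.measurable

omit hφ in
lemma weightMeasure_Iic (u : ℝ) :
    weightMeasure p θ (Set.Iic u) = ENNReal.ofReal (cumWeight p θ u) := by
  rw [weightMeasure, withDensity_apply _ measurableSet_Iic]
  rcases le_total u 0 with hu | hu
  · rw [cumWeight_of_nonpos hp hθ hθ2 hu, ENNReal.ofReal_zero]
    rw [setLIntegral_congr_fun (g := fun _ => 0) measurableSet_Iic, lintegral_zero]
    intro x hx
    simp only
    rw [weight_eq_zero hθ hθ2 fun h => absurd (le_trans hx hu) (not_le.mpr h.1), ENNReal.ofReal_zero]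
  · have h1 : Set.Iic u = Set.Iic 0 ∪ Set.Ioc 0 u := (Set.Iic_union_Ioc_eq_Iic hu).symm
    rw [h1, lintegral_union measurableSet_Ioc (Set.Iic_disjoint_Ioc le_rfl),
      setLIntegral_congr_fun (g := fun _ => 0) measurableSet_Iic, lintegral_zero, zero_add,
      cumWeight, intervalIntegral.integral_of_le hu, ofReal_integral_eq_lintegral_ofReal]
    · exact (intervalIntegrable_weight hp hθ hθ2 0 u).1
    · exact Eventually.of_forall fun x => weight_nonneg hp hθ hθ2 x
    · intro x hx
      simp only
      rw [weight_eq_zero hθ hθ2 fun h => absurd hx (not_le.mpr h.1), ENNReal.ofReal_zero]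

lemma map_invTransport : (lineMeasure φ).map (invTransport φ p θ) = weightMeasure p θ := by
  have := hφ.isProbabilityMeasure
  refine Measure.ext_of_Iic _ _ fun u => ?_
  rw [Measure.map_apply (measurable_invTransport hφ hp hθ hθ2) measurableSet_Iic,
    weightMeasure_Iic hp hθ hθ2]
  rcases le_or_gt u 0 with h | h
  · have : invTransport φ p θ ⁻¹' Set.Iic u = ∅ := by
      ext x
      simp only [Set.mem_preimage, Set.mem_Iic, Set.mem_empty_iff_false, iff_false, not_le]
      exact h.trans_lt (invTransport_mem hφ hp hθ hθ2 x).1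
    rw [this, measure_empty, cumWeight_of_nonpos hp hθ hθ2 h, ENNReal.ofReal_zero]
  rcases lt_or_ge u 1 with h1 | h1
  · have : invTransport φ p θ ⁻¹' Set.Iic u = Set.Iic (transport φ p θ u) := by
      ext x; exact invTransport_le_iff hφ hp hθ hθ2 ⟨h, h1⟩
    rw [this, lineMeasure_Iic hφ, cdf_transport hφ hp hθ hθ2 ⟨h, h1⟩]
  · have : invTransport φ p θ ⁻¹' Set.Iic u = Set.univ := by
      ext x
      simp only [Set.mem_preimage, Set.mem_Iic, Set.mem_univ, iff_true]
      exact ((invTransport_mem hφ hp hθ hθ2 x).2.trans_le h1).le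
    rw [this, measure_univ, cumWeight_of_one_le hp hθ hθ2 h1, ENNReal.ofReal_one]

lemma measurePreserving_invTransport :
    MeasurePreserving (invTransport φ p θ) (lineMeasure φ) (weightMeasure p θ) :=
  ⟨measurable_invTransport hφ hp hθ hθ2, map_invTransport hφ hp hθ hθ2⟩

omit hφ in
lemma lintegral_weightMeasure (g : ℝ → ENNReal) :
    ∫⁻ u, g u ∂weightMeasure p θ = ∫⁻ u, ENNReal.ofReal (weight p θ u) * g u := by
  have h : Measurable fun u => ENNReal.ofReal (weight p θ u) :=
    (continuous_weight hp hθ hθ2).measurable.ennreal_ofReal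
  rw [weightMeasure, lintegral_withDensity_eq_lintegral_mul_non_measurable _ h
    (Eventually.of_forall fun u => ENNReal.ofReal_lt_top)]
  rfl

lemma lintegral_comp_invTransport {g : ℝ → ENNReal} (hg : Measurable g) :
    ∫⁻ x, g (invTransport φ p θ x) ∂lineMeasure φ =
      ∫⁻ u, ENNReal.ofReal (weight p θ u) * g u := by
  rw [← lintegral_weightMeasure hp hθ hθ2, ← map_invTransport hφ hp hθ hθ2,
    lintegral_map hg (measurable_invTransport hφ hp hθ hθ2)]

lemma integral_comp_invTransport {g : ℝ → ℝ} (hg : Measurable g) :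
    ∫ x, g (invTransport φ p θ x) ∂lineMeasure φ = ∫ u, g u * weight p θ u := by
  rw [← integral_map (measurable_invTransport hφ hp hθ hθ2).aemeasurable
    hg.aestronglyMeasurable, map_invTransport hφ hp hθ hθ2, weightMeasure,
    integral_withDensity_eq_integral_toReal_smul
      (continuous_weight hp hθ hθ2).measurable.ennreal_ofReal
      (Eventually.of_forall fun u => ENNReal.ofReal_lt_top)]
  refine integral_congr_ae (Eventually.of_forall fun u => ?_)
  simp only [smul_eq_mul]
  rw [ENNReal.toReal_ofReal (weight_nonneg hp hθ hθ2 u), mul_comm]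

end

/-! ### Two weighted bounds -/

/-- The logarithmic derivative of the weight. -/
def logWeightDeriv (p θ u : ℝ) : ℝ := weightDeriv p θ u / weight p θ u

/-- With `κ = 1 - 1/r` the derivative bound reads `|w'|/w ≤ C θ⁻¹ w^(-1/r)`, and the `r`-th power of
`w^(-1/r)` is cancelled exactly by the factor `w`. Since `w'` lives in the boundary layer, where
`bdist = θ`, this is a bound by the distance. The exponent is weakened by `δ` to match
`exists_weightRatio_le`. -/
lemma exists_logWeightDeriv_le {p r δ : ℝ} (hp : 1 ≤ p) (hr : 1 < r) (hδ : 0 ≤ δ) :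
    ∃ C, 0 < C ∧ ∀ θ : ℝ, 0 < θ → θ ≤ 1 / 2 → ∀ u ∈ Set.Ioo (0 : ℝ) 1,
      |logWeightDeriv p θ u| ^ r * weight p θ u ≤ (C * bdist θ u ^ (-(1 + δ))) ^ r := by
  have hr0 : 0 < r := by linarith
  obtain ⟨C, hC, h⟩ := exists_abs_weightDeriv_le (p := p) (κ := 1 - 1 / r) hp
    (by rw [sub_nonneg, div_le_one hr0]; exact hr.le) (by
      have : 0 < 1 / r := by positivity
      linarith)
  refine ⟨C, hC, fun θ hθ hθ2 u hu => ?_⟩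
  have hw := weight_pos hp hθ hθ2 hu
  have hb := bdist_pos hθ u
  by_cases hc : u ∈ Set.Icc θ (1 - θ)
  · rw [logWeightDeriv, weightDeriv_eq_zero hθ hc, zero_div, abs_zero, Real.zero_rpow hr0.ne',
      zero_mul]
    positivity
  · have hbd : bdist θ u = θ := by
      rw [bdist, max_eq_left]
      rw [Set.mem_Icc, not_and_or, not_le, not_le] at hc
      rcases hc with h | h
      · exact (min_le_left _ _).trans h.le
      · exact (min_le_right _ _).trans (by linarith)
    rw [hbd]
    have e1 : |logWeightDeriv p θ u| ≤ C * θ⁻¹ * weight p θ u ^ (-(1 / r)) := by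
      rw [logWeightDeriv, abs_div, abs_of_pos hw, div_le_iff₀ hw]
      refine (h θ hθ hθ2 u).trans (le_of_eq ?_)
      rw [mul_assoc (C * θ⁻¹), mul_comm _ (weight p θ u), ← Real.rpow_one_add' hw.le]
      · congr 2
      · have : 1 / r < 1 := by rw [div_lt_one hr0]; exact hr
        linarith
    calc |logWeightDeriv p θ u| ^ r * weight p θ u
        ≤ (C * θ⁻¹ * weight p θ u ^ (-(1 / r))) ^ r * weight p θ u := by gcongr
      _ = (C * θ⁻¹) ^ r := by
        rw [Real.mul_rpow (by positivity) (by positivity), ← Real.rpow_mul hw.le,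
          neg_mul, one_div_mul_cancel hr0.ne', Real.rpow_neg_one, mul_assoc,
          inv_mul_cancel₀ hw.ne', mul_one]
      _ ≤ _ := by
        have : θ⁻¹ ≤ θ ^ (-(1 + δ)) := by
          rw [← Real.rpow_neg_one]
          exact Real.rpow_le_rpow_of_exponent_ge hθ (by linarith) (by linarith)
        gcongr

/-- The ratio of the weight and the transported density. -/
def weightRatio (φ : ℝ → ℝ) (p θ u : ℝ) : ℝ := weight p θ u / φ (transport φ p θ u)

/-- The light tail gives `φ(T) ≥ c min(W, 1-W)^(1+δ)`, and the minimum is bounded below by `w^τ ·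
bdist` up to a constant. The choice `τ = (1 + 1/r)/(1 + δ)` turns this into `w^(1+1/r) bdist^(1+δ) ≤
C φ(T)`; it exceeds 1 precisely because `δ < 1/r`. -/
lemma exists_weightRatio_le {φ : ℝ → ℝ} (hφ : IsAdmissibleDensity φ) {p r δ : ℝ} (hp : 1 ≤ p)
    (hr : 1 < r) (hδ : 0 < δ) (hδr : δ < 1 / r) :
    ∃ C, 0 < C ∧ ∀ θ : ℝ, 0 < θ → θ ≤ 1 / 2 → ∀ u ∈ Set.Ioo (0 : ℝ) 1,
      |weightRatio φ p θ u| ^ r * weight p θ u ≤ (C * bdist θ u ^ (-(1 + δ))) ^ r := by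
  have hr0 : 0 < r := by linarith
  set τ := (1 + 1 / r) / (1 + δ) with hτ
  have hτ1 : 1 < τ := by rw [hτ, lt_div_iff₀ (by linarith)]; linarith
  obtain ⟨c, hc, h⟩ := exists_min_rpow_le_density hφ hδ
  obtain ⟨C, hC, hw⟩ := exists_weight_rpow_mul_bdist_le hp hτ1
  refine ⟨C ^ (1 + δ) / c, by positivity, fun θ hθ hθ2 u hu => ?_⟩
  have hwp := weight_pos hp hθ hθ2 hu
  have hb := bdist_pos hθ u
  set x := transport φ p θ u with hx
  have hφx := hφ.pos x
  have e1 : bdist θ u ^ (1 + δ) * weight p θ u ^ (1 + 1 / r) ≤ C ^ (1 + δ) / c * φ x := by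
    have h1 := hw θ hθ hθ2 u hu
    rw [← cdf_transport hφ hp hθ hθ2 hu, ← hx] at h1
    have h2 := Real.rpow_le_rpow (by positivity) h1 (by linarith : 0 ≤ 1 + δ)
    have hm : 0 ≤ min (cdf φ x) (1 - cdf φ x) :=
      le_min (cdf_pos hφ x).le (by linarith [cdf_lt_one hφ x])
    rw [Real.mul_rpow (by positivity) hb.le, ← Real.rpow_mul hwp.le, Real.mul_rpow hC.le hm,
      hτ, div_mul_cancel₀ _ (by linarith)] at h2
    calc _ = weight p θ u ^ (1 + 1 / r) * bdist θ u ^ (1 + δ) := mul_comm _ _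
      _ ≤ _ := h2
      _ = C ^ (1 + δ) / c * (c * min (cdf φ x) (1 - cdf φ x) ^ (1 + δ)) := by field_simp
      _ ≤ _ := mul_le_mul_of_nonneg_left (h x) (by positivity)
  have e2 : weightRatio φ p θ u * weight p θ u ^ (1 / r) ≤ C ^ (1 + δ) / c * bdist θ u ^ (-(1 + δ)) := by
    rw [weightRatio, ← hx, div_mul_eq_mul_div, div_le_iff₀ hφx, ← Real.rpow_one_add' hwp.le
      (by positivity), Real.rpow_neg hb.le, mul_right_comm, ← div_eq_mul_inv, le_div_iff₀
      (by positivity), mul_comm]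
    exact e1
  have hR : 0 ≤ weightRatio φ p θ u := div_nonneg hwp.le hφx.le
  calc |weightRatio φ p θ u| ^ r * weight p θ u
      = (weightRatio φ p θ u * weight p θ u ^ (1 / r)) ^ r := by
        rw [abs_of_nonneg hR, Real.mul_rpow hR (by positivity), ← Real.rpow_mul hwp.le,
          one_div_mul_cancel hr0.ne', Real.rpow_one]
    _ ≤ _ := Real.rpow_le_rpow (by positivity) e2 hr0.le

end

end BDIS

/-! ### Integration by parts in weighted spaces against products -/

open MeasureTheory

namespace BDIS

noncomputable section

open Filter Topology

/-! ### Integrals of products over product measures -/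

lemma lintegral_prod_eval {n : ℕ} {X : Type*} [MeasurableSpace X]
    (μ : Fin n → Measure X) [∀ i, SigmaFinite (μ i)]
    (g : Fin n → X → ENNReal) (hg : ∀ i, AEMeasurable (g i) (μ i)) :
    ∫⁻ x, ∏ i, g i (x i) ∂(Measure.pi μ) = ∏ i, ∫⁻ x, g i x ∂(μ i) := by
  induction n with
  | zero => simp
  | succ n ih =>
    have h := ih (fun i => μ i.succ) (fun i => g i.succ) (fun i => hg _)
    have h2 : ∫⁻ x : X × (Fin n → X), g 0 x.1 * ∏ i : Fin n, g i.succ (x.2 i)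
        ∂((μ 0).prod (Measure.pi fun i : Fin n => μ i.succ)) =
        (∫⁻ x, g 0 x ∂μ 0) * ∏ i : Fin n, ∫⁻ x, g i.succ x ∂μ i.succ := by
      rw [← h]
      refine lintegral_prod_mul (f := g 0) (g := fun y : Fin n → X => ∏ i, g (Fin.succ i) (y i)) (hg 0) ?_
      exact Finset.aemeasurable_fun_prod _ fun i _ =>
        (hg i.succ).comp_quasiMeasurePreserving (Measure.quasiMeasurePreserving_eval _ i)
    rw [Fin.prod_univ_succ, ← h2]
    refine Eq.trans ?_ ((measurePreserving_piFinSuccAbove μ 0).lintegral_comp_emb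
      (MeasurableEquiv.measurableEmbedding _)
      fun x : X × (Fin n → X) => g 0 x.1 * ∏ i : Fin n, g i.succ (x.2 i))
    refine lintegral_congr fun x => ?_
    rw [Fin.prod_univ_succ]
    rfl

lemma pi_withDensity_ofReal {s : ℕ} {g : Fin s → ℝ → ℝ} (hg : ∀ j, Measurable (g j))
    (hg0 : ∀ j u, 0 ≤ g j u)
    [∀ j, SigmaFinite ((volume : Measure ℝ).withDensity fun u => ENNReal.ofReal (g j u))] :
    Measure.pi (fun j => (volume : Measure ℝ).withDensity fun u => ENNReal.ofReal (g j u)) =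
      (volume : Measure (Fin s → ℝ)).withDensity fun x => ENNReal.ofReal (∏ j, g j (x j)) := by
  refine Measure.pi_eq fun t ht => ?_
  rw [withDensity_apply _ (MeasurableSet.univ_pi ht), ← lintegral_indicator (MeasurableSet.univ_pi ht)]
  have h1 : ∀ x : Fin s → ℝ, (Set.univ.pi t).indicator (fun x => ENNReal.ofReal (∏ j, g j (x j))) x =
      ∏ j, (t j).indicator (fun y => ENNReal.ofReal (g j y)) (x j) := by
    intro x
    by_cases hx : x ∈ Set.univ.pi t
    · rw [Set.indicator_of_mem hx, ENNReal.ofReal_prod_of_nonneg fun j _ => hg0 j _]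
      exact Finset.prod_congr rfl fun j _ =>
        (Set.indicator_of_mem (hx j trivial) fun y => ENNReal.ofReal (g j y)).symm
    · rw [Set.indicator_of_notMem hx]
      simp only [Set.mem_pi, Set.mem_univ, true_imp_iff, not_forall] at hx
      obtain ⟨j, hj⟩ := hx
      exact (Finset.prod_eq_zero (Finset.mem_univ j) (Set.indicator_of_notMem hj _)).symm
  simp_rw [h1]
  rw [volume_pi, lintegral_prod_eval _ (fun j => (t j).indicator fun y => ENNReal.ofReal (g j y))
    fun j => ((hg j).ennreal_ofReal.indicator (ht j)).aemeasurable]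
  refine Finset.prod_congr rfl fun j _ => ?_
  rw [lintegral_indicator (ht j), withDensity_apply _ (ht j)]

section

variable {φ : ℝ → ℝ} (hφ : IsAdmissibleDensity φ)

include hφ

/-- The density need not be continuous; its positivity on compact sets is made uniform by the
light-tail condition, `Φ` being increasing and positive. -/
lemma exists_density_ge (R : ℝ) : ∃ c, 0 < c ∧ ∀ x, |x| ≤ R → c ≤ φ x := by
  obtain ⟨c, hc, h⟩ := hφ.light_tail 1 one_pos
  refine ⟨c * cdf φ (-R) ^ (1 + 1 : ℝ), mul_pos hc (Real.rpow_pos_of_pos (cdf_pos hφ _) _),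
    fun x hx => ?_⟩
  have key : ∀ y, y ≤ 0 → -R ≤ y → c * cdf φ (-R) ^ (1 + 1 : ℝ) ≤ φ y := by
    intro y hy hR
    refine le_trans ?_ (h y hy)
    have := (strictMono_cdf hφ).monotone hR
    have := cdf_pos hφ (-R)
    gcongr
  rw [abs_le] at hx
  rcases le_total x 0 with h0 | h0
  · exact key x h0 hx.1
  · rw [hφ.symm]; exact key (-x) (by linarith) (by linarith)

lemma measurable_density : Measurable fun x => ENNReal.ofReal (φ x) := hφ.measurable.ennreal_ofReal

lemma prodMeasure_eq_withDensity (s : ℕ) :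
    prodMeasure φ s = (volume : Measure (Fin s → ℝ)).withDensity
      fun x => ENNReal.ofReal (∏ j, φ (x j)) := by
  have := hφ.isProbabilityMeasure
  have : SigmaFinite ((volume : Measure ℝ).withDensity fun u => ENNReal.ofReal (φ u)) :=
    inferInstanceAs (SigmaFinite (lineMeasure φ))
  exact pi_withDensity_ofReal (fun _ => hφ.measurable) fun _ u => (hφ.pos u).le

lemma measurable_prod_density (s : ℕ) : Measurable fun x : Fin s → ℝ => ∏ j, φ (x j) :=
  Finset.measurable_fun_prod _ fun _ _ => hφ.measurable.comp (measurable_pi_apply _)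

lemma prod_density_pos {s : ℕ} (x : Fin s → ℝ) : 0 < ∏ j, φ (x j) :=
  Finset.prod_pos fun _ _ => hφ.pos _

lemma integral_prodMeasure {s : ℕ} (F : (Fin s → ℝ) → ℝ) :
    ∫ x, F x ∂prodMeasure φ s = ∫ x, F x * ∏ j, φ (x j) := by
  rw [prodMeasure_eq_withDensity hφ, integral_withDensity_eq_integral_toReal_smul
    (measurable_prod_density hφ s).ennreal_ofReal (Eventually.of_forall fun u => ENNReal.ofReal_lt_top)]
  refine integral_congr_ae (Eventually.of_forall fun x => ?_)
  simp only [smul_eq_mul]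
  rw [ENNReal.toReal_ofReal (prod_density_pos hφ x).le, mul_comm]

lemma integral_volume_eq {s : ℕ} (F : (Fin s → ℝ) → ℝ) :
    ∫ x, F x = ∫ x, F x * ∏ j, (φ (x j))⁻¹ ∂prodMeasure φ s := by
  rw [integral_prodMeasure hφ]
  refine integral_congr_ae (Eventually.of_forall fun x => ?_)
  simp only
  rw [Finset.prod_inv_distrib, mul_assoc, inv_mul_cancel₀ (prod_density_pos hφ x).ne', mul_one]

lemma isProbabilityMeasure_prodMeasure (s : ℕ) : IsProbabilityMeasure (prodMeasure φ s) := by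
  have := hφ.isProbabilityMeasure
  unfold prodMeasure
  infer_instance

lemma prodMeasure_absolutelyContinuous (s : ℕ) :
    prodMeasure φ s ≪ (volume : Measure (Fin s → ℝ)) := by
  rw [prodMeasure_eq_withDensity hφ]; exact withDensity_absolutelyContinuous _ _

end

/-! ### Pairing with products of functions of one variable -/

/-- The norm of `L^r(ℝ, φ)`. -/
def lineNorm (φ : ℝ → ℝ) (r : ℝ) (g : ℝ → ℝ) : ℝ :=
  (eLpNorm g (ENNReal.ofReal r) (lineMeasure φ)).toReal

/-- The norm of `L^q(ℝ^s, φ)`. -/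
def spaceNorm (φ : ℝ → ℝ) {s : ℕ} (q : ℝ) (h : (Fin s → ℝ) → ℝ) : ℝ :=
  (eLpNorm h (ENNReal.ofReal q) (prodMeasure φ s)).toReal

lemma lineNorm_nonneg (φ : ℝ → ℝ) (r : ℝ) (g : ℝ → ℝ) : 0 ≤ lineNorm φ r g := ENNReal.toReal_nonneg

lemma spaceNorm_nonneg (φ : ℝ → ℝ) {s : ℕ} (q : ℝ) (h : (Fin s → ℝ) → ℝ) :
    0 ≤ spaceNorm φ q h := ENNReal.toReal_nonneg

/-- Membership in `L^r(ℝ, φ)`. -/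
abbrev MemLine (φ : ℝ → ℝ) (r : ℝ) (g : ℝ → ℝ) : Prop := MemLp g (ENNReal.ofReal r) (lineMeasure φ)

/-- Membership in `L^q(ℝ^s, φ)`. -/
abbrev MemSpace (φ : ℝ → ℝ) {s : ℕ} (q : ℝ) (h : (Fin s → ℝ) → ℝ) : Prop :=
  MemLp h (ENNReal.ofReal q) (prodMeasure φ s)

section

variable {φ : ℝ → ℝ} (hφ : IsAdmissibleDensity φ) {q r : ℝ} (hqr : q.HolderConjugate r) {s : ℕ}

include hφ hqr

lemma aestronglyMeasurable_prod_eval {g : Fin s → ℝ → ℝ} (hg : ∀ j, MemLine φ r (g j)) :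
    AEStronglyMeasurable (fun x : Fin s → ℝ => ∏ j, g j (x j)) (prodMeasure φ s) := by
  have := hφ.isProbabilityMeasure
  refine Finset.aestronglyMeasurable_fun_prod _ fun j _ => ?_
  exact (hg j).1.comp_quasiMeasurePreserving (Measure.quasiMeasurePreserving_eval _ j)

lemma eLpNorm_prod_eval {g : Fin s → ℝ → ℝ} (hg : ∀ j, MemLine φ r (g j)) :
    eLpNorm (fun x : Fin s → ℝ => ∏ j, g j (x j)) (ENNReal.ofReal r) (prodMeasure φ s) =
      ∏ j, eLpNorm (g j) (ENNReal.ofReal r) (lineMeasure φ) := by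
  have := hφ.isProbabilityMeasure
  have hr : 0 < r := hqr.symm.pos
  have h0 : ENNReal.ofReal r ≠ 0 := by simpa using hr
  simp_rw [eLpNorm_eq_lintegral_rpow_enorm_toReal h0 ENNReal.ofReal_ne_top,
    ENNReal.toReal_ofReal hr.le]
  rw [ENNReal.prod_rpow_of_nonneg (by positivity)]
  congr 1
  have h1 : ∀ x : Fin s → ℝ, ‖∏ j, g j (x j)‖ₑ ^ r = ∏ j, ‖g j (x j)‖ₑ ^ r := by
    intro x
    rw [ENNReal.prod_rpow_of_nonneg hr.le]
    congr 1
    simp only [← ofReal_norm]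
    rw [norm_prod, ENNReal.ofReal_prod_of_nonneg fun _ _ => norm_nonneg _]
  simp_rw [h1]
  exact lintegral_prod_eval _ (fun j y => ‖g j y‖ₑ ^ r) fun j => (hg j).1.enorm.pow_const r

lemma memLp_prod_eval {g : Fin s → ℝ → ℝ} (hg : ∀ j, MemLine φ r (g j)) :
    MemSpace φ r (fun x : Fin s → ℝ => ∏ j, g j (x j)) := by
  refine ⟨aestronglyMeasurable_prod_eval hφ hqr hg, ?_⟩
  rw [eLpNorm_prod_eval hφ hqr hg]
  exact ENNReal.prod_lt_top fun j _ => (hg j).2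

lemma integrable_mul_prod_eval {h : (Fin s → ℝ) → ℝ} (hh : MemSpace φ q h) {g : Fin s → ℝ → ℝ}
    (hg : ∀ j, MemLine φ r (g j)) :
    Integrable (fun x => h x * ∏ j, g j (x j)) (prodMeasure φ s) := by
  have := hqr.ennrealOfReal
  exact hh.integrable_mul (memLp_prod_eval hφ hqr hg)

lemma abs_integral_mul_prod_eval_le {h : (Fin s → ℝ) → ℝ} (hh : MemSpace φ q h)
    {g : Fin s → ℝ → ℝ} (hg : ∀ j, MemLine φ r (g j)) :
    |∫ x, h x * ∏ j, g j (x j) ∂prodMeasure φ s| ≤ spaceNorm φ q h * ∏ j, lineNorm φ r (g j) := by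
  have := hqr.ennrealOfReal
  have h1 : eLpNorm (h • fun x => ∏ j, g j (x j)) 1 (prodMeasure φ s) ≤
      eLpNorm h (ENNReal.ofReal q) (prodMeasure φ s) *
        ∏ j, eLpNorm (g j) (ENNReal.ofReal r) (lineMeasure φ) := by
    rw [← eLpNorm_prod_eval hφ hqr hg]
    have hm := (memLp_prod_eval hφ hqr hg).1
    generalize (fun x : Fin s → ℝ => ∏ j, g j (x j)) = G at hm ⊢
    exact eLpNorm_smul_le_mul_eLpNorm hm hh.1
  have h2 : |∫ x, h x * ∏ j, g j (x j) ∂prodMeasure φ s| ≤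
      (eLpNorm (fun x => h x * ∏ j, g j (x j)) 1 (prodMeasure φ s)).toReal := by
    rw [eLpNorm_one_eq_lintegral_enorm, ← integral_norm_eq_lintegral_enorm
      (integrable_mul_prod_eval hφ hqr hh hg).1]
    exact norm_integral_le_integral_norm (fun x : Fin s → ℝ => h x * ∏ j, g j (x j))
  refine h2.trans ?_
  rw [spaceNorm]
  unfold lineNorm
  rw [← ENNReal.toReal_prod, ← ENNReal.toReal_mul]
  refine ENNReal.toReal_mono ?_ h1
  exact ENNReal.mul_ne_top hh.2.ne (ENNReal.prod_ne_top fun j _ => (hg j).2.ne)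

lemma abs_lineNorm_sub_le {f g : ℝ → ℝ} (hf : MemLine φ r f) (hg : MemLine φ r g) :
    |lineNorm φ r f - lineNorm φ r g| ≤ lineNorm φ r (fun x => f x - g x) := by
  have h1 : (1 : ENNReal) ≤ ENNReal.ofReal r := by
    rw [← ENNReal.ofReal_one]; exact ENNReal.ofReal_le_ofReal hqr.symm.lt.le
  have key : ∀ {f g : ℝ → ℝ}, MemLine φ r f → MemLine φ r g →
      lineNorm φ r f ≤ lineNorm φ r g + lineNorm φ r (fun x => f x - g x) := by
    intro f g hf hg
    have := eLpNorm_add_le (hg.1) (hf.sub hg).1 h1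
    rw [add_sub_cancel] at this
    change _ ≤ _ + (eLpNorm (f - g) _ _).toReal
    rw [lineNorm, lineNorm, ← ENNReal.toReal_add hg.2.ne (hf.sub hg).2.ne]
    exact ENNReal.toReal_mono (ENNReal.add_ne_top.mpr ⟨hg.2.ne, (hf.sub hg).2.ne⟩) this
  have h2 := key hf hg
  have h3 := key hg hf
  have h4 : lineNorm φ r (fun x => g x - f x) = lineNorm φ r (fun x => f x - g x) := by
    rw [lineNorm, lineNorm]; congr 1; exact eLpNorm_sub_comm g f _ _
  rw [h4] at h3
  rw [abs_le]; constructor <;> linarith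

/-- Hölder's inequality applied to the telescoping difference of the two products. -/
lemma tendsto_integral_mul_prod_eval {h : (Fin s → ℝ) → ℝ} (hh : MemSpace φ q h)
    {g : Fin s → ℝ → ℝ} (hg : ∀ j, MemLine φ r (g j)) {G : ℕ → Fin s → ℝ → ℝ}
    (hG : ∀ n j, MemLine φ r (G n j))
    (hlim : ∀ j, Tendsto (fun n => lineNorm φ r (fun x => G n j x - g j x)) atTop (𝓝 0)) :
    Tendsto (fun n => ∫ x, h x * ∏ j, G n j (x j) ∂prodMeasure φ s) atTop
      (𝓝 (∫ x, h x * ∏ j, g j (x j) ∂prodMeasure φ s)) := by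
  -- The hybrid with index `i`: new factors before `i`, the error at `i`, old factors after `i`.
  let F : ℕ → Fin s → Fin s → ℝ → ℝ := fun n i j =>
    if j < i then G n j else if j = i then fun x => G n j x - g j x else g j
  have hF : ∀ n i j, MemLine φ r (F n i j) := by
    intro n i j
    simp only [F]
    split_ifs
    · exact hG n j
    · exact (hG n j).sub (hg j)
    · exact hg j
  have hnorm : ∀ j, Tendsto (fun n => lineNorm φ r (G n j)) atTop (𝓝 (lineNorm φ r (g j))) := by
    intro j
    rw [tendsto_iff_norm_sub_tendsto_zero]
    exact squeeze_zero (fun n => norm_nonneg _)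
      (fun n => abs_lineNorm_sub_le hφ hqr (hG n j) (hg j)) (hlim j)
  have hsum : ∀ n, ∫ x, h x * ∏ j, G n j (x j) ∂prodMeasure φ s -
      ∫ x, h x * ∏ j, g j (x j) ∂prodMeasure φ s =
      ∑ i, ∫ x, h x * ∏ j, F n i j (x j) ∂prodMeasure φ s := by
    intro n
    rw [← integral_sub (integrable_mul_prod_eval hφ hqr hh (hG n))
      (integrable_mul_prod_eval hφ hqr hh hg),
      ← integral_finsetSum _ fun i _ => integrable_mul_prod_eval hφ hqr hh (hF n i)]
    refine integral_congr_ae (Eventually.of_forall fun x => ?_)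
    simp only
    rw [← mul_sub, ← Finset.mul_sum]
    congr 1
    have e := Finset.prod_add_ordered (Finset.univ : Finset (Fin s)) (fun j => g j (x j))
      (fun j => G n j (x j) - g j (x j))
    have e1 : ∀ i : Fin s, ∏ j, F n i j (x j) = (G n i (x i) - g i (x i)) *
        (∏ j ∈ Finset.univ.filter (fun j => j < i), G n j (x j)) *
        ∏ j ∈ Finset.univ.filter (fun j => i < j), g j (x j) := by
      intro i
      rw [← Finset.mul_prod_erase _ _ (Finset.mem_univ i)]
      have hs : Finset.univ.erase i =
          Finset.univ.filter (fun j => j < i) ∪ Finset.univ.filter (fun j => i < j) := by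
        ext j
        simp only [Finset.mem_erase, Finset.mem_univ, and_true, Finset.mem_union, Finset.mem_filter,
          true_and]
        exact ne_iff_lt_or_gt
      rw [hs, Finset.prod_union, ← mul_assoc]
      · congr 1
        · congr 1
          · simp [F]
          · refine Finset.prod_congr rfl fun j hj => ?_
            simp only [Finset.mem_filter, Finset.mem_univ, true_and] at hj
            simp [F, hj]
        · refine Finset.prod_congr rfl fun j hj => ?_
          simp only [Finset.mem_filter, Finset.mem_univ, true_and] at hj
          simp [F, hj.not_gt, hj.ne']
      · rw [Finset.disjoint_filter]
        intro j _ h1 h2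
        exact absurd h1 h2.not_gt
    simp only [add_sub_cancel] at e
    rw [e, add_sub_cancel_left]
    exact Finset.sum_congr rfl fun i _ => (e1 i).symm
  rw [tendsto_iff_norm_sub_tendsto_zero]
  simp_rw [hsum]
  have hterm : ∀ i : Fin s, Tendsto (fun n => ∫ x, h x * ∏ j, F n i j (x j) ∂prodMeasure φ s)
      atTop (𝓝 0) := by
    intro i
    refine squeeze_zero_norm (fun n => abs_integral_mul_prod_eval_le hφ hqr hh (hF n i)) ?_
    have hp : Tendsto (fun n => ∏ j, lineNorm φ r (F n i j)) atTop
        (𝓝 (∏ j, if j < i then lineNorm φ r (g j) else if j = i then 0 else lineNorm φ r (g j))) := by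
      refine tendsto_finsetProd _ fun j _ => ?_
      simp only [F]
      split_ifs
      · exact hnorm j
      · exact hlim j
      · exact tendsto_const_nhds
    have hz : (∏ j, if j < i then lineNorm φ r (g j) else if j = i then 0
        else lineNorm φ r (g j)) = 0 := Finset.prod_eq_zero (Finset.mem_univ i) (by simp)
    rw [hz] at hp
    simpa using hp.const_mul (spaceNorm φ q h)
  have := tendsto_finsetSum (s := Finset.univ) fun i _ => hterm i
  simpa using this.norm

end

end

end BDIS

open MeasureTheory

namespace BDIS

noncomputable section

open Filter Topology

/-! ### Products of test functions -/

section

variable {s : ℕ}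

lemma contDiff_prod_eval {ψ : Fin s → ℝ → ℝ} (hψ : ∀ j, ContDiff ℝ (⊤ : ℕ∞) (ψ j)) :
    ContDiff ℝ (⊤ : ℕ∞) fun x : Fin s → ℝ => ∏ j, ψ j (x j) :=
  contDiff_prod fun j _ => (hψ j).comp (contDiff_apply ℝ ℝ j)

lemma hasCompactSupport_prod_eval {ψ : Fin s → ℝ → ℝ} (hψ : ∀ j, HasCompactSupport (ψ j)) :
    HasCompactSupport fun x : Fin s → ℝ => ∏ j, ψ j (x j) := by
  refine HasCompactSupport.intro (isCompact_univ_pi fun j => hψ j) fun x hx => ?_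
  simp only [Set.mem_pi, Set.mem_univ, true_imp_iff, not_forall] at hx
  obtain ⟨j, hj⟩ := hx
  exact Finset.prod_eq_zero (Finset.mem_univ j) (image_eq_zero_of_notMem_tsupport hj)

lemma fderiv_prod_eval {g : Fin s → ℝ → ℝ} (hg : ∀ j, Differentiable ℝ (g j)) (x : Fin s → ℝ)
    (i : Fin s) : fderiv ℝ (fun x : Fin s → ℝ => ∏ j, g j (x j)) x (Pi.single i 1) =
      ∏ j, (if j = i then deriv (g j) else g j) (x j) := by
  have h1 : ∀ j ∈ (Finset.univ : Finset (Fin s)), HasFDerivAt (fun x : Fin s → ℝ => g j (x j))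
      ((deriv (g j) (x j)) • ContinuousLinearMap.proj (R := ℝ) (φ := fun _ : Fin s => ℝ) j) x := by
    intro j _
    have h2 : HasFDerivAt (fun x : Fin s → ℝ => x j)
        (ContinuousLinearMap.proj (R := ℝ) (φ := fun _ : Fin s => ℝ) j) x :=
      (ContinuousLinearMap.proj (R := ℝ) (φ := fun _ : Fin s => ℝ) j).hasFDerivAt
    exact (hg j (x j)).hasDerivAt.comp_hasFDerivAt x h2
  rw [(HasFDerivAt.finsetProd h1).fderiv]
  simp only [sum_apply, smul_apply,
    ContinuousLinearMap.proj_apply, smul_eq_mul]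
  rw [Finset.sum_eq_single i]
  · rw [Pi.single_eq_same, mul_one, ← Finset.mul_prod_erase _ _ (Finset.mem_univ i), mul_comm]
    congr 1
    · simp
    · refine Finset.prod_congr rfl fun j hj => ?_
      rw [if_neg (Finset.ne_of_mem_erase hj)]
  · intro j _ hj
    rw [Pi.single_eq_of_ne hj]; simp
  · simp

lemma mixedPartial_prod_eval {ψ : Fin s → ℝ → ℝ} (hψ : ∀ j, ContDiff ℝ (⊤ : ℕ∞) (ψ j))
    (v : Finset (Fin s)) : mixedPartial v (fun x => ∏ j, ψ j (x j)) =
      fun x => ∏ j, (if j ∈ v then deriv (ψ j) else ψ j) (x j) := by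
  have key : ∀ l : List (Fin s), l.Nodup →
      l.foldr (fun j g x => fderiv ℝ g x (Pi.single j 1)) (fun x => ∏ j, ψ j (x j)) =
        fun x : Fin s → ℝ => ∏ j, (if j ∈ l then deriv (ψ j) else ψ j) (x j) := by
    intro l
    induction l with
    | nil => intro _; simp
    | cons i l ih =>
      intro hl
      rw [List.nodup_cons] at hl
      rw [List.foldr_cons, ih hl.2]
      funext x
      rw [fderiv_prod_eval]
      · refine Finset.prod_congr rfl fun j _ => ?_
        by_cases hj : j = i
        · subst hj; simp [hl.1]
        · simp [hj]
      · intro j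
        split_ifs
        · exact ((contDiff_infty_iff_deriv.mp (hψ j)).2).differentiable (by simp)
        · exact (hψ j).differentiable (by simp)
  rw [mixedPartial, key _ (Finset.sort_nodup _ _)]
  simp

/-- `g` is the weak mixed derivative `∂^v f` as far as products of test functions can tell. -/
def HasProductWeakDeriv (v : Finset (Fin s)) (f g : (Fin s → ℝ) → ℝ) : Prop :=
  ∀ ψ : Fin s → ℝ → ℝ, (∀ j, ContDiff ℝ (⊤ : ℕ∞) (ψ j)) → (∀ j, HasCompactSupport (ψ j)) →
    ∫ x, f x * ∏ j, (if j ∈ v then deriv (ψ j) else ψ j) (x j) =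
      (-1 : ℝ) ^ v.card * ∫ x, g x * ∏ j, ψ j (x j)

lemma HasWeakMixedDeriv.hasProductWeakDeriv {v : Finset (Fin s)} {f g : (Fin s → ℝ) → ℝ}
    (h : HasWeakMixedDeriv v f g) : HasProductWeakDeriv v f g := by
  intro ψ hψ hc
  have := h.integral_eq _ (contDiff_prod_eval hψ) (hasCompactSupport_prod_eval hc)
  rwa [mixedPartial_prod_eval hψ] at this

end

/-! ### Approximation by quotients of test functions and the density -/

section

variable {φ : ℝ → ℝ} (hφ : IsAdmissibleDensity φ) {q r : ℝ} (hqr : q.HolderConjugate r)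

include hφ in
lemma lintegral_lineMeasure (g : ℝ → ENNReal) :
    ∫⁻ x, g x ∂lineMeasure φ = ∫⁻ x, ENNReal.ofReal (φ x) * g x := by
  rw [lineMeasure, lintegral_withDensity_eq_lintegral_mul_non_measurable _ (measurable_density hφ)
    (Eventually.of_forall fun u => ENNReal.ofReal_lt_top)]
  rfl

include hφ in
lemma integral_lineMeasure (g : ℝ → ℝ) : ∫ x, g x ∂lineMeasure φ = ∫ x, g x * φ x := by
  rw [lineMeasure, integral_withDensity_eq_integral_toReal_smul (measurable_density hφ)
    (Eventually.of_forall fun u => ENNReal.ofReal_lt_top)]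
  refine integral_congr_ae (Eventually.of_forall fun x => ?_)
  simp only [smul_eq_mul]
  rw [ENNReal.toReal_ofReal (hφ.pos x).le, mul_comm]

/-- The quotient of a function and the density. -/
def overDensity (φ ψ : ℝ → ℝ) (x : ℝ) : ℝ := ψ x / φ x

lemma lineNorm_mono_abs {r : ℝ} {f g : ℝ → ℝ} (hg : MemLine φ r g) (h : ∀ x, |f x| ≤ |g x|) :
    lineNorm φ r f ≤ lineNorm φ r g :=
  ENNReal.toReal_mono hg.2.ne (eLpNorm_mono h)

include hqr in
lemma lineNorm_add_le {f g : ℝ → ℝ} (hf : MemLine φ r f) (hg : MemLine φ r g) :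
    lineNorm φ r (fun x => f x + g x) ≤ lineNorm φ r f + lineNorm φ r g := by
  have h1 : (1 : ENNReal) ≤ ENNReal.ofReal r := by
    rw [← ENNReal.ofReal_one]; exact ENNReal.ofReal_le_ofReal hqr.symm.lt.le
  rw [lineNorm, lineNorm, lineNorm, ← ENNReal.toReal_add hf.2.ne hg.2.ne]
  exact ENNReal.toReal_mono (ENNReal.add_ne_top.mpr ⟨hf.2.ne, hg.2.ne⟩)
    (eLpNorm_add_le hf.1 hg.1 h1)

lemma lineNorm_const_mul {r : ℝ} (c : ℝ) (f : ℝ → ℝ) :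
    lineNorm φ r (fun x => c * f x) = |c| * lineNorm φ r f := by
  rw [lineNorm, lineNorm]
  have := eLpNorm_const_smul c f (ENNReal.ofReal r) (lineMeasure φ)
  change eLpNorm (fun x => c * f x) _ _ = _ at this
  rw [this, ENNReal.toReal_mul]
  simp

include hφ in
lemma memLine_of_bounded {r : ℝ} {f : ℝ → ℝ} (hf : Measurable f) {C : ℝ} (hC : ∀ x, |f x| ≤ C) :
    MemLine φ r f := by
  have := hφ.isProbabilityMeasure
  exact MemLp.of_bound hf.aestronglyMeasurable C (Eventually.of_forall hC)

include hφ in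
lemma exists_abs_overDensity_le {ψ : ℝ → ℝ} {R : ℝ} (h0 : ∀ x, R < |x| → ψ x = 0) :
    ∃ c, 0 < c ∧ ∀ x, |overDensity φ ψ x| ≤ c * |ψ x| := by
  obtain ⟨c, hc, h⟩ := exists_density_ge hφ R
  refine ⟨c⁻¹, by positivity, fun x => ?_⟩
  rw [overDensity, abs_div, abs_of_pos (hφ.pos x), div_eq_mul_inv, mul_comm]
  rcases le_or_gt |x| R with hx | hx
  · exact mul_le_mul_of_nonneg_right (inv_anti₀ hc (h x hx)) (abs_nonneg _)
  · rw [h0 x hx]; simp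

include hφ in
lemma memLine_overDensity_of_continuous {r : ℝ} {ψ : ℝ → ℝ} (hψ : Continuous ψ)
    (hc : HasCompactSupport ψ) : MemLine φ r (overDensity φ ψ) := by
  obtain ⟨C, hC⟩ := hψ.bounded_above_of_compact_support hc
  obtain ⟨R, hR⟩ := hc.isBounded.subset_closedBall 0
  obtain ⟨c, hc0, h⟩ := exists_abs_overDensity_le hφ (ψ := ψ) (R := R) (by
    intro x hx
    refine image_eq_zero_of_notMem_tsupport fun h => ?_
    have := hR h
    rw [Metric.mem_closedBall, Real.dist_eq, sub_zero] at this
    exact absurd hx (not_lt.mpr this))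
  refine memLine_of_bounded hφ (hψ.measurable.div hφ.measurable) (C := c * C) fun x => ?_
  exact (h x).trans (mul_le_mul_of_nonneg_left (hC x) hc0.le)

include hφ hqr in
-- Multiplication by `φ` is an isometry from `L^r(φ)` to `L^r` of the measure with density
-- `φ^(1-r)`. That measure is finite on compact sets, so smooth functions of compact support are
-- dense there.
lemma exists_test_overDensity_le {B : ℝ → ℝ} (hB : MemLine φ r B) {ε : ℝ} (hε : 0 < ε) :
    ∃ ψ : ℝ → ℝ, ContDiff ℝ (⊤ : ℕ∞) ψ ∧ HasCompactSupport ψ ∧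
      lineNorm φ r (fun x => overDensity φ ψ x - B x) ≤ ε := by
  have hr : 0 < r := hqr.symm.pos
  have h0 : ENNReal.ofReal r ≠ 0 := by simpa using hr
  let d : ℝ → ENNReal := fun x => ENNReal.ofReal (φ x ^ (1 - r))
  have hd : Measurable d := (hφ.measurable.pow_const _).ennreal_ofReal
  let ν : Measure ℝ := volume.withDensity d
  have hν : IsFiniteMeasureOnCompacts ν := by
    refine ⟨fun K hK => ?_⟩
    obtain ⟨R, hR⟩ := hK.isBounded.subset_closedBall 0
    obtain ⟨c, hc, h⟩ := exists_density_ge hφ R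
    rw [withDensity_apply _ hK.measurableSet]
    calc ∫⁻ x in K, d x ≤ ∫⁻ x in K, ENNReal.ofReal (c ^ (1 - r)) := by
          refine setLIntegral_mono measurable_const fun x hx => ENNReal.ofReal_le_ofReal ?_
          have := hR hx
          rw [Metric.mem_closedBall, Real.dist_eq, sub_zero] at this
          exact Real.rpow_le_rpow_of_nonpos hc (h x this) (by linarith [hqr.symm.lt])
      _ = ENNReal.ofReal (c ^ (1 - r)) * volume K := by rw [setLIntegral_const]
      _ < ⊤ := ENNReal.mul_lt_top ENNReal.ofReal_lt_top hK.measure_lt_top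
  have key : ∀ g : ℝ → ℝ, eLpNorm (fun x => g x * φ x) (ENNReal.ofReal r) ν =
      eLpNorm g (ENNReal.ofReal r) (lineMeasure φ) := by
    intro g
    rw [eLpNorm_eq_lintegral_rpow_enorm_toReal h0 ENNReal.ofReal_ne_top,
      eLpNorm_eq_lintegral_rpow_enorm_toReal h0 ENNReal.ofReal_ne_top, ENNReal.toReal_ofReal hr.le,
      lintegral_lineMeasure hφ, lintegral_withDensity_eq_lintegral_mul_non_measurable _ hd
      (Eventually.of_forall fun u => ENNReal.ofReal_lt_top)]
    congr 1
    refine lintegral_congr fun x => ?_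
    have hx := hφ.pos x
    rw [Pi.mul_apply, enorm_mul, ENNReal.mul_rpow_of_nonneg _ _ hr.le, ← mul_assoc, mul_right_comm]
    congr 1
    rw [Real.enorm_of_nonneg hx.le, ENNReal.ofReal_rpow_of_pos hx, ← ENNReal.ofReal_mul
      (by positivity), ← Real.rpow_add hx, sub_add_cancel, Real.rpow_one]
  have hBφ : MemLp (fun x => B x * φ x) (ENNReal.ofReal r) ν := by
    refine ⟨?_, by rw [key]; exact hB.2⟩
    have h1 : ν ≪ lineMeasure φ := by
      refine (withDensity_absolutelyContinuous _ _).trans ?_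
      exact withDensity_absolutelyContinuous' (measurable_density hφ).aemeasurable
        (Eventually.of_forall fun x => by simpa using hφ.pos x)
    exact (hB.1.mono_ac h1).mul hφ.measurable.aestronglyMeasurable
  obtain ⟨ψ, hc, hψ, hle⟩ := hBφ.exist_eLpNorm_sub_le ENNReal.ofReal_ne_top (by
    rw [← ENNReal.ofReal_one]; exact ENNReal.ofReal_le_ofReal hqr.symm.lt.le) hε
  refine ⟨ψ, hψ, hc, ?_⟩
  have e : eLpNorm (fun x => overDensity φ ψ x - B x) (ENNReal.ofReal r) (lineMeasure φ) =
      eLpNorm ((fun x => B x * φ x) - ψ) (ENNReal.ofReal r) ν := by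
    rw [← key, eLpNorm_sub_comm]
    refine congrArg (fun f => eLpNorm f _ ν) (funext fun x => ?_)
    have := (hφ.pos x).ne'
    rw [overDensity, Pi.sub_apply]
    field_simp
  rw [lineNorm, e]
  exact ENNReal.toReal_le_of_le_ofReal hε.le hle

/-- The pair `(B, A)` is a limit of pairs `(ψ/φ, ψ'/φ)` of test functions `ψ` in `L^r(ℝ, φ)`. -/
structure IsTestLimit (φ : ℝ → ℝ) (r : ℝ) (B A : ℝ → ℝ) : Prop where
  memB : MemLine φ r B
  memA : MemLine φ r A
  approx : ∀ ε : ℝ, 0 < ε → ∃ ψ : ℝ → ℝ, ContDiff ℝ (⊤ : ℕ∞) ψ ∧ HasCompactSupport ψ ∧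
    lineNorm φ r (fun x => overDensity φ ψ x - B x) ≤ ε ∧
    lineNorm φ r (fun x => overDensity φ (deriv ψ) x - A x) ≤ ε

include hφ hqr in
lemma IsTestLimit.of_approx {B A : ℝ → ℝ} (hB : MemLine φ r B) (hA : MemLine φ r A)
    (h : ∀ ε : ℝ, 0 < ε → ∃ B' A', IsTestLimit φ r B' A' ∧
      lineNorm φ r (fun x => B' x - B x) ≤ ε ∧ lineNorm φ r (fun x => A' x - A x) ≤ ε) :
    IsTestLimit φ r B A := by
  refine ⟨hB, hA, fun ε hε => ?_⟩
  obtain ⟨B', A', hL, h1, h2⟩ := h (ε / 2) (by positivity)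
  obtain ⟨ψ, hψ, hc, h3, h4⟩ := hL.approx (ε / 2) (by positivity)
  refine ⟨ψ, hψ, hc, ?_, ?_⟩
  · have m := memLine_overDensity_of_continuous hφ (r := r) hψ.continuous hc
    have := lineNorm_add_le hqr (m.sub hL.memB) (hL.memB.sub hB)
    simp only [Pi.sub_apply, sub_add_sub_cancel] at this
    exact this.trans (le_trans (add_le_add h3 h1) (by linarith))
  · have m := memLine_overDensity_of_continuous hφ (r := r)
      (hψ.continuous_deriv (by simp)) hc.deriv
    have := lineNorm_add_le hqr (m.sub hL.memA) (hL.memA.sub hA)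
    simp only [Pi.sub_apply, sub_add_sub_cancel] at this
    exact this.trans (le_trans (add_le_add h4 h2) (by linarith))

include hφ hqr in
/-- Integration by parts against products of limits of test functions. -/
lemma integral_mul_prod_of_isTestLimit {s : ℕ} {v : Finset (Fin s)} {f g : (Fin s → ℝ) → ℝ}
    (hfg : HasProductWeakDeriv v f g) (hf : MemSpace φ q f) (hg : MemSpace φ q g)
    {B A : Fin s → ℝ → ℝ} (hBA : ∀ j ∈ v, IsTestLimit φ r (B j) (A j))
    (hB : ∀ j, MemLine φ r (B j)) :
    ∫ x, f x * ∏ j, (if j ∈ v then A j else B j) (x j) ∂prodMeasure φ s =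
      (-1 : ℝ) ^ v.card * ∫ x, g x * ∏ j, B j (x j) ∂prodMeasure φ s := by
  -- Coordinates outside `v` carry no derivative; there the density of the quotients `ψ/φ` is
  -- enough.
  have hex : ∀ (n : ℕ) (j : Fin s), ∃ ψ : ℝ → ℝ, ContDiff ℝ (⊤ : ℕ∞) ψ ∧ HasCompactSupport ψ ∧
      lineNorm φ r (fun x => overDensity φ ψ x - B j x) ≤ 1 / ((n : ℝ) + 1) ∧
      (j ∈ v → lineNorm φ r (fun x => overDensity φ (deriv ψ) x - A j x) ≤ 1 / ((n : ℝ) + 1)) := by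
    intro n j
    by_cases hj : j ∈ v
    · obtain ⟨ψ, h1, h2, h3, h4⟩ := (hBA j hj).approx (1 / ((n : ℝ) + 1)) (by positivity)
      exact ⟨ψ, h1, h2, h3, fun _ => h4⟩
    · obtain ⟨ψ, h1, h2, h3⟩ := exists_test_overDensity_le hφ hqr (hB j)
        (show 0 < 1 / ((n : ℝ) + 1) by positivity)
      exact ⟨ψ, h1, h2, h3, fun h => absurd h hj⟩
  choose ψ hψ hc hψB hψA using hex
  have hder : ∀ n j, MemLine φ r (overDensity φ (deriv (ψ n j))) := fun n j =>
    memLine_overDensity_of_continuous hφ ((hψ n j).continuous_deriv (by simp)) (hc n j).deriv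
  have hfun : ∀ n j, MemLine φ r (overDensity φ (ψ n j)) := fun n j =>
    memLine_overDensity_of_continuous hφ (hψ n j).continuous (hc n j)
  have hid : ∀ n, ∫ x, f x * ∏ j, (if j ∈ v then overDensity φ (deriv (ψ n j))
        else overDensity φ (ψ n j)) (x j) ∂prodMeasure φ s =
      (-1 : ℝ) ^ v.card * ∫ x, g x * ∏ j, overDensity φ (ψ n j) (x j) ∂prodMeasure φ s := by
    intro n
    have h1 := hfg (ψ n) (hψ n) (hc n)
    rw [integral_volume_eq hφ, integral_volume_eq hφ] at h1
    simp only [mul_assoc, ← Finset.prod_mul_distrib, ← div_eq_mul_inv] at h1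
    refine Eq.trans ?_ h1
    refine integral_congr_ae (Eventually.of_forall fun x => ?_)
    simp only
    congr 1
    refine Finset.prod_congr rfl fun j _ => ?_
    split_ifs <;> rfl
  have hz : Tendsto (fun n : ℕ => 1 / ((n : ℝ) + 1)) atTop (𝓝 0) :=
    tendsto_one_div_add_atTop_nhds_zero_nat
  have t1 := tendsto_integral_mul_prod_eval hφ hqr hf
    (g := fun j => if j ∈ v then A j else B j)
    (G := fun n j => if j ∈ v then overDensity φ (deriv (ψ n j)) else overDensity φ (ψ n j))
    (by
      intro j
      split_ifs with h
      · exact (hBA j h).memA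
      · exact hB j)
    (by
      intro n j
      split_ifs with h
      · exact hder n j
      · exact hfun n j)
    (by
      intro j
      split_ifs with h
      · exact squeeze_zero (fun n => lineNorm_nonneg _ _ _) (fun n => hψA n j h) hz
      · exact squeeze_zero (fun n => lineNorm_nonneg _ _ _) (fun n => hψB n j) hz)
  have t2 := (tendsto_integral_mul_prod_eval hφ hqr hg (g := B)
    (G := fun n j => overDensity φ (ψ n j)) hB (fun n j => hfun n j)
    (fun j => squeeze_zero (fun n => lineNorm_nonneg _ _ _) (fun n => hψB n j) hz)).const_mul
    ((-1 : ℝ) ^ v.card)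
  simp_rw [hid] at t1
  exact tendsto_nhds_unique t1 t2

end

end

end BDIS

open MeasureTheory

namespace BDIS

noncomputable section

open Filter Topology

/-! ### Antiderivatives as limits of test functions -/

section

variable {φ : ℝ → ℝ} (hφ : IsAdmissibleDensity φ) {q r : ℝ} (hqr : q.HolderConjugate r)

include hφ hqr

lemma integral_abs_le_lineNorm {g : ℝ → ℝ} (hg : MemLine φ r g) :
    Integrable g (lineMeasure φ) ∧ ∫ x, |g x| ∂lineMeasure φ ≤ lineNorm φ r g := by
  have := hφ.isProbabilityMeasure
  have h1 : (1 : ENNReal) ≤ ENNReal.ofReal r := by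
    rw [← ENNReal.ofReal_one]; exact ENNReal.ofReal_le_ofReal hqr.symm.lt.le
  refine ⟨hg.integrable h1, ?_⟩
  have h2 := eLpNorm_le_eLpNorm_of_exponent_le h1 hg.1
  have h3 : ∫ x, |g x| ∂lineMeasure φ = (eLpNorm g 1 (lineMeasure φ)).toReal := by
    rw [eLpNorm_one_eq_lintegral_enorm, ← integral_norm_eq_lintegral_enorm hg.1]; rfl
  rw [h3]
  exact ENNReal.toReal_mono hg.2.ne h2

omit hqr in
lemma integrable_iff_overDensity {f : ℝ → ℝ} :
    Integrable f ↔ Integrable (overDensity φ f) (lineMeasure φ) := by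
  have h : lineMeasure φ = volume.withDensity fun x => ((φ x).toNNReal : ENNReal) := rfl
  rw [h, integrable_withDensity_iff_integrable_smul hφ.measurable.real_toNNReal]
  refine integrable_congr (Eventually.of_forall fun x => ?_)
  have := hφ.pos x
  simp only [NNReal.smul_def, smul_eq_mul, Real.coe_toNNReal _ this.le, overDensity]
  field_simp

omit hqr in
lemma integral_overDensity (f : ℝ → ℝ) : ∫ x, overDensity φ f x ∂lineMeasure φ = ∫ x, f x := by
  rw [integral_lineMeasure hφ]
  refine integral_congr_ae (Eventually.of_forall fun x => ?_)
  have := (hφ.pos x).ne'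
  simp only [overDensity]
  field_simp

/-- The antiderivative of a function of mean zero with bounded support. -/
lemma isTestLimit_antideriv {k : ℝ → ℝ} {R : ℝ} (hR : 0 < R) (hk0 : ∀ x, R < |x| → k x = 0)
    (hk : MemLine φ r (overDensity φ k)) (hmean : ∫ x, k x = 0) :
    IsTestLimit φ r (overDensity φ fun x => ∫ y in Set.Iic x, k y) (overDensity φ k) := by
  have hkint : Integrable k :=
    (integrable_iff_overDensity hφ).mpr (integral_abs_le_lineNorm hφ hqr hk).1
  let χ : ContDiffBump (0 : ℝ) := ⟨R, R + 1, hR, by linarith⟩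
  set M := R + 1
  have hχ1 : ∀ x, |x| ≤ R → χ x = 1 := fun x hx =>
    χ.one_of_mem_closedBall (by simpa [Real.dist_eq] using hx)
  have hχ0 : ∀ x, M < |x| → χ x = 0 := fun x hx =>
    χ.zero_of_le_dist (by rw [Real.dist_eq, sub_zero]; exact hx.le)
  have hχb : ∀ x, |χ x| ≤ 1 := fun x => by rw [abs_of_nonneg χ.nonneg]; exact χ.le_one
  have hχs : ContDiff ℝ (⊤ : ℕ∞) χ := χ.contDiff
  -- A bump of mass one, used to restore mean zero after the cut-off by `χ`, so that the
  -- antiderivative has compact support.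
  let β : ℝ → ℝ := χ.normed volume
  have hβs : ContDiff ℝ (⊤ : ℕ∞) β := χ.contDiff_normed
  have hβc : HasCompactSupport β := χ.hasCompactSupport_normed
  have hβ1 : ∫ x, β x = 1 := χ.integral_normed
  have hβ0 : ∀ x, M < |x| → β x = 0 := fun x hx => by
    simp only [β, ContDiffBump.normed_def, hχ0 x hx, zero_div]
  have hβm := memLine_overDensity_of_continuous hφ (r := r) hβs.continuous hβc
  set b := lineNorm φ r (overDensity φ β)
  have hb : 0 ≤ b := lineNorm_nonneg _ _ _
  obtain ⟨c, hc, hcφ⟩ := exists_density_ge hφ M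
  -- the antiderivative vanishes outside `[-M, M]`
  have hanti : ∀ f : ℝ → ℝ, (∀ x, M < |x| → f x = 0) → Integrable f → ∫ x, f x = 0 →
      ∀ x, M < |x| → ∫ y in Set.Iic x, f y = 0 := by
    intro f hf0 hfi hfm x hx
    rcases lt_or_ge x 0 with hx0 | hx0
    · refine setIntegral_eq_zero_of_forall_eq_zero fun y hy => hf0 y ?_
      have hy' : y ≤ x := hy
      rw [abs_of_neg hx0] at hx
      rw [abs_of_neg (by linarith)]; linarith
    · have h1 := intervalIntegral.integral_Iic_add_Ioi (b := x) hfi.integrableOn hfi.integrableOn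
      have h2 : ∫ y in Set.Ioi x, f y = 0 := by
        refine setIntegral_eq_zero_of_forall_eq_zero fun y hy => hf0 y ?_
        have hy' : x < y := hy
        rw [abs_of_nonneg hx0] at hx
        rw [abs_of_nonneg (by linarith)]; linarith
      rw [h2, add_zero] at h1
      rw [h1, hfm]
  have hk0' : ∀ x, M < |x| → k x = 0 := fun x hx => hk0 x (by linarith)
  have hKm : ∀ f : ℝ → ℝ, Integrable f → Measurable fun x => ∫ y in Set.Iic x, f y := by
    intro f hf
    have : (fun x => ∫ y in Set.Iic x, f y) =
        fun x => (∫ y in Set.Iic 0, f y) + ∫ y in (0 : ℝ)..x, f y := by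
      funext x
      rw [← intervalIntegral.integral_Iic_sub_Iic hf.integrableOn hf.integrableOn]; ring
    rw [this]
    exact (continuous_const.add (intervalIntegral.continuous_primitive
      (fun a b => hf.intervalIntegrable) 0)).measurable
  have hKbd : ∀ f : ℝ → ℝ, (∀ x, M < |x| → f x = 0) → Integrable f → ∫ x, f x = 0 → ∀ D,
      (∫ x, |f x|) ≤ D → ∀ x, |overDensity φ (fun x => ∫ y in Set.Iic x, f y) x| ≤ c⁻¹ * D := by
    intro f hf0 hfi hfm D hD x
    have h1 : |∫ y in Set.Iic x, f y| ≤ D :=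
      (norm_integral_le_integral_norm _).trans
        ((setIntegral_le_integral hfi.norm (Eventually.of_forall fun _ => norm_nonneg _)).trans hD)
    have hD0 : 0 ≤ D := (abs_nonneg _).trans h1
    rw [overDensity, abs_div, abs_of_pos (hφ.pos x), div_eq_mul_inv, mul_comm]
    rcases le_or_gt |x| M with hx | hx
    · exact mul_le_mul (inv_anti₀ hc (hcφ x hx)) h1 (abs_nonneg _) (by positivity)
    · rw [hanti f hf0 hfi hfm x hx]; simp; positivity
  have hKmem : ∀ f : ℝ → ℝ, (∀ x, M < |x| → f x = 0) → Integrable f → ∫ x, f x = 0 →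
      MemLine φ r (overDensity φ fun x => ∫ y in Set.Iic x, f y) := fun f hf0 hfi hfm =>
    memLine_of_bounded hφ ((hKm f hfi).div hφ.measurable) (hKbd f hf0 hfi hfm _ le_rfl)
  refine ⟨hKmem k hk0' hkint hmean, hk, fun ε hε => ?_⟩
  -- The derivative will be approximated within `η (1 + b)` and the antiderivative within `c⁻¹ η (1
  -- + b)`; both are at most `ε`.
  set η := ε / ((1 + b) * (1 + c⁻¹)) with hη
  have hη0 : 0 < η := by positivity
  obtain ⟨g, hgs, hgc, hgle⟩ := exists_test_overDensity_le hφ hqr hk hη0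
  have hgm := memLine_overDensity_of_continuous hφ (r := r) hgs.continuous hgc
  -- the truncated approximation
  set a := ∫ x, χ x * g x
  have hχgs : ContDiff ℝ (⊤ : ℕ∞) fun x => χ x * g x := hχs.mul hgs
  have hχgc : HasCompactSupport fun x => χ x * g x := hgc.mul_left
  have hχgi : Integrable fun x => χ x * g x := hχgs.continuous.integrable_of_hasCompactSupport hχgc
  have hβi : Integrable β := hβs.continuous.integrable_of_hasCompactSupport hβc
  set k' : ℝ → ℝ := fun x => χ x * g x - a * β x with hk'
  have hk's : ContDiff ℝ (⊤ : ℕ∞) k' := hχgs.sub (contDiff_const.mul hβs)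
  have hk'0 : ∀ x, M < |x| → k' x = 0 := fun x hx => by
    simp only [hk', hχ0 x hx, hβ0 x hx]; ring
  have hk'i : Integrable k' := hχgi.sub (hβi.const_mul a)
  have hk'm : ∫ x, k' x = 0 := by
    simp only [hk']
    rw [integral_sub hχgi (hβi.const_mul a), integral_const_mul, hβ1, mul_one, sub_self]
  have hd1m : MemLine φ r (fun x => overDensity φ g x - overDensity φ k x) := hgm.sub hk
  have hd2m : MemLine φ r (fun x => overDensity φ (fun x => χ x * g x) x - overDensity φ k x) :=
    (memLine_overDensity_of_continuous hφ hχgs.continuous hχgc).sub hk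
  have hd2 : lineNorm φ r (fun x => overDensity φ (fun x => χ x * g x) x - overDensity φ k x) ≤ η := by
    refine (lineNorm_mono_abs hd1m fun x => ?_).trans hgle
    have e : χ x * g x - k x = χ x * (g x - k x) := by
      rcases le_or_gt |x| R with hx | hx
      · rw [hχ1 x hx]; ring
      · rw [hk0 x hx]; ring
    simp only [overDensity, ← sub_div]
    rw [e, mul_div_assoc, abs_mul]
    exact mul_le_of_le_one_left (abs_nonneg _) (hχb x)
  -- As `k` has mean zero, the mass `a` to be removed is the integral of the approximation error.
  have ha : |a| ≤ η := by
    have h1 : a = ∫ x, (overDensity φ (fun x => χ x * g x) x - overDensity φ k x)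
        ∂lineMeasure φ := by
      rw [integral_sub ((integrable_iff_overDensity hφ).mp hχgi)
        ((integrable_iff_overDensity hφ).mp hkint), integral_overDensity hφ,
        integral_overDensity hφ, hmean, sub_zero]
    rw [h1]
    refine abs_integral_le_integral_abs.trans ?_
    exact ((integral_abs_le_lineNorm hφ hqr hd2m).2).trans hd2
  have hd3 : lineNorm φ r (fun x => overDensity φ k' x - overDensity φ k x) ≤ η * (1 + b) := by
    have h1 := lineNorm_add_le hqr hd2m (hβm.const_mul (-a))
    rw [lineNorm_const_mul, abs_neg] at h1
    have h2 : (fun x => overDensity φ k' x - overDensity φ k x) =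
        fun x => (overDensity φ (fun x => χ x * g x) x - overDensity φ k x) +
          -a * overDensity φ β x := by
      funext x; simp only [overDensity, hk']; ring
    rw [h2]
    refine h1.trans ?_
    have := mul_le_mul_of_nonneg_right ha hb
    linarith
  have hdm : MemLine φ r (fun x => overDensity φ k' x - overDensity φ k x) :=
    (memLine_overDensity_of_continuous hφ hk's.continuous (by
      refine HasCompactSupport.intro (isCompact_closedBall (0 : ℝ) M) fun x hx => hk'0 x ?_
      simpa [Real.dist_eq] using hx)).sub hk
  set K' : ℝ → ℝ := fun x => ∫ y in Set.Iic x, k' y with hK'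
  have hK'd : ∀ x, HasDerivAt K' (k' x) x := by
    intro x
    have e : K' = fun x => (∫ y in Set.Iic 0, k' y) + ∫ y in (0 : ℝ)..x, k' y := by
      funext x
      rw [hK', ← intervalIntegral.integral_Iic_sub_Iic hk'i.integrableOn hk'i.integrableOn]; ring
    rw [e]
    exact (intervalIntegral.integral_hasDerivAt_right hk'i.intervalIntegrable
      hk's.continuous.measurable.stronglyMeasurable.stronglyMeasurableAtFilter
      hk's.continuous.continuousAt).const_add _
  have hK'deriv : deriv K' = k' := funext fun x => (hK'd x).deriv
  have h1b : (1 : ℝ) ≤ 1 + c⁻¹ := by have := inv_pos.mpr hc; linarith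
  have hηε : η * (1 + b) * (1 + c⁻¹) = ε := by rw [hη]; field_simp
  refine ⟨K', ?_, ?_, ?_, ?_⟩
  · rw [contDiff_infty_iff_deriv, hK'deriv]
    exact ⟨fun x => (hK'd x).differentiableAt, hk's⟩
  · refine HasCompactSupport.intro (isCompact_closedBall (0 : ℝ) M) fun x hx => ?_
    exact hanti k' hk'0 hk'i hk'm x (by simpa [Real.dist_eq] using hx)
  · have hs0 : ∀ x, M < |x| → k' x - k x = 0 := fun x hx => by rw [hk'0 x hx, hk0' x hx, sub_self]
    have hsi : Integrable fun x => k' x - k x := hk'i.sub hkint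
    have hsm : ∫ x, (k' x - k x) = 0 := by rw [integral_sub hk'i hkint, hk'm, hmean, sub_self]
    have hsD : ∫ x, |k' x - k x| ≤ η * (1 + b) := by
      have h1 := (integral_abs_le_lineNorm hφ hqr hdm).2
      refine le_trans (le_of_eq ?_) (h1.trans hd3)
      rw [integral_lineMeasure hφ]
      refine integral_congr_ae (Eventually.of_forall fun x => ?_)
      have hx := hφ.pos x
      simp only [overDensity, ← sub_div]
      rw [abs_div, abs_of_pos hx]
      field_simp
    have hbd := hKbd _ hs0 hsi hsm _ hsD
    have e : (fun x => overDensity φ K' x - overDensity φ (fun x => ∫ y in Set.Iic x, k y) x) =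
        overDensity φ (fun x => ∫ y in Set.Iic x, (k' y - k y)) := by
      funext x
      simp only [overDensity, hK']
      rw [integral_sub hk'i.integrableOn hkint.integrableOn, sub_div]
    rw [e]
    have := hφ.isProbabilityMeasure
    have h2 : lineNorm φ r (overDensity φ (fun x => ∫ y in Set.Iic x, (k' y - k y))) ≤
        lineNorm φ r (fun _ => c⁻¹ * (η * (1 + b))) := by
      refine lineNorm_mono_abs (memLp_const _) fun x => (hbd x).trans (le_abs_self _)
    refine h2.trans ?_
    have hr : ENNReal.ofReal r ≠ 0 := by simpa using hqr.symm.pos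
    rw [lineNorm, eLpNorm_const _ hr (IsProbabilityMeasure.ne_zero _)]
    rw [measure_univ, ENNReal.one_rpow, mul_one, toReal_enorm, Real.norm_of_nonneg (by positivity),
      ← hηε]
    have : 0 ≤ η * (1 + b) := by positivity
    nlinarith
  · rw [hK'deriv]
    refine hd3.trans ?_
    rw [← hηε]
    exact le_mul_of_one_le_right (by positivity) h1b

end

end

end BDIS

open MeasureTheory

namespace BDIS

noncomputable section

open Filter Topology

/-! ### Functions of the inverse transport as limits of test functions -/

/-- The antiderivative `∫_0^u ψ`. -/
def antideriv (ψ : ℝ → ℝ) (u : ℝ) : ℝ := ∫ t in (0 : ℝ)..u, ψ t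

/-- The function `Ψ w'/w` with `Ψ = ∫_0 ψ`. -/
def antiderivLog (p θ : ℝ) (ψ : ℝ → ℝ) (u : ℝ) : ℝ := antideriv ψ u * logWeightDeriv p θ u

/-- The function `Ψ w / φ(T)` with `Ψ = ∫_0 ψ`. -/
def antiderivRatio (φ : ℝ → ℝ) (p θ : ℝ) (ψ : ℝ → ℝ) (u : ℝ) : ℝ :=
  antideriv ψ u * weightRatio φ p θ u

lemma measurable_weightDeriv {p θ : ℝ} (hp : 1 ≤ p) (hθ : 0 < θ) (hθ2 : θ ≤ 1 / 2) :
    Measurable (weightDeriv p θ) := by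
  have : weightDeriv p θ = deriv (weight p θ) :=
    funext fun u => (hasDerivAt_weight hp hθ hθ2 u).deriv.symm
  rw [this]
  exact measurable_deriv _

/-- A bounded measurable function with countably many discontinuities. -/
structure IsPiecewise (ψ : ℝ → ℝ) (M : ℝ) (D : Set ℝ) : Prop where
  measurable : Measurable ψ
  abs_le : ∀ u, |ψ u| ≤ M
  countable : D.Countable
  continuousAt : ∀ u, u ∉ D → ContinuousAt ψ u

namespace IsPiecewise

variable {ψ : ℝ → ℝ} {M : ℝ} {D : Set ℝ} (hψ : IsPiecewise ψ M D)

include hψ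

lemma bound_nonneg : 0 ≤ M := (abs_nonneg _).trans (hψ.abs_le 0)

lemma intervalIntegrable (a b : ℝ) : IntervalIntegrable ψ volume a b := by
  refine (intervalIntegrable_const (c := M)).mono_fun hψ.measurable.aestronglyMeasurable ?_
  refine Eventually.of_forall fun u => ?_
  exact (hψ.abs_le u).trans (le_abs_self _)

lemma continuous_antideriv : Continuous (antideriv ψ) :=
  intervalIntegral.continuous_primitive hψ.intervalIntegrable 0

lemma hasDerivAt_antideriv {u : ℝ} (hu : u ∉ D) : HasDerivAt (antideriv ψ) (ψ u) u :=
  intervalIntegral.integral_hasDerivAt_right (hψ.intervalIntegrable _ _)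
    hψ.measurable.stronglyMeasurable.stronglyMeasurableAtFilter (hψ.continuousAt u hu)

lemma abs_antideriv_le {u : ℝ} (hu : u ∈ Set.Ioo (0 : ℝ) 1) : |antideriv ψ u| ≤ M := by
  have h := intervalIntegral.norm_integral_le_of_norm_le_const (a := 0) (b := u) (f := ψ) (C := M)
    fun _ _ => hψ.abs_le _
  rw [sub_zero, abs_of_pos hu.1] at h
  exact h.trans (mul_le_of_le_one_right hψ.bound_nonneg hu.2.le)

omit hψ in
lemma const (c : ℝ) : IsPiecewise (fun _ => c) |c| ∅ :=
  ⟨measurable_const, fun _ => le_rfl, Set.countable_empty, fun _ _ => continuousAt_const⟩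

lemma indicator {s : Set ℝ} (hs : MeasurableSet s) (hf : (frontier s).Countable) :
    IsPiecewise (s.indicator ψ) M (D ∪ frontier s) := by
  refine ⟨hψ.measurable.indicator hs, fun u => ?_, hψ.countable.union hf, fun u hu => ?_⟩
  · by_cases h : u ∈ s
    · rw [Set.indicator_of_mem h]; exact hψ.abs_le u
    · rw [Set.indicator_of_notMem h, abs_zero]; exact hψ.bound_nonneg
  · rw [Set.mem_union, not_or] at hu
    by_cases h : u ∈ s
    · have h1 : s ∈ 𝓝 u := by
        rw [mem_interior_iff_mem_nhds.symm]
        by_contra h2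
        exact hu.2 ⟨subset_closure h, h2⟩
      refine (hψ.continuousAt u hu.1).congr ?_
      filter_upwards [h1] with x hx
      rw [Set.indicator_of_mem hx]
    · have h1 : sᶜ ∈ 𝓝 u := by
        rw [mem_interior_iff_mem_nhds.symm]
        by_contra h2
        rw [← frontier_compl] at hu
        exact hu.2 ⟨subset_closure h, h2⟩
      refine (continuousAt_const (y := (0 : ℝ))).congr ?_
      filter_upwards [h1] with x hx
      rw [Set.indicator_of_notMem hx]

lemma sub {ψ' : ℝ → ℝ} {M' : ℝ} {D' : Set ℝ} (hψ' : IsPiecewise ψ' M' D') :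
    IsPiecewise (fun u => ψ u - ψ' u) (M + M') (D ∪ D') := by
  refine ⟨hψ.measurable.sub hψ'.measurable, fun u => ?_, hψ.countable.union hψ'.countable,
    fun u hu => ?_⟩
  · exact (abs_sub _ _).trans (add_le_add (hψ.abs_le u) (hψ'.abs_le u))
  · rw [Set.mem_union, not_or] at hu
    exact (hψ.continuousAt u hu.1).sub (hψ'.continuousAt u hu.2)

end IsPiecewise

section

variable {φ : ℝ → ℝ} (hφ : IsAdmissibleDensity φ) {q r : ℝ} (hqr : q.HolderConjugate r)
  {p θ : ℝ} (hp : 1 ≤ p) (hθ : 0 < θ) (hθ2 : θ ≤ 1 / 2)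

include hφ hp hθ hθ2

omit hφ in
lemma measurable_logWeightDeriv : Measurable (logWeightDeriv p θ) :=
  (measurable_weightDeriv hp hθ hθ2).div (continuous_weight hp hθ hθ2).measurable

/-- The quotient of the weight and the density, made measurable on the whole line. -/
lemma measurable_indicator_weightRatio :
    Measurable ((Set.Ioo (0 : ℝ) 1).indicator (weightRatio φ p θ)) := by
  have hT : MonotoneOn (transport φ p θ) (Set.Ioo (0 : ℝ) 1) := by
    intro u hu v hv huv
    rw [← (strictMono_cdf hφ).le_iff_le, cdf_transport hφ hp hθ hθ2 hu,
      cdf_transport hφ hp hθ hθ2 hv]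
    exact monotone_cumWeight hp hθ hθ2 huv
  have h1 : Measurable ((Set.Ioo (0 : ℝ) 1).domRestrict (transport φ p θ)) :=
    (Monotone.measurable fun u v huv => hT u.2 v.2 huv)
  have h2 : Measurable ((Set.Ioo (0 : ℝ) 1).domRestrict (weightRatio φ p θ)) :=
    ((continuous_weight hp hθ hθ2).measurable.comp measurable_subtype_coe).div
      (hφ.measurable.comp h1)
  refine measurable_of_restrict_of_restrict_compl (s := Set.Ioo (0 : ℝ) 1) measurableSet_Ioo ?_ ?_
  · convert h2 using 1
    funext u
    rw [Set.domRestrict_apply, Set.domRestrict_apply, Set.indicator_of_mem u.2]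
  · convert measurable_const (a := (0 : ℝ)) using 1
    funext u
    rw [Set.domRestrict_apply, Set.indicator_of_notMem u.2]

/-- Norms of functions of the inverse transport. -/
lemma lineNorm_comp_invTransport_le {r : ℝ} (hr : 0 < r) {g : ℝ → ℝ}
    (hg : Measurable ((Set.Ioo (0 : ℝ) 1).indicator g)) {K H : ℝ} (hK : 0 ≤ K) (hH : 0 ≤ H)
    {I : Set ℝ} (hI : MeasurableSet I) (hvol : volume I ≤ ENNReal.ofReal H)
    (h1 : ∀ u ∈ Set.Ioo (0 : ℝ) 1, u ∈ I → |g u| ^ r * weight p θ u ≤ K ^ r)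
    (h0 : ∀ u ∈ Set.Ioo (0 : ℝ) 1, u ∉ I → g u = 0) :
    MemLine φ r (fun x => g (invTransport φ p θ x)) ∧
      lineNorm φ r (fun x => g (invTransport φ p θ x)) ≤ K * H ^ (1 / r) := by
  set g' := (Set.Ioo (0 : ℝ) 1).indicator g with hg'
  have e : (fun x => g (invTransport φ p θ x)) = fun x => g' (invTransport φ p θ x) := by
    funext x
    rw [hg', Set.indicator_of_mem (invTransport_mem hφ hp hθ hθ2 x)]
  have hr0 : ENNReal.ofReal r ≠ 0 := by simpa using hr
  have hb : eLpNorm (fun x => g (invTransport φ p θ x)) (ENNReal.ofReal r) (lineMeasure φ) ≤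
      ENNReal.ofReal (K * H ^ (1 / r)) := by
    rw [e, eLpNorm_eq_lintegral_rpow_enorm_toReal hr0 ENNReal.ofReal_ne_top,
      ENNReal.toReal_ofReal hr.le,
      lintegral_comp_invTransport hφ hp hθ hθ2 (g := fun u => ‖g' u‖ₑ ^ r)
        (hg.enorm.pow_const r)]
    have h2 : ∀ u, ENNReal.ofReal (weight p θ u) * ‖g' u‖ₑ ^ r ≤
        I.indicator (fun _ => ENNReal.ofReal (K ^ r)) u := by
      intro u
      by_cases hu : u ∈ Set.Ioo (0 : ℝ) 1
      · rw [hg', Set.indicator_of_mem hu]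
        by_cases huI : u ∈ I
        · rw [Set.indicator_of_mem huI, Real.enorm_eq_ofReal_abs,
            ENNReal.ofReal_rpow_of_nonneg (abs_nonneg _) hr.le,
            ← ENNReal.ofReal_mul (weight_nonneg hp hθ hθ2 u), mul_comm]
          exact ENNReal.ofReal_le_ofReal (h1 u hu huI)
        · rw [h0 u hu huI, enorm_zero, ENNReal.zero_rpow_of_pos hr, mul_zero]
          exact zero_le
      · rw [weight_eq_zero hθ hθ2 hu]; simp
    calc (∫⁻ u, ENNReal.ofReal (weight p θ u) * ‖g' u‖ₑ ^ r) ^ (1 / r)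
        ≤ (∫⁻ u, I.indicator (fun _ => ENNReal.ofReal (K ^ r)) u) ^ (1 / r) :=
          ENNReal.rpow_le_rpow (lintegral_mono h2) (by positivity)
      _ = (ENNReal.ofReal (K ^ r) * volume I) ^ (1 / r) := by
          rw [lintegral_indicator hI, setLIntegral_const]
      _ ≤ (ENNReal.ofReal (K ^ r) * ENNReal.ofReal H) ^ (1 / r) := by gcongr
      _ = ENNReal.ofReal (K * H ^ (1 / r)) := by
          rw [← ENNReal.ofReal_mul (by positivity), ENNReal.ofReal_rpow_of_nonneg (by positivity)
            (by positivity), Real.mul_rpow (by positivity) hH, ← Real.rpow_mul hK,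
            mul_one_div_cancel hr.ne', Real.rpow_one]
  refine ⟨⟨?_, hb.trans_lt ENNReal.ofReal_lt_top⟩, ENNReal.toReal_le_of_le_ofReal (by positivity) hb⟩
  rw [e]
  exact (hg.comp (measurable_invTransport hφ hp hθ hθ2)).aestronglyMeasurable

lemma memLine_comp_invTransport {ψ : ℝ → ℝ} {M : ℝ} {D : Set ℝ} (hψ : IsPiecewise ψ M D) :
    MemLine φ r (fun x => ψ (invTransport φ p θ x)) :=
  memLine_of_bounded hφ (hψ.measurable.comp (measurable_invTransport hφ hp hθ hθ2))
    fun x => hψ.abs_le _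

include hqr

/-- Here the constant may depend on `θ`: the bound only serves to pass to limits of truncations,
where `K` tends to zero. -/
lemma exists_lineNorm_antideriv_le : ∃ C, 0 < C ∧ ∀ ψ M D, IsPiecewise ψ M D → ∀ K, 0 ≤ K →
    (∀ u ∈ Set.Ioo (0 : ℝ) 1, |antideriv ψ u| ≤ K) →
    (MemLine φ r (fun x => antiderivRatio φ p θ ψ (invTransport φ p θ x)) ∧
      lineNorm φ r (fun x => antiderivRatio φ p θ ψ (invTransport φ p θ x)) ≤ K * C) ∧
    (MemLine φ r (fun x => antiderivLog p θ ψ (invTransport φ p θ x)) ∧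
      lineNorm φ r (fun x => antiderivLog p θ ψ (invTransport φ p θ x)) ≤ K * C) := by
  have hr : 1 < r := hqr.symm.lt
  have hr0 : 0 < r := by linarith
  obtain ⟨C₁, hC₁, h₁⟩ := exists_logWeightDeriv_le hp hr le_rfl
  have hδ : 1 / (2 * r) < 1 / r := by
    rw [div_lt_div_iff₀ (by positivity) hr0]; linarith
  have hδ0 : 0 < 1 / (2 * r) := by positivity
  obtain ⟨C₂, hC₂, h₂⟩ := exists_weightRatio_le hφ hp hr hδ0 hδ
  set K₁ := C₁ * θ ^ (-(1 + 0 : ℝ))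
  set K₂ := C₂ * θ ^ (-(1 + 1 / (2 * r)))
  have hK₁ : 0 < K₁ := by positivity
  have hK₂ : 0 < K₂ := by positivity
  have hbd : ∀ u, ∀ a : ℝ, 0 < a → bdist θ u ^ (-a) ≤ θ ^ (-a) := fun u a ha =>
    Real.rpow_le_rpow_of_nonpos hθ (le_max_left _ _) (by linarith)
  have hgen : ∀ (ρ : ℝ → ℝ) (K' : ℝ), 0 < K' → K' ≤ K₁ + K₂ →
      Measurable ((Set.Ioo (0 : ℝ) 1).indicator ρ) →
      (∀ u ∈ Set.Ioo (0 : ℝ) 1, |ρ u| ^ r * weight p θ u ≤ K' ^ r) → ∀ ψ M D, IsPiecewise ψ M D →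
      ∀ K, 0 ≤ K → (∀ u ∈ Set.Ioo (0 : ℝ) 1, |antideriv ψ u| ≤ K) →
      MemLine φ r (fun x => antideriv ψ (invTransport φ p θ x) * ρ (invTransport φ p θ x)) ∧
      lineNorm φ r (fun x => antideriv ψ (invTransport φ p θ x) * ρ (invTransport φ p θ x)) ≤
        K * (K₁ + K₂) := by
    intro ρ K' hK' hle hρ hρb ψ M D hψ K hK hΨ
    have := lineNorm_comp_invTransport_le hφ hp hθ hθ2 hr0 (g := fun u => antideriv ψ u * ρ u)
      (K := K * K') (H := 1) (I := Set.Ioo 0 1) (by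
        have h3 : (Set.Ioo (0 : ℝ) 1).indicator (fun u => antideriv ψ u * ρ u) =
            fun u => antideriv ψ u * (Set.Ioo (0 : ℝ) 1).indicator ρ u := by
          funext u; rw [Set.indicator_mul_right]
        rw [h3]
        exact hψ.continuous_antideriv.measurable.mul hρ) (by positivity) zero_le_one
      measurableSet_Ioo (by simp) (fun u hu _ => by
        rw [abs_mul, Real.mul_rpow (abs_nonneg _) (abs_nonneg _), mul_assoc,
          Real.mul_rpow hK hK'.le]
        exact mul_le_mul (Real.rpow_le_rpow (abs_nonneg _) (hΨ u hu) hr0.le) (hρb u hu)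
          (mul_nonneg (by positivity) (weight_nonneg hp hθ hθ2 u)) (by positivity))
      (fun _ hu hu' => absurd hu hu')
    refine ⟨this.1, this.2.trans ?_⟩
    rw [Real.one_rpow, mul_one]
    exact mul_le_mul_of_nonneg_left hle hK
  refine ⟨K₁ + K₂, by positivity, fun ψ M D hψ K hK hΨ => ⟨?_, ?_⟩⟩
  · refine hgen (weightRatio φ p θ) K₂ hK₂ (by linarith)
      (measurable_indicator_weightRatio hφ hp hθ hθ2) (fun u hu => (h₂ θ hθ hθ2 u hu).trans ?_)
      ψ M D hψ K hK hΨ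
    have := hbd u _ (show 0 < 1 + 1 / (2 * r) by positivity)
    have := bdist_pos hθ u
    refine Real.rpow_le_rpow (by positivity) (mul_le_mul_of_nonneg_left ‹_› (by positivity)) hr0.le
  · refine hgen (logWeightDeriv p θ) K₁ hK₁ (by linarith)
      ((measurable_logWeightDeriv hp hθ hθ2).indicator measurableSet_Ioo)
      (fun u hu => (h₁ θ hθ hθ2 u hu).trans ?_) ψ M D hψ K hK hΨ
    have := hbd u _ (show (0 : ℝ) < 1 + 0 by norm_num)
    have := bdist_pos hθ u
    refine Real.rpow_le_rpow (by positivity) (mul_le_mul_of_nonneg_left ‹_› (by positivity)) hr0.le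

omit hφ hqr in
/-- The product rule for `Ψ w`, in integrated form. -/
lemma integral_indicator_mul_weight {ψ : ℝ → ℝ} {M : ℝ} {D : Set ℝ} (hψ : IsPiecewise ψ M D)
    {v : ℝ} (hv : v ∈ Set.Ioc (0 : ℝ) 1) :
    ∫ u, (Set.Iic v).indicator (fun u => ψ u + antiderivLog p θ ψ u) u * weight p θ u =
      antideriv ψ v * weight p θ v := by
  obtain ⟨C, hC, hwd⟩ := exists_abs_weightDeriv_le (p := p) hp le_rfl one_pos
  -- The endpoint `u = 1` may belong to the range of integration, but there the quotient `w'/w` is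
  -- useless because `w` vanishes.
  have hw1 : weightDeriv p θ 1 = 0 := by
    rw [weightDeriv, rampDeriv_of_one_le (by rw [le_div_iff₀ hθ]; linarith),
      rampDeriv_of_nonpos (by simp)]
    ring
  have h1 : ∀ u, (Set.Iic v).indicator (fun u => ψ u + antiderivLog p θ ψ u) u * weight p θ u =
      (Set.Ioc 0 v).indicator (fun u => ψ u * weight p θ u + antideriv ψ u * weightDeriv p θ u) u := by
    intro u
    by_cases hu : u ∈ Set.Ioo (0 : ℝ) 1
    · have hw := (weight_pos hp hθ hθ2 hu).ne'
      by_cases huv : u ≤ v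
      · rw [Set.indicator_of_mem (show u ∈ Set.Iic v from huv),
          Set.indicator_of_mem (show u ∈ Set.Ioc 0 v from ⟨hu.1, huv⟩), antiderivLog,
          logWeightDeriv]
        field_simp
      · rw [Set.indicator_of_notMem (show u ∉ Set.Iic v from huv),
          Set.indicator_of_notMem (fun h : u ∈ Set.Ioc 0 v => huv h.2), zero_mul]
    · rw [weight_eq_zero hθ hθ2 hu, mul_zero]
      by_cases h : u ∈ Set.Ioc 0 v
      · have hu1 : u = 1 := by
          have h2 : ¬ u < 1 := fun h3 => hu ⟨h.1, h3⟩
          linarith [h.2, hv.2, not_lt.mp h2]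
        rw [Set.indicator_of_mem h, weight_eq_zero hθ hθ2 hu, hu1, hw1]; ring
      · rw [Set.indicator_of_notMem h]
  simp_rw [h1]
  rw [integral_indicator measurableSet_Ioc, ← intervalIntegral.integral_of_le hv.1.le]
  have hmeas : Measurable fun u => ψ u * weight p θ u + antideriv ψ u * weightDeriv p θ u :=
    (hψ.measurable.mul (continuous_weight hp hθ hθ2).measurable).add
      (hψ.continuous_antideriv.measurable.mul (measurable_weightDeriv hp hθ hθ2))
  have hint : IntervalIntegrable (fun u => ψ u * weight p θ u + antideriv ψ u * weightDeriv p θ u)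
      volume 0 v := by
    refine IntervalIntegrable.add ?_ ?_
    · exact (hψ.intervalIntegrable 0 v).mul_continuousOn (continuous_weight hp hθ hθ2).continuousOn
    · refine IntervalIntegrable.continuousOn_mul ?_ hψ.continuous_antideriv.continuousOn
      refine (intervalIntegrable_const (c := C * θ⁻¹)).mono_fun
        (measurable_weightDeriv hp hθ hθ2).aestronglyMeasurable (Eventually.of_forall fun u => ?_)
      have := hwd θ hθ hθ2 u
      rw [Real.rpow_zero, mul_one] at this
      exact this.trans (le_abs_self _)
  rw [integral_eq_of_hasDerivAt_off_countable (fun u => antideriv ψ u * weight p θ u) _ hψ.countable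
    (hψ.continuous_antideriv.mul (continuous_weight hp hθ hθ2)).continuousOn
    (fun u hu => (hψ.hasDerivAt_antideriv hu.2).mul (hasDerivAt_weight hp hθ hθ2 u)) hint]
  simp [antideriv]

/-- By the product rule, `k = φ · (ψ + Ψ w'/w)(S)` has the antiderivative `(Ψ w)(S)`. Because `Ψ`
and `ψ` vanish outside `[e, 1-e]`, `k` has bounded support and mean zero, so `isTestLimit_antideriv`
applies. -/
lemma isTestLimit_of_support {ψ : ℝ → ℝ} {M : ℝ} {D : Set ℝ} (hψ : IsPiecewise ψ M D) {e : ℝ}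
    (he : 0 < e) (he2 : e < 1 / 2) (h0 : ∀ u, u ∉ Set.Icc e (1 - e) → ψ u = 0)
    (hm : antideriv ψ 1 = 0) :
    IsTestLimit φ r (fun x => antiderivRatio φ p θ ψ (invTransport φ p θ x))
      (fun x => ψ (invTransport φ p θ x) + antiderivLog p θ ψ (invTransport φ p θ x)) := by
  obtain ⟨C, hC, hCb⟩ := exists_lineNorm_antideriv_le hφ hqr hp hθ hθ2
  have hA : MemLine φ r (fun x => ψ (invTransport φ p θ x) +
      antiderivLog p θ ψ (invTransport φ p θ x)) :=
    (memLine_comp_invTransport hφ hp hθ hθ2 hψ).add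
      (hCb ψ M D hψ M hψ.bound_nonneg fun u hu => hψ.abs_antideriv_le hu).2.1
  set S := invTransport φ p θ with hS
  set T := transport φ p θ with hT
  set a : ℝ → ℝ := fun u => ψ u + antiderivLog p θ ψ u with ha
  have hSm := invTransport_mem hφ hp hθ hθ2
  have he3 : 1 - e ∈ Set.Ioo (0 : ℝ) 1 := ⟨by linarith, by linarith⟩
  have he4 : e ∈ Set.Ioo (0 : ℝ) 1 := ⟨he, by linarith⟩
  have hmeas : Measurable a :=
    hψ.measurable.add (hψ.continuous_antideriv.measurable.mul
      (measurable_logWeightDeriv hp hθ hθ2))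
  have hzero : ∀ u ∈ Set.Ioo (0 : ℝ) 1, u ∉ Set.Icc e (1 - e) → a u = 0 := by
    intro u hu hu'
    have h1 : antideriv ψ u = 0 := by
      rw [Set.mem_Icc, not_and_or, not_le, not_le] at hu'
      rcases hu' with h | h
      · rw [antideriv, intervalIntegral.integral_congr (g := fun _ => 0),
          intervalIntegral.integral_zero]
        intro t ht
        rw [Set.uIcc_of_le hu.1.le] at ht
        exact h0 t fun h' => absurd h'.1 (not_le.mpr (ht.2.trans_lt h))
      · have h2 := intervalIntegral.integral_add_adjacent_intervals
          (hψ.intervalIntegrable 0 u) (hψ.intervalIntegrable u 1)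
        have h3 : ∫ t in u..1, ψ t = 0 := by
          rw [intervalIntegral.integral_congr (g := fun _ => 0), intervalIntegral.integral_zero]
          intro t ht
          rw [Set.uIcc_of_le hu.2.le] at ht
          exact h0 t fun h' => absurd h'.2 (not_le.mpr (h.trans_le ht.1))
        rw [h3, add_zero] at h2
        rw [antideriv, h2]; exact hm
    simp only [ha, antiderivLog, h0 u hu', h1]; ring
  set k : ℝ → ℝ := fun x => φ x * a (S x) with hk
  have hkA : overDensity φ k = fun x => a (S x) := by
    funext x
    have := (hφ.pos x).ne'
    simp only [overDensity, hk]
    field_simp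
  have hkint : ∀ g : ℝ → ℝ, Measurable g →
      ∫ x, φ x * g (S x) = ∫ u, g u * weight p θ u := by
    intro g hg
    rw [← integral_comp_invTransport hφ hp hθ hθ2 hg, integral_lineMeasure hφ]
    exact integral_congr_ae (Eventually.of_forall fun x => mul_comm _ _)
  have hmean : ∫ x, k x = 0 := by
    have h1 := integral_indicator_mul_weight hp hθ hθ2 hψ (v := 1) ⟨one_pos, le_rfl⟩
    rw [hm, zero_mul, ← hkint _ (hmeas.indicator measurableSet_Iic)] at h1
    rw [← h1]
    refine integral_congr_ae (Eventually.of_forall fun x => ?_)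
    simp only [hk]
    rw [Set.indicator_of_mem (show S x ∈ Set.Iic (1 : ℝ) from (hSm x).2.le)]
  have hK : (overDensity φ fun x => ∫ y in Set.Iic x, k y) = fun x => antiderivRatio φ p θ ψ (S x) := by
    funext x
    have h1 := integral_indicator_mul_weight hp hθ hθ2 hψ (v := S x) ⟨(hSm x).1, (hSm x).2.le⟩
    rw [← hkint _ (hmeas.indicator measurableSet_Iic)] at h1
    have h2 : ∫ y in Set.Iic x, k y = antideriv ψ (S x) * weight p θ (S x) := by
      rw [← h1, ← integral_indicator measurableSet_Iic]
      refine integral_congr_ae (Eventually.of_forall fun y => ?_)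
      simp only [hk]
      have hiff : S y ≤ S x ↔ y ≤ x := (strictMono_invTransport hφ hp hθ hθ2).le_iff_le
      by_cases hy : y ≤ x
      · rw [Set.indicator_of_mem (show y ∈ Set.Iic x from hy),
          Set.indicator_of_mem (show S y ∈ Set.Iic (S x) from hiff.mpr hy)]
      · rw [Set.indicator_of_notMem (show y ∉ Set.Iic x from hy),
          Set.indicator_of_notMem (show S y ∉ Set.Iic (S x) from fun h => hy (hiff.mp h)), mul_zero]
    rw [overDensity, h2, antiderivRatio, weightRatio, hS, transport_invTransport hφ hp hθ hθ2,
      mul_div_assoc]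
  have := isTestLimit_antideriv hφ hqr (k := k) (R := |T e| + |T (1 - e)| + 1) (by positivity) (by
    intro x hx
    simp only [hk]
    rw [hzero (S x) (hSm x), mul_zero]
    intro hmem
    have h1 : x ≤ T (1 - e) := (invTransport_le_iff hφ hp hθ hθ2 he3).mp hmem.2
    have h2 : T e ≤ x := by
      rw [← (strictMono_invTransport hφ hp hθ hθ2).le_iff_le, hT,
        invTransport_transport hφ hp hθ hθ2 he4]
      exact hmem.1
    have h3 : |x| ≤ |T e| + |T (1 - e)| := by
      rw [abs_le]
      have := neg_abs_le (T e)
      have := abs_nonneg (T e)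
      have := le_abs_self (T (1 - e))
      have := abs_nonneg (T (1 - e))
      constructor <;> linarith
    linarith) (by rw [hkA]; exact hA) hmean
  rwa [hK, hkA] at this

/-- For `ψ` of mean zero with antiderivative `Ψ`, the functions `Ψ w / φ(T)` and `ψ + Ψ w'/w` of
the inverse transport form a limit of test functions. -/
lemma isTestLimit_antideriv_comp {ψ : ℝ → ℝ} {M : ℝ} {D : Set ℝ} (hψ : IsPiecewise ψ M D)
    (hm : antideriv ψ 1 = 0) :
    IsTestLimit φ r (fun x => antiderivRatio φ p θ ψ (invTransport φ p θ x))
      (fun x => ψ (invTransport φ p θ x) + antiderivLog p θ ψ (invTransport φ p θ x)) := by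
  have hr : 1 < r := hqr.symm.lt
  have hr0 : 0 < r := by linarith
  obtain ⟨C, hC, hCb⟩ := exists_lineNorm_antideriv_le hφ hqr hp hθ hθ2
  have hM := hψ.bound_nonneg
  have hψb := hCb ψ M D hψ M hM fun u hu => hψ.abs_antideriv_le hu
  have hψS := memLine_comp_invTransport hφ hp hθ hθ2 (r := r) hψ
  refine IsTestLimit.of_approx hφ hqr hψb.1.1 (hψS.add hψb.2.1) fun ε hε => ?_
  -- The three errors: the removed part of `ψ`, the correction restoring mean zero, and the
  -- antiderivative of both multiplied by `w'/w` or by `w/φ(T)`.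
  have hlim : Tendsto (fun e : ℝ => 2 * M * (2 * e) ^ (1 / r) + 12 * M * e + 4 * M * C * e)
      (𝓝[>] 0) (𝓝 0) := by
    have hc : ContinuousAt (fun e : ℝ => 2 * M * (2 * e) ^ (1 / r) + 12 * M * e + 4 * M * C * e) 0 := by
      refine ContinuousAt.add (ContinuousAt.add (ContinuousAt.mul continuousAt_const
        (ContinuousAt.rpow_const (by fun_prop) (Or.inr (by positivity)))) (by fun_prop)) (by fun_prop)
    have h1 := hc.tendsto
    simp only [mul_zero, add_zero] at h1
    rw [Real.zero_rpow (by positivity), mul_zero] at h1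
    exact h1.mono_left nhdsWithin_le_nhds
  obtain ⟨e, hee, he3, he⟩ := ((hlim.eventually (ge_mem_nhds hε)).and
    (((gt_mem_nhds (show (0 : ℝ) < 1 / 3 by norm_num)).filter_mono nhdsWithin_le_nhds).and
      self_mem_nhdsWithin)).exists
  have he0 : (0 : ℝ) < e := he
  -- the truncation
  have hcut := hψ.indicator (s := Set.Icc e (1 - e)) measurableSet_Icc
    (by rw [frontier_Icc (by linarith)]; exact Set.countable_insert.mpr (Set.countable_singleton _))
  set ψ₁ := (Set.Icc e (1 - e)).indicator ψ with hψ₁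
  set c := antideriv ψ₁ 1 with hc
  have hbump := (IsPiecewise.const (3 * c)).indicator (s := Set.Icc (1 / 3) (2 / 3)) measurableSet_Icc
    (by rw [frontier_Icc (by norm_num)]; exact Set.countable_insert.mpr (Set.countable_singleton _))
  -- Height `3c` on an interval of length `1/3`: the total mass is `c`, the mean of the truncated
  -- function.
  set β := (Set.Icc (1 / 3 : ℝ) (2 / 3)).indicator (fun _ => 3 * c) with hβ
  have hψ' := hcut.sub hbump
  have hsub := hψ'.sub hψ
  have hout := hψ.sub hcut
  have hanti : ∀ {f g : ℝ → ℝ} {Mf Mg : ℝ} {Df Dg : Set ℝ}, IsPiecewise f Mf Df →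
      IsPiecewise g Mg Dg → ∀ u, antideriv (fun u => f u - g u) u = antideriv f u - antideriv g u :=
    fun hf hg u => intervalIntegral.integral_sub (hf.intervalIntegrable 0 u) (hg.intervalIntegrable 0 u)
  have hin : Set.Icc e (1 - e) ⊆ Set.Ioc 0 1 := fun t ht =>
    ⟨lt_of_lt_of_le he0 ht.1, by linarith [ht.2]⟩
  have hin2 : Set.Icc e (1 - e) ⊆ Set.Ioo 0 1 := fun t ht =>
    ⟨lt_of_lt_of_le he0 ht.1, by linarith [ht.2]⟩
  have hin3 : Set.Icc (1 / 3 : ℝ) (2 / 3) ⊆ Set.Ioc 0 1 := fun t ht =>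
    ⟨by linarith [ht.1], by linarith [ht.2]⟩
  -- the part cut off is small
  have hcutb : ∀ u ∈ Set.Icc (0 : ℝ) 1, |antideriv (fun u => ψ u - ψ₁ u) u| ≤ 2 * M * e := by
    intro u hu
    have h1 : ∀ t, |ψ t - ψ₁ t| ≤ (Set.Icc e (1 - e))ᶜ.indicator (fun _ => M) t := by
      intro t
      by_cases ht : t ∈ Set.Icc e (1 - e)
      · rw [hψ₁, Set.indicator_of_mem ht, sub_self, abs_zero,
          Set.indicator_of_notMem (fun h : t ∈ (Set.Icc e (1 - e))ᶜ => h ht)]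
      · rw [hψ₁, Set.indicator_of_notMem ht, sub_zero, Set.indicator_of_mem (show t ∈ _ᶜ from ht)]
        exact hψ.abs_le t
    have hi : IntegrableOn ((Set.Icc e (1 - e))ᶜ.indicator (fun _ => M)) (Set.Ioc 0 1) :=
      IntegrableOn.indicator (integrableOn_const (by simp)) measurableSet_Icc.compl
    calc |antideriv (fun u => ψ u - ψ₁ u) u|
        ≤ ∫ t in (0 : ℝ)..u, |ψ t - ψ₁ t| := by
          simpa [antideriv] using intervalIntegral.abs_integral_le_integral_abs (f := fun t => ψ t - ψ₁ t)
            (μ := volume) hu.1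
      _ ≤ ∫ t in (0 : ℝ)..1, |ψ t - ψ₁ t| := by
          refine intervalIntegral.integral_mono_interval le_rfl hu.1 hu.2
            (Eventually.of_forall fun t => abs_nonneg _) (hout.intervalIntegrable 0 1).abs
      _ ≤ ∫ t in Set.Ioc (0 : ℝ) 1, (Set.Icc e (1 - e))ᶜ.indicator (fun _ => M) t := by
          rw [intervalIntegral.integral_of_le zero_le_one]
          exact integral_mono (hout.intervalIntegrable 0 1).1.abs hi h1
      _ = 2 * M * e := by
          rw [setIntegral_indicator measurableSet_Icc.compl, setIntegral_const, smul_eq_mul,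
            ← Set.sdiff_eq, measureReal_sdiff hin measurableSet_Icc (h₁ := by simp)]
          rw [Real.volume_real_Ioc_of_le zero_le_one, Real.volume_real_Icc_of_le (by linarith)]
          ring
  have hcb : |c| ≤ 2 * M * e := by
    have h1 := hcutb 1 ⟨zero_le_one, le_rfl⟩
    rw [hanti hψ hcut, hm, zero_sub, abs_neg] at h1
    exact h1
  have hβi : antideriv β 1 = c := by
    rw [antideriv, intervalIntegral.integral_of_le zero_le_one, hβ,
      setIntegral_indicator measurableSet_Icc, setIntegral_const, smul_eq_mul,
      Set.inter_eq_right.mpr hin3,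
      Real.volume_real_Icc_of_le (by norm_num)]
    ring
  have hm' : antideriv (fun u => ψ₁ u - β u) 1 = 0 := by
    rw [hanti hcut hbump, hβi, sub_self]
  have hβb : ∀ u ∈ Set.Ioo (0 : ℝ) 1, |antideriv β u| ≤ 2 * M * e := by
    intro u hu
    have h1 : |antideriv β u| ≤ ∫ t in (0 : ℝ)..1, |β t| := by
      refine le_trans (b := ∫ t in (0 : ℝ)..u, |β t|) ?_ ?_
      · simpa [antideriv] using intervalIntegral.abs_integral_le_integral_abs (f := β) (μ := volume) hu.1.le
      · exact intervalIntegral.integral_mono_interval le_rfl hu.1.le hu.2.le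
          (Eventually.of_forall fun t => abs_nonneg _) (hbump.intervalIntegrable 0 1).abs
    refine h1.trans (le_trans (le_of_eq ?_) hcb)
    have h2 : ∀ t, |β t| = (Set.Icc (1 / 3 : ℝ) (2 / 3)).indicator (fun _ => 3 * |c|) t := by
      intro t
      by_cases ht : t ∈ Set.Icc (1 / 3 : ℝ) (2 / 3)
      · rw [hβ, Set.indicator_of_mem ht, Set.indicator_of_mem ht, abs_mul]; norm_num
      · rw [hβ, Set.indicator_of_notMem ht, Set.indicator_of_notMem ht, abs_zero]
    simp_rw [h2]
    rw [intervalIntegral.integral_of_le zero_le_one,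
      setIntegral_indicator measurableSet_Icc, setIntegral_const, smul_eq_mul,
      Set.inter_eq_right.mpr hin3,
      Real.volume_real_Icc_of_le (by norm_num)]
    ring
  have hsubb : ∀ u ∈ Set.Ioo (0 : ℝ) 1,
      |antideriv (fun u => (ψ₁ u - β u) - ψ u) u| ≤ 4 * M * e := by
    intro u hu
    have h1 := hcutb u (Set.Ioo_subset_Icc_self hu)
    have h2 := hβb u hu
    rw [hanti hψ hcut] at h1
    rw [hanti hψ' hψ, hanti hcut hbump]
    rw [abs_le] at h1 h2 ⊢
    constructor <;> linarith [h1.1, h1.2, h2.1, h2.2]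
  have hd := hCb _ _ _ hsub (4 * M * e) (by positivity) hsubb
  have hpos1 : 0 ≤ 2 * M * (2 * e) ^ (1 / r) := by positivity
  have hpos2 : 0 ≤ 12 * M * e := by positivity
  refine ⟨_, _, isTestLimit_of_support hφ hqr hp hθ hθ2 hψ' he0 (by linarith) (fun u hu => ?_) hm',
    ?_, ?_⟩
  · have h1 : u ∉ Set.Icc (1 / 3 : ℝ) (2 / 3) := fun h => hu ⟨by linarith [h.1], by linarith [h.2]⟩
    rw [hψ₁, hβ, Set.indicator_of_notMem hu, Set.indicator_of_notMem h1, sub_zero]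
  · have e1 : (fun x => antiderivRatio φ p θ (fun u => ψ₁ u - β u) (invTransport φ p θ x) -
        antiderivRatio φ p θ ψ (invTransport φ p θ x)) =
        fun x => antiderivRatio φ p θ (fun u => (ψ₁ u - β u) - ψ u) (invTransport φ p θ x) := by
      funext x
      rw [antiderivRatio, antiderivRatio, antiderivRatio, hanti hψ' hψ, sub_mul]
    rw [e1]
    refine hd.1.2.trans ?_
    linarith
  · have hS1 := memLine_comp_invTransport hφ hp hθ hθ2 (r := r) hout
    have hS2 := memLine_comp_invTransport hφ hp hθ hθ2 (r := r) hbump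
    have e1 : (fun x => (ψ₁ (invTransport φ p θ x) - β (invTransport φ p θ x)) +
        antiderivLog p θ (fun u => ψ₁ u - β u) (invTransport φ p θ x) -
        (ψ (invTransport φ p θ x) + antiderivLog p θ ψ (invTransport φ p θ x))) =
        fun x => (-1 * (ψ (invTransport φ p θ x) - ψ₁ (invTransport φ p θ x)) +
          -1 * β (invTransport φ p θ x)) +
          antiderivLog p θ (fun u => (ψ₁ u - β u) - ψ u) (invTransport φ p θ x) := by
      funext x
      rw [antiderivLog, antiderivLog, antiderivLog, hanti hψ' hψ]; ring
    rw [e1]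
    have hw2 := weight_le_two hp hθ hθ2
    have hb1 : lineNorm φ r (fun x => ψ (invTransport φ p θ x) - ψ₁ (invTransport φ p θ x)) ≤
        2 * M * (2 * e) ^ (1 / r) := by
      refine (lineNorm_comp_invTransport_le hφ hp hθ hθ2 hr0 (g := fun u => ψ u - ψ₁ u)
        (I := Set.Ioo 0 1 \ Set.Icc e (1 - e)) (hout.measurable.indicator measurableSet_Ioo)
        (by positivity) (by positivity) (measurableSet_Ioo.diff measurableSet_Icc) ?_ ?_ ?_).2
      · rw [measure_sdiff hin2 measurableSet_Icc.nullMeasurableSet (by simp), Real.volume_Ioo, Real.volume_Icc,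
          ← ENNReal.ofReal_sub _ (by linarith)]
        exact ENNReal.ofReal_le_ofReal (by linarith)
      · intro u hu hu'
        simp only [hψ₁]
        rw [Set.indicator_of_notMem hu'.2, sub_zero, Real.mul_rpow two_pos.le hM, mul_comm]
        have h2 : (2 : ℝ) ≤ 2 ^ r := by
          simpa using Real.rpow_le_rpow_of_exponent_le one_le_two hr.le
        exact mul_le_mul ((hw2 u).trans h2) (Real.rpow_le_rpow (abs_nonneg _) (hψ.abs_le u) hr0.le)
          (by positivity) (by positivity)
      · intro u hu hu'
        have : u ∈ Set.Icc e (1 - e) := by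
          by_contra h
          exact hu' ⟨hu, h⟩
        simp only [hψ₁]
        rw [Set.indicator_of_mem this, sub_self]
    have hb2 : lineNorm φ r (fun x => β (invTransport φ p θ x)) ≤ 12 * M * e := by
      have h2 := (lineNorm_comp_invTransport_le hφ hp hθ hθ2 hr0 (g := β) (K := 2 * (3 * |c|)) (H := 1)
        (I := Set.Ioo 0 1) (hbump.measurable.indicator measurableSet_Ioo)
        (by positivity) zero_le_one measurableSet_Ioo (by simp) ?_
        (fun _ hu hu' => absurd hu hu')).2
      · rw [Real.one_rpow, mul_one] at h2
        linarith
      · intro u hu _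
        rw [Real.mul_rpow two_pos.le (by positivity), mul_comm]
        have h2 : (2 : ℝ) ≤ 2 ^ r := by
          simpa using Real.rpow_le_rpow_of_exponent_le one_le_two hr.le
        refine mul_le_mul ((hw2 u).trans h2) (Real.rpow_le_rpow (abs_nonneg _) ?_ hr0.le)
          (by positivity) (by positivity)
        refine (hbump.abs_le u).trans (le_of_eq ?_)
        rw [abs_mul]; norm_num
    have h3 := lineNorm_add_le hqr (hS1.const_mul (-1)) (hS2.const_mul (-1))
    have hS12 : MemLine φ r (fun x => -1 * (ψ (invTransport φ p θ x) - ψ₁ (invTransport φ p θ x)) +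
      -1 * β (invTransport φ p θ x)) := (hS1.const_mul (-1)).add (hS2.const_mul (-1))
    have h4 := lineNorm_add_le hqr hS12 hd.2.1
    rw [lineNorm_const_mul, lineNorm_const_mul, abs_neg, abs_one, one_mul, one_mul] at h3
    refine h4.trans ?_
    have h5 := hd.2.2
    linarith

end

end

end BDIS

/-! ### Weak derivatives of the ANOVA terms -/

open MeasureTheory

namespace BDIS

noncomputable section

open Filter Topology

/-! ### Products of test functions suffice -/

section

variable {s : ℕ}

lemma contDiff_fderiv_single {g : (Fin s → ℝ) → ℝ} (hg : ContDiff ℝ (⊤ : ℕ∞) g) (j : Fin s) :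
    ContDiff ℝ (⊤ : ℕ∞) fun x => fderiv ℝ g x (Pi.single j 1) :=
  (hg.fderiv_right (m := (⊤ : ℕ∞)) (by simp)).clm_apply contDiff_const

/-- One integration by parts per coordinate. Its sign cancels the one from differentiating the
reflected argument `x_j - y_j`, so no sign is left. Smoothness and compact support are proved along
because the induction needs them. -/
lemma integral_foldr_fderiv_mul (l : List (Fin s)) (hl : l.Nodup) (x : Fin s → ℝ)
    {ψ : (Fin s → ℝ) → ℝ} (hψ : ContDiff ℝ (⊤ : ℕ∞) ψ) (hc : HasCompactSupport ψ) :
    ContDiff ℝ (⊤ : ℕ∞) (l.foldr (fun j g x => fderiv ℝ g x (Pi.single j 1)) ψ) ∧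
    HasCompactSupport (l.foldr (fun j g x => fderiv ℝ g x (Pi.single j 1)) ψ) ∧
    ∀ h : Fin s → ℝ → ℝ, (∀ j, ContDiff ℝ (⊤ : ℕ∞) (h j)) →
    ∫ y, l.foldr (fun j g x => fderiv ℝ g x (Pi.single j 1)) ψ y * ∏ j, h j (x j - y j) =
      ∫ y, ψ y * ∏ j, (if j ∈ l then deriv (h j) else h j) (x j - y j) := by
  induction l with
  | nil => exact ⟨hψ, hc, fun h hh => by simp⟩
  | cons i l ih =>
    rw [List.nodup_cons] at hl
    obtain ⟨h1, h2, h3⟩ := ih hl.2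
    rw [List.foldr_cons]
    set χ := l.foldr (fun j g x => fderiv ℝ g x (Pi.single j 1)) ψ
    refine ⟨contDiff_fderiv_single h1 i, h2.fderiv_apply (𝕜 := ℝ) _, fun h hh => ?_⟩
    have hd : ∀ j, ContDiff ℝ (⊤ : ℕ∞) (deriv (h j)) := fun j =>
      (contDiff_infty_iff_deriv.mp (hh j)).2
    have hd' : ∀ j, ContDiff ℝ (⊤ : ℕ∞) (if j = i then deriv (h j) else h j) := by
      intro j
      split_ifs
      exacts [hd j, hh j]
    -- the derivative of the reflected product
    have hP : ∀ g : Fin s → ℝ → ℝ, (∀ j, ContDiff ℝ (⊤ : ℕ∞) (g j)) →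
        ContDiff ℝ (⊤ : ℕ∞) fun y : Fin s → ℝ => ∏ j, g j (x j - y j) := fun g hg =>
      contDiff_prod fun j _ => (hg j).comp (contDiff_const.sub (contDiff_apply ℝ ℝ j))
    have hder : ∀ y : Fin s → ℝ, fderiv ℝ (fun y : Fin s → ℝ => ∏ j, h j (x j - y j)) y
        (Pi.single i 1) = - ∏ j, (if j = i then deriv (h j) else h j) (x j - y j) := by
      intro y
      have := fderiv_prod_eval (g := fun j t => h j (x j - t))
        (fun j => ((hh j).differentiable (by simp)).comp (by fun_prop)) y i
      rw [this, ← Finset.mul_prod_erase _ _ (Finset.mem_univ i), ← Finset.mul_prod_erase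
        (a := i) (s := Finset.univ) _ (Finset.mem_univ i), ← neg_mul]
      congr 1
      · simp only [if_true]
        exact deriv_comp_const_sub (f := h i) (x i) (y i)
      · refine Finset.prod_congr rfl fun j hj => ?_
        rw [if_neg (Finset.ne_of_mem_erase hj), if_neg (Finset.ne_of_mem_erase hj)]
    have hint : ∀ {u v : (Fin s → ℝ) → ℝ}, Continuous u → HasCompactSupport u → Continuous v →
        Integrable fun y => u y * v y := fun hu huc hv =>
      (hu.mul hv).integrable_of_hasCompactSupport huc.mul_right
    have ibp := integral_mul_fderiv_eq_neg_fderiv_mul_of_integrable (μ := volume)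
      (f := fun y : Fin s → ℝ => ∏ j, h j (x j - y j)) (g := χ) (v := Pi.single i 1)
      (by
        simp_rw [hder]
        refine ((hint h1.continuous h2 (hP _ hd').continuous).neg).congr
          (Eventually.of_forall fun y => ?_)
        simp only [Pi.neg_apply]; ring)
      (by
        refine (hint (contDiff_fderiv_single h1 i).continuous (h2.fderiv_apply (𝕜 := ℝ) _)
          (hP h hh).continuous).congr (Eventually.of_forall fun y => mul_comm _ _))
      (by
        refine (hint h1.continuous h2 (hP h hh).continuous).congr
          (Eventually.of_forall fun y => mul_comm _ _))
      (fun y _ => (hP h hh).differentiable (by simp) y) (fun y _ => h1.differentiable (by simp) y)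
    simp_rw [mul_comm (fderiv ℝ χ _ _)]
    rw [ibp]
    simp_rw [hder, neg_mul]
    rw [integral_neg, neg_neg]
    simp_rw [mul_comm _ (χ _)]
    rw [h3 _ hd']
    refine integral_congr_ae (Eventually.of_forall fun y => ?_)
    simp only
    congr 1
    refine Finset.prod_congr rfl fun j _ => ?_
    by_cases hj : j = i
    · subst hj; simp [hl.1]
    · simp [hj]

lemma integral_mul_integral_prod_comm {f : (Fin s → ℝ) → ℝ} (hf : LocallyIntegrable f)
    {ψ : (Fin s → ℝ) → ℝ} (hψ : Continuous ψ) (hc : HasCompactSupport ψ) {h : Fin s → ℝ → ℝ}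
    (hh : ∀ j, Continuous (h j)) (hhc : ∀ j, HasCompactSupport (h j)) :
    ∫ x, f x * ∫ y, ψ y * ∏ j, h j (x j - y j) = ∫ y, ψ y * ∫ x, f x * ∏ j, h j (x j - y j) := by
  have hfun : ∀ x y : Fin s → ℝ, f x * (ψ y * ∏ j, h j (x j - y j)) =
      ψ y * (f x * ∏ j, h j (x j - y j)) := fun x y => by ring
  simp_rw [← integral_const_mul]
  rw [integral_integral_swap]
  · simp_rw [hfun]
  obtain ⟨R₁, hR₁⟩ := hc.isBounded.subset_closedBall 0
  have hR₂ : ∀ j, ∃ R, tsupport (h j) ⊆ Metric.closedBall 0 R := fun j =>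
    (hhc j).isBounded.subset_closedBall 0
  choose R₂ hR₂ using hR₂
  have hC : ∀ j, ∃ C, ∀ t, ‖h j t‖ ≤ C := fun j => (hh j).bounded_above_of_compact_support (hhc j)
  choose C hC using hC
  -- `f` is only locally integrable, but for `y` in the support of `ψ` the product vanishes unless
  -- `x` lies in the ball of radius `R`.
  set R := R₁ + ∑ j, |R₂ j|
  set K : Set (Fin s → ℝ) := Metric.closedBall 0 R
  have hfK : Integrable (K.indicator f) :=
    (integrable_indicator_iff Metric.isClosed_closedBall.measurableSet).mpr
      (hf.integrableOn_isCompact (isCompact_closedBall _ _))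
  have hψi : Integrable ψ := hψ.integrable_of_hasCompactSupport hc
  have hprod := hfK.mul_prod hψi
  have hb : Integrable (fun z : (Fin s → ℝ) × (Fin s → ℝ) =>
      (∏ j, h j (z.1 j - z.2 j)) * (K.indicator f z.1 * ψ z.2)) (volume.prod volume) := by
    refine hprod.bdd_mul (c := ∏ j, C j) ?_ (Eventually.of_forall fun z => ?_)
    · refine Continuous.aestronglyMeasurable ?_
      exact continuous_finsetProd _ fun j _ => (hh j).comp (by fun_prop)
    · rw [norm_prod]
      exact Finset.prod_le_prod (fun j _ => norm_nonneg _) fun j _ => hC j _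
  refine hb.congr (Eventually.of_forall fun z => ?_)
  obtain ⟨x, y⟩ := z
  simp only [Function.uncurry]
  by_cases hx : x ∈ K
  · rw [Set.indicator_of_mem hx]; ring
  · rw [Set.indicator_of_notMem hx]
    by_cases hy : ψ y = 0
    · rw [hy]; ring
    · have : ∃ j, h j (x j - y j) = 0 := by
        by_contra! hne
        refine hx ?_
        have hy1 := hR₁ (subset_tsupport _ hy)
        rw [Metric.mem_closedBall, dist_zero_right] at hy1 ⊢
        have h0 : 0 ≤ ∑ j, |R₂ j| := Finset.sum_nonneg fun j _ => abs_nonneg _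
        refine (pi_norm_le_iff_of_nonneg (add_nonneg ((norm_nonneg _).trans hy1) h0)).mpr fun j => ?_
        have hj := hR₂ j (subset_tsupport _ (hne j))
        rw [Metric.mem_closedBall, dist_zero_right] at hj
        have h1 : ‖x j‖ ≤ ‖x j - y j‖ + ‖y j‖ := by
          simpa using norm_add_le (x j - y j) (y j)
        have h2 := (norm_le_pi_norm y j).trans hy1
        have h3 : |R₂ j| ≤ ∑ j, |R₂ j| :=
          Finset.single_le_sum (f := fun j => |R₂ j|) (fun j _ => abs_nonneg _) (Finset.mem_univ j)
        have h4 := le_abs_self (R₂ j)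
        linarith
      obtain ⟨j, hj⟩ := this
      rw [Finset.prod_eq_zero (Finset.mem_univ j) hj]; ring

/-- A sequence of bump functions shrinking to the origin. -/
def bumpSeq (n : ℕ) : ContDiffBump (0 : ℝ) where
  rIn := 1 / (2 * (n + 1))
  rOut := 1 / (n + 1)
  rIn_pos := by positivity
  rIn_lt_rOut := by
    rw [one_div, one_div]
    refine inv_strictAnti₀ (by positivity) ?_
    have : (0 : ℝ) ≤ n := Nat.cast_nonneg n
    linarith

/-- The convolution with a product of bump functions. -/
def mollify (n : ℕ) (χ : (Fin s → ℝ) → ℝ) (x : Fin s → ℝ) : ℝ :=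
  ∫ y, χ y * ∏ j, (bumpSeq n).normed volume (x j - y j)

lemma prod_bumpSeq_eq_zero {n : ℕ} {x y : Fin s → ℝ} (h : 1 / ((n : ℝ) + 1) < dist x y) :
    ∏ j, (bumpSeq n).normed volume (x j - y j) = 0 := by
  have h1 : ¬ dist x y ≤ 1 / ((n : ℝ) + 1) := not_le.mpr h
  rw [dist_pi_le_iff (by positivity), not_forall] at h1
  obtain ⟨j, hj⟩ := h1
  refine Finset.prod_eq_zero (Finset.mem_univ j) ?_
  rw [ContDiffBump.normed_def, ContDiffBump.zero_of_le_dist, zero_div]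
  rw [dist_zero_right]
  rw [Real.dist_eq] at hj
  exact (not_le.mp hj).le

/-- The kernel is a probability density supported in a small cube about `x`. The constant `c` is
free: `c = χ x` gives convergence, `c = 0` gives boundedness and control of the support. -/
lemma abs_mollify_sub_le {n : ℕ} {χ : (Fin s → ℝ) → ℝ} (hχ : Continuous χ)
    (hc : HasCompactSupport χ) (x : Fin s → ℝ) (c : ℝ) {ω : ℝ}
    (hω : ∀ y, dist x y ≤ 1 / ((n : ℝ) + 1) → |χ y - c| ≤ ω) : |mollify n χ x - c| ≤ ω := by
  set k : (Fin s → ℝ) → ℝ := fun y => ∏ j, (bumpSeq n).normed volume (x j - y j)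
  have hk0 : ∀ y, 0 ≤ k y := fun y => Finset.prod_nonneg fun j _ => (bumpSeq n).nonneg_normed _
  have hk1 : ∫ y, k y = 1 := by
    have h1 := integral_fintype_prod_volume_eq_prod (𝕜 := ℝ)
      fun (j : Fin s) t => (bumpSeq n).normed volume (x j - t)
    simp only [k]
    rw [h1]
    refine Finset.prod_eq_one fun j _ => ?_
    rw [integral_sub_left_eq_self (fun t => (bumpSeq n).normed volume t) volume (x j)]
    exact (bumpSeq n).integral_normed
  have hki : Integrable k := integrable_of_integral_eq_one hk1
  have hkc : Continuous k := continuous_finsetProd _ fun j _ =>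
    (bumpSeq n).continuous_normed.comp (by fun_prop)
  have hχk : Integrable fun y => χ y * k y :=
    (hχ.mul hkc).integrable_of_hasCompactSupport hc.mul_right
  have e : mollify n χ x - c = ∫ y, (χ y - c) * k y := by
    simp_rw [sub_mul]
    rw [integral_sub hχk (hki.const_mul c), integral_const_mul, hk1, mul_one]
    rfl
  rw [e]
  calc |∫ y, (χ y - c) * k y| ≤ ∫ y, ω * k y := by
        rw [← Real.norm_eq_abs]
        refine norm_integral_le_of_norm_le (hki.const_mul ω) (Eventually.of_forall fun y => ?_)
        rw [Real.norm_eq_abs, abs_mul, abs_of_nonneg (hk0 y)]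
        rcases le_or_gt (dist x y) (1 / ((n : ℝ) + 1)) with h | h
        · exact mul_le_mul_of_nonneg_right (hω y h) (hk0 y)
        · have : k y = 0 := prod_bumpSeq_eq_zero h
          rw [this]; simp
    _ = ω := by rw [integral_const_mul, hk1, mul_one]

lemma tendsto_integral_mul_mollify {f : (Fin s → ℝ) → ℝ} (hf : LocallyIntegrable f)
    {χ : (Fin s → ℝ) → ℝ} (hχ : Continuous χ) (hc : HasCompactSupport χ) :
    Tendsto (fun n => ∫ x, f x * mollify n χ x) atTop (𝓝 (∫ x, f x * χ x)) := by
  obtain ⟨C, hC⟩ := hχ.bounded_above_of_compact_support hc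
  set K := Metric.cthickening 1 (tsupport χ)
  have hKc : IsCompact K := IsCompact.cthickening hc
  have hn1 : ∀ n : ℕ, 1 / ((n : ℝ) + 1) ≤ 1 := fun n => by
    rw [div_le_one (by positivity)]
    have : (0 : ℝ) ≤ n := Nat.cast_nonneg n
    linarith
  have hC0 : 0 ≤ C := (norm_nonneg _).trans (hC 0)
  have hbd : ∀ n x, ‖mollify n χ x‖ ≤ C := fun n x => by
    have := abs_mollify_sub_le (n := n) hχ hc x 0 (ω := C) fun y _ => by
      rw [sub_zero]; exact hC y
    rwa [sub_zero] at this
  have h0 : ∀ n x, x ∉ K → mollify n χ x = 0 := by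
    intro n x hx
    have := abs_mollify_sub_le (n := n) hχ hc x 0 (ω := 0) fun y hy => by
      have hy0 : χ y = 0 := by
        by_contra hne
        exact hx (Metric.mem_cthickening_of_dist_le x y 1 _ (subset_tsupport _ hne) (hy.trans (hn1 n)))
      rw [hy0]; simp
    rw [sub_zero] at this
    exact abs_eq_zero.mp (le_antisymm this (abs_nonneg _))
  refine tendsto_integral_of_dominated_convergence (fun x => K.indicator (fun x => ‖f x‖ * C) x)
    (fun n => ?_) ?_ (fun n => Eventually.of_forall fun x => ?_) (Eventually.of_forall fun x => ?_)
  · refine hf.aestronglyMeasurable.mul ?_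
    have hcont : Continuous fun z : (Fin s → ℝ) × (Fin s → ℝ) =>
        χ z.2 * ∏ j, (bumpSeq n).normed volume (z.1 j - z.2 j) :=
      (hχ.comp continuous_snd).mul (continuous_finsetProd _ fun j _ =>
        (bumpSeq n).continuous_normed.comp (by fun_prop))
    exact (hcont.stronglyMeasurable.integral_prod_right (ν := volume)).aestronglyMeasurable
  · rw [integrable_indicator_iff hKc.isClosed.measurableSet]
    exact ((hf.integrableOn_isCompact hKc).norm).mul_const C
  · by_cases hx : x ∈ K
    · rw [Set.indicator_of_mem hx, norm_mul]
      exact mul_le_mul_of_nonneg_left (hbd n x) (norm_nonneg _)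
    · rw [h0 n x hx, Set.indicator_of_notMem hx]; simp
  · refine Tendsto.const_mul _ ?_
    rw [Metric.tendsto_atTop]
    intro ε hε
    obtain ⟨δ, hδ, hδε⟩ := Metric.continuous_iff.mp hχ x (ε / 2) (by positivity)
    obtain ⟨N, hN⟩ := exists_nat_one_div_lt hδ
    refine ⟨N, fun n hn => ?_⟩
    rw [Real.dist_eq]
    refine lt_of_le_of_lt (abs_mollify_sub_le (ω := ε / 2) hχ hc x (χ x) fun y hy => ?_) (by linarith)
    have h1 : 1 / ((n : ℝ) + 1) ≤ 1 / ((N : ℝ) + 1) := by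
      have : (N : ℝ) ≤ n := by exact_mod_cast hn
      gcongr
    have := hδε y (by rw [dist_comm]; linarith)
    rw [Real.dist_eq] at this
    exact this.le

/-- Mollify with products of bumps: by Fubini, testing with the mollified function is an average
over `y` of tests with translated products, for which the identity is assumed. The derivatives fall
on the bumps, and the mollification converges against locally integrable functions. -/
lemma HasProductWeakDeriv.hasWeakMixedDeriv {v : Finset (Fin s)} {f g : (Fin s → ℝ) → ℝ}
    (h : HasProductWeakDeriv v f g) (hf : LocallyIntegrable f) (hg : LocallyIntegrable g) :
    HasWeakMixedDeriv v f g := by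
  refine ⟨hf, hg, fun ψ hψ hc => ?_⟩
  have hnodup := Finset.sort_nodup v (· ≤ ·)
  obtain ⟨h1, h2, -⟩ := integral_foldr_fderiv_mul _ hnodup 0 hψ hc
  have hbs : ∀ n, ContDiff ℝ (⊤ : ℕ∞) ((bumpSeq n).normed volume) := fun n =>
    (bumpSeq n).contDiff_normed
  have hbc : ∀ n, HasCompactSupport ((bumpSeq n).normed volume) := fun n =>
    (bumpSeq n).hasCompactSupport_normed
  have key : ∀ n, ∫ x, f x * mollify n (mixedPartial v ψ) x =
      (-1 : ℝ) ^ v.card * ∫ x, g x * mollify n ψ x := by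
    intro n
    set β := (bumpSeq n).normed volume
    have e1 : ∀ x, mollify n (mixedPartial v ψ) x =
        ∫ y, ψ y * ∏ j, (if j ∈ v then deriv β else β) (x j - y j) := by
      intro x
      have := (integral_foldr_fderiv_mul _ hnodup x hψ hc).2.2 (fun _ => β) fun _ => hbs n
      simp only [Finset.mem_sort] at this
      exact this
    simp_rw [e1, mollify]
    rw [integral_mul_integral_prod_comm hf hψ.continuous hc
      (h := fun j => if j ∈ v then deriv β else β) (fun j => by
        split_ifs
        exacts [(hbs n).continuous_deriv (by simp), (hbs n).continuous]) (fun j => by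
        split_ifs
        exacts [(hbc n).deriv, hbc n]),
      integral_mul_integral_prod_comm hg hψ.continuous hc (h := fun _ => β)
        (fun _ => (hbs n).continuous) (fun _ => hbc n), ← integral_const_mul]
    refine integral_congr_ae (Eventually.of_forall fun y => ?_)
    simp only
    have h3 := h (fun j t => β (t - y j)) (fun j => (hbs n).comp (by fun_prop)) fun j =>
      (hbc n).comp_homeomorph (Homeomorph.subRight (y j))
    have h4 : ∀ x : Fin s → ℝ, ∏ j, (if j ∈ v then deriv β else β) (x j - y j) =
        ∏ j, (if j ∈ v then deriv fun t => β (t - y j) else fun t => β (t - y j)) (x j) := by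
      intro x
      refine Finset.prod_congr rfl fun j _ => ?_
      split_ifs
      · rw [deriv_comp_sub_const]
      · rfl
    simp_rw [h4]
    rw [h3]
    ring
  have t1 := tendsto_integral_mul_mollify hf (χ := mixedPartial v ψ) h1.continuous h2
  have t2 := (tendsto_integral_mul_mollify hg hψ.continuous hc).const_mul ((-1 : ℝ) ^ v.card)
  simp_rw [key] at t1
  exact tendsto_nhds_unique t1 t2

end

end

end BDIS

open MeasureTheory

namespace BDIS

noncomputable section

open Filter Topology

/-! ### Integrating out variables -/

/-- Exchanging the coordinates in `A` between two independent copies leaves their joint law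
unchanged. This yields both the `L^q` membership and the self-adjointness of integrating out. -/
lemma measurePreserving_piecewise {ι X : Type*} [Fintype ι] [DecidableEq ι] [MeasurableSpace X]
    (μ : ι → Measure X) [∀ i, SigmaFinite (μ i)] (A : Finset ι) :
    MeasurePreserving (fun z : (ι → X) × (ι → X) => (A.piecewise z.2 z.1, A.piecewise z.1 z.2))
      ((Measure.pi μ).prod (Measure.pi μ)) ((Measure.pi μ).prod (Measure.pi μ)) := by
  have h1 := measurePreserving_arrowProdEquivProdArrow X X ι μ μ
  have h2 : MeasurePreserving (fun (z : ι → X × X) i => if i ∈ A then (z i).swap else z i)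
      (Measure.pi fun i => (μ i).prod (μ i)) (Measure.pi fun i => (μ i).prod (μ i)) := by
    refine measurePreserving_pi (fun i => (μ i).prod (μ i)) (fun i => (μ i).prod (μ i))
      (f := fun i (z : X × X) => if i ∈ A then z.swap else z) fun i => ?_
    by_cases hi : i ∈ A
    · simp only [hi, if_true]; exact Measure.measurePreserving_swap
    · simp only [hi, if_false]; exact MeasurePreserving.id _
  have h3 := (h1.comp h2).comp (h1.symm)
  convert h3 using 1
  funext z
  refine Prod.ext ?_ ?_
  · funext i
    by_cases hi : i ∈ A <;>
      simp [hi, MeasurableEquiv.arrowProdEquivProdArrow, Equiv.arrowProdEquivProdArrow,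
        Finset.piecewise]
  · funext i
    by_cases hi : i ∈ A <;>
      simp [hi, MeasurableEquiv.arrowProdEquivProdArrow, Equiv.arrowProdEquivProdArrow,
        Finset.piecewise]

section

variable {φ : ℝ → ℝ} (hφ : IsAdmissibleDensity φ) {q r : ℝ} (hqr : q.HolderConjugate r) {s : ℕ}

include hφ

lemma measurePreserving_piecewise_fst (A : Finset (Fin s)) :
    MeasurePreserving (fun z : (Fin s → ℝ) × (Fin s → ℝ) => A.piecewise z.2 z.1)
      ((prodMeasure φ s).prod (prodMeasure φ s)) (prodMeasure φ s) := by
  have := hφ.isProbabilityMeasure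
  have := isProbabilityMeasure_prodMeasure hφ s
  exact measurePreserving_fst.comp (measurePreserving_piecewise (fun _ => lineMeasure φ) A)

include hqr

/-- Jensen's inequality in the inner variable, then the exchange of coordinates. -/
lemma memSpace_integrateOut {f : (Fin s → ℝ) → ℝ} (hf : MemSpace φ q f) (A : Finset (Fin s)) :
    MemSpace φ q (integrateOut φ A f) := by
  have := isProbabilityMeasure_prodMeasure hφ s
  have hmp := measurePreserving_piecewise_fst hφ A
  have hq : 0 < q := hqr.pos
  have hq0 : ENNReal.ofReal q ≠ 0 := by simpa using hq
  have h1q : (1 : ENNReal) ≤ ENNReal.ofReal q := by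
    rw [← ENNReal.ofReal_one]; exact ENNReal.ofReal_le_ofReal hqr.lt.le
  set F : (Fin s → ℝ) × (Fin s → ℝ) → ℝ := fun z => f (A.piecewise z.2 z.1)
  have hF : MemLp F (ENNReal.ofReal q) ((prodMeasure φ s).prod (prodMeasure φ s)) :=
    hf.comp_measurePreserving hmp
  refine ⟨hF.1.integral_prod_right', ?_⟩
  have hmeas : ∀ᵐ x ∂prodMeasure φ s, AEStronglyMeasurable (fun y => F (x, y)) (prodMeasure φ s) :=
    hF.1.prodMk_left
  have hle : ∀ᵐ x ∂prodMeasure φ s, ‖integrateOut φ A f x‖ₑ ^ q ≤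
      ∫⁻ y, ‖F (x, y)‖ₑ ^ q ∂prodMeasure φ s := by
    filter_upwards [hmeas] with x hx
    have h2 : ‖integrateOut φ A f x‖ₑ ≤ eLpNorm (fun y => F (x, y)) (ENNReal.ofReal q)
        (prodMeasure φ s) := by
      refine (enorm_integral_le_lintegral_enorm _).trans ?_
      rw [← eLpNorm_one_eq_lintegral_enorm]
      exact eLpNorm_le_eLpNorm_of_exponent_le h1q hx
    refine (ENNReal.rpow_le_rpow h2 hq.le).trans (le_of_eq ?_)
    rw [eLpNorm_eq_lintegral_rpow_enorm_toReal hq0 ENNReal.ofReal_ne_top, ENNReal.toReal_ofReal hq.le,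
      ← ENNReal.rpow_mul, one_div_mul_cancel hq.ne', ENNReal.rpow_one]
  rw [eLpNorm_eq_lintegral_rpow_enorm_toReal hq0 ENNReal.ofReal_ne_top, ENNReal.toReal_ofReal hq.le]
  refine ENNReal.rpow_lt_top_of_nonneg (by positivity) (ne_of_lt ?_)
  refine (lintegral_mono_ae hle).trans_lt ?_
  rw [← lintegral_prod _ (hF.1.enorm.pow_const q)]
  have h3 := hF.2
  rw [eLpNorm_eq_lintegral_rpow_enorm_toReal hq0 ENNReal.ofReal_ne_top,
    ENNReal.toReal_ofReal hq.le] at h3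
  by_contra hcon
  rw [not_lt, top_le_iff] at hcon
  rw [hcon, ENNReal.top_rpow_of_pos (by positivity)] at h3
  exact lt_irrefl _ h3

/-- Integrating out variables is self-adjoint. -/
lemma integral_integrateOut_mul_prod {f : (Fin s → ℝ) → ℝ} (hf : MemSpace φ q f)
    (A : Finset (Fin s)) {B : Fin s → ℝ → ℝ} (hB : ∀ j, MemLine φ r (B j)) :
    ∫ x, integrateOut φ A f x * ∏ j, B j (x j) ∂prodMeasure φ s =
      ∫ x, f x * ∏ j, (if j ∈ A then fun _ => ∫ t, B j t ∂lineMeasure φ else B j) (x j)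
        ∂prodMeasure φ s := by
  have := hφ.isProbabilityMeasure
  have := isProbabilityMeasure_prodMeasure hφ s
  have hmp : MeasurePreserving (fun z : (Fin s → ℝ) × (Fin s → ℝ) =>
      (A.piecewise z.2 z.1, A.piecewise z.1 z.2)) ((prodMeasure φ s).prod (prodMeasure φ s))
      ((prodMeasure φ s).prod (prodMeasure φ s)) :=
    measurePreserving_piecewise (fun _ : Fin s => lineMeasure φ) A
  set F : (Fin s → ℝ) × (Fin s → ℝ) → ℝ := fun z =>
    (f z.1 * ∏ j, (if j ∈ A then fun _ => 1 else B j) (z.1 j)) *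
      ∏ j, (if j ∈ A then B j else fun _ => 1) (z.2 j)
  have h1 : Integrable (fun x => f x * ∏ j, (if j ∈ A then fun _ => 1 else B j) (x j))
      (prodMeasure φ s) := integrable_mul_prod_eval hφ hqr hf fun j => by
    split_ifs
    · exact memLp_const _
    · exact hB j
  have h2 : Integrable (fun x => ∏ j, (if j ∈ A then B j else fun _ => 1) (x j))
      (prodMeasure φ s) := by
    refine Integrable.fintype_prod (f := fun j => if j ∈ A then B j else fun _ => 1) fun j => ?_
    split_ifs
    · exact (integral_abs_le_lineNorm hφ hqr (hB j)).1
    · exact integrable_const _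
  have hF : Integrable F ((prodMeasure φ s).prod (prodMeasure φ s)) := h1.mul_prod h2
  have hF2 := hmp.integrable_comp_of_integrable hF
  have e1 : ∀ x y : Fin s → ℝ, F (A.piecewise y x, A.piecewise x y) =
      f (A.piecewise y x) * ∏ j, B j (x j) := by
    intro x y
    simp only [F]
    rw [mul_assoc, ← Finset.prod_mul_distrib]
    congr 1
    refine Finset.prod_congr rfl fun j _ => ?_
    by_cases hj : j ∈ A <;> simp [hj]
  calc ∫ x, integrateOut φ A f x * ∏ j, B j (x j) ∂prodMeasure φ s
      = ∫ x, ∫ y, F (A.piecewise y x, A.piecewise x y) ∂prodMeasure φ s ∂prodMeasure φ s := by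
        refine integral_congr_ae (Eventually.of_forall fun x => ?_)
        simp only
        simp_rw [e1]
        rw [integral_mul_const]
        rfl
    _ = ∫ z, F (A.piecewise z.2 z.1, A.piecewise z.1 z.2)
          ∂((prodMeasure φ s).prod (prodMeasure φ s)) := (integral_prod _ hF2).symm
    _ = ∫ z, F z ∂((prodMeasure φ s).prod (prodMeasure φ s)) := by
        conv_rhs => rw [← hmp.map_eq]
        rw [integral_map hmp.measurable.aemeasurable]
        rw [hmp.map_eq]
        exact hF.1
    _ = (∫ x, f x * ∏ j, (if j ∈ A then fun _ => 1 else B j) (x j) ∂prodMeasure φ s) *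
          ∏ j, ∫ t, (if j ∈ A then B j else fun _ => 1) t ∂lineMeasure φ := by
        rw [integral_prod_mul (μ := prodMeasure φ s) (ν := prodMeasure φ s)
          (fun x => f x * ∏ j, (if j ∈ A then fun _ => 1 else B j) (x j))
          (fun x => ∏ j, (if j ∈ A then B j else fun _ => 1) (x j))]
        congr 1
        exact integral_fintype_prod_eq_prod (𝕜 := ℝ)
          (fun (j : Fin s) => if j ∈ A then B j else fun _ => 1)
    _ = _ := by
        rw [← integral_mul_const]
        refine integral_congr_ae (Eventually.of_forall fun x => ?_)
        simp only
        rw [mul_assoc, ← Finset.prod_mul_distrib]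
        congr 1
        refine Finset.prod_congr rfl fun j _ => ?_
        by_cases hj : j ∈ A <;> simp [hj]

/-! ### Weak derivatives of the ANOVA terms -/

/-- On a compact set Lebesgue measure is dominated by a multiple of the product measure, as the
density is bounded below there. -/
lemma MemSpace.locallyIntegrable {f : (Fin s → ℝ) → ℝ} (hf : MemSpace φ q f) :
    LocallyIntegrable f := by
  have := isProbabilityMeasure_prodMeasure hφ s
  have h1q : (1 : ENNReal) ≤ ENNReal.ofReal q := by
    rw [← ENNReal.ofReal_one]; exact ENNReal.ofReal_le_ofReal hqr.lt.le
  have hfi : Integrable f (prodMeasure φ s) := hf.integrable h1q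
  rw [locallyIntegrable_iff]
  intro K hK
  obtain ⟨R, hR⟩ := hK.isBounded.subset_closedBall 0
  obtain ⟨c, hc, hcφ⟩ := exists_density_ge hφ R
  have hle : (volume : Measure (Fin s → ℝ)).restrict K ≤
      ENNReal.ofReal ((c ^ s)⁻¹) • prodMeasure φ s := by
    refine Measure.le_iff.mpr fun t ht => ?_
    rw [Measure.restrict_apply ht, Measure.smul_apply, smul_eq_mul, prodMeasure_eq_withDensity hφ,
      withDensity_apply _ ht]
    have h1 : ENNReal.ofReal (c ^ s) * volume (t ∩ K) ≤ ∫⁻ x in t, ENNReal.ofReal (∏ j, φ (x j)) := by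
      rw [← setLIntegral_const]
      refine (setLIntegral_mono (measurable_prod_density hφ s).ennreal_ofReal fun x hx =>
        ENNReal.ofReal_le_ofReal ?_).trans (lintegral_mono_set Set.inter_subset_left)
      rw [← Fin.prod_const]
      refine Finset.prod_le_prod (fun _ _ => hc.le) fun j _ => hcφ _ ?_
      have := hR hx.2
      rw [Metric.mem_closedBall, dist_zero_right] at this
      exact (norm_le_pi_norm x j).trans this
    rw [ENNReal.ofReal_inv_of_pos (by positivity), mul_comm, ← div_eq_mul_inv,
      ENNReal.le_div_iff_mul_le (by left; simpa using pow_pos hc s) (by left; exact ENNReal.ofReal_ne_top),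
      mul_comm]
    exact h1
  exact (hfi.smul_measure ENNReal.ofReal_ne_top).mono_measure hle

lemma integral_volume_mul_prod (f : (Fin s → ℝ) → ℝ) (ψ : Fin s → ℝ → ℝ) :
    ∫ x, f x * ∏ j, ψ j (x j) = ∫ x, f x * ∏ j, overDensity φ (ψ j) (x j) ∂prodMeasure φ s := by
  rw [integral_volume_eq hφ]
  refine integral_congr_ae (Eventually.of_forall fun x => ?_)
  simp only [overDensity, div_eq_mul_inv, Finset.prod_mul_distrib]
  ring

lemma isTestLimit_test {ψ : ℝ → ℝ} (hψ : ContDiff ℝ (⊤ : ℕ∞) ψ) (hc : HasCompactSupport ψ) :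
    IsTestLimit φ r (overDensity φ ψ) (overDensity φ (deriv ψ)) := by
  refine ⟨memLine_overDensity_of_continuous hφ hψ.continuous hc,
    memLine_overDensity_of_continuous hφ (hψ.continuous_deriv (by simp)) hc.deriv,
    fun ε hε => ⟨ψ, hψ, hc, ?_, ?_⟩⟩ <;> simp [lineNorm, hε.le]

/-- Self-adjointness replaces the factors in `A` by their means. If `z` meets `A`, one of them is
the mean of `ψ'/φ`, that is `∫ ψ' = 0`. Otherwise the constants in `A` are undifferentiated factors,
which need only be in `L^r(φ)`. -/
lemma hasProductWeakDeriv_integrateOut {f g : (Fin s → ℝ) → ℝ} {z : Finset (Fin s)}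
    (h : HasProductWeakDeriv z f g) (hf : MemSpace φ q f) (hg : MemSpace φ q g)
    (A : Finset (Fin s)) :
    HasProductWeakDeriv z (integrateOut φ A f) (if Disjoint z A then integrateOut φ A g else 0) := by
  intro ψ hψ hc
  have hder : ∀ j, MemLine φ r (overDensity φ (deriv (ψ j))) := fun j =>
    memLine_overDensity_of_continuous hφ ((hψ j).continuous_deriv (by simp)) (hc j).deriv
  have hfun : ∀ j, MemLine φ r (overDensity φ (ψ j)) := fun j =>
    memLine_overDensity_of_continuous hφ (hψ j).continuous (hc j)
  have hmix : ∀ j, MemLine φ r (overDensity φ (if j ∈ z then deriv (ψ j) else ψ j)) := by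
    intro j
    split_ifs
    exacts [hder j, hfun j]
  rw [integral_volume_mul_prod hφ hqr, integral_volume_mul_prod hφ hqr,
    integral_integrateOut_mul_prod hφ hqr hf A hmix]
  split_ifs with hd
  · rw [integral_integrateOut_mul_prod hφ hqr hg A hfun]
    have := hφ.isProbabilityMeasure
    have key := integral_mul_prod_of_isTestLimit hφ hqr h hf hg
      (A := fun j => overDensity φ (deriv (ψ j)))
      (B := fun j => if j ∈ A then fun _ => ∫ t, overDensity φ (ψ j) t ∂lineMeasure φ
        else overDensity φ (ψ j))
      (fun j hj => by
        rw [if_neg (Finset.disjoint_left.mp hd hj)]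
        exact isTestLimit_test hφ hqr (hψ j) (hc j))
      (fun j => by
        split_ifs
        · exact memLp_const _
        · exact hfun j)
    rw [← key]
    refine integral_congr_ae (Eventually.of_forall fun x => ?_)
    simp only
    congr 1
    refine Finset.prod_congr rfl fun j _ => ?_
    by_cases hz : j ∈ z
    · simp [hz, Finset.disjoint_left.mp hd hz]
    · simp [hz]
  · rw [Finset.not_disjoint_iff] at hd
    obtain ⟨i, hiz, hiA⟩ := hd
    have h0 : ∫ t, overDensity φ (deriv (ψ i)) t ∂lineMeasure φ = 0 := by
      rw [integral_overDensity hφ]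
      exact integral_eq_zero_of_hasDerivAt_of_integrable
        (fun t => ((hψ i).differentiable (by simp) t).hasDerivAt)
        (((hψ i).continuous_deriv (by simp)).integrable_of_hasCompactSupport (hc i).deriv)
        ((hψ i).continuous.integrable_of_hasCompactSupport (hc i))
    have h1 : ∀ x : Fin s → ℝ, ∏ j, (if j ∈ A then fun _ => ∫ t, overDensity φ
        (if j ∈ z then deriv (ψ j) else ψ j) t ∂lineMeasure φ
        else overDensity φ (if j ∈ z then deriv (ψ j) else ψ j)) (x j) = 0 := fun x =>
      Finset.prod_eq_zero (Finset.mem_univ i) (by simp [hiz, hiA, h0])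
    simp [h1]

end

end

end BDIS

open MeasureTheory

namespace BDIS

noncomputable section

open Filter Topology

/-! ### Uniqueness of weak derivatives and Sobolev membership of the ANOVA terms -/

section

variable {φ : ℝ → ℝ} (hφ : IsAdmissibleDensity φ) {q r : ℝ} (hqr : q.HolderConjugate r) {s : ℕ}

lemma HasWeakMixedDeriv.ae_eq {v : Finset (Fin s)} {f g g' : (Fin s → ℝ) → ℝ}
    (h : HasWeakMixedDeriv v f g) (h' : HasWeakMixedDeriv v f g') : g =ᵐ[volume] g' := by
  refine ae_eq_of_integral_contDiff_smul_eq h.locallyIntegrable_deriv h'.locallyIntegrable_deriv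
    fun ψ hψ hc => ?_
  have e := (h.integral_eq ψ hψ hc).symm.trans (h'.integral_eq ψ hψ hc)
  have hne : (-1 : ℝ) ^ v.card ≠ 0 := pow_ne_zero _ (by norm_num)
  have := mul_left_cancel₀ hne e
  simpa only [smul_eq_mul, mul_comm] using this

lemma HasWeakMixedDeriv.weakMixedDeriv_spec {v : Finset (Fin s)} {f g : (Fin s → ℝ) → ℝ}
    (h : HasWeakMixedDeriv v f g) : HasWeakMixedDeriv v f (weakMixedDeriv v f) := by
  have hex : ∃ g, HasWeakMixedDeriv v f g := ⟨g, h⟩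
  rw [weakMixedDeriv, dif_pos hex]
  exact hex.choose_spec

lemma hasWeakMixedDeriv_empty {f : (Fin s → ℝ) → ℝ} (hf : LocallyIntegrable f) :
    HasWeakMixedDeriv ∅ f f := ⟨hf, hf, fun ψ _ _ => by simp [mixedPartial]⟩

include hφ

lemma MemWmix.memSpace_weakMixedDeriv {f : (Fin s → ℝ) → ℝ} (hf : MemWmix φ q f)
    (v : Finset (Fin s)) : MemSpace φ q (weakMixedDeriv v f) := by
  obtain ⟨g, hg, hgm⟩ := hf v
  exact hgm.ae_eq ((prodMeasure_absolutelyContinuous hφ s).ae_eq (hg.ae_eq hg.weakMixedDeriv_spec))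

lemma MemWmix.memSpace {f : (Fin s → ℝ) → ℝ} (hf : MemWmix φ q f) : MemSpace φ q f := by
  obtain ⟨g, hg, hgm⟩ := hf ∅
  exact hgm.ae_eq ((prodMeasure_absolutelyContinuous hφ s).ae_eq
    (hg.ae_eq (hasWeakMixedDeriv_empty hg.locallyIntegrable)))

omit hφ in
lemma MemWmix.hasProductWeakDeriv {f : (Fin s → ℝ) → ℝ} (hf : MemWmix φ q f)
    (v : Finset (Fin s)) : HasProductWeakDeriv v f (weakMixedDeriv v f) := by
  obtain ⟨g, hg, -⟩ := hf v
  exact hg.weakMixedDeriv_spec.hasProductWeakDeriv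

omit hφ in
lemma wmixNorm_nonneg (f : (Fin s → ℝ) → ℝ) : 0 ≤ wmixNorm φ q f := by
  unfold wmixNorm; positivity

omit hφ in
lemma sum_spaceNorm_rpow (hq : 0 < q) (f : (Fin s → ℝ) → ℝ) :
    ∑ v, spaceNorm φ q (weakMixedDeriv v f) ^ q = wmixNorm φ q f ^ q := by
  unfold wmixNorm spaceNorm
  rw [← Real.rpow_mul (by positivity), one_div_mul_cancel hq.ne', Real.rpow_one]

include hqr

lemma memSpace_anovaTerm {f : (Fin s → ℝ) → ℝ} (hf : MemSpace φ q f) (v : Finset (Fin s)) :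
    MemSpace φ q (anovaTerm φ f v) :=
  memLp_finsetSum _ fun z _ => (memSpace_integrateOut hφ hqr hf (vᶜ ∪ z)).const_mul _

lemma MemWmix.anovaTerm {f : (Fin s → ℝ) → ℝ} (hf : MemWmix φ q f) (v : Finset (Fin s)) :
    MemWmix φ q (anovaTerm φ f v) := by
  intro z
  have hfm := hf.memSpace hφ
  have hgm := hf.memSpace_weakMixedDeriv hφ z
  have hprod : ∀ {h : (Fin s → ℝ) → ℝ}, MemSpace φ q h → ∀ ψ : Fin s → ℝ → ℝ,
      (∀ j, Continuous (ψ j)) → (∀ j, HasCompactSupport (ψ j)) →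
      Integrable fun x => h x * ∏ j, ψ j (x j) := by
    intro h hh ψ hψ hc
    have hcont : Continuous fun x : Fin s → ℝ => ∏ j, ψ j (x j) :=
      continuous_finsetProd _ fun j _ => (hψ j).comp (continuous_apply j)
    have := (hh.locallyIntegrable hφ hqr).integrable_smul_right_of_hasCompactSupport hcont
      (hasCompactSupport_prod_eval hc)
    simpa only [smul_eq_mul, mul_comm] using this
  set G : Finset (Fin s) → (Fin s → ℝ) → ℝ := fun y =>
    if Disjoint z (vᶜ ∪ y) then integrateOut φ (vᶜ ∪ y) (weakMixedDeriv z f) else 0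
  have hG : ∀ y, MemSpace φ q (G y) := by
    intro y
    simp only [G]
    split_ifs
    · exact memSpace_integrateOut hφ hqr hgm _
    · exact MemLp.zero
  have hGs : MemSpace φ q (fun x => ∑ y ∈ v.powerset, (-1 : ℝ) ^ y.card * G y x) :=
    memLp_finsetSum _ fun y _ => (hG y).const_mul _
  refine ⟨_, HasProductWeakDeriv.hasWeakMixedDeriv ?_
    ((memSpace_anovaTerm hφ hqr hfm v).locallyIntegrable hφ hqr)
    (hGs.locallyIntegrable hφ hqr), hGs⟩
  intro ψ hψ hc
  have hψ' : ∀ j, Continuous (if j ∈ z then deriv (ψ j) else ψ j) := by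
    intro j
    split_ifs
    exacts [(hψ j).continuous_deriv (by simp), (hψ j).continuous]
  have hc' : ∀ j, HasCompactSupport (if j ∈ z then deriv (ψ j) else ψ j) := by
    intro j
    split_ifs
    exacts [(hc j).deriv, hc j]
  simp only [BDIS.anovaTerm, Finset.sum_mul, mul_assoc]
  rw [integral_finsetSum _ fun y _ =>
      (hprod (memSpace_integrateOut hφ hqr hfm (vᶜ ∪ y)) _ hψ' hc').const_mul _,
    integral_finsetSum _ fun y _ =>
      (hprod (hG y) ψ (fun j => (hψ j).continuous) hc).const_mul _, Finset.mul_sum]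
  refine Finset.sum_congr rfl fun y _ => ?_
  rw [integral_const_mul, integral_const_mul, hasProductWeakDeriv_integrateOut hφ hqr
    (hf.hasProductWeakDeriv z) hfm hgm (vᶜ ∪ y) ψ hψ hc]
  ring

/-! ### Integrals of products against the ANOVA terms -/

/-- By self-adjointness the ANOVA projection acts on the product instead of `f`, where it centres
every factor in `v`. -/
lemma integral_anovaTerm_mul_prod {f : (Fin s → ℝ) → ℝ} (hf : MemSpace φ q f)
    (v : Finset (Fin s)) {ρ : Fin s → ℝ → ℝ} (hρ : ∀ j, MemLine φ r (ρ j)) :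
    ∫ x, anovaTerm φ f v x * ∏ j ∈ v, ρ j (x j) ∂prodMeasure φ s =
      ∫ x, f x * ∏ j ∈ v, (ρ j (x j) - ∫ t, ρ j t ∂lineMeasure φ) ∂prodMeasure φ s := by
  have := hφ.isProbabilityMeasure
  set B : Fin s → ℝ → ℝ := fun j => if j ∈ v then ρ j else fun _ => 1
  have hB : ∀ j, MemLine φ r (B j) := by
    intro j
    simp only [B]
    split_ifs
    exacts [hρ j, memLp_const _]
  have e0 : ∀ x : Fin s → ℝ, ∏ j ∈ v, ρ j (x j) = ∏ j, B j (x j) := by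
    intro x
    rw [← Finset.prod_subset v.subset_univ]
    · exact Finset.prod_congr rfl fun j hj => by simp [B, hj]
    · intro j _ hj; simp [B, hj]
  have hBz : ∀ z j, MemLine φ r
      (if j ∈ vᶜ ∪ z then fun _ => ∫ t, B j t ∂lineMeasure φ else B j) := by
    intro z j
    split_ifs
    exacts [memLp_const _, hB j]
  simp only [e0, anovaTerm, Finset.sum_mul, mul_assoc]
  rw [integral_finsetSum _ fun z _ => (integrable_mul_prod_eval hφ hqr
    (memSpace_integrateOut hφ hqr hf (vᶜ ∪ z)) hB).const_mul _]
  simp only [integral_const_mul, integral_integrateOut_mul_prod hφ hqr hf _ hB]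
  simp only [← integral_const_mul]
  rw [← integral_finsetSum _ fun z _ => (integrable_mul_prod_eval hφ hqr hf (hBz z)).const_mul _]
  refine integral_congr_ae (Eventually.of_forall fun x => ?_)
  simp only
  rw [Finset.prod_sub, Finset.mul_sum]
  refine Finset.sum_congr rfl fun z hz => ?_
  rw [Finset.mem_powerset] at hz
  have e1 : ∏ j, (if j ∈ vᶜ ∪ z then fun _ => ∫ t, B j t ∂lineMeasure φ else B j) (x j) =
      (∏ j ∈ v \ z, ρ j (x j)) * ∏ j ∈ z, ∫ t, ρ j t ∂lineMeasure φ := by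
    rw [← Finset.prod_sdiff (Finset.subset_univ v), ← Finset.prod_sdiff hz]
    have a1 : ∏ j ∈ Finset.univ \ v,
        (if j ∈ vᶜ ∪ z then fun _ => ∫ t, B j t ∂lineMeasure φ else B j) (x j) = 1 := by
      refine Finset.prod_eq_one fun j hj => ?_
      have hjv : j ∉ v := (Finset.mem_sdiff.mp hj).2
      simp [hjv, B]
    rw [a1, one_mul]
    congr 1
    · refine Finset.prod_congr rfl fun j hj => ?_
      obtain ⟨h1, h2⟩ := Finset.mem_sdiff.mp hj
      simp [h1, h2, B]
    · refine Finset.prod_congr rfl fun j hj => ?_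
      simp [hj, hz hj, B]
  rw [e1]
  ring

/-- The ANOVA decomposition of an integral against a product of functions of the coordinates
in `ω`. -/
lemma integral_mul_prod_eq_sum_anovaTerm {f : (Fin s → ℝ) → ℝ} (hf : MemSpace φ q f)
    (ω : Finset (Fin s)) {ρ : Fin s → ℝ → ℝ} (hρ : ∀ j, MemLine φ r (ρ j)) :
    ∫ x, f x * ∏ j ∈ ω, ρ j (x j) ∂prodMeasure φ s =
      ∑ v ∈ ω.powerset, (∏ j ∈ ω \ v, ∫ t, ρ j t ∂lineMeasure φ) *
        ∫ x, anovaTerm φ f v x * ∏ j ∈ v, ρ j (x j) ∂prodMeasure φ s := by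
  have := hφ.isProbabilityMeasure
  have hint : ∀ v : Finset (Fin s), Integrable (fun x => f x *
      ∏ j ∈ v, (ρ j (x j) - ∫ t, ρ j t ∂lineMeasure φ)) (prodMeasure φ s) := by
    intro v
    have := integrable_mul_prod_eval hφ hqr hf (g := fun j => if j ∈ v then
      fun y => ρ j y - ∫ t, ρ j t ∂lineMeasure φ else fun _ => 1) fun j => by
        split_ifs
        · exact (hρ j).sub (memLp_const _)
        · exact memLp_const _
    refine this.congr (Eventually.of_forall fun x => ?_)
    simp only
    congr 1
    rw [← Finset.prod_subset v.subset_univ]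
    · exact Finset.prod_congr rfl fun j hj => by simp [hj]
    · intro j _ hj; simp [hj]
  simp only [integral_anovaTerm_mul_prod hφ hqr hf _ hρ, ← integral_const_mul]
  rw [← integral_finsetSum _ fun v _ => (hint v).const_mul _]
  refine integral_congr_ae (Eventually.of_forall fun x => ?_)
  simp only
  have e : ∏ j ∈ ω, ρ j (x j) = ∏ j ∈ ω, ((ρ j (x j) - ∫ t, ρ j t ∂lineMeasure φ) +
      ∫ t, ρ j t ∂lineMeasure φ) := by simp
  rw [e, Finset.prod_add, Finset.mul_sum]
  refine Finset.sum_congr rfl fun v _ => ?_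
  ring

end

end

end BDIS

/-! ### Haar coefficients of the transformed integrand -/

open MeasureTheory

namespace BDIS

noncomputable section

open Filter Topology

/-! ### Haar functions of one variable as step functions -/

/-- The `b`-adic interval `[c b^{-l}, (c+1) b^{-l})`. -/
def baseInterval (b l c : ℕ) : Set ℝ := Set.Ico ((c : ℝ) / (b : ℝ) ^ l) (((c : ℝ) + 1) / (b : ℝ) ^ l)

/-- The Haar function of level `l + 1` belonging to the cell `c`. -/
def cellStep (b l c : ℕ) (u : ℝ) : ℝ :=
  (baseInterval b (l + 1) c).indicator (fun _ => (b : ℝ) ^ (l + 1)) u -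
    (baseInterval b l (c / b)).indicator (fun _ => (b : ℝ) ^ l) u

lemma measurableSet_baseInterval (b l c : ℕ) : MeasurableSet (baseInterval b l c) := measurableSet_Ico

section

variable {b : ℕ} (hb : 0 < b) (l c : ℕ)

include hb

lemma baseInterval_lt : (c : ℝ) / (b : ℝ) ^ l < ((c : ℝ) + 1) / (b : ℝ) ^ l := by
  have : (0 : ℝ) < (b : ℝ) ^ l := by positivity
  gcongr
  linarith

lemma baseInterval_succ_subset : baseInterval b (l + 1) c ⊆ baseInterval b l (c / b) := by
  have hbR : (0 : ℝ) < b := by exact_mod_cast hb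
  have h1 : ((c / b : ℕ) : ℝ) * b ≤ c := by exact_mod_cast Nat.div_mul_le_self c b
  have h2 : (c : ℝ) + 1 ≤ (((c / b : ℕ) : ℝ) + 1) * b := by
    exact_mod_cast Nat.lt_iff_add_one_le.mp (Nat.lt_mul_of_div_lt (Nat.lt_succ_self _) hb)
  refine Set.Ico_subset_Ico ?_ ?_
  · rw [div_le_div_iff₀ (by positivity) (by positivity), pow_succ]
    calc ((c / b : ℕ) : ℝ) * ((b : ℝ) ^ l * b) = ((c / b : ℕ) : ℝ) * b * (b : ℝ) ^ l := by ring
      _ ≤ _ := by gcongr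
  · rw [div_le_div_iff₀ (by positivity) (by positivity), pow_succ]
    calc ((c : ℝ) + 1) * (b : ℝ) ^ l ≤ (((c / b : ℕ) : ℝ) + 1) * b * (b : ℝ) ^ l := by gcongr
      _ = _ := by ring

lemma isPiecewise_cellStep :
    ∃ D, IsPiecewise (cellStep b l c) (|(b : ℝ) ^ (l + 1)| + |(b : ℝ) ^ l|) D := by
  have h : ∀ l c, (frontier (baseInterval b l c)).Countable := fun l c => by
    rw [baseInterval, frontier_Ico (baseInterval_lt hb l c)]
    exact Set.countable_insert.mpr (Set.countable_singleton _)
  exact ⟨_, ((IsPiecewise.const _).indicator measurableSet_Ico (h _ _)).sub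
    ((IsPiecewise.const _).indicator measurableSet_Ico (h _ _))⟩

lemma cellStep_eq_zero {u : ℝ} (hu : u ∉ baseInterval b l (c / b)) : cellStep b l c u = 0 := by
  rw [cellStep, Set.indicator_of_notMem hu,
    Set.indicator_of_notMem fun h => hu (baseInterval_succ_subset hb l c h), sub_zero]

lemma abs_cellStep_le (u : ℝ) : |cellStep b l c u| ≤ (b : ℝ) ^ (l + 1) := by
  have h1 : (1 : ℝ) ≤ b := by exact_mod_cast hb
  have h2 : (b : ℝ) ^ l ≤ (b : ℝ) ^ (l + 1) := pow_le_pow_right₀ h1 (by omega)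
  have h3 : (0 : ℝ) < (b : ℝ) ^ l := by positivity
  rw [cellStep, abs_le]
  by_cases hu : u ∈ baseInterval b (l + 1) c
  · rw [Set.indicator_of_mem hu, Set.indicator_of_mem (baseInterval_succ_subset hb l c hu)]
    constructor <;> linarith
  · rw [Set.indicator_of_notMem hu]
    by_cases hu' : u ∈ baseInterval b l (c / b)
    · rw [Set.indicator_of_mem hu']
      constructor <;> linarith
    · rw [Set.indicator_of_notMem hu']
      constructor <;> linarith

end

lemma integral_indicator_Ico {x y u a : ℝ} (hx : 0 ≤ x) (hu : 0 ≤ u) :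
    ∫ t in (0 : ℝ)..u, (Set.Ico x y).indicator (fun _ => a) t = a * max (min u y - x) 0 := by
  rw [intervalIntegral.integral_of_le hu, ← integral_Ico_eq_integral_Ioc,
    setIntegral_indicator measurableSet_Ico, Set.Ico_inter_Ico, setIntegral_const,
    max_eq_right hx, Measure.real, Real.volume_Ico, ENNReal.toReal_ofReal', smul_eq_mul, mul_comm]

section

variable {b : ℕ} (hb : 0 < b) (l c : ℕ)

include hb

lemma antideriv_cellStep {u : ℝ} (hu : 0 ≤ u) :
    antideriv (cellStep b l c) u =
      (b : ℝ) ^ (l + 1) * max (min u (((c : ℝ) + 1) / (b : ℝ) ^ (l + 1)) -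
        (c : ℝ) / (b : ℝ) ^ (l + 1)) 0 -
      (b : ℝ) ^ l * max (min u ((((c / b : ℕ) : ℝ) + 1) / (b : ℝ) ^ l) -
        ((c / b : ℕ) : ℝ) / (b : ℝ) ^ l) 0 := by
  have hi : ∀ (x y a : ℝ), IntervalIntegrable ((Set.Ico x y).indicator fun _ => a) volume 0 u := by
    intro x y a
    exact (intervalIntegrable_const (c := |a|)).mono_fun
      ((measurable_const.indicator measurableSet_Ico).aestronglyMeasurable)
      (Eventually.of_forall fun t => by
        by_cases h : t ∈ Set.Ico x y <;> simp [h])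
  rw [antideriv, ← integral_indicator_Ico (a := (b : ℝ) ^ (l + 1)) (by positivity) hu,
    ← integral_indicator_Ico (a := (b : ℝ) ^ l) (by positivity) hu,
    ← intervalIntegral.integral_sub (hi _ _ _) (hi _ _ _)]
  rfl

lemma mul_max_min_baseInterval (u : ℝ) :
    (b : ℝ) ^ l * max (min u (((c : ℝ) + 1) / (b : ℝ) ^ l) - (c : ℝ) / (b : ℝ) ^ l) 0 =
      max (min (u * (b : ℝ) ^ l - c) 1) 0 := by
  have h : (0 : ℝ) < (b : ℝ) ^ l := by positivity
  rw [mul_max_of_nonneg _ _ h.le, mul_zero, mul_sub, mul_min_of_nonneg _ _ h.le,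
    mul_div_cancel₀ _ h.ne', mul_div_cancel₀ _ h.ne', ← min_sub_sub_right, add_sub_cancel_left,
    mul_comm]

/-- The antiderivative is a difference of two clamped linear functions with values in `[0,1]`. -/
lemma abs_antideriv_cellStep_le {u : ℝ} (hu : 0 ≤ u) : |antideriv (cellStep b l c) u| ≤ 1 := by
  rw [antideriv_cellStep hb l c hu, mul_max_min_baseInterval hb, mul_max_min_baseInterval hb]
  have h : ∀ a : ℝ, 0 ≤ max (min a 1) 0 ∧ max (min a 1) 0 ≤ 1 := fun a =>
    ⟨le_max_right _ _, max_le (min_le_right _ _) zero_le_one⟩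
  have h1 := h (u * (b : ℝ) ^ (l + 1) - c)
  have h2 := h (u * (b : ℝ) ^ l - (c / b : ℕ))
  rw [abs_le]
  constructor <;> linarith

lemma antideriv_cellStep_eq_zero {u : ℝ} (hu : 0 ≤ u) (hI : u ∉ baseInterval b l (c / b)) :
    antideriv (cellStep b l c) u = 0 := by
  have hsub := baseInterval_succ_subset hb l c
  rw [baseInterval, baseInterval, Set.Ico_subset_Ico_iff (baseInterval_lt hb _ _)] at hsub
  rw [antideriv_cellStep hb l c hu, mul_max_min_baseInterval hb, mul_max_min_baseInterval hb]
  have h : ∀ l, (0 : ℝ) < (b : ℝ) ^ l := fun l => by positivity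
  have hI' : u < ((c / b : ℕ) : ℝ) / (b : ℝ) ^ l ∨ (((c / b : ℕ) : ℝ) + 1) / (b : ℝ) ^ l ≤ u := by
    by_contra hcon
    push Not at hcon
    exact hI ⟨hcon.1, hcon.2⟩
  rcases hI' with h1 | h1
  · have h2 := h1.trans_le hsub.1
    rw [lt_div_iff₀ (h _)] at h1 h2
    rw [max_eq_right ((min_le_left _ _).trans (by linarith)),
      max_eq_right ((min_le_left _ _).trans (by linarith)), sub_zero]
  · have h2 := hsub.2.trans h1
    rw [div_le_iff₀ (h _)] at h1 h2
    rw [min_eq_right (by linarith), min_eq_right (by linarith), sub_self]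

lemma div_lt_pow {c : ℕ} (hc : c < b ^ (l + 1)) : c / b < b ^ l :=
  Nat.div_lt_of_lt_mul (by rwa [pow_succ, mul_comm] at hc)

omit hb in
lemma baseInterval_subset {e : ℕ} (he : e < b ^ l) : baseInterval b l e ⊆ Set.Ico 0 1 := by
  refine Set.Ico_subset_Ico (by positivity) ?_
  have : ((e : ℝ) + 1) ≤ (b : ℝ) ^ l := by exact_mod_cast he
  exact div_le_one_of_le₀ this (by positivity)

lemma antideriv_cellStep_one {c : ℕ} (hc : c < b ^ (l + 1)) :
    antideriv (cellStep b l c) 1 = 0 :=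
  antideriv_cellStep_eq_zero hb l c zero_le_one fun h =>
    lt_irrefl _ (baseInterval_subset l (div_lt_pow hb l hc) h).2

lemma volume_baseInterval : volume (baseInterval b l c) = ENNReal.ofReal ((b : ℝ) ^ l)⁻¹ := by
  rw [baseInterval, Real.volume_Ico, ← sub_div, add_sub_cancel_left, one_div]

end

lemma haar_succ_digits {b : ℕ} [NeZero b] (l c : ℕ) {u : ℝ} (hu : u ∈ Set.Ico (0 : ℝ) 1) :
    haar (l + 1) c (Real.digits u b) = cellStep b l c u := by
  simp only [haar, cellStep, Set.indicator_apply, baseInterval]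
  simp only [← prefixVal_digits_eq_iff hu]
  split_ifs <;> simp

end

end BDIS

open MeasureTheory

namespace BDIS

noncomputable section

open Filter Topology

/-! ### Splitting a Haar function composed with the inverse transport -/

/-- `ρ` is the sum of a function `A` that is the derivative of some `B` and of a remainder, where
`B` and the remainder vanish off `I` and have norms at most `N`. -/
def IsSplit (φ : ℝ → ℝ) (r : ℝ) (ρ : ℝ → ℝ) (I : Set ℝ) (N : ℝ) : Prop :=
  ∃ B A A₀ : ℝ → ℝ, IsTestLimit φ r B A ∧ MemLine φ r A₀ ∧ (∀ x, ρ x = A x + A₀ x) ∧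
    (∀ x, x ∉ I → B x = 0 ∧ A₀ x = 0) ∧ lineNorm φ r B ≤ N ∧ lineNorm φ r A₀ ≤ N

/-- The distance of a cell of level `l` from the boundary of `[0,1]`, but not less than `θ` and
the length of the cell. -/
def cellScale (b l : ℕ) (θ : ℝ) (e : ℕ) : ℝ :=
  max (max θ ((b : ℝ) ^ l)⁻¹) (((min e (b ^ l - 1 - e) : ℕ) : ℝ) * ((b : ℝ) ^ l)⁻¹)

lemma cellScale_pos {b l : ℕ} {θ : ℝ} (hθ : 0 < θ) (e : ℕ) : 0 < cellScale b l θ e :=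
  lt_max_of_lt_left (lt_max_of_lt_left hθ)

lemma min_mul_le_of_mem_baseInterval {b l : ℕ} (hb : 0 < b) {e : ℕ} (he : e < b ^ l) {u : ℝ}
    (hu : u ∈ baseInterval b l e) :
    ((min e (b ^ l - 1 - e) : ℕ) : ℝ) * ((b : ℝ) ^ l)⁻¹ ≤ min u (1 - u) := by
  have hpos : (0 : ℝ) < (b : ℝ) ^ l := by positivity
  set H := ((b : ℝ) ^ l)⁻¹ with hH
  have hHpos : 0 < H := inv_pos.mpr hpos
  set d := min e (b ^ l - 1 - e) with hd
  have h1 : (d : ℝ) * H ≤ u := by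
    have : (d : ℝ) ≤ e := by exact_mod_cast min_le_left _ _
    have h2 := hu.1
    rw [div_eq_mul_inv] at h2
    exact (mul_le_mul_of_nonneg_right this hHpos.le).trans h2
  have h2 : (d : ℝ) * H ≤ 1 - u := by
    have h3 : d + (e + 1) ≤ b ^ l := by
      have : d ≤ b ^ l - 1 - e := min_le_right _ _
      omega
    have h3' : (d : ℝ) + ((e : ℝ) + 1) ≤ (b : ℝ) ^ l := by exact_mod_cast h3
    have h4 := hu.2
    rw [div_eq_mul_inv] at h4
    have h5 : ((d : ℝ) + ((e : ℝ) + 1)) * H ≤ 1 := by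
      rw [hH, ← div_eq_mul_inv]; exact div_le_one_of_le₀ h3' hpos.le
    linarith [add_mul (d : ℝ) ((e : ℝ) + 1) H]
  exact le_min h1 h2

/-- The excluded case is a boundary cell longer than `θ`: there `bdist` comes down to `θ`, while the
scale is the length of the cell. -/
lemma cellScale_le_bdist {b l : ℕ} {θ : ℝ} (hb : 0 < b) {e : ℕ} (he : e < b ^ l)
    (h : ((b : ℝ) ^ l)⁻¹ ≤ θ ∨ 0 < min e (b ^ l - 1 - e)) {u : ℝ} (hu : u ∈ baseInterval b l e) :
    cellScale b l θ e ≤ bdist θ u := by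
  have hpos : (0 : ℝ) < (b : ℝ) ^ l := by positivity
  set H := ((b : ℝ) ^ l)⁻¹ with hH
  have hHpos : 0 < H := inv_pos.mpr hpos
  set d := min e (b ^ l - 1 - e) with hd
  have h3 : (d : ℝ) * H ≤ min u (1 - u) := min_mul_le_of_mem_baseInterval hb he hu
  refine max_le (max_le (le_max_left _ _) ?_) (h3.trans (le_max_right _ _))
  rcases h with h | h
  · exact h.trans (le_max_left _ _)
  · refine le_trans ?_ (h3.trans (le_max_right _ _))
    have : (1 : ℝ) ≤ d := by exact_mod_cast h
    exact le_mul_of_one_le_left hHpos.le this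

section

variable {φ : ℝ → ℝ} (hφ : IsAdmissibleDensity φ) {q r : ℝ} (hqr : q.HolderConjugate r)
  {p : ℝ} (hp : 1 ≤ p)

include hφ

lemma isTestLimit_zero : IsTestLimit φ r (fun _ => 0) (fun _ => 0) := by
  have h0 : lineNorm φ r (fun _ => 0) = 0 := by
    rw [lineNorm, eLpNorm_zero', ENNReal.toReal_zero]
  refine ⟨MemLp.zero', MemLp.zero', fun ε hε => ⟨fun _ => 0, contDiff_const,
    HasCompactSupport.zero, ?_, ?_⟩⟩
  · simpa [overDensity, h0] using hε.le
  · simpa [overDensity, h0] using hε.le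

include hp

lemma lineNorm_antideriv_cellStep_le {θ : ℝ} (hθ : 0 < θ) (hθ2 : θ ≤ 1 / 2) (hr : 1 < r) {b : ℕ}
    (hb : 0 < b) (l : ℕ) {c : ℕ} (hc : c < b ^ (l + 1))
    (h : ((b : ℝ) ^ l)⁻¹ ≤ θ ∨ 0 < min (c / b) (b ^ l - 1 - c / b)) {ρ : ℝ → ℝ} {C a : ℝ}
    (hC : 0 < C) (ha : 0 ≤ a) (hρ : Measurable ((Set.Ioo (0 : ℝ) 1).indicator ρ))
    (hρC : ∀ u ∈ Set.Ioo (0 : ℝ) 1, |ρ u| ^ r * weight p θ u ≤ (C * bdist θ u ^ (-a)) ^ r) :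
    MemLine φ r (fun x => antideriv (cellStep b l c) (invTransport φ p θ x) *
        ρ (invTransport φ p θ x)) ∧
      lineNorm φ r (fun x => antideriv (cellStep b l c) (invTransport φ p θ x) *
        ρ (invTransport φ p θ x)) ≤
        C * cellScale b l θ (c / b) ^ (-a) * (((b : ℝ) ^ l)⁻¹) ^ (1 / r) := by
  obtain ⟨D, hD⟩ := isPiecewise_cellStep hb l c
  have hs := cellScale_pos (b := b) (l := l) hθ (c / b)
  have hr0 : 0 < r := by linarith
  refine lineNorm_comp_invTransport_le hφ hp hθ hθ2 hr0
    (g := fun u => antideriv (cellStep b l c) u * ρ u) ?_ (by positivity) (by positivity)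
    (measurableSet_baseInterval b l (c / b)) (volume_baseInterval hb l (c / b)).le
    (fun u hu hI => ?_) (fun u hu hI => ?_)
  · have h3 : (Set.Ioo (0 : ℝ) 1).indicator (fun u => antideriv (cellStep b l c) u * ρ u) =
        fun u => antideriv (cellStep b l c) u * (Set.Ioo (0 : ℝ) 1).indicator ρ u := by
      funext u; rw [Set.indicator_mul_right]
    rw [h3]
    exact hD.continuous_antideriv.measurable.mul hρ
  · have h1 := abs_antideriv_cellStep_le hb l c hu.1.le
    have hw := weight_nonneg hp hθ hθ2 u
    have hbd := bdist_pos hθ u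
    rw [abs_mul, Real.mul_rpow (abs_nonneg _) (abs_nonneg _), mul_assoc]
    refine (mul_le_of_le_one_left (mul_nonneg (by positivity) hw)
      (Real.rpow_le_one (abs_nonneg _) h1 hr0.le)).trans ((hρC u hu).trans ?_)
    refine Real.rpow_le_rpow (by positivity) (mul_le_mul_of_nonneg_left ?_ hC.le) hr0.le
    exact Real.rpow_le_rpow_of_nonpos hs
      (cellScale_le_bdist hb (div_lt_pow hb l hc) h hI) (by linarith)
  · rw [antideriv_cellStep_eq_zero hb l c hu.1.le hI, zero_mul]

include hqr

/-- With `Ψ` the antiderivative of the Haar function, take `B = (Ψ w / φ(T))(S)`, `A` its companion,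
and `A₀ = -(Ψ w'/w)(S)`. On the cell the two weighted bounds are uniform, so the norms are that
uniform bound times the `1/r`-th power of the cell length. -/
lemma exists_isSplit_cellStep {δ : ℝ} (hδ : 0 < δ) (hδr : δ < 1 / r) {b : ℕ} (hb : 0 < b) :
    ∃ C, 0 < C ∧ ∀ θ : ℝ, 0 < θ → θ ≤ 1 / 2 → ∀ l c : ℕ, c < b ^ (l + 1) →
      IsSplit φ r (fun x => cellStep b l c (invTransport φ p θ x))
        (invTransport φ p θ ⁻¹' baseInterval b l (c / b))
        (C * cellScale b l θ (c / b) ^ (-(1 + δ)) * (((b : ℝ) ^ l)⁻¹) ^ (1 / r)) := by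
  have hr : 1 < r := hqr.symm.lt
  have hr0 : 0 < r := by linarith
  have hbR : (1 : ℝ) ≤ b := by exact_mod_cast hb
  obtain ⟨C₁, hC₁, h₁⟩ := exists_logWeightDeriv_le hp hr hδ.le
  obtain ⟨C₂, hC₂, h₂⟩ := exists_weightRatio_le hφ hp hr hδ hδr
  refine ⟨C₁ + C₂ + 2 * b, by positivity, fun θ hθ hθ2 l c hc => ?_⟩
  set e := c / b with he
  have hs := cellScale_pos (b := b) (l := l) hθ e
  have hHpos : (0 : ℝ) < ((b : ℝ) ^ l)⁻¹ := by positivity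
  set X := cellScale b l θ e ^ (-(1 + δ)) with hX
  have hXpos : 0 < X := Real.rpow_pos_of_pos hs _
  set Y := (((b : ℝ) ^ l)⁻¹) ^ (1 / r) with hY
  have hYpos : 0 < Y := Real.rpow_pos_of_pos hHpos _
  have hmono : ∀ {K : ℝ}, K ≤ C₁ + C₂ + 2 * b → K * X * Y ≤ (C₁ + C₂ + 2 * b) * X * Y := by
    intro K hK
    gcongr
  obtain ⟨D, hD⟩ := isPiecewise_cellStep hb l c
  by_cases hcase : ((b : ℝ) ^ l)⁻¹ ≤ θ ∨ 0 < min e (b ^ l - 1 - e)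
  · have hL := lineNorm_antideriv_cellStep_le hφ hp hθ hθ2 hr hb l hc hcase hC₁
      (show 0 ≤ 1 + δ by linarith)
      ((measurable_logWeightDeriv hp hθ hθ2).indicator measurableSet_Ioo) (h₁ θ hθ hθ2)
    have hR := lineNorm_antideriv_cellStep_le hφ hp hθ hθ2 hr hb l hc hcase hC₂
      (show 0 ≤ 1 + δ by linarith)
      (measurable_indicator_weightRatio hφ hp hθ hθ2) (h₂ θ hθ hθ2)
    refine ⟨_, _, fun x => (-1) * antiderivLog p θ (cellStep b l c) (invTransport φ p θ x),
      isTestLimit_antideriv_comp hφ hqr hp hθ hθ2 hD (antideriv_cellStep_one hb l hc),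
      hL.1.const_mul _, fun x => by ring, fun x hx => ?_, hR.2.trans (hmono (by linarith)), ?_⟩
    · have := antideriv_cellStep_eq_zero hb l c (invTransport_mem hφ hp hθ hθ2 x).1.le hx
      simp [antiderivRatio, antiderivLog, this]
    · rw [lineNorm_const_mul, abs_neg, abs_one, one_mul]
      exact hL.2.trans (hmono (by linarith))
  -- Boundary cell longer than `θ`: nothing is integrated by parts, and the Haar function itself is
  -- the remainder `A₀`.
  · push Not at hcase
    obtain ⟨hH, hd⟩ := hcase
    have hd0 : min e (b ^ l - 1 - e) = 0 := Nat.le_zero.mp hd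
    have hscale : cellScale b l θ e = ((b : ℝ) ^ l)⁻¹ := by
      rw [cellScale, hd0, Nat.cast_zero, zero_mul, max_eq_right hH.le, max_eq_left hHpos.le]
    have hkey := lineNorm_comp_invTransport_le hφ hp hθ hθ2 hr0 (g := cellStep b l c)
      (K := 2 * (b : ℝ) ^ (l + 1)) (hD.measurable.indicator measurableSet_Ioo) (by positivity)
      (by positivity)
      (measurableSet_baseInterval b l e) (volume_baseInterval hb l e).le
      (fun u hu hI => by
        have h1 := abs_cellStep_le hb l c u
        rw [Real.mul_rpow two_pos.le (by positivity), mul_comm]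
        refine mul_le_mul ((weight_le_two hp hθ hθ2 u).trans ?_)
          (Real.rpow_le_rpow (abs_nonneg _) h1 hr0.le) (by positivity) (by positivity)
        exact Real.self_le_rpow_of_one_le one_le_two hr.le)
      (fun u hu hI => cellStep_eq_zero hb l c hI)
    refine ⟨fun _ => 0, fun _ => 0, _, isTestLimit_zero hφ, hkey.1, fun x => by rw [zero_add],
      fun x hx => ⟨rfl, cellStep_eq_zero hb l c hx⟩, ?_, hkey.2.trans (le_trans ?_
        (hmono (K := 2 * b) (by linarith)))⟩
    · rw [lineNorm, eLpNorm_zero', ENNReal.toReal_zero]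
      positivity
    -- The scale is the cell length here, so the size `b^(l+1)` of the Haar function already fits
    -- the bound.
    · have h1 : (b : ℝ) ^ l ≤ X := by
        rw [hX, hscale, Real.rpow_neg hHpos.le, ← Real.inv_rpow hHpos.le, inv_inv]
        exact Real.self_le_rpow_of_one_le (one_le_pow₀ hbR) (by linarith)
      rw [pow_succ, ← hY]
      have : 2 * ((b : ℝ) ^ l * b) ≤ 2 * b * X := by
        calc 2 * ((b : ℝ) ^ l * b) = 2 * b * (b : ℝ) ^ l := by ring
          _ ≤ _ := by gcongr
      gcongr

end

end

end BDIS

open MeasureTheory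

namespace BDIS

noncomputable section

open Filter Topology

/-! ### Sums over the cells of one level -/

lemma sum_range_mul_div {b : ℕ} (hb : 0 < b) (n : ℕ) (F : ℕ → ℝ) :
    ∑ c ∈ Finset.range (n * b), F (c / b) = b * ∑ e ∈ Finset.range n, F e := by
  induction n with
  | zero => simp
  | succ n ih =>
    rw [Nat.succ_mul, Finset.sum_range_add, ih, Finset.sum_range_succ, mul_add]
    congr 1
    rw [Finset.sum_congr rfl (g := fun _ => F n), Finset.sum_const, Finset.card_range, nsmul_eq_mul]
    intro c hc
    rw [mul_comm n b, Nat.mul_add_div hb, Nat.div_eq_of_lt (Finset.mem_range.mp hc), add_zero]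

lemma sum_range_min_le (M : ℕ) {g : ℕ → ℝ} (hg : ∀ i, 0 ≤ g i) :
    ∑ e ∈ Finset.range M, g (min e (M - 1 - e)) ≤ 2 * ∑ i ∈ Finset.range M, g i := by
  have h : ∑ e ∈ Finset.range M, g (min e (M - 1 - e)) ≤
      ∑ e ∈ Finset.range M, (g e + g (M - 1 - e)) := by
    refine Finset.sum_le_sum fun e _ => ?_
    rcases min_choice e (M - 1 - e) with h | h <;> rw [h]
    · linarith [hg (M - 1 - e)]
    · linarith [hg e]
  rw [Finset.sum_add_distrib, Finset.sum_range_reflect] at h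
  linarith

/-- Each term is dominated by a difference of consecutive values of `8 (y + iH)⁻¹`; the condition `H
≤ y` makes the term `i = 0` harmless. -/
lemma sum_inv_sq_max_le {H y : ℝ} (hH : 0 < H) (hy : H ≤ y) (M : ℕ) :
    ∑ i ∈ Finset.range M, H * ((max y (i * H)) ^ 2)⁻¹ ≤ 8 * y⁻¹ := by
  have hy0 : 0 < y := hH.trans_le hy
  have hterm : ∀ i : ℕ, H * ((max y (i * H)) ^ 2)⁻¹ ≤
      8 * (y + i * H)⁻¹ - 8 * (y + ((i + 1 : ℕ) : ℝ) * H)⁻¹ := by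
    intro i
    set m := max y (i * H) with hm
    have hm0 : 0 < m := lt_max_of_lt_left hy0
    have h1 : y ≤ m := le_max_left _ _
    have h2 : i * H ≤ m := le_max_right _ _
    have hiH : 0 ≤ (i : ℝ) * H := by positivity
    set a := y + i * H with ha
    have ha0 : 0 < a := by positivity
    have e1 : y + ((i + 1 : ℕ) : ℝ) * H = a + H := by rw [ha]; push_cast; ring
    have e2 : 8 * a⁻¹ - 8 * (a + H)⁻¹ = 8 * H / (a * (a + H)) := by
      field_simp
      ring
    rw [e1, e2, ← div_eq_mul_inv, div_le_div_iff₀ (by positivity) (by positivity)]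
    have h3 : a ≤ 2 * m := by linarith
    have h4 : a + H ≤ 4 * m := by linarith
    calc H * (a * (a + H)) ≤ H * ((2 * m) * (4 * m)) := by gcongr
      _ = 8 * H * m ^ 2 := by ring
  refine (Finset.sum_le_sum fun i _ => hterm i).trans ?_
  rw [Finset.sum_range_sub' (fun i : ℕ => 8 * (y + (i : ℝ) * H)⁻¹)]
  have : 0 ≤ 8 * (y + (M : ℝ) * H)⁻¹ := by positivity
  simp only [Nat.cast_zero, zero_mul, add_zero]
  linarith

lemma sum_indicator_baseInterval_le {b : ℕ} (hb : 0 < b) (l M : ℕ) {g : ℕ → ℝ} {K : ℝ}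
    (hK : 0 ≤ K) (hg : ∀ e, g e ≤ K) (u : ℝ) :
    ∑ e ∈ Finset.range M, (baseInterval b l e).indicator (fun _ => g e) u ≤ K := by
  have hpos : (0 : ℝ) < (b : ℝ) ^ l := by positivity
  have h : ∀ e, (baseInterval b l e).indicator (fun _ => g e) u ≤
      if e = ⌊u * (b : ℝ) ^ l⌋₊ then K else 0 := by
    intro e
    by_cases hu : u ∈ baseInterval b l e
    · rw [Set.indicator_of_mem hu, if_pos]
      · exact hg e
      · rw [baseInterval, Set.mem_Ico, div_le_iff₀ hpos, lt_div_iff₀ hpos] at hu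
        exact ((Nat.floor_eq_iff ((Nat.cast_nonneg e).trans hu.1)).mpr hu).symm
    · rw [Set.indicator_of_notMem hu]
      split_ifs <;> simp [hK]
  refine (Finset.sum_le_sum fun e _ => h e).trans ?_
  rw [Finset.sum_ite_eq']
  split_ifs <;> simp [hK]

lemma rpow_neg_le_rpow_neg {y θ β ν : ℝ} (hθ : 0 < θ) (hθy : θ ≤ y) (hy : y ≤ 1) (hβ : β ≤ ν)
    (hν : 0 ≤ ν) : y ^ (-β) ≤ θ ^ (-ν) := by
  rcases le_total 0 β with h | h
  · exact (Real.rpow_le_rpow_of_nonpos hθ hθy (by linarith)).trans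
      (Real.rpow_le_rpow_of_exponent_ge hθ (hθy.trans hy) (by linarith))
  · exact (Real.rpow_le_one (hθ.trans_le hθy).le hy (by linarith)).trans
      (Real.one_le_rpow_of_pos_of_le_one_of_nonpos hθ (hθy.trans hy) (by linarith))

lemma nu_nonneg {α q : ℝ} (hα : 0 ≤ α) (hq : 0 ≤ q) : 0 ≤ nu α q :=
  le_max_of_le_left (by positivity)

/-- Because `H ≤ y`, the factor `(H/y)^(E-α)` is at most 1; there remains `H^α` and the power `-(2/q
+ α - 1)` of `y`. If that power is not negative it is simply bounded by 1, which is allowed since `ν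
≥ 0`. -/
lemma rpow_mul_rpow_le_nu {α q H θ y E κ : ℝ} (hα : 0 ≤ α) (hq : 0 ≤ q) (hH : 0 < H) (hHy : H ≤ y)
    (hθ : 0 < θ) (hθy : θ ≤ y) (hy : y ≤ 1) (hE : α ≤ E) (hκ : κ = E - 1 + 2 / q) :
    H ^ E * y ^ (-κ) ≤ H ^ α * θ ^ (-nu α q) := by
  have hy0 : 0 < y := hH.trans_le hHy
  have e1 : H ^ E = H ^ α * H ^ (E - α) := by rw [← Real.rpow_add hH]; congr 1; ring
  have e2 : y ^ (-κ) = y ^ (-(E - α)) * y ^ (-(2 / q + α - 1)) := by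
    rw [← Real.rpow_add hy0, hκ]; congr 1; ring
  have h1 : H ^ (E - α) * y ^ (-(E - α)) ≤ 1 := by
    rw [Real.rpow_neg hy0.le, ← div_eq_mul_inv]
    exact div_le_one_of_le₀ (Real.rpow_le_rpow hH.le hHy (by linarith)) (by positivity)
  rw [e1, e2, mul_assoc, ← mul_assoc (H ^ (E - α))]
  refine mul_le_mul_of_nonneg_left ?_ (by positivity)
  refine (mul_le_of_le_one_left (by positivity) h1).trans ?_
  exact rpow_neg_le_rpow_neg hθ hθy hy (le_max_right _ _) (nu_nonneg hα hq)

section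

variable {φ : ℝ → ℝ} (hφ : IsAdmissibleDensity φ) {q r : ℝ} (hqr : q.HolderConjugate r)
  {p : ℝ} (hp : 1 ≤ p)

include hφ hqr hp

/-- The bounds for the pieces of the Haar functions of one level, summed over the cells. -/
lemma exists_isSplit_sum_le {α ε : ℝ} (hα : 0 < α) (hα1 : α < 1) (hε : 0 < ε) {b : ℕ} (hb : 0 < b) :
    ∃ K, 0 < K ∧ ∀ θ : ℝ, 0 < θ → θ ≤ 1 / 2 → ∀ l : ℕ, ∃ N : ℕ → ℝ, (∀ c, 0 ≤ N c) ∧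
      (∀ c, c < b ^ (l + 1) → IsSplit φ r (fun x => cellStep b l c (invTransport φ p θ x))
        (invTransport φ p θ ⁻¹' baseInterval b l (c / b)) (N c)) ∧
      (2 ≤ q → ∑ c ∈ Finset.range (b ^ (l + 1)), ((b : ℝ) ^ (l + 1))⁻¹ * N c ^ 2 ≤
          K * (((b : ℝ) ^ (l + 1))⁻¹ ^ α * θ ^ (-nu α q - ε))) ∧
        (∀ u, ∑ c ∈ Finset.range (b ^ (l + 1)),
          (baseInterval b l (c / b)).indicator (fun _ => ((b : ℝ) ^ (l + 1))⁻¹ * N c ^ 2) u ≤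
          K * (((b : ℝ) ^ (l + 1))⁻¹ ^ α * θ ^ (-nu α q - ε))) := by
  have hr : 1 < r := hqr.symm.lt
  have hr0 : 0 < r := by linarith
  have hq0 : 0 < q := hqr.pos
  have hrq : 1 / r = 1 - 1 / q := by
    have := hqr.inv_add_inv_eq_one
    rw [one_div, one_div]; linarith
  have hbR : (0 : ℝ) < b := by exact_mod_cast hb
  -- `2δ ≤ ε` turns the loss `y^(-2δ)` into `θ^(-ε)`, and `δ < 1/r` is required for the splitting.
  set δ := min (ε / 2) (1 / (2 * r)) with hδdef
  have hδ : 0 < δ := lt_min (by positivity) (by positivity)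
  have hδε : 2 * δ ≤ ε := by have := min_le_left (ε / 2) (1 / (2 * r)); linarith
  have hδr : δ < 1 / r := (min_le_right _ _).trans_lt (by
    rw [div_lt_div_iff₀ (by positivity) hr0]; linarith)
  obtain ⟨C, hC, h⟩ := exists_isSplit_cellStep hφ hqr hp hδ hδr hb
  refine ⟨16 * C ^ 2 * (b : ℝ) ^ α, by positivity, fun θ hθ hθ2 l => ?_⟩
  set T := ((b : ℝ) ^ (l + 1))⁻¹ with hT
  set H := ((b : ℝ) ^ l)⁻¹ with hH
  have hHpos : 0 < H := by positivity
  have hTpos : 0 < T := by positivity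
  have hHT : H = b * T := by rw [hH, hT, pow_succ]; field_simp
  have hH1 : H ≤ 1 := inv_le_one_of_one_le₀ (one_le_pow₀ (by exact_mod_cast hb))
  have hHα : (b : ℝ) ^ α * T ^ α = H ^ α := by rw [hHT, Real.mul_rpow hbR.le hTpos.le]
  set y := max θ H with hy
  have hy0 : 0 < y := lt_max_of_lt_left hθ
  have hθy : θ ≤ y := le_max_left _ _
  have hHy : H ≤ y := le_max_right _ _
  have hy1 : y ≤ 1 := max_le (by linarith) hH1
  have hyδ : y ^ (-(2 * δ)) ≤ θ ^ (-ε) := rpow_neg_le_rpow_neg hθ hθy hy1 hδε hε.le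
  set S := cellScale b l θ with hS
  have hSpos : ∀ e, 0 < S e := fun e => cellScale_pos hθ e
  have hyS : ∀ e, y ≤ S e := fun e => le_max_left _ _
  set N : ℕ → ℝ := fun c => C * S (c / b) ^ (-(1 + δ)) * H ^ (1 / r) with hN
  have hN0 : ∀ c, 0 ≤ N c := fun c => by have := hSpos (c / b); positivity
  have hNsq : ∀ c, N c ^ 2 ≤ C ^ 2 * H ^ (2 - 2 / q) * θ ^ (-ε) * (S (c / b) ^ 2)⁻¹ := by
    intro c
    have hs := hSpos (c / b)
    have e1 : N c ^ 2 = C ^ 2 * H ^ (2 - 2 / q) * S (c / b) ^ (-(2 * δ)) * (S (c / b) ^ 2)⁻¹ := by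
      have e2 : (S (c / b) ^ (-(1 + δ))) ^ 2 = S (c / b) ^ (-(2 * δ)) * (S (c / b) ^ 2)⁻¹ := by
        rw [← Real.rpow_natCast, ← Real.rpow_natCast, ← Real.rpow_mul hs.le, ← Real.rpow_neg hs.le,
          ← Real.rpow_add hs]
        congr 1; push_cast; ring
      have e3 : (H ^ (1 / r)) ^ 2 = H ^ (2 - 2 / q) := by
        rw [← Real.rpow_natCast, ← Real.rpow_mul hHpos.le, hrq]
        congr 1; push_cast; ring
      simp only [hN]
      rw [mul_pow, mul_pow, e2, e3]; ring
    rw [e1]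
    gcongr
    exact (Real.rpow_le_rpow_of_nonpos hy0 (hyS _) (by linarith)).trans hyδ
  have hfin : ∀ {E κ : ℝ}, α ≤ E → κ = E - 1 + 2 / q →
      C ^ 2 * 16 * (H ^ E * y ^ (-κ)) * θ ^ (-ε) ≤
        16 * C ^ 2 * (b : ℝ) ^ α * (T ^ α * θ ^ (-nu α q - ε)) := by
    intro E κ hE hκ
    have h1 := rpow_mul_rpow_le_nu hα.le hq0.le hHpos hHy hθ hθy hy1 hE hκ
    calc C ^ 2 * 16 * (H ^ E * y ^ (-κ)) * θ ^ (-ε)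
        ≤ C ^ 2 * 16 * (H ^ α * θ ^ (-nu α q)) * θ ^ (-ε) := by gcongr
      _ = _ := by
        rw [← hHα, sub_eq_add_neg, Real.rpow_add hθ]; ring
  refine ⟨N, hN0, fun c hc => h θ hθ hθ2 l c hc, ?_⟩
  refine ⟨fun hq => ?_, fun u => ?_⟩
  -- The squares of the norms are summed over all cells: `H^(2/r) = H^(2-2/q)`, and the sum of
  -- inverse squared scales, weighted by `H`, contributes `y⁻¹`.
  · have h2q : 2 / q ≤ 1 := by rw [div_le_one hq0]; exact hq
    refine le_trans ?_ (hfin (E := 2 - 2 / q) (κ := 1) (by linarith) (by ring))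
    have e1 : ∑ c ∈ Finset.range (b ^ (l + 1)), T * N c ^ 2 ≤
        ∑ c ∈ Finset.range (b ^ l * b), T * (C ^ 2 * H ^ (2 - 2 / q) * θ ^ (-ε)) *
          (S (c / b) ^ 2)⁻¹ := by
      rw [← pow_succ]
      refine Finset.sum_le_sum fun c _ => ?_
      rw [mul_assoc]
      exact mul_le_mul_of_nonneg_left (hNsq c) hTpos.le
    refine e1.trans ?_
    rw [sum_range_mul_div hb (b ^ l) (fun e => T * (C ^ 2 * H ^ (2 - 2 / q) * θ ^ (-ε)) *
      (S e ^ 2)⁻¹), ← Finset.mul_sum]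
    have e2 : ∑ e ∈ Finset.range (b ^ l), H * (S e ^ 2)⁻¹ ≤ 16 * y⁻¹ := by
      have := sum_range_min_le (b ^ l) (g := fun i : ℕ => H * ((max y (i * H)) ^ 2)⁻¹)
        (fun i => by positivity)
      have h2 := sum_inv_sq_max_le hHpos hHy (b ^ l)
      refine this.trans ?_
      linarith
    rw [← Finset.mul_sum] at e2
    calc (b : ℝ) * (T * (C ^ 2 * H ^ (2 - 2 / q) * θ ^ (-ε)) *
          ∑ e ∈ Finset.range (b ^ l), (S e ^ 2)⁻¹)
        = (C ^ 2 * H ^ (2 - 2 / q) * θ ^ (-ε)) * (H * ∑ e ∈ Finset.range (b ^ l), (S e ^ 2)⁻¹) := by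
          rw [hHT]; ring
      _ ≤ (C ^ 2 * H ^ (2 - 2 / q) * θ ^ (-ε)) * (16 * y⁻¹) := by gcongr
      _ = _ := by rw [Real.rpow_neg_one]; ring
  -- At a fixed `u` only the children of one parent cell count, so a maximum replaces the sum: one
  -- more factor `H`, and `y⁻²` in place of `y⁻¹`.
  · have h2q : 2 / q ≤ 2 := by rw [div_le_iff₀ hq0]; linarith [hqr.lt]
    refine le_trans ?_ (hfin (E := 3 - 2 / q) (κ := 2) (by linarith) (by ring))
    set K := T * (C ^ 2 * H ^ (2 - 2 / q) * θ ^ (-ε) * y ^ (-2 : ℝ)) with hK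
    have hK0 : 0 ≤ K := by positivity
    have hNK : ∀ c, T * N c ^ 2 ≤ K := by
      intro c
      refine mul_le_mul_of_nonneg_left ((hNsq c).trans ?_) hTpos.le
      gcongr
      rw [Real.rpow_neg hy0.le, Real.rpow_two]
      gcongr
      exact hyS _
    have e1 : ∑ c ∈ Finset.range (b ^ (l + 1)),
        (baseInterval b l (c / b)).indicator (fun _ => T * N c ^ 2) u ≤
        ∑ c ∈ Finset.range (b ^ l * b), (baseInterval b l (c / b)).indicator (fun _ => K) u := by
      rw [← pow_succ]
      exact Finset.sum_le_sum fun c _ => Set.indicator_le_indicator (hNK c)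
    refine e1.trans ?_
    rw [sum_range_mul_div hb (b ^ l) (fun e => (baseInterval b l e).indicator (fun _ => K) u)]
    calc (b : ℝ) * ∑ e ∈ Finset.range (b ^ l), (baseInterval b l e).indicator (fun _ => K) u
        ≤ b * K := by
          gcongr
          exact sum_indicator_baseInterval_le hb l _ hK0 (fun _ => le_rfl) u
      _ = C ^ 2 * 1 * (H ^ (3 - 2 / q) * y ^ (-2 : ℝ)) * θ ^ (-ε) := by
          have : H ^ (3 - 2 / q) = H * H ^ (2 - 2 / q) := by
            rw [← Real.rpow_one_add' hHpos.le (by linarith)]; congr 1; ring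
          rw [this, hK]
          nth_rewrite 2 [hHT]
          ring
      _ ≤ _ := by gcongr; norm_num

end

end

end BDIS

open MeasureTheory

namespace BDIS

noncomputable section

open Filter Topology

/-! ### Means of the Haar functions -/

section

variable {b : ℕ} (hb : 0 < b) (l c : ℕ)

include hb

lemma integrable_cellStep : Integrable (cellStep b l c) := by
  have h : ∀ l c, ∀ a : ℝ, Integrable ((baseInterval b l c).indicator fun _ => a) := fun l c a =>
    (integrable_indicator_iff (measurableSet_baseInterval b l c)).mpr
      (integrableOn_const (by rw [volume_baseInterval hb]; exact ENNReal.ofReal_ne_top))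
  exact (h _ _ _).sub (h _ _ _)

lemma integral_cellStep : ∫ u, cellStep b l c u = 0 := by
  have hi : ∀ l c, ∀ a : ℝ, Integrable ((baseInterval b l c).indicator fun _ => a) := fun l c a =>
    (integrable_indicator_iff (measurableSet_baseInterval b l c)).mpr
      (integrableOn_const (by rw [volume_baseInterval hb]; exact ENNReal.ofReal_ne_top))
  have h : ∀ l c, ∫ u, (baseInterval b l c).indicator (fun _ => (b : ℝ) ^ l) u = 1 := by
    intro l c
    have hpos : (0 : ℝ) < (b : ℝ) ^ l := by positivity
    rw [integral_indicator_const _ (measurableSet_baseInterval b l c), Measure.real,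
      volume_baseInterval hb, ENNReal.toReal_ofReal (by positivity), smul_eq_mul,
      inv_mul_cancel₀ hpos.ne']
  simp only [cellStep]
  rw [integral_sub (hi _ _ _) (hi _ _ _), h, h, sub_self]

/-- A Haar function has mean zero, so any constant `κ` may be subtracted from `w`. -/
lemma abs_integral_cellStep_mul_le {w : ℝ → ℝ} (hw : Continuous w) {W : ℝ} (hW : ∀ u, |w u| ≤ W)
    (κ : ℝ) {E : Set ℝ} (hE : MeasurableSet E) {V D : ℝ} (hV : 0 ≤ V)
    (hEV : volume E ≤ ENNReal.ofReal V) (hD : 0 ≤ D)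
    (h1 : ∀ u ∈ baseInterval b l (c / b), u ∈ E → |w u - κ| ≤ D)
    (h0 : ∀ u ∈ baseInterval b l (c / b), u ∉ E → w u = κ) :
    |∫ u, cellStep b l c u * w u| ≤ (b : ℝ) ^ (l + 1) * D * V := by
  have hi := integrable_cellStep hb l c
  have e : ∫ u, cellStep b l c u * w u = ∫ u, cellStep b l c u * (w u - κ) := by
    simp only [mul_sub]
    rw [integral_sub (hi.mul_bdd (c := W) hw.aestronglyMeasurable (Eventually.of_forall hW))
      (hi.mul_const κ), integral_mul_const, integral_cellStep hb, zero_mul, sub_zero]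
  have hEtop : volume E ≠ ⊤ := (hEV.trans_lt ENNReal.ofReal_lt_top).ne
  have hb0 : (0 : ℝ) ≤ (b : ℝ) ^ (l + 1) * D := by positivity
  rw [e, ← Real.norm_eq_abs]
  refine (norm_integral_le_of_norm_le (g := E.indicator fun _ => (b : ℝ) ^ (l + 1) * D)
    ((integrable_indicator_iff hE).mpr (integrableOn_const hEtop))
    (Eventually.of_forall fun u => ?_)).trans ?_
  · rw [Real.norm_eq_abs, abs_mul]
    by_cases hI : u ∈ baseInterval b l (c / b)
    · by_cases hu : u ∈ E
      · rw [Set.indicator_of_mem hu]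
        exact mul_le_mul (abs_cellStep_le hb l c u) (h1 u hI hu) (abs_nonneg _) (by positivity)
      · rw [Set.indicator_of_notMem hu, h0 u hI hu, sub_self, abs_zero, mul_zero]
    · rw [cellStep_eq_zero hb l c hI, abs_zero, zero_mul]
      exact Set.indicator_nonneg (fun _ _ => hb0) u
  · rw [integral_indicator_const _ hE, smul_eq_mul, mul_comm]
    exact mul_le_mul_of_nonneg_left (ENNReal.toReal_le_of_le_ofReal hV hEV) hb0

end

section

variable {φ : ℝ → ℝ} (hφ : IsAdmissibleDensity φ) {p : ℝ} (hp : 1 ≤ p)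

include hφ hp

/-- Against short cells the Lipschitz constant `L/θ` of `w` gives `H/θ`; for long cells `w` differs
from `(1-θ)⁻¹` only on a set of measure at most `2θ`, which gives `θ/H`. Away from the boundary
layer `w` is constant and the mean vanishes. -/
lemma exists_abs_integral_cellStep_le {b : ℕ} (hb : 0 < b) :
    ∃ C, 0 < C ∧ ∀ θ : ℝ, 0 < θ → θ ≤ 1 / 2 → ∀ l c : ℕ, c < b ^ (l + 1) →
      |∫ x, cellStep b l c (invTransport φ p θ x) ∂lineMeasure φ| ≤
        if (min (c / b) (b ^ l - 1 - c / b) : ℕ) * ((b : ℝ) ^ l)⁻¹ < θ then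
          C * min (((b : ℝ) ^ l)⁻¹ / θ) (θ / ((b : ℝ) ^ l)⁻¹) else 0 := by
  obtain ⟨L, hL, hwd⟩ := exists_abs_weightDeriv_le (p := p) hp le_rfl one_pos
  simp only [Real.rpow_zero, mul_one] at hwd
  have hbR : (0 : ℝ) < b := by exact_mod_cast hb
  refine ⟨b * (L + 4), by positivity, fun θ hθ hθ2 l c hc => ?_⟩
  obtain ⟨D, hD⟩ := isPiecewise_cellStep hb l c
  rw [integral_comp_invTransport hφ hp hθ hθ2 hD.measurable]
  set H := ((b : ℝ) ^ l)⁻¹ with hH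
  have hpos : (0 : ℝ) < (b : ℝ) ^ l := by positivity
  have hHpos : 0 < H := by positivity
  have hbH : (b : ℝ) ^ (l + 1) = b * H⁻¹ := by rw [hH, inv_inv, pow_succ, mul_comm]
  have hw2 : ∀ u, |weight p θ u| ≤ 2 := fun u => by
    rw [abs_of_nonneg (weight_nonneg hp hθ hθ2 u)]; exact weight_le_two hp hθ hθ2 u
  have hwc := continuous_weight hp hθ hθ2
  have hc1 := one_sub_inv_bounds hθ hθ2
  have hconst : ∀ u, |weight p θ u - (1 - θ)⁻¹| ≤ 2 := fun u => by
    have h1 := weight_nonneg hp hθ hθ2 u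
    have h2 := weight_le_two hp hθ hθ2 u
    rw [abs_le]; constructor <;> linarith [hc1.1, hc1.2]
  split_ifs with hd
  · rw [mul_min_of_nonneg _ _ (by positivity)]
    refine le_min ?_ ?_
    · have hLip : ∀ u a, |weight p θ u - weight p θ a| ≤ L * θ⁻¹ * |u - a| := by
        intro u a
        have := Convex.norm_image_sub_le_of_norm_hasDerivWithin_le (f := weight p θ)
          (f' := weightDeriv p θ) (C := L * θ⁻¹) (s := Set.univ) (x := a) (y := u)
          (fun t _ => (hasDerivAt_weight hp hθ hθ2 t).hasDerivWithinAt)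
          (fun t _ => hwd θ hθ hθ2 t) convex_univ trivial trivial
        exact this
      refine (abs_integral_cellStep_mul_le hb l c hwc hw2
        (weight p θ (((c / b : ℕ) : ℝ) / (b : ℝ) ^ l)) (measurableSet_baseInterval b l (c / b))
        hHpos.le (volume_baseInterval hb l (c / b)).le (D := L * θ⁻¹ * H) (by positivity)
        (fun u hu _ => (hLip _ _).trans ?_) (fun u hu hu' => absurd hu hu')).trans (le_of_lt ?_)
      · refine mul_le_mul_of_nonneg_left ?_ (by positivity)
        have h1 := hu.1
        have h2 := hu.2
        rw [add_div, one_div] at h2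
        rw [abs_of_nonneg (by linarith)]
        linarith
      · rw [hbH]
        have : (b : ℝ) * H⁻¹ * (L * θ⁻¹ * H) * H = b * L * (H / θ) := by field_simp
        rw [this]
        have : 0 < H / θ := by positivity
        nlinarith [mul_pos hbR this]
    · refine (abs_integral_cellStep_mul_le hb l c hwc hw2 (1 - θ)⁻¹
        (E := Set.Ico 0 θ ∪ Set.Ioc (1 - θ) 1) (measurableSet_Ico.union measurableSet_Ioc)
        (V := 2 * θ) (by positivity) ?_ two_pos.le (fun u _ _ => hconst u)
        (fun u hu hu' => ?_)).trans (le_of_lt ?_)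
      · refine (measure_union_le _ _).trans ?_
        rw [Real.volume_Ico, Real.volume_Ioc, ← ENNReal.ofReal_add (by linarith) (by linarith)]
        exact ENNReal.ofReal_le_ofReal (by linarith)
      · have hu1 := baseInterval_subset l (div_lt_pow hb l hc) hu
        refine weight_eq_const hθ hθ2 ?_
        rw [Set.mem_union, not_or] at hu'
        constructor
        · by_contra hcon
          exact hu'.1 ⟨hu1.1, not_le.mp hcon⟩
        · by_contra hcon
          exact hu'.2 ⟨not_le.mp hcon, hu1.2.le⟩
      · rw [hbH]
        have : (b : ℝ) * H⁻¹ * 2 * (2 * θ) = b * 4 * (θ / H) := by field_simp; ring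
        rw [this]
        have : 0 < θ / H := by positivity
        nlinarith [mul_pos (mul_pos hbR hL) this]
  · rw [not_lt] at hd
    refine (abs_integral_cellStep_mul_le hb l c hwc hw2 (1 - θ)⁻¹ (E := ∅) MeasurableSet.empty
      (V := 0) le_rfl (by simp) two_pos.le (fun u _ _ => hconst u) (fun u hu _ => ?_)).trans
      (by simp)
    have h1 := hd.trans (min_mul_le_of_mem_baseInterval hb (div_lt_pow hb l hc) hu)
    exact weight_eq_const hθ hθ2 ⟨h1.trans (min_le_left _ _), by linarith [h1.trans (min_le_right _ _)]⟩

/-- About `θ/H + 1` parent cells at each end contribute, each of them `min(H/θ, θ/H)²`. After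
weighting by `H` the total is of order `(θ + H) min(H/θ, θ/H)²`, and comparing `H` with `θ` bounds
this by `2 θ (H/θ)^α`. -/
lemma exists_sum_mean_sq_le {α : ℝ} (hα : 0 < α) (hα1 : α < 1) {b : ℕ} (hb : 0 < b) :
    ∃ K, 0 < K ∧ ∀ θ : ℝ, 0 < θ → θ ≤ 1 / 2 → ∀ l : ℕ,
      ∑ c ∈ Finset.range (b ^ (l + 1)), ((b : ℝ) ^ (l + 1))⁻¹ *
        (∫ x, cellStep b l c (invTransport φ p θ x) ∂lineMeasure φ) ^ 2 ≤
        K * (((b : ℝ) ^ (l + 1))⁻¹ ^ α * θ ^ (1 - α)) := by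
  obtain ⟨C, hC, hm⟩ := exists_abs_integral_cellStep_le hφ hp hb
  have hbR : (0 : ℝ) < b := by exact_mod_cast hb
  refine ⟨4 * C ^ 2 * (b : ℝ) ^ α, by positivity, fun θ hθ hθ2 l => ?_⟩
  set T := ((b : ℝ) ^ (l + 1))⁻¹ with hT
  have hm' := hm θ hθ hθ2 l
  set H := ((b : ℝ) ^ l)⁻¹ with hH
  have hHpos : 0 < H := by positivity
  have hTpos : 0 < T := by positivity
  have hHT : H = b * T := by rw [hH, hT, pow_succ]; field_simp
  have hHα : (b : ℝ) ^ α * T ^ α = H ^ α := by rw [hHT, Real.mul_rpow hbR.le hTpos.le]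
  set M := C * min (H / θ) (θ / H) with hM
  have hM0 : 0 ≤ M := by positivity
  set g : ℕ → ℝ := fun i => if (i : ℝ) * H < θ then M ^ 2 else 0 with hg
  have hg0 : ∀ i, 0 ≤ g i := fun i => by simp only [hg]; split_ifs <;> positivity
  have e1 : ∑ c ∈ Finset.range (b ^ (l + 1)), T *
      (∫ x, cellStep b l c (invTransport φ p θ x) ∂lineMeasure φ) ^ 2 ≤
      ∑ c ∈ Finset.range (b ^ l * b), T * g (min (c / b) (b ^ l - 1 - c / b)) := by
    rw [← pow_succ]
    refine Finset.sum_le_sum fun c hc => mul_le_mul_of_nonneg_left ?_ hTpos.le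
    have := hm' c (Finset.mem_range.mp hc)
    rw [← sq_abs]
    simp only [hg]
    split_ifs at this ⊢ with hd
    · gcongr
    · rw [le_antisymm this (abs_nonneg _)]; simp
  refine e1.trans ?_
  rw [sum_range_mul_div hb (b ^ l) (fun e => T * g (min e (b ^ l - 1 - e))), ← Finset.mul_sum,
    ← mul_assoc, ← hHT]
  have e2 : ∑ i ∈ Finset.range (b ^ l), g i ≤ (θ / H + 1) * M ^ 2 := by
    simp only [hg]
    rw [← Finset.sum_filter, Finset.sum_const, nsmul_eq_mul]
    refine mul_le_mul_of_nonneg_right ?_ (by positivity)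
    have hsub : (Finset.range (b ^ l)).filter (fun i : ℕ => (i : ℝ) * H < θ) ⊆
        Finset.range ⌈θ / H⌉₊ := by
      intro i hi
      rw [Finset.mem_range, Nat.lt_ceil, lt_div_iff₀ hHpos]
      exact (Finset.mem_filter.mp hi).2
    have h1 := Finset.card_le_card hsub
    rw [Finset.card_range] at h1
    have h2 := Nat.ceil_lt_add_one (show 0 ≤ θ / H by positivity)
    have h3 : (((Finset.range (b ^ l)).filter (fun i : ℕ => (i : ℝ) * H < θ)).card : ℝ) ≤
      (⌈θ / H⌉₊ : ℝ) := by exact_mod_cast h1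
    linarith
  have e3 := (sum_range_min_le (b ^ l) hg0).trans (mul_le_mul_of_nonneg_left e2 two_pos.le)
  refine (mul_le_mul_of_nonneg_left e3 hHpos.le).trans ?_
  have e4 : H * (2 * ((θ / H + 1) * M ^ 2)) = 2 * C ^ 2 * ((θ + H) * min (H / θ) (θ / H) ^ 2) := by
    rw [hM]; field_simp
  have e5 : 4 * C ^ 2 * (b : ℝ) ^ α * (T ^ α * θ ^ (1 - α)) =
      2 * C ^ 2 * (2 * (θ * (H / θ) ^ α)) := by
    rw [Real.div_rpow hHpos.le hθ.le, ← hHα, Real.rpow_sub hθ, Real.rpow_one]; ring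
  rw [e4, e5]
  refine mul_le_mul_of_nonneg_left ?_ (by positivity)
  rcases le_total H θ with hle | hle
  · have h1 : H / θ ≤ 1 := (div_le_one hθ).mpr hle
    have h0 : 0 ≤ H / θ := by positivity
    have h2 : min (H / θ) (θ / H) ^ 2 ≤ (H / θ) ^ α := by
      calc min (H / θ) (θ / H) ^ 2 ≤ (H / θ) ^ 2 := by gcongr; exact min_le_left _ _
        _ = (H / θ) ^ (2 : ℝ) := (Real.rpow_two _).symm
        _ ≤ _ := Real.rpow_le_rpow_of_exponent_ge' h0 h1 hα.le (by linarith)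
    calc (θ + H) * min (H / θ) (θ / H) ^ 2 ≤ (θ + θ) * (H / θ) ^ α := by gcongr
      _ = _ := by ring
  · have h1 : 1 ≤ (H / θ) ^ α := Real.one_le_rpow ((one_le_div hθ).mpr hle) hα.le
    have h2 : (θ + H) * min (H / θ) (θ / H) ^ 2 ≤ 2 * θ := by
      calc (θ + H) * min (H / θ) (θ / H) ^ 2 ≤ (H + H) * (θ / H) ^ 2 := by
            gcongr; exact min_le_right _ _
        _ = 2 * (θ * (θ / H)) := by field_simp; ring
        _ ≤ 2 * (θ * 1) := by gcongr; exact (div_le_one hHpos).mpr hle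
        _ = 2 * θ := by ring
    refine h2.trans ?_
    have := mul_le_mul_of_nonneg_left h1 hθ.le
    linarith

end

end

end BDIS

open MeasureTheory

namespace BDIS

noncomputable section

open Filter Topology

section

variable {φ : ℝ → ℝ} (hφ : IsAdmissibleDensity φ) {q r : ℝ} (hqr : q.HolderConjugate r) {s : ℕ}

/-! ### Sums of norms over boxes -/

lemma spaceNorm_rpow (hq : 0 < q) {h : (Fin s → ℝ) → ℝ} (hh : MemSpace φ q h) :
    spaceNorm φ q h ^ q = ∫ x, |h x| ^ q ∂prodMeasure φ s := by
  have hq0 : ENNReal.ofReal q ≠ 0 := by simpa using hq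
  have hn : 0 ≤ ∫ x, |h x| ^ q ∂prodMeasure φ s := integral_nonneg fun x => by positivity
  rw [spaceNorm, hh.eLpNorm_eq_integral_rpow_norm hq0 ENNReal.ofReal_ne_top,
    ENNReal.toReal_ofReal (by positivity), ENNReal.toReal_ofReal hq.le]
  simp only [Real.norm_eq_abs]
  rw [← Real.rpow_mul hn, inv_mul_cancel₀ hq.ne', Real.rpow_one]

lemma spaceNorm_indicator_le {h : (Fin s → ℝ) → ℝ} (hh : MemSpace φ q h) (E : Set (Fin s → ℝ)) :
    spaceNorm φ q (E.indicator h) ≤ spaceNorm φ q h :=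
  ENNReal.toReal_mono hh.2.ne (eLpNorm_indicator_le h)

/-- In the first case each local norm is bounded by the full norm, and the weights are summed over
all cells. For `q ≤ 2`, the square of a local norm is at most its `q`-th power times the full norm
to the power `2 - q`; the `q`-th powers add up under the integral, where only overlapping boxes
accumulate. -/
lemma sum_mul_spaceNorm_indicator_sq_le (hq : 0 < q) {D : (Fin s → ℝ) → ℝ} (hD : MemSpace φ q D)
    {R : Fin s → Finset ℕ} {W : Fin s → ℕ → ℝ} (hW : ∀ j c, 0 ≤ W j c) {I : Fin s → ℕ → Set ℝ}
    (hI : ∀ j c, MeasurableSet (I j c)) {K : Fin s → ℝ}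
    (h : (2 ≤ q ∧ ∀ j, ∑ c ∈ R j, W j c ≤ K j) ∨
      (q ≤ 2 ∧ ∀ j x, ∑ c ∈ R j, (I j c).indicator (fun _ => W j c) x ≤ K j)) :
    ∑ c ∈ Fintype.piFinset R, (∏ j, W j (c j)) *
        spaceNorm φ q ((Set.univ.pi fun j => I j (c j)).indicator D) ^ 2 ≤
      (∏ j, K j) * spaceNorm φ q D ^ 2 := by
  have hA := spaceNorm_nonneg φ q D
  set A := spaceNorm φ q D with hAdef
  set a : (Fin s → ℕ) → ℝ := fun c =>
    spaceNorm φ q ((Set.univ.pi fun j => I j (c j)).indicator D) with ha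
  have ha0 : ∀ c, 0 ≤ a c := fun c => spaceNorm_nonneg _ _ _
  have haA : ∀ c, a c ≤ A := fun c => spaceNorm_indicator_le hD _
  have hprod : ∀ c : Fin s → ℕ, 0 ≤ ∏ j, W j (c j) := fun c => Finset.prod_nonneg fun j _ => hW j _
  rcases h with ⟨-, h⟩ | ⟨hq2, h⟩
  · calc ∑ c ∈ Fintype.piFinset R, (∏ j, W j (c j)) * a c ^ 2
        ≤ ∑ c ∈ Fintype.piFinset R, (∏ j, W j (c j)) * A ^ 2 :=
          Finset.sum_le_sum fun c _ => mul_le_mul_of_nonneg_left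
            (pow_le_pow_left₀ (ha0 c) (haA c) 2) (hprod c)
      _ = (∏ j, ∑ c ∈ R j, W j c) * A ^ 2 := by rw [← Finset.sum_mul, Finset.prod_univ_sum]
      _ ≤ _ := by
        refine mul_le_mul_of_nonneg_right ?_ (by positivity)
        exact Finset.prod_le_prod (fun j _ => Finset.sum_nonneg fun c _ => hW j c) fun j _ => h j
  · have hmeas : ∀ c : Fin s → ℕ, MeasurableSet (Set.univ.pi fun j => I j (c j)) := fun c =>
      MeasurableSet.univ_pi fun j => hI j _
    have hint : Integrable (fun x => |D x| ^ q) (prodMeasure φ s) := by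
      have := hD.integrable_norm_rpow (by simpa using hq) ENNReal.ofReal_ne_top
      simpa only [ENNReal.toReal_ofReal hq.le, Real.norm_eq_abs] using this
    have haq : ∀ c, a c ^ q = ∫ x, (Set.univ.pi fun j => I j (c j)).indicator
        (fun x => |D x| ^ q) x ∂prodMeasure φ s := by
      intro c
      rw [ha]
      simp only
      rw [spaceNorm_rpow hq (hD.indicator (hmeas c))]
      refine integral_congr_ae (Eventually.of_forall fun x => ?_)
      by_cases hx : x ∈ Set.univ.pi fun j => I j (c j)
      · simp only [Set.indicator_of_mem hx]
      · simp only [Set.indicator_of_notMem hx, abs_zero, Real.zero_rpow hq.ne']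
    have hsq : ∀ c, a c ^ 2 ≤ a c ^ q * A ^ (2 - q) := by
      intro c
      rw [← Real.rpow_two, show (2 : ℝ) = q + (2 - q) by ring,
        Real.rpow_add_of_nonneg (ha0 c) hq.le (by linarith), add_sub_cancel]
      exact mul_le_mul_of_nonneg_left (Real.rpow_le_rpow (ha0 c) (haA c) (by linarith))
        (Real.rpow_nonneg (ha0 c) q)
    have hsum : ∑ c ∈ Fintype.piFinset R, (∏ j, W j (c j)) * a c ^ q ≤ (∏ j, K j) * A ^ q := by
      simp only [haq, ← integral_const_mul]
      rw [← integral_finsetSum _ fun c _ => (hint.indicator (hmeas c)).const_mul _, hAdef,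
        spaceNorm_rpow hq hD, ← integral_const_mul]
      refine integral_mono (integrable_finsetSum _ fun c _ => (hint.indicator (hmeas c)).const_mul _)
        (hint.const_mul _) fun x => ?_
      have e : ∀ c : Fin s → ℕ, (∏ j, W j (c j)) * (Set.univ.pi fun j => I j (c j)).indicator
          (fun x => |D x| ^ q) x =
          (∏ j, (I j (c j)).indicator (fun _ => W j (c j)) (x j)) * |D x| ^ q := by
        intro c
        by_cases hx : x ∈ Set.univ.pi fun j => I j (c j)
        · rw [Set.indicator_of_mem hx]
          congr 1
          exact Finset.prod_congr rfl fun j _ => (Set.indicator_of_mem (hx j trivial) (fun _ => W j (c j))).symm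
        · rw [Set.indicator_of_notMem hx, mul_zero]
          rw [Set.mem_univ_pi] at hx
          push Not at hx
          obtain ⟨j, hj⟩ := hx
          rw [Finset.prod_eq_zero (Finset.mem_univ j) (Set.indicator_of_notMem hj _), zero_mul]
      simp only [e]
      rw [← Finset.sum_mul,
        ← Finset.prod_univ_sum R (fun j c => (I j c).indicator (fun _ => W j c) (x j))]
      refine mul_le_mul_of_nonneg_right ?_ (by positivity)
      exact Finset.prod_le_prod (fun j _ => Finset.sum_nonneg fun c _ =>
        Set.indicator_nonneg (fun _ _ => hW j c) _) fun j _ => h j (x j)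
    calc ∑ c ∈ Fintype.piFinset R, (∏ j, W j (c j)) * a c ^ 2
        ≤ ∑ c ∈ Fintype.piFinset R, (∏ j, W j (c j)) * (a c ^ q * A ^ (2 - q)) :=
          Finset.sum_le_sum fun c _ => mul_le_mul_of_nonneg_left (hsq c) (hprod c)
      _ = (∑ c ∈ Fintype.piFinset R, (∏ j, W j (c j)) * a c ^ q) * A ^ (2 - q) := by
          rw [Finset.sum_mul]; simp only [mul_assoc]
      _ ≤ ((∏ j, K j) * A ^ q) * A ^ (2 - q) := by gcongr
      _ = (∏ j, K j) * A ^ 2 := by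
          rw [mul_assoc, ← Real.rpow_add_of_nonneg hA hq.le (by linarith), add_sub_cancel,
            Real.rpow_two]

/-! ### Integrals against products of split functions -/

include hφ hqr

/-- Expanding `∏ (A_j + A₀_j)` over `z ⊆ v` and integrating by parts in the coordinates of `z` moves
the derivative `∂^z` onto `h` and turns each `A_j` into `B_j`. Hölder's inequality then bounds every
term. -/
lemma abs_integral_mul_prod_isSplit_le {h : (Fin s → ℝ) → ℝ} (hh : MemWmix φ q h)
    (v : Finset (Fin s)) {ρ : Fin s → ℝ → ℝ} {I : Fin s → Set ℝ} {N : Fin s → ℝ}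
    (hI : ∀ j, MeasurableSet (I j))
    (hρ : ∀ j ∈ v, IsSplit φ r (ρ j) (I j) (N j)) :
    |∫ x, h x * ∏ j ∈ v, ρ j (x j) ∂prodMeasure φ s| ≤
      (∏ j ∈ v, N j) * ∑ z ∈ v.powerset, spaceNorm φ q
        ((Set.univ.pi fun j => if j ∈ v then I j else Set.univ).indicator (weakMixedDeriv z h)) := by
  have := hφ.isProbabilityMeasure
  have hsplit : ∀ j, ∃ B A A₀ : ℝ → ℝ, j ∈ v → (IsTestLimit φ r B A ∧ MemLine φ r A₀ ∧
      (∀ x, ρ j x = A x + A₀ x) ∧ (∀ x, x ∉ I j → B x = 0 ∧ A₀ x = 0) ∧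
      lineNorm φ r B ≤ N j ∧ lineNorm φ r A₀ ≤ N j) := by
    intro j
    by_cases hj : j ∈ v
    · obtain ⟨B, A, A₀, h⟩ := hρ j hj
      exact ⟨B, A, A₀, fun _ => h⟩
    · exact ⟨0, 0, 0, fun h => absurd h hj⟩
  choose B A A₀ hBA using hsplit
  have hhm := hh.memSpace hφ
  set E : Set (Fin s → ℝ) := Set.univ.pi fun j => if j ∈ v then I j else Set.univ with hE
  have hEm : MeasurableSet E := MeasurableSet.univ_pi fun j => by
    split_ifs
    exacts [hI j, MeasurableSet.univ]
  set G : Finset (Fin s) → Fin s → ℝ → ℝ := fun z j =>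
    if j ∈ z then B j else if j ∈ v then A₀ j else fun _ => 1 with hG
  have hGm : ∀ z ∈ v.powerset, ∀ j, MemLine φ r (G z j) := by
    intro z hz j
    simp only [hG]
    split_ifs with h1 h2
    · exact (hBA j (Finset.mem_powerset.mp hz h1)).1.memB
    · exact (hBA j h2).2.1
    · exact memLp_const _
  set F : Finset (Fin s) → Fin s → ℝ → ℝ := fun z j => if j ∈ z then A j else G z j with hF
  have hFm : ∀ z ∈ v.powerset, ∀ j, MemLine φ r (F z j) := by
    intro z hz j
    simp only [hF]
    split_ifs with h1
    · exact (hBA j (Finset.mem_powerset.mp hz h1)).1.memA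
    · exact hGm z hz j
  have e1 : ∫ x, h x * ∏ j ∈ v, ρ j (x j) ∂prodMeasure φ s =
      ∑ z ∈ v.powerset, ∫ x, h x * ∏ j, F z j (x j) ∂prodMeasure φ s := by
    rw [← integral_finsetSum _ fun z hz => integrable_mul_prod_eval hφ hqr hhm (hFm z hz)]
    refine integral_congr_ae (Eventually.of_forall fun x => ?_)
    simp only
    rw [← Finset.mul_sum]
    congr 1
    rw [Finset.prod_congr rfl fun j hj => (hBA j hj).2.2.1 (x j), Finset.prod_add]
    refine Finset.sum_congr rfl fun z hz => ?_
    rw [Finset.mem_powerset] at hz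
    rw [← Finset.prod_sdiff (Finset.subset_univ v), ← Finset.prod_sdiff hz]
    have a1 : ∏ j ∈ Finset.univ \ v, F z j (x j) = 1 := by
      refine Finset.prod_eq_one fun j hj => ?_
      have hjv : j ∉ v := (Finset.mem_sdiff.mp hj).2
      have hjz : j ∉ z := fun h => hjv (hz h)
      simp [hF, hG, hjv, hjz]
    rw [a1, one_mul, mul_comm]
    congr 1
    · refine Finset.prod_congr rfl fun j hj => ?_
      obtain ⟨h1, h2⟩ := Finset.mem_sdiff.mp hj
      simp [hF, hG, h1, h2]
    · exact Finset.prod_congr rfl fun j hj => by simp [hF, hj]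
  rw [e1, Finset.mul_sum]
  refine (Finset.abs_sum_le_sum_abs _ _).trans (Finset.sum_le_sum fun z hz => ?_)
  have hz' := Finset.mem_powerset.mp hz
  have hgm := hh.memSpace_weakMixedDeriv hφ z
  have e2 := integral_mul_prod_of_isTestLimit hφ hqr (hh.hasProductWeakDeriv z) hhm hgm
    (A := A) (B := G z) (fun j hj => by
      simp only [hG, hj, if_true]
      exact (hBA j (hz' hj)).1) (hGm z hz)
  -- Each factor in `v` is now `B` or `A₀` and vanishes off its interval, so only the restriction of
  -- the derivative to the box matters. This localization is what allows summation over the cells.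
  have e3 : ∫ x, weakMixedDeriv z h x * ∏ j, G z j (x j) ∂prodMeasure φ s =
      ∫ x, E.indicator (weakMixedDeriv z h) x * ∏ j, G z j (x j) ∂prodMeasure φ s := by
    refine integral_congr_ae (Eventually.of_forall fun x => ?_)
    simp only
    by_cases hx : x ∈ E
    · rw [Set.indicator_of_mem hx]
    · rw [Set.indicator_of_notMem hx, zero_mul]
      rw [hE, Set.mem_univ_pi] at hx
      push Not at hx
      obtain ⟨j, hj⟩ := hx
      by_cases hjv : j ∈ v
      · rw [if_pos hjv] at hj
        have h0 := (hBA j hjv).2.2.2.1 _ hj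
        rw [Finset.prod_eq_zero (Finset.mem_univ j), mul_zero]
        simp only [hG]
        split_ifs
        exacts [h0.1, h0.2]
      · rw [if_neg hjv] at hj
        exact absurd trivial hj
  change |∫ x, h x * ∏ j, (if j ∈ z then A j else G z j) (x j) ∂prodMeasure φ s| ≤ _
  rw [e2, abs_mul, abs_pow, abs_neg, abs_one, one_pow, one_mul, e3, mul_comm]
  refine (abs_integral_mul_prod_eval_le hφ hqr (hgm.indicator hEm) (hGm z hz)).trans ?_
  refine mul_le_mul_of_nonneg_left ?_ (spaceNorm_nonneg _ _ _)
  rw [← Finset.prod_subset v.subset_univ (f := fun j => lineNorm φ r (G z j))]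
  · refine Finset.prod_le_prod (fun j _ => lineNorm_nonneg _ _ _) fun j hj => ?_
    simp only [hG]
    split_ifs
    exacts [(hBA j hj).2.2.2.2.1, (hBA j hj).2.2.2.2.2]
  · intro j _ hj
    have hjz : j ∉ z := fun h => hj (hz' h)
    simp only [hG, if_neg hj, if_neg hjz]
    rw [lineNorm, eLpNorm_const _ (by simpa using hqr.symm.pos) (IsProbabilityMeasure.ne_zero _)]
    simp

omit hφ in
lemma spaceNorm_weakMixedDeriv_le (h : (Fin s → ℝ) → ℝ) (z : Finset (Fin s)) :
    spaceNorm φ q (weakMixedDeriv z h) ≤ wmixNorm φ q h := by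
  rw [← Real.rpow_le_rpow_iff (spaceNorm_nonneg _ _ _) (wmixNorm_nonneg h) hqr.pos,
    ← sum_spaceNorm_rpow hqr.pos]
  exact Finset.single_le_sum (f := fun z => spaceNorm φ q (weakMixedDeriv z h) ^ q)
    (fun z _ => Real.rpow_nonneg (spaceNorm_nonneg _ _ _) q) (Finset.mem_univ z)

/-- One factor `2^|v|` comes from the Cauchy-Schwarz inequality for the sum over `z ⊆ v`, another
from the number of these `z`. Coordinates outside `v` enter only through the weights `U`, which
leaves room for the squared means. -/
lemma sum_sq_integral_mul_prod_isSplit_le {h : (Fin s → ℝ) → ℝ} (hh : MemWmix φ q h)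
    (v : Finset (Fin s)) {R : Fin s → Finset ℕ} {ρ : Fin s → ℕ → ℝ → ℝ} {I : Fin s → ℕ → Set ℝ}
    {N U : Fin s → ℕ → ℝ} (hU : ∀ j c, 0 ≤ U j c)
    (hI : ∀ j c, MeasurableSet (I j c))
    (hρ : ∀ j ∈ v, ∀ c ∈ R j, IsSplit φ r (ρ j c) (I j c) (N j c)) {K : Fin s → ℝ}
    (hK : ∀ j, 0 ≤ K j)
    (hv : (2 ≤ q ∧ ∀ j ∈ v, ∑ c ∈ R j, U j c * N j c ^ 2 ≤ K j) ∨
      (q ≤ 2 ∧ ∀ j ∈ v, ∀ x, ∑ c ∈ R j, (I j c).indicator (fun _ => U j c * N j c ^ 2) x ≤ K j))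
    (hv' : ∀ j, j ∉ v → ∑ c ∈ R j, U j c ≤ K j) :
    ∑ c ∈ Fintype.piFinset R, (∏ j, U j (c j)) *
        (∫ x, h x * ∏ j ∈ v, ρ j (c j) (x j) ∂prodMeasure φ s) ^ 2 ≤
      4 ^ v.card * (∏ j, K j) * wmixNorm φ q h ^ 2 := by
  set W : Fin s → ℕ → ℝ := fun j c => if j ∈ v then U j c * N j c ^ 2 else U j c with hW
  set J : Fin s → ℕ → Set ℝ := fun j c => if j ∈ v then I j c else Set.univ with hJ
  have hW0 : ∀ j c, 0 ≤ W j c := by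
    intro j c
    simp only [hW]
    split_ifs
    exacts [mul_nonneg (hU j c) (sq_nonneg _), hU j c]
  have hJm : ∀ j c, MeasurableSet (J j c) := by
    intro j c
    simp only [hJ]
    split_ifs
    exacts [hI j c, MeasurableSet.univ]
  set a : Finset (Fin s) → (Fin s → ℕ) → ℝ := fun z c =>
    spaceNorm φ q ((Set.univ.pi fun j => J j (c j)).indicator (weakMixedDeriv z h)) with ha
  have hcell : ∀ c ∈ Fintype.piFinset R, (∏ j, U j (c j)) *
      (∫ x, h x * ∏ j ∈ v, ρ j (c j) (x j) ∂prodMeasure φ s) ^ 2 ≤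
      2 ^ v.card * ∑ z ∈ v.powerset, (∏ j, W j (c j)) * a z c ^ 2 := by
    intro c hc
    rw [Fintype.mem_piFinset] at hc
    have h1 := abs_integral_mul_prod_isSplit_le hφ hqr hh v (ρ := fun j => ρ j (c j))
      (I := fun j => I j (c j)) (N := fun j => N j (c j)) (fun j => hI j _)
      fun j hj => hρ j hj _ (hc j)
    have h2 : (∑ z ∈ v.powerset, a z c) ^ 2 ≤ 2 ^ v.card * ∑ z ∈ v.powerset, a z c ^ 2 := by
      have := sq_sum_le_card_mul_sum_sq (s := v.powerset) (f := fun z => a z c)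
      rw [Finset.card_powerset] at this
      exact_mod_cast this
    have e : ∏ j, W j (c j) = (∏ j, U j (c j)) * (∏ j ∈ v, N j (c j)) ^ 2 := by
      have e0 : ∏ j ∈ v, N j (c j) ^ 2 = ∏ j, if j ∈ v then N j (c j) ^ 2 else 1 := by
        rw [Finset.prod_ite_mem, Finset.univ_inter]
      rw [← Finset.prod_pow, e0, ← Finset.prod_mul_distrib]
      refine Finset.prod_congr rfl fun j _ => ?_
      simp only [hW]
      split_ifs <;> simp
    have hUp : 0 ≤ ∏ j, U j (c j) := Finset.prod_nonneg fun j _ => hU j _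
    rw [← Finset.mul_sum, e]
    have h3 : (∫ x, h x * ∏ j ∈ v, ρ j (c j) (x j) ∂prodMeasure φ s) ^ 2 ≤
        ((∏ j ∈ v, N j (c j)) * ∑ z ∈ v.powerset, a z c) ^ 2 := by
      rw [← sq_abs]
      exact pow_le_pow_left₀ (abs_nonneg _) h1 2
    calc (∏ j, U j (c j)) * (∫ x, h x * ∏ j ∈ v, ρ j (c j) (x j) ∂prodMeasure φ s) ^ 2
        ≤ (∏ j, U j (c j)) * ((∏ j ∈ v, N j (c j)) * ∑ z ∈ v.powerset, a z c) ^ 2 := by gcongr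
      _ = (∏ j, U j (c j)) * (∏ j ∈ v, N j (c j)) ^ 2 * (∑ z ∈ v.powerset, a z c) ^ 2 := by ring
      _ ≤ (∏ j, U j (c j)) * (∏ j ∈ v, N j (c j)) ^ 2 *
          (2 ^ v.card * ∑ z ∈ v.powerset, a z c ^ 2) := by gcongr
      _ = _ := by ring
  refine (Finset.sum_le_sum hcell).trans ?_
  rw [← Finset.mul_sum, Finset.sum_comm]
  have hbox : ∀ z ∈ v.powerset, ∑ c ∈ Fintype.piFinset R, (∏ j, W j (c j)) * a z c ^ 2 ≤
      (∏ j, K j) * wmixNorm φ q h ^ 2 := by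
    intro z _
    refine (sum_mul_spaceNorm_indicator_sq_le hqr.pos (hh.memSpace_weakMixedDeriv hφ z) (K := K) hW0 hJm
      ?_).trans ?_
    · rcases hv with ⟨hq, h1⟩ | ⟨hq, h1⟩
      · refine Or.inl ⟨hq, fun j => ?_⟩
        simp only [hW]
        split_ifs with hj
        exacts [h1 j hj, hv' j hj]
      · refine Or.inr ⟨hq, fun j x => ?_⟩
        simp only [hW, hJ]
        split_ifs with hj
        · exact h1 j hj x
        · simpa using hv' j hj
    · refine mul_le_mul_of_nonneg_left ?_ (Finset.prod_nonneg fun j _ => hK j)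
      exact pow_le_pow_left₀ (spaceNorm_nonneg _ _ _) (spaceNorm_weakMixedDeriv_le hqr h z) 2
  refine (mul_le_mul_of_nonneg_left (Finset.sum_le_sum hbox) (by positivity)).trans (le_of_eq ?_)
  rw [Finset.sum_const, Finset.card_powerset, nsmul_eq_mul, Nat.cast_pow, Nat.cast_ofNat,
    show (4 : ℝ) = 2 * 2 by norm_num, mul_pow]
  ring

end

end

end BDIS

open MeasureTheory

namespace BDIS

noncomputable section

open Filter Topology

section

variable {φ : ℝ → ℝ} (hφ : IsAdmissibleDensity φ) {p : ℝ} (hp : 1 ≤ p) {s : ℕ} {θ : Fin s → ℝ}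
  (hθ : ∀ j, 0 < θ j ∧ θ j ≤ 1 / 2)

/-! ### The change of variables -/

/-- The inverse of the transport map in all coordinates. -/
def invTransportPi (φ : ℝ → ℝ) (p : ℝ) {s : ℕ} (θ : Fin s → ℝ) (x : Fin s → ℝ) : Fin s → ℝ :=
  fun j => invTransport φ p (θ j) (x j)

include hφ hp hθ

lemma isProbabilityMeasure_weightMeasure (j : Fin s) :
    IsProbabilityMeasure (weightMeasure p (θ j)) := by
  have := hφ.isProbabilityMeasure
  rw [← map_invTransport hφ hp (hθ j).1 (hθ j).2]
  exact Measure.isProbabilityMeasure_map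
    (measurable_invTransport hφ hp (hθ j).1 (hθ j).2).aemeasurable

lemma measurePreserving_invTransportPi :
    MeasurePreserving (invTransportPi φ p θ) (prodMeasure φ s)
      ((volume : Measure (Fin s → ℝ)).withDensity fun u =>
        ENNReal.ofReal (∏ j, weight p (θ j) (u j))) := by
  have := hφ.isProbabilityMeasure
  have hw := isProbabilityMeasure_weightMeasure hφ hp hθ
  have hfin : ∀ j, SigmaFinite ((volume : Measure ℝ).withDensity fun u =>
      ENNReal.ofReal (weight p (θ j) u)) := fun j =>
    have := hw j
    inferInstanceAs (SigmaFinite (weightMeasure p (θ j)))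
  rw [← pi_withDensity_ofReal (g := fun j => weight p (θ j))
    (fun j => (continuous_weight hp (hθ j).1 (hθ j).2).measurable)
    fun j u => weight_nonneg hp (hθ j).1 (hθ j).2 u]
  exact measurePreserving_pi (fun _ => lineMeasure φ) (fun j => weightMeasure p (θ j))
    fun j => measurePreserving_invTransport hφ hp (hθ j).1 (hθ j).2

lemma measurableEmbedding_invTransportPi : MeasurableEmbedding (invTransportPi φ p θ) := by
  refine (measurePreserving_invTransportPi hφ hp hθ).measurable.measurableEmbedding fun x y h => ?_
  funext j
  exact (strictMono_invTransport hφ hp (hθ j).1 (hθ j).2).injective (congrFun h j)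

omit hφ in
lemma measurable_prod_weight :
    Measurable fun u : Fin s → ℝ => ENNReal.ofReal (∏ j, weight p (θ j) (u j)) :=
  (Finset.measurable_fun_prod _ fun j _ =>
    (continuous_weight hp (hθ j).1 (hθ j).2).measurable.comp (measurable_pi_apply j)).ennreal_ofReal

omit hφ in
lemma prod_weight_nonneg (u : Fin s → ℝ) : 0 ≤ ∏ j, weight p (θ j) (u j) :=
  Finset.prod_nonneg fun j _ => weight_nonneg hp (hθ j).1 (hθ j).2 _

/-- The inverse transport carries the product measure to the measure with density `∏ w`. It is a
measurable embedding, so nothing is required of `f` or `ψ`. -/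
lemma integral_transformed_mul (f ψ : (Fin s → ℝ) → ℝ) :
    ∫ u, transformed φ p θ f u * ψ u =
      ∫ x, f x * ψ (invTransportPi φ p θ x) ∂prodMeasure φ s := by
  have h := (measurePreserving_invTransportPi hφ hp hθ).integral_comp
    (measurableEmbedding_invTransportPi hφ hp hθ)
    (fun u => f (fun j => transport φ p (θ j) (u j)) * ψ u)
  rw [integral_withDensity_eq_integral_toReal_smul (measurable_prod_weight hp hθ)
    (Eventually.of_forall fun u => ENNReal.ofReal_lt_top)] at h
  have e : ∀ x : Fin s → ℝ, (fun j => transport φ p (θ j) (invTransportPi φ p θ x j)) = x := fun x =>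
    funext fun j => transport_invTransport hφ hp (hθ j).1 (hθ j).2 (x j)
  simp only [e] at h
  rw [h]
  refine integral_congr_ae (Eventually.of_forall fun u => ?_)
  simp only [transformed, smul_eq_mul]
  rw [ENNReal.toReal_ofReal (prod_weight_nonneg hp hθ u), mul_assoc]

lemma integral_transformed (f : (Fin s → ℝ) → ℝ) :
    ∫ u, transformed φ p θ f u = ∫ x, f x ∂prodMeasure φ s := by
  have := integral_transformed_mul hφ hp hθ f (fun _ => 1)
  simpa only [mul_one] using this

lemma integrable_transformed {f : (Fin s → ℝ) → ℝ} (hf : Integrable f (prodMeasure φ s)) :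
    Integrable (transformed φ p θ f) := by
  have e : (fun u => f (fun j => transport φ p (θ j) (u j))) ∘ invTransportPi φ p θ = f := by
    funext x
    simp only [Function.comp_apply]
    congr 1
    exact funext fun j => transport_invTransport hφ hp (hθ j).1 (hθ j).2 (x j)
  have h := (measurePreserving_invTransportPi hφ hp hθ).integrable_comp_emb
    (measurableEmbedding_invTransportPi hφ hp hθ)
    (g := fun u => f (fun j => transport φ p (θ j) (u j)))
  rw [e] at h
  have h2 := (integrable_withDensity_iff_integrable_smul' (measurable_prod_weight hp hθ)
    (Eventually.of_forall fun u => ENNReal.ofReal_lt_top)).mp (h.mp hf)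
  refine h2.congr (Eventually.of_forall fun u => ?_)
  simp only [transformed, smul_eq_mul]
  rw [ENNReal.toReal_ofReal (prod_weight_nonneg hp hθ u)]

omit hφ hp in
lemma transformed_eq_zero (f : (Fin s → ℝ) → ℝ) {u : Fin s → ℝ} (hu : u ∉ unitCube s) :
    transformed φ p θ f u = 0 := by
  rw [unitCube, Set.mem_univ_pi] at hu
  push Not at hu
  obtain ⟨j, hj⟩ := hu
  rw [transformed, Finset.prod_eq_zero (Finset.mem_univ j)
    (weight_eq_zero (hθ j).1 (hθ j).2 fun h => hj ⟨h.1.le, h.2⟩), zero_mul]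

/-! ### Haar energies of the transformed integrand -/

lemma haarInt_transformed {b : ℕ} [NeZero b] (f : (Fin s → ℝ) → ℝ) (k c : Fin s → ℕ) :
    haarInt b (transformed φ p θ f) k c = ∫ x, f x * ∏ j ∈ support k,
      cellStep b (k j - 1) (c j) (invTransport φ p (θ j) (x j)) ∂prodMeasure φ s := by
  rw [haarInt, integral_transformed_mul hφ hp hθ f
    (fun u => ∏ j, haar (k j) (c j) (Real.digits (u j) b))]
  refine integral_congr_ae (Eventually.of_forall fun x => ?_)
  simp only
  congr 1
  rw [← Finset.prod_subset (support k).subset_univ]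
  · refine Finset.prod_congr rfl fun j hj => ?_
    have hk : k j ≠ 0 := (Finset.mem_filter.mp hj).2
    obtain ⟨l, hl⟩ := Nat.exists_eq_succ_of_ne_zero hk
    rw [hl, Nat.succ_eq_add_one, Nat.add_sub_cancel]
    exact haar_succ_digits l (c j)
      (Set.Ioo_subset_Ico_self (invTransport_mem hφ hp (hθ j).1 (hθ j).2 (x j)))
  · intro j _ hj
    have hk : k j = 0 := by
      by_contra h
      exact hj (Finset.mem_filter.mpr ⟨Finset.mem_univ j, h⟩)
    rw [hk]
    rfl

end

/-- Each Haar coefficient is a sum over `v ⊆ ω` of means over `ω \ v` times an integral against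
`f_v`. After the Cauchy-Schwarz inequality the sum over the cells factorizes into coordinates:
coordinates in `v` are handled by the split norms, coordinates in `ω \ v` by the squared means. -/
lemma exists_haarEnergy_transformed_le {φ : ℝ → ℝ} (hφ : IsAdmissibleDensity φ) {p q r : ℝ}
    (hqr : q.HolderConjugate r) (hp : 1 ≤ p) {α ε : ℝ} (hα : 0 < α) (hα1 : α < 1) (hε : 0 < ε)
    {b : ℕ} [NeZero b] :
    ∃ C, 0 < C ∧ ∀ (s : ℕ) (θ : Fin s → ℝ), (∀ j, 0 < θ j ∧ θ j ≤ 1 / 2) →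
      ∀ f : (Fin s → ℝ) → ℝ, MemWmix φ q f → ∀ k : Fin s → ℕ,
      haarEnergy b (transformed φ p θ f) k ≤
        C ^ (support k).card * (∏ j ∈ support k, ((b : ℝ) ^ k j)⁻¹ ^ α) *
          ∑ v ∈ (support k).powerset, wmixNorm φ q (anovaTerm φ f v) ^ 2 *
            (∏ j ∈ v, θ j ^ (-nu α q - ε)) * ∏ j ∈ support k \ v, θ j ^ (1 - α) := by
  have hb : 0 < b := NeZero.pos b
  obtain ⟨K₁, hK₁, h₁⟩ := exists_isSplit_sum_le hφ hqr hp hα hα1 hε hb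
  obtain ⟨K₂, hK₂, h₂⟩ := exists_sum_mean_sq_le hφ hp hα hα1 hb
  -- The 2 is from Cauchy-Schwarz over the subsets of `ω`, the 4 from
  -- `sum_sq_integral_mul_prod_isSplit_le`.
  refine ⟨2 * (4 * (K₁ + K₂ + 1)), by positivity, fun s θ hθ f hf k => ?_⟩
  set ω := support k with hω
  have hkω : ∀ j ∈ ω, k j - 1 + 1 = k j := fun j hj => by
    have : k j ≠ 0 := (Finset.mem_filter.mp hj).2
    omega
  have hk0 : ∀ j, j ∉ ω → k j = 0 := fun j hj => by
    by_contra h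
    exact hj (Finset.mem_filter.mpr ⟨Finset.mem_univ j, h⟩)
  have hbR : (0 : ℝ) < b := by exact_mod_cast hb
  have hN := fun j => h₁ (θ j) (hθ j).1 (hθ j).2 (k j - 1)
  choose N _ hNs hNsum using hN
  have hm := fun j => h₂ (θ j) (hθ j).1 (hθ j).2 (k j - 1)
  set ρ : Fin s → ℕ → ℝ → ℝ := fun j c x =>
    cellStep b (k j - 1) c (invTransport φ p (θ j) x) with hρ
  set M : Fin s → ℕ → ℝ := fun j c => ∫ x, ρ j c x ∂lineMeasure φ with hM
  set T : Fin s → ℝ := fun j => ((b : ℝ) ^ k j)⁻¹ with hT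
  have hT0 : ∀ j, 0 < T j := fun j => by positivity
  set R : Fin s → Finset ℕ := fun j => Finset.range (b ^ k j) with hR
  have hρm : ∀ j c, MemLine φ r (ρ j c) := fun j c => by
    obtain ⟨D, hD⟩ := isPiecewise_cellStep hb (k j - 1) c
    exact memLine_comp_invTransport hφ hp (hθ j).1 (hθ j).2 hD
  set X : Finset (Fin s) → (Fin s → ℕ) → ℝ := fun v c =>
    ∫ x, anovaTerm φ f v x * ∏ j ∈ v, ρ j (c j) (x j) ∂prodMeasure φ s with hX
  -- The squared means are absorbed into the weights of the cells.
  set U : Finset (Fin s) → Fin s → ℕ → ℝ := fun v j c =>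
    if j ∈ ω \ v then T j * M j c ^ 2 else T j with hU
  -- Outside `ω` the level is 0: there is one cell, of weight 1.
  set K : Finset (Fin s) → Fin s → ℝ := fun v j =>
    if j ∈ v then K₁ * (T j ^ α * θ j ^ (-nu α q - ε)) else
      if j ∈ ω then K₂ * (T j ^ α * θ j ^ (1 - α)) else 1 with hK
  have hint : ∀ c, haarInt b (transformed φ p θ f) k c ^ 2 ≤
      2 ^ ω.card * ∑ v ∈ ω.powerset, (∏ j ∈ ω \ v, M j (c j)) ^ 2 * X v c ^ 2 := by
    intro c
    rw [haarInt_transformed hφ hp hθ]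
    have e := integral_mul_prod_eq_sum_anovaTerm hφ hqr (hf.memSpace hφ) ω
      (ρ := fun j => ρ j (c j)) (fun j => hρm j _)
    refine (le_of_eq (congrArg (· ^ 2) e)).trans ?_
    have := sq_sum_le_card_mul_sum_sq (s := ω.powerset)
      (f := fun v => (∏ j ∈ ω \ v, M j (c j)) * X v c)
    rw [Finset.card_powerset] at this
    simp only [mul_pow] at this
    exact_mod_cast this
  have hXsum : ∀ v ∈ ω.powerset, ∑ c ∈ Fintype.piFinset R, (∏ j, U v j (c j)) * X v c ^ 2 ≤
      4 ^ v.card * (∏ j, K v j) * wmixNorm φ q (anovaTerm φ f v) ^ 2 := by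
    intro v hv
    rw [Finset.mem_powerset] at hv
    refine sum_sq_integral_mul_prod_isSplit_le hφ hqr (hf.anovaTerm hφ hqr v) v
      (I := fun j c => invTransport φ p (θ j) ⁻¹' baseInterval b (k j - 1) (c / b)) (N := N)
      (fun j c => ?_) (fun j c => ?_) (fun j hj c hc => ?_) (fun j => ?_) ?_ (fun j hj => ?_)
    · have := (hT0 j).le
      simp only [hU]
      split_ifs <;> positivity
    · exact measurable_invTransport hφ hp (hθ j).1 (hθ j).2 (measurableSet_baseInterval _ _ _)
    · refine hNs j c ?_
      rw [hkω j (hv hj)]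
      exact Finset.mem_range.mp hc
    · have h1 := hT0 j
      have h2 := (hθ j).1
      simp only [hK]
      split_ifs <;> positivity
    · have hUv : ∀ j ∈ v, ∀ c, U v j c = T j := fun j hj c => by simp [hU, hj]
      have hKv : ∀ j ∈ v, K v j = K₁ * (T j ^ α * θ j ^ (-nu α q - ε)) := fun j hj => by
        simp [hK, hj]
      rcases le_total 2 q with hq | hq
      · refine Or.inl ⟨hq, fun j hj => ?_⟩
        have h3 := (hNsum j).1 hq
        rw [hkω j (hv hj)] at h3
        simp only [hUv j hj, hKv j hj]
        exact h3
      · refine Or.inr ⟨hq, fun j hj x => ?_⟩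
        have h3 := (hNsum j).2 (invTransport φ p (θ j) x)
        rw [hkω j (hv hj)] at h3
        simp only [hUv j hj, hKv j hj]
        exact h3
    · simp only [hU, hK]
      by_cases hjω : j ∈ ω
      · have h3 := hm j
        rw [hkω j hjω] at h3
        simp only [Finset.mem_sdiff, hjω, hj, not_false_eq_true, and_self, if_true, if_false]
        exact h3
      · simp [hj, hjω, hR, hT, hk0 j hjω]
  have hKprod : ∀ v ∈ ω.powerset, 4 ^ v.card * ∏ j, K v j ≤ (4 * (K₁ + K₂ + 1)) ^ ω.card *
      ((∏ j ∈ ω, T j ^ α) * ((∏ j ∈ v, θ j ^ (-nu α q - ε)) * ∏ j ∈ ω \ v, θ j ^ (1 - α))) := by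
    intro v hv
    rw [Finset.mem_powerset] at hv
    have hθp : ∀ (a : ℝ) j, 0 ≤ θ j ^ a := fun a j => Real.rpow_nonneg (hθ j).1.le a
    have hTα : ∀ j, 0 ≤ T j ^ α := fun j => Real.rpow_nonneg (hT0 j).le α
    have e1 : ∏ j, K v j = (∏ j ∈ ω \ v, K₂ * (T j ^ α * θ j ^ (1 - α))) *
        ∏ j ∈ v, K₁ * (T j ^ α * θ j ^ (-nu α q - ε)) := by
      rw [← Finset.prod_subset ω.subset_univ (f := K v)]
      · rw [← Finset.prod_sdiff hv]
        congr 1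
        · refine Finset.prod_congr rfl fun j hj => ?_
          obtain ⟨h1, h2⟩ := Finset.mem_sdiff.mp hj
          simp [hK, h1, h2]
        · exact Finset.prod_congr rfl fun j hj => by simp [hK, hj]
      · intro j _ hj
        have hjv : j ∉ v := fun h => hj (hv h)
        simp [hK, hj, hjv]
    have h4 : (4 : ℝ) ^ v.card ≤ 4 ^ ω.card :=
      pow_le_pow_right₀ (by norm_num) (Finset.card_le_card hv)
    have e2 : (∏ j ∈ ω, T j ^ α) = (∏ j ∈ ω \ v, T j ^ α) * ∏ j ∈ v, T j ^ α :=
      (Finset.prod_sdiff hv).symm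
    have e3 : (K₁ + K₂ + 1) ^ ω.card =
        (K₁ + K₂ + 1) ^ (ω \ v).card * (K₁ + K₂ + 1) ^ v.card := by
      rw [← pow_add, Finset.card_sdiff_add_card_eq_card hv]
    rw [e1, Finset.prod_mul_distrib, Finset.prod_mul_distrib, Finset.prod_mul_distrib,
      Finset.prod_mul_distrib, Finset.prod_const, Finset.prod_const, mul_pow, e2, e3]
    have hp1 : 0 ≤ ∏ j ∈ ω \ v, T j ^ α := Finset.prod_nonneg fun j _ => hTα j
    have hp2 : 0 ≤ ∏ j ∈ v, T j ^ α := Finset.prod_nonneg fun j _ => hTα j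
    have hp3 : 0 ≤ ∏ j ∈ ω \ v, θ j ^ (1 - α) := Finset.prod_nonneg fun j _ => hθp _ j
    have hp4 : 0 ≤ ∏ j ∈ v, θ j ^ (-nu α q - ε) := Finset.prod_nonneg fun j _ => hθp _ j
    calc 4 ^ v.card * (K₂ ^ (ω \ v).card * ((∏ j ∈ ω \ v, T j ^ α) *
          ∏ j ∈ ω \ v, θ j ^ (1 - α)) * (K₁ ^ v.card * ((∏ j ∈ v, T j ^ α) *
          ∏ j ∈ v, θ j ^ (-nu α q - ε))))
        = 4 ^ v.card * (K₂ ^ (ω \ v).card * K₁ ^ v.card) *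
          (((∏ j ∈ ω \ v, T j ^ α) * ∏ j ∈ v, T j ^ α) * ((∏ j ∈ v, θ j ^ (-nu α q - ε)) *
          ∏ j ∈ ω \ v, θ j ^ (1 - α))) := by ring
      _ ≤ 4 ^ ω.card * ((K₁ + K₂ + 1) ^ (ω \ v).card * (K₁ + K₂ + 1) ^ v.card) *
          (((∏ j ∈ ω \ v, T j ^ α) * ∏ j ∈ v, T j ^ α) * ((∏ j ∈ v, θ j ^ (-nu α q - ε)) *
          ∏ j ∈ ω \ v, θ j ^ (1 - α))) := by
        gcongr <;> linarith
  have hUprod : ∀ (v : Finset (Fin s)) (c : Fin s → ℕ), ∏ j, U v j (c j) = (∏ j, T j) * (∏ j ∈ ω \ v, M j (c j)) ^ 2 := by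
    intro v c
    have e0 : ∏ j ∈ ω \ v, M j (c j) ^ 2 = ∏ j, if j ∈ ω \ v then M j (c j) ^ 2 else 1 := by
      rw [Finset.prod_ite_mem, Finset.univ_inter]
    rw [← Finset.prod_pow, e0, ← Finset.prod_mul_distrib]
    refine Finset.prod_congr rfl fun j _ => ?_
    simp only [hU]
    split_ifs <;> simp
  have hTp : 0 ≤ ∏ j, T j := Finset.prod_nonneg fun j _ => (hT0 j).le
  calc haarEnergy b (transformed φ p θ f) k
      = (∏ j, T j) * ∑ c ∈ Fintype.piFinset R, haarInt b (transformed φ p θ f) k c ^ 2 := rfl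
    _ ≤ (∏ j, T j) * ∑ c ∈ Fintype.piFinset R, 2 ^ ω.card *
          ∑ v ∈ ω.powerset, (∏ j ∈ ω \ v, M j (c j)) ^ 2 * X v c ^ 2 := by
        gcongr with c hc
        exact hint c
    _ = 2 ^ ω.card * ∑ v ∈ ω.powerset, ∑ c ∈ Fintype.piFinset R,
          (∏ j, U v j (c j)) * X v c ^ 2 := by
        rw [← Finset.mul_sum, Finset.sum_comm, ← mul_assoc, mul_comm (∏ j, T j), mul_assoc,
          Finset.mul_sum]
        simp only [hUprod, Finset.mul_sum, mul_assoc]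
    _ ≤ 2 ^ ω.card * ∑ v ∈ ω.powerset, (4 * (K₁ + K₂ + 1)) ^ ω.card *
          ((∏ j ∈ ω, T j ^ α) * ((∏ j ∈ v, θ j ^ (-nu α q - ε)) * ∏ j ∈ ω \ v, θ j ^ (1 - α))) *
          wmixNorm φ q (anovaTerm φ f v) ^ 2 := by
        refine mul_le_mul_of_nonneg_left (Finset.sum_le_sum fun v hv => (hXsum v hv).trans ?_)
          (by positivity)
        exact mul_le_mul_of_nonneg_right (hKprod v hv) (sq_nonneg _)
    _ = _ := by
        rw [mul_pow 2, Finset.mul_sum, Finset.mul_sum]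
        refine Finset.sum_congr rfl fun v _ => ?_
        ring

end

end BDIS

/-! ### Summation over the levels and the final bound -/

open MeasureTheory

namespace BDIS

noncomputable section

/-! ### Sums over the levels -/

lemma sum_pow_le {y : ℝ} (hy : 0 ≤ y) (hy1 : y < 1) (R : Finset ℕ) :
    ∑ i ∈ R, y ^ i ≤ (1 - y)⁻¹ := by
  rw [← tsum_geometric_of_lt_one hy hy1]
  exact (summable_geometric_of_lt_one hy hy1).sum_le_tsum R fun i _ => pow_nonneg hy i

/-- The sum of `y ^ (a + n)` over positive `a` with `a + n > N`. -/
lemma sum_filter_pow_add_le {y : ℝ} (hy : 0 ≤ y) (hy1 : y < 1) (R : Finset ℕ)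
    (hR : ∀ a ∈ R, 1 ≤ a) (n N : ℕ) :
    ∑ a ∈ R.filter (fun a => N < a + n), y ^ (a + n) ≤ (1 - y)⁻¹ * y ^ max N n := by
  have h : ∑ a ∈ R.filter (fun a => N < a + n), y ^ (a + n) =
      (∑ i ∈ (R.filter (fun a => N < a + n)).image (fun a => a + n - max N n), y ^ i) *
        y ^ max N n := by
    rw [Finset.sum_image, Finset.sum_mul]
    · refine Finset.sum_congr rfl fun a ha => ?_
      obtain ⟨h1, h2⟩ := Finset.mem_filter.mp ha
      have := hR a h1
      rw [← pow_add, Nat.sub_add_cancel (by omega)]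
    · intro a ha a' ha' h
      obtain ⟨h1, h2⟩ := Finset.mem_filter.mp ha
      obtain ⟨h1', h2'⟩ := Finset.mem_filter.mp ha'
      have := hR a h1
      have := hR a' h1'
      simp only at h
      omega
  rw [h]
  exact mul_le_mul_of_nonneg_right (sum_pow_le hy hy1 _) (by positivity)

lemma pow_mul_pow_max_le {y z : ℝ} (hy : 0 ≤ y) (hyz : y ≤ z) (hz : z ≤ 1) (N n : ℕ) :
    z ^ N * y ^ max N n ≤ y ^ N * z ^ n := by
  have hz0 : 0 ≤ z := hy.trans hyz
  rcases le_total n N with h | h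
  · rw [max_eq_left h, mul_comm]
    exact mul_le_mul_of_nonneg_left (pow_le_pow_of_le_one hz0 hz h) (by positivity)
  · rw [max_eq_right h]
    obtain ⟨d, rfl⟩ := Nat.exists_eq_add_of_le h
    rw [pow_add, pow_add]
    have := pow_le_pow_left₀ hy hyz d
    calc z ^ N * (y ^ N * y ^ d) ≤ z ^ N * (y ^ N * z ^ d) := by gcongr
      _ = _ := by ring

/-- One level `k_i` is summed as a geometric tail, giving `y^max(N, n)` with `n` the sum of the
other levels. Replacing it by `2 y^N z^n`, with `z` at distance of order `1/m` from 1, decouples the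
other levels; each contributes a geometric sum of order `m`, whence `m^(|ω|-1)`. -/
lemma sum_prod_pow_le {s : ℕ} {y : ℝ} (hy : 0 < y) (hy1 : y < 1) {m N : ℕ} (hm : 1 ≤ m)
    (hN : N ≤ m) {ω : Finset (Fin s)} (hω : ω.Nonempty) (K : ℕ) :
    ∑ k ∈ (Fintype.piFinset fun j => if j ∈ ω then Finset.Icc 1 K else {0}).filter
        (fun k => N < ∑ j, k j), y ^ (∑ j, k j) ≤
      (2 * (1 - y)⁻¹) ^ ω.card * (m : ℝ) ^ (ω.card - 1) * y ^ N := by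
  obtain ⟨i, hi⟩ := hω
  have hmR : (1 : ℝ) ≤ m := by exact_mod_cast hm
  have hy' : 0 < 1 - y := by linarith
  set R : Fin s → Finset ℕ := fun j => if j ∈ ω then Finset.Icc 1 K else {0} with hR
  set R' : Fin s → Finset ℕ := fun j => if j ∈ ω.erase i then Finset.Icc 1 K else {0} with hR'
  -- Close enough to 1 that `z^N ≥ 1/2` for `N ≤ m`, by Bernoulli's inequality, and far enough that
  -- `1/(1-z)` is only linear in `m`.
  set z : ℝ := 1 - (1 - y) / (2 * m) with hz
  have h2m : (1 - y) / (2 * m) ≤ (1 - y) / 2 := by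
    rw [div_le_div_iff₀ (by positivity) two_pos]; nlinarith
  have hzpos : 0 < (1 - y) / (2 * m) := by positivity
  have hyz : y ≤ z := by rw [hz]; linarith
  have hz0 : 0 < z := hy.trans_le hyz
  have hz1 : z < 1 := by rw [hz]; linarith
  have hzN : 1 / 2 ≤ z ^ N := by
    have h1 := one_add_mul_le_pow (a := -((1 - y) / (2 * m))) (by linarith) m
    have h2 : (m : ℝ) * ((1 - y) / (2 * m)) = (1 - y) / 2 := by field_simp
    have h3 : z ^ m ≤ z ^ N := pow_le_pow_of_le_one hz0.le hz1.le hN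
    rw [← sub_eq_add_neg 1, ← hz] at h1
    linarith
  have hsum : ∀ k : Fin s → ℕ, ∑ j, k j = k i + ∑ j, Function.update k i 0 j := by
    intro k
    rw [← Finset.add_sum_erase _ _ (Finset.mem_univ i),
      ← Finset.add_sum_erase _ (Function.update k i 0) (Finset.mem_univ i), Function.update_self,
      zero_add]
    congr 1
    exact Finset.sum_congr rfl fun j hj =>
      (Function.update_of_ne (Finset.ne_of_mem_erase hj) _ _).symm
  have hmaps : ∀ k ∈ (Fintype.piFinset R).filter (fun k => N < ∑ j, k j),
      Function.update k i 0 ∈ Fintype.piFinset R' := by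
    intro k hk
    have hk1 := Fintype.mem_piFinset.mp (Finset.mem_filter.mp hk).1
    refine Fintype.mem_piFinset.mpr fun j => ?_
    by_cases hj : j = i
    · subst hj; simp [hR']
    · rw [Function.update_of_ne hj]
      have := hk1 j
      simpa [hR, hR', hj] using this
  rw [← Finset.sum_fiberwise_of_maps_to hmaps]
  have hfib : ∀ k' ∈ Fintype.piFinset R', ∑ k ∈ ((Fintype.piFinset R).filter
      (fun k => N < ∑ j, k j)).filter (fun k => Function.update k i 0 = k'), y ^ (∑ j, k j) ≤
      2 * (1 - y)⁻¹ * y ^ N * ∏ j, z ^ k' j := by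
    intro k' _
    set F := ((Fintype.piFinset R).filter (fun k => N < ∑ j, k j)).filter
      (fun k => Function.update k i 0 = k') with hF
    have hinj : ∑ k ∈ F, y ^ (∑ j, k j) =
        ∑ a ∈ F.image (fun k => k i), y ^ (a + ∑ j, k' j) := by
      rw [Finset.sum_image]
      · refine Finset.sum_congr rfl fun k hk => ?_
        rw [hsum k, (Finset.mem_filter.mp hk).2]
      · intro k hk l hl h
        have h1 := (Finset.mem_filter.mp hk).2
        have h2 := (Finset.mem_filter.mp hl).2
        rw [← Function.update_eq_self i k, ← Function.update_eq_self i l,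
          ← Function.update_idem (a := i) 0 (k i) k, ← Function.update_idem (a := i) 0 (l i) l,
          h1, h2]
        exact congrArg _ h
    have hsub : F.image (fun k => k i) ⊆
        (Finset.Icc 1 K).filter (fun a => N < a + ∑ j, k' j) := by
      intro a ha
      obtain ⟨k, hk, rfl⟩ := Finset.mem_image.mp ha
      obtain ⟨hk1, hk2⟩ := Finset.mem_filter.mp hk
      obtain ⟨hk3, hk4⟩ := Finset.mem_filter.mp hk1
      refine Finset.mem_filter.mpr ⟨?_, ?_⟩
      · have := Fintype.mem_piFinset.mp hk3 i
        simpa only [hR, hi, if_true] using this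
      · rwa [← hk2, ← hsum k]
    rw [hinj]
    refine (Finset.sum_le_sum_of_subset_of_nonneg hsub fun a _ _ => by positivity).trans ?_
    refine (sum_filter_pow_add_le hy.le hy1 _ (fun a ha => (Finset.mem_Icc.mp ha).1) _ _).trans ?_
    have h1 := pow_mul_pow_max_le hy.le hyz hz1.le N (∑ j, k' j)
    have h2 : y ^ max N (∑ j, k' j) ≤ 2 * (y ^ N * z ^ ∑ j, k' j) := by
      have h3 : 0 ≤ y ^ max N (∑ j, k' j) := by positivity
      nlinarith
    rw [Finset.prod_pow_eq_pow_sum]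
    calc (1 - y)⁻¹ * y ^ max N (∑ j, k' j) ≤ (1 - y)⁻¹ * (2 * (y ^ N * z ^ ∑ j, k' j)) := by
          gcongr
      _ = _ := by ring
  refine (Finset.sum_le_sum hfib).trans ?_
  rw [← Finset.mul_sum, ← Finset.prod_univ_sum R' (fun _ a => z ^ a)]
  have hprod : ∏ j, ∑ a ∈ R' j, z ^ a ≤ (2 * m * (1 - y)⁻¹) ^ (ω.card - 1) := by
    have hzz : (1 - z)⁻¹ = 2 * m * (1 - y)⁻¹ := by
      rw [hz, sub_sub_cancel, inv_div, div_eq_mul_inv]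
    rw [← hzz, ← Finset.card_erase_of_mem hi, ← Finset.prod_const,
      ← Finset.prod_subset (ω.erase i).subset_univ]
    · exact Finset.prod_le_prod (fun j _ => Finset.sum_nonneg fun a _ => by positivity)
        fun j _ => sum_pow_le hz0.le hz1 _
    · intro j _ hj
      simp only [hR', hj, if_false, Finset.sum_singleton, pow_zero]
  refine (mul_le_mul_of_nonneg_left hprod (by positivity)).trans (le_of_eq ?_)
  obtain ⟨d, hd⟩ := Nat.exists_eq_succ_of_ne_zero (Finset.card_ne_zero_of_mem hi)
  rw [hd, Nat.succ_eq_add_one, Nat.add_sub_cancel, pow_succ, mul_pow, mul_pow, mul_pow]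
  ring

end

end BDIS

open MeasureTheory

namespace BDIS

noncomputable section

/-! ### The error bound -/

lemma anovaNorm_sq_mul_gam_sq {s : ℕ} (φ : ℝ → ℝ) (q : ℝ) (f : (Fin s → ℝ) → ℝ)
    (v : Finset (Fin s)) :
    anovaNorm φ q f ^ 2 * gam φ q f v ^ 2 = wmixNorm φ q (anovaTerm φ f v) ^ 2 := by
  unfold gam
  split_ifs with h
  · rw [mul_pow, ← mul_assoc, ← mul_pow, mul_inv_cancel₀ h.ne', one_pow, one_mul]
  -- If the supremum is not positive, all the norms vanish and the convention `γ = 0` is consistent.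
  · have h1 : wmixNorm φ q (anovaTerm φ f v) ≤ anovaNorm φ q f :=
      le_ciSup (f := fun v => wmixNorm φ q (anovaTerm φ f v)) (Set.finite_range _).bddAbove v
    rw [le_antisymm (h1.trans (not_lt.mp h)) (wmixNorm_nonneg _)]
    simp

lemma prod_inv_pow_rpow_eq {s b : ℕ} (hb : 0 < b) (α : ℝ) (k : Fin s → ℕ) :
    ∏ j ∈ support k, ((b : ℝ) ^ k j)⁻¹ ^ α = ((b : ℝ) ^ (-α)) ^ ∑ j, k j := by
  have hbR : (0 : ℝ) < b := by exact_mod_cast hb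
  rw [← Finset.prod_pow_eq_pow_sum, Finset.prod_subset (support k).subset_univ]
  · refine Finset.prod_congr rfl fun j _ => ?_
    rw [Real.inv_rpow (by positivity), ← Real.rpow_natCast, ← Real.rpow_mul hbR.le,
      ← Real.rpow_natCast, ← Real.rpow_mul hbR.le, ← Real.rpow_neg hbR.le]
    congr 1
    ring
  · intro j _ hj
    have hk : k j = 0 := by
      by_contra h
      exact hj (Finset.mem_filter.mpr ⟨Finset.mem_univ j, h⟩)
    simp [hk]

/-- The gain removes all levels with `∑ k_j ≤ m - t_ω`, and on the others the energy decays like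
`b^(-α ∑ k_j)`. -/
lemma sum_gainBound_mul_le {b : ℕ} (hb : 2 ≤ b) {α C : ℝ} (hα : 0 < α) (hC : 0 ≤ C) {s m : ℕ}
    (hm : 1 ≤ m) {t : Finset (Fin s) → ℕ} {ω : Finset (Fin s)} (hω : ω.Nonempty) (ht : t ω ≤ m)
    {E : (Fin s → ℕ) → ℝ} {G : ℝ} (hG : 0 ≤ G)
    (hE : ∀ k, support k = ω →
      E k ≤ C ^ ω.card * (∏ j ∈ support k, ((b : ℝ) ^ k j)⁻¹ ^ α) * G) (K : ℕ) :
    ((b : ℝ) ^ m)⁻¹ * ∑ k ∈ (Fintype.piFinset fun _ : Fin s =>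
      Finset.range (K + 1)).filter (fun k => support k = ω), gainBound b m t k * E k ≤
    (4 * C * (2 * (1 - (b : ℝ) ^ (-α))⁻¹)) ^ ω.card * (m : ℝ) ^ (ω.card - 1) *
      ((b : ℝ) ^ ((1 + α) * (t ω : ℝ)) * G) / ((b : ℝ) ^ m) ^ (1 + α) := by
  have hb0 : 0 < b := by omega
  have hbR : (0 : ℝ) < b := by exact_mod_cast hb0
  have hb1 : (1 : ℝ) < b := by exact_mod_cast hb
  set y : ℝ := (b : ℝ) ^ (-α) with hy
  have hy0 : 0 < y := Real.rpow_pos_of_pos hbR _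
  have hy1 : y < 1 := Real.rpow_lt_one_of_one_lt_of_neg hb1 (by linarith)
  set D := 4 ^ ω.card * (b : ℝ) ^ t ω * (C ^ ω.card * G) with hD
  have hD0 : 0 ≤ D := by positivity
  set F := (Fintype.piFinset fun _ : Fin s => Finset.range (K + 1)).filter
    (fun k => support k = ω) with hF
  have h1 : ∑ k ∈ F, gainBound b m t k * E k ≤
      ∑ k ∈ F.filter (fun k => m - t ω < ∑ j, k j), D * y ^ ∑ j, k j := by
    rw [Finset.sum_filter (fun k : Fin s → ℕ => m - t ω < ∑ j, k j)]
    refine Finset.sum_le_sum fun k hk => ?_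
    have hs : support k = ω := (Finset.mem_filter.mp hk).2
    have hEk := hE k hs
    rw [prod_inv_pow_rpow_eq hb0] at hEk
    unfold gainBound
    rw [hs]
    split_ifs with h2 h3
    · omega
    · exact (zero_mul _).le
    · calc 4 ^ ω.card * (b : ℝ) ^ t ω * E k
          ≤ 4 ^ ω.card * (b : ℝ) ^ t ω * (C ^ ω.card * y ^ (∑ j, k j) * G) :=
            mul_le_mul_of_nonneg_left hEk (by positivity)
        _ = D * y ^ ∑ j, k j := by rw [hD]; ring
    · omega
  have hsub : F.filter (fun k => m - t ω < ∑ j, k j) ⊆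
      (Fintype.piFinset fun j => if j ∈ ω then Finset.Icc 1 K else {0}).filter
        (fun k => m - t ω < ∑ j, k j) := by
    refine Finset.filter_subset_filter _ fun k hk => ?_
    obtain ⟨hk1, hk2⟩ := Finset.mem_filter.mp hk
    refine Fintype.mem_piFinset.mpr fun j => ?_
    have hj := Finset.mem_range.mp (Fintype.mem_piFinset.mp hk1 j)
    have hjω : j ∈ ω ↔ k j ≠ 0 := by rw [← hk2]; simp [support]
    split_ifs with h
    · exact Finset.mem_Icc.mpr ⟨Nat.one_le_iff_ne_zero.mpr (hjω.mp h), by omega⟩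
    · rw [Finset.mem_singleton]
      by_contra hne
      exact h (hjω.mpr hne)
  have h2 : ∑ k ∈ F, gainBound b m t k * E k ≤ D * ((2 * (1 - y)⁻¹) ^ ω.card *
      (m : ℝ) ^ (ω.card - 1) * y ^ (m - t ω)) := by
    refine h1.trans ((Finset.sum_le_sum_of_subset_of_nonneg hsub fun k _ _ => by positivity).trans ?_)
    rw [← Finset.mul_sum]
    exact mul_le_mul_of_nonneg_left (sum_prod_pow_le hy0 hy1 hm (Nat.sub_le _ _) hω K) hD0
  refine (mul_le_mul_of_nonneg_left h2 (by positivity)).trans (le_of_eq ?_)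
  -- The factor `1/n` of the variance, the gain `b^t` and the tail `b^(-α(m-t))` combine to
  -- `b^((1+α)t) / n^(1+α)`.
  have hpow : ((b : ℝ) ^ m)⁻¹ * ((b : ℝ) ^ t ω * y ^ (m - t ω)) =
      (b : ℝ) ^ ((1 + α) * (t ω : ℝ)) / ((b : ℝ) ^ m) ^ (1 + α) := by
    rw [hy, ← Real.rpow_natCast, ← Real.rpow_natCast, ← Real.rpow_natCast, ← Real.rpow_mul hbR.le,
      ← Real.rpow_mul hbR.le, ← Real.rpow_neg hbR.le, ← Real.rpow_add hbR, ← Real.rpow_add hbR,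
      ← Real.rpow_sub hbR, Nat.cast_sub ht]
    congr 1
    ring
  calc ((b : ℝ) ^ m)⁻¹ * (D * ((2 * (1 - y)⁻¹) ^ ω.card * (m : ℝ) ^ (ω.card - 1) *
        y ^ (m - t ω)))
      = (4 * C * (2 * (1 - y)⁻¹)) ^ ω.card * (m : ℝ) ^ (ω.card - 1) * G *
        (((b : ℝ) ^ m)⁻¹ * ((b : ℝ) ^ t ω * y ^ (m - t ω))) := by
        rw [hD, mul_pow (4 * C), mul_pow 4 C]; ring
    _ = _ := by rw [hpow]; ring

end

end BDIS

theorem mainTheorem1 (φ : ℝ → ℝ) (hφ : BDIS.IsAdmissibleDensity φ)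
    (b : ℕ) [NeZero b] (hb : 2 ≤ b) (p q α ε : ℝ) (hp : 1 ≤ p) (hq : 1 < q)
    (hα : 0 < α) (hα1 : α < 1) (hε : 0 < ε) :
    ∃ C : ℝ, 0 < C ∧
      ∀ (s m : ℕ), 1 ≤ m →
      ∀ (x : Fin (b ^ m) → Fin s → ℝ) (t : Finset (Fin s) → ℕ), BDIS.HasQualityParams b m t x →
      ∀ (Ω : Type*) (_ : MeasurableSpace Ω) (P : Measure Ω) (_ : IsProbabilityMeasure P)
        (σ : Fin s → List (Fin b) → Ω → Equiv.Perm (Fin b)), BDIS.IsOwenPermutations P σ →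
      ∀ (f : (Fin s → ℝ) → ℝ), BDIS.MemWmix φ q f →
      ∀ (θ : Fin s → ℝ), (∀ j, 0 < θ j ∧ θ j ≤ 1 / 2) →
        MemLp (fun r => BDIS.estimator φ p θ f x fun j l => σ j l r) 2 P ∧
        ∫ r, |BDIS.estimator φ p θ f x (fun j l => σ j l r)
            - ∫ y, f y ∂(BDIS.prodMeasure φ s)| ^ 2 ∂P ≤
          BDIS.anovaNorm φ q f ^ 2 / ((b : ℝ) ^ m) ^ (1 + α) *
            ∑ ω ∈ (Finset.univ : Finset (Finset (Fin s))).filter (fun ω => ω.Nonempty),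
              C ^ ω.card * (m : ℝ) ^ (ω.card - 1) * BDIS.gamTilde φ q α ε b t θ f ω := by
  have hqr : q.HolderConjugate q.conjExponent := Real.HolderConjugate.conjExponent hq
  have hbR : (1 : ℝ) < b := by exact_mod_cast hb
  obtain ⟨C, hC, hE⟩ := BDIS.exists_haarEnergy_transformed_le hφ hqr hp hα hα1 hε (b := b)
  have hy1 : (b : ℝ) ^ (-α) < 1 := Real.rpow_lt_one_of_one_lt_of_neg hbR (by linarith)
  have hy2 : 0 < 1 - (b : ℝ) ^ (-α) := by linarith
  -- Per coordinate: 4 from the gain, `C` from the energy, the rest from the geometric sums.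
  refine ⟨4 * C * (2 * (1 - (b : ℝ) ^ (-α))⁻¹), by positivity, ?_⟩
  intro s m hm x t hx Ω _ P _ σ hσ f hf θ hθ
  have := BDIS.isProbabilityMeasure_prodMeasure hφ s
  have hfi : Integrable f (BDIS.prodMeasure φ s) := (hf.memSpace hφ).integrable (by
    rw [← ENNReal.ofReal_one]; exact ENNReal.ofReal_le_ofReal hq.le)
  rw [← BDIS.integral_transformed hφ hp hθ f]
  refine BDIS.scrambled_net_error_le hb hσ hx (BDIS.integrable_transformed hφ hp hθ hfi)
    (fun u hu => BDIS.transformed_eq_zero hθ f hu) fun K => ?_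
  set G : Finset (Fin s) → ℝ := fun ω => ∑ v ∈ ω.powerset,
    BDIS.wmixNorm φ q (BDIS.anovaTerm φ f v) ^ 2 * (∏ j ∈ v, θ j ^ (-BDIS.nu α q - ε)) *
      ∏ j ∈ ω \ v, θ j ^ (1 - α) with hG
  have hG0 : ∀ ω, 0 ≤ G ω := fun ω => Finset.sum_nonneg fun v _ =>
    mul_nonneg (mul_nonneg (sq_nonneg _) (Finset.prod_nonneg fun j _ =>
      Real.rpow_nonneg (hθ j).1.le _)) (Finset.prod_nonneg fun j _ => Real.rpow_nonneg (hθ j).1.le _)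
  have hgam : ∀ ω, BDIS.anovaNorm φ q f ^ 2 * BDIS.gamTilde φ q α ε b t θ f ω =
      (b : ℝ) ^ ((1 + α) * (t ω : ℝ)) * G ω := by
    intro ω
    rw [BDIS.gamTilde, mul_left_comm, Finset.mul_sum]
    congr 1
    refine Finset.sum_congr rfl fun v _ => ?_
    rw [← BDIS.anovaNorm_sq_mul_gam_sq]
    ring
  have hmaps : ∀ k ∈ (Fintype.piFinset fun _ : Fin s => Finset.range (K + 1)).filter
      (fun k => (BDIS.support k).Nonempty), BDIS.support k ∈
      (Finset.univ : Finset (Finset (Fin s))).filter (fun ω => ω.Nonempty) := fun k hk =>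
    Finset.mem_filter.mpr ⟨Finset.mem_univ _, (Finset.mem_filter.mp hk).2⟩
  -- The multi-levels are grouped by their support `ω`, and the bound is proved for each `ω`
  -- separately.
  rw [← Finset.sum_fiberwise_of_maps_to hmaps, Finset.mul_sum, Finset.mul_sum]
  refine Finset.sum_le_sum fun ω hω => ?_
  have hωn : ω.Nonempty := (Finset.mem_filter.mp hω).2
  have hfilter : ((Fintype.piFinset fun _ : Fin s => Finset.range (K + 1)).filter
      (fun k => (BDIS.support k).Nonempty)).filter (fun k => BDIS.support k = ω) =
      (Fintype.piFinset fun _ : Fin s => Finset.range (K + 1)).filter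
        (fun k => BDIS.support k = ω) := by
    rw [Finset.filter_filter]
    refine Finset.filter_congr fun k _ => ⟨fun h => h.2, fun h => ⟨h ▸ hωn, h⟩⟩
  rw [hfilter]
  refine (BDIS.sum_gainBound_mul_le hb hα hC.le hm hωn (hx ω hωn).t_le (hG0 ω)
    (fun k hk => ?_) K).trans (le_of_eq ?_)
  · have := hE s θ hθ f hf k
    rw [hk] at this ⊢
    exact this
  · rw [← hgam]
    ring
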